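/- Let $d\ge 0$, $n=\lfloor d/2\rfloor$, $B=2n+1$, and consider the Liénard system $\dot x=y$, $\dot y=-x+p(x)y$ with $p(x)=\sum_{i=1}^d\lambda_i x^i$, $\lambda=(\lambda_1,\dots,\lambda_d)\in\mathbb C^d$, $|\lambda|=\sum_i|\lambda_i|$. In polar coordinates it becomes $$\frac{dr}{d\theta}=\frac{r\,p(r\cos\theta)\sin^2\theta}{-1+\sin\theta\cos\theta\,p(r\cos\theta)}.\qquad(*)$$ Let $v_1=1$, $v_j=0$ for $j\le 0$, and, for $k\ge2$, $v_k(0)=0$ and $$v_k'(\theta)=\sum_{l=1}^d\lambda_l\cos^l\theta\,\sin\theta\,\bigl[\cos\theta\,v_{k-l}'(\theta)+(k-l)\sin\theta\,v_{k-l}(\theta)\bigr];$$ these are the coefficients of the expansion $r(0)=\sum_{k\ge1}v_k(\theta)\,r(\theta)^k$ along the solutions of $(*)$. Put $f_k(\lambda)=v_k(2\pi)$ and $$f(\lambda,x)=x+f_2(\lambda)x^2+f_3(\lambda)x^3+\cdots.$$ Let $c_{2n+1}=\int_0^{2\pi}\cos^{2n}\theta\,\sin^2\theta\,d\theta$. For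 a polynomial $a$ in $\lambda_1,\dots,\lambda_d$ let $|a|$ be the sum of the absolute values of its coefficients. For an integer $N\ge 0$ and reals $R>0$, $c$, a power series $\sum a_kx^k$ belongs to the Bernstein class $B^2_{(N,R,c)}$ if it converges for $|x|<R$ and $|a_k|R^k\le c\max_{0\le i\le N}|a_i|R^i$ for all $k>N$. Then the coefficients $f_k$ are polynomials in $\lambda$ with real coefficients; for every $\lambda\in\mathbb C^d$ the series $f(\lambda,\cdot)$ represents near $0$ the inverse of the (complexified) return map $r(0)\mapsto r(2\pi)$ of $(*)$; and there are constants $K_3,K_4>0$ with $$\deg f_k\le k-1,\qquad |f_k|\le K_3K_4^k\qquad\text{for all }k\ge1.\qquad(**)$$ Moreover, for all $K_3,K_4>0$ satisfying $(**)$ and all $\lambda\in\mathbb C^d$, the series $f(\lambda,x)$, and also the series $f(\lambda,x)-x$, belong to the Bernstein class $B^2_{(B,R,c)}$ with $$B=2n+1,\qquad R=\frac1{K_4(1+|\lambda|)},\qquad c=\frac{n\,K_3^2\,K_4^{2n-1}}{c_{2n+1}^{\,n}}.$$ -/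

import Mathlib

noncomputable section

/-- The damping polynomial `p(x) = ∑_{i=1}^{d} λ_i x^i` of the Liénard system
`x' = y`, `y' = -x + p(x) y`. The parameter `λ_i` is stored as `lam (i - 1)`. -/
def lienardPoly {d : ℕ} (lam : Fin d → ℂ) (x : ℂ) : ℂ :=
  ∑ i : Fin d, lam i * x ^ ((i : ℕ) + 1)

/-- `|λ| = |λ_1| + ... + |λ_d|`. -/
def paramNorm {d : ℕ} (lam : Fin d → ℂ) : ℝ :=
  ∑ i : Fin d, ‖lam i‖

/-- `ρ` solves, for `θ ∈ [0, 2π]`, the polar form of the (complexified) Liénard system,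
`dr/dθ = r p(r cos θ) sin² θ / (-1 + sin θ cos θ p(r cos θ))`, with `r(0) = r₀`. -/
def IsPolarSolution {d : ℕ} (lam : Fin d → ℂ) (r₀ : ℂ) (ρ : ℝ → ℂ) : Prop :=
  ρ 0 = r₀ ∧
  ∀ θ ∈ Set.Icc (0 : ℝ) (2 * Real.pi),
    -1 + (Real.sin θ : ℂ) * (Real.cos θ : ℂ) * lienardPoly lam (ρ θ * (Real.cos θ : ℂ)) ≠ 0 ∧
    HasDerivWithinAt ρ
      (ρ θ * lienardPoly lam (ρ θ * (Real.cos θ : ℂ)) * (Real.sin θ : ℂ) ^ 2 /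
        (-1 + (Real.sin θ : ℂ) * (Real.cos θ : ℂ) * lienardPoly lam (ρ θ * (Real.cos θ : ℂ))))
      (Set.Icc (0 : ℝ) (2 * Real.pi)) θ

/-- The derivatives `v_k'(θ)` of the coefficients of the expansion
`r₀ = r + v_2(θ) r² + v_3(θ) r³ + ...` of the initial value `r₀ = r(0)` in terms of `r = r(θ)`:
`v_k' = ∑_{l=1}^{d} λ_l cos^l θ sin θ (cos θ v_{k-l}' + (k-l) sin θ v_{k-l})`, where
`v_j = 0` for `j ≤ 0`, `v_1 = 1`, and `v_j(θ) = ∫₀^θ v_j'` for `j ≥ 2`. -/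
def bautinCoeffDeriv {d : ℕ} (lam : Fin d → ℂ) : ℕ → ℝ → ℂ
  | k => fun θ =>
    ∑ i : Fin d,
      if _h : (i : ℕ) + 1 < k then
        lam i * (Real.cos θ : ℂ) ^ ((i : ℕ) + 1) * (Real.sin θ : ℂ) *
          ((Real.cos θ : ℂ) * bautinCoeffDeriv lam (k - ((i : ℕ) + 1)) θ +
            ((k - ((i : ℕ) + 1) : ℕ) : ℂ) * (Real.sin θ : ℂ) *
              ((if k - ((i : ℕ) + 1) = 1 then 1 else 0) +
                ∫ t in (0 : ℝ)..θ, bautinCoeffDeriv lam (k - ((i : ℕ) + 1)) t))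
      else 0
termination_by k => k
decreasing_by all_goals omega

/-- The coefficients `v_k(θ)`. -/
def bautinCoeff {d : ℕ} (lam : Fin d → ℂ) (k : ℕ) (θ : ℝ) : ℂ :=
  (if k = 1 then 1 else 0) + ∫ t in (0 : ℝ)..θ, bautinCoeffDeriv lam k t

/-- The complexified inverse return map, as the power series
`f(λ, x) = x + f_2(λ) x² + f_3(λ) x³ + ...` with `f_k(λ) = v_k(2π)`. -/
def inverseReturnSeries {d : ℕ} (lam : Fin d → ℂ) : PowerSeries ℂ :=
  PowerSeries.mk fun k => bautinCoeff lam k (2 * Real.pi)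

/-- The power series `f` is the germ at `0` of the inverse of the return map
`r(0) ↦ r(2π)` of the polar equation: for small `r₀` the equation has a solution on `[0, 2π]`
starting at `r₀`, and for each such solution `f` converges at `r(2π)`, with sum `r₀`. -/
def IsInverseReturnMap {d : ℕ} (lam : Fin d → ℂ) (f : PowerSeries ℂ) : Prop :=
  ∃ δ > 0, ∀ r₀ : ℂ, ‖r₀‖ < δ →
    (∃ ρ : ℝ → ℂ, IsPolarSolution lam r₀ ρ) ∧
    ∀ ρ : ℝ → ℂ, IsPolarSolution lam r₀ ρ →
      HasSum (fun k : ℕ => PowerSeries.coeff k f * ρ (2 * Real.pi) ^ k) r₀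

/-- The norm of a polynomial: the sum of the absolute values of its coefficients. -/
def coeffNorm {d : ℕ} (p : MvPolynomial (Fin d) ℝ) : ℝ :=
  ∑ m ∈ p.support, |MvPolynomial.coeff m p|

/-- `∑ a_k(λ) x^k` is an `A₀`-series with constants `K₁, K₂, K₃, K₄`:
`deg a_k ≤ K₁ k + K₂` (with `deg 0 = -∞`) and `|a_k| ≤ K₃ K₄^k` for all `k`. -/
structure IsA0Series {d : ℕ} (K₁ K₂ K₃ K₄ : ℝ) (a : ℕ → MvPolynomial (Fin d) ℝ) : Prop where
  K₃_pos : 0 < K₃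
  K₄_pos : 0 < K₄
  degree_le : ∀ k : ℕ, a k ≠ 0 → ((a k).totalDegree : ℝ) ≤ K₁ * k + K₂
  norm_le : ∀ k : ℕ, coeffNorm (a k) ≤ K₃ * K₄ ^ k

/-- The Bernstein class `B²_{(N, R, c)}`: the series `∑ a_k x^k`, convergent on the disc
`|x| < R`, with `|a_k| R^k ≤ c max_{0 ≤ i ≤ N} |a_i| R^i` for all `k > N`. -/
def bernsteinClass2 (N : ℕ) (R c : ℝ) : Set (PowerSeries ℂ) :=
  {f | (∀ x : ℂ, ‖x‖ < R → Summable fun k : ℕ => PowerSeries.coeff k f * x ^ k) ∧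
    ∀ k : ℕ, N < k →
      ‖PowerSeries.coeff k f‖ * R ^ k ≤
        c * (Finset.range (N + 1)).sup' Finset.nonempty_range_add_one
          fun i => ‖PowerSeries.coeff i f‖ * R ^ i}

/-- `wallisConst n` is `c_{2n+1} = ∫₀^{2π} cos^{2n} θ sin² θ dθ`. -/
def wallisConst (n : ℕ) : ℝ :=
  ∫ θ in (0 : ℝ)..(2 * Real.pi), Real.cos θ ^ (2 * n) * Real.sin θ ^ 2

/-- The constant `c = n K₃² K₄^{2n-1} / c_{2n+1}^n` (which is `0` if `n = 0`). -/
def bernsteinConst (n : ℕ) (K₃ K₄ : ℝ) : ℝ :=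
  n * K₃ ^ 2 * K₄ ^ (2 * n - 1) / wallisConst n ^ n

end

/-! ### Formal first integrals, rescaling and the majorant principle. -/

noncomputable section

open Finset MeasureTheory

/-! A series `∑ v_k(θ) r^k` is formally constant along `(1 - c G) r' = - r s G` exactly when `∂_θ v
= G (c ∂_θ v + s r ∂_r v)`. Comparing coefficients gives the recursion `recD`, `recV`. With `g_w =
λ_w cos^w sin` it is the recursion of the theorem, and `f_k` is `holonomy`. By induction `f_k` is a
polynomial, weighted homogeneous of weight `k - 1` when `λ_l` has weight `l`, and a recursion with
absolute values bounds its norm geometrically (`exists_holonomy_polynomial`). Along a small true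
solution the truncated first integral is constant up to terms of order `K`, so the series sums to
`r(0)` at `r(2π)` (`isInverseReturnMap_inverseReturnSeries`).

For the Bernstein inequality, homogeneity allows `λ_l` to be replaced by `λ_l s^{-l}` with `s = 1 +
|λ|`; the factor `s^{k-1}` that this costs is what the choice of `R` absorbs. The new parameters
satisfy `|λ_1| = 1 - p`, and the remaining ones are small in terms of `p`
(`exists_normalizedParam`). Two facts then organise everything. If only odd-index parameters are
present, every `v_k` is a function of `sin θ`, so the origin is a center and `f_k = 0` for `k ≠ 1`
(`recV_two_pi_eq_zero`). And `f_{2j+1} = c_{2j+1} λ_{2j} + ` a polynomial in `λ_1, ..., λ_{2j-1}`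
(`holonomy_succ_sub`). So it suffices to bound the even parameters by the `f_{2j+1}`, `j ≤ n`, and
to bound every later `f_k` linearly by the even parameters.

The obstacle is `λ_1`, whose modulus may be close to `1`. It is removed by a change of variable. If
`Y Y' = η (1 - λ_1 Y)` and `y = Y(η)`, then `y dy = (-x + p(x) y) dx` becomes `η dη = (-x + p_2(x)
ψ(η)) dx`, where `p_2` is the part of `p` of degree at least two and `ψ = Y / (1 - λ_1 Y)`. The
positive `x`-axis is fixed, so the return map does not change (`recV_eq_reduced_real`,
`holonomy_eq_recV_reducedG`). The coefficients of `ψ` obey `|ψ_{m+1}| ≤ (2/3)^m` when `λ_1 = 1`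
(`abs_psiCoeff_le`), so in estimates `λ_1` counts as `x = (2/3) |λ_1|`, a quantity bounded away from
`1`.

Since the odd part of the parameters has trivial holonomy, `f_k` is dominated by the difference of
two majorant recursions, for all the parameters and for the odd ones. This difference is estimated
along a decreasing barrier `β(θ)` that compensates the transport term of the majorant equation; the
growth of the odd majorant costs an exponential factor (`sum_majorant_sub_le`). Two choices of
constants give `|f_k| 0.8^k ≤ 1.3 ∑ |λ_{2j}|` (`norm_holonomy_le_even_sum`) and a bound for the
non-linear part of `f_{2n+1}` (`norm_holonomy_le_of_truncated`). The latter drives an induction on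
`j` showing `|λ_{2j}| ≤ evenBound j · max |f_{2i+1}|` (`IsNormalizedParam.norm_le_evenBound`).

The given constants enter at the end. Since `f_1 = 1`, one has `K₃ K₄ ≥ 1`. For moderate `K₄` the
inequality follows by multiplying the coefficient norm of `f_k` by the largest even parameter; for
large `K₄` the growth `1.25^k` is beaten by `K₄^k`. When `n = 1` there is too little room for this
alone, so the coefficient of `λ_1^{k-3} λ_2` and the cases `k = 4, 5, 6` are treated separately. -/

/-- The `θ`-derivatives of the coefficients of a formal first integral `∑ v_k(θ) r^k` of the
equation `(1 - c G) dr = - r s G dθ`, `G = ∑ g_w(θ) r^w`. -/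
def recD {𝕜 : Type*} [RCLike 𝕜] (c s : ℝ → 𝕜) (g : ℕ → ℝ → 𝕜) : ℕ → ℝ → 𝕜
  | k => fun θ =>
    ∑ j : Fin k, g (k - j) θ * (c θ * recD c s g j θ + (j : ℕ) * s θ *
      ((if (j : ℕ) = 1 then 1 else 0) + ∫ t in (0 : ℝ)..θ, recD c s g j t))
termination_by k => k
decreasing_by all_goals exact j.2

/-- The coefficients of the formal first integral, normalised by `v_k(0) = [k = 1]`. -/
def recV {𝕜 : Type*} [RCLike 𝕜] (c s : ℝ → 𝕜) (g : ℕ → ℝ → 𝕜) (k : ℕ) (θ : ℝ) : 𝕜 :=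
  (if k = 1 then 1 else 0) + ∫ t in (0 : ℝ)..θ, recD c s g k t

/-- The combination `c v_j' + j s v_j`. -/
def recX {𝕜 : Type*} [RCLike 𝕜] (c s : ℝ → 𝕜) (g : ℕ → ℝ → 𝕜) (j : ℕ) (θ : ℝ) : 𝕜 :=
  c θ * recD c s g j θ + (j : ℕ) * s θ * recV c s g j θ

section Basic

variable {𝕜 : Type*} [RCLike 𝕜] {c s : ℝ → 𝕜} {g : ℕ → ℝ → 𝕜}

theorem recD_eq (c s : ℝ → 𝕜) (g : ℕ → ℝ → 𝕜) (k : ℕ) (θ : ℝ) :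
    recD c s g k θ = ∑ j ∈ range k, g (k - j) θ * recX c s g j θ := by
  rw [recD, Finset.sum_range]
  rfl

theorem recD_zero : recD c s g 0 = fun _ => 0 := by
  funext θ; rw [recD_eq]; simp

theorem recV_zero : recV c s g 0 = fun _ => 0 := by
  funext θ; simp [recV, recD_zero]

theorem recX_zero : recX c s g 0 = fun _ => 0 := by
  funext θ; simp [recX, recD_zero]

theorem recD_one : recD c s g 1 = fun _ => 0 := by
  funext θ; rw [recD_eq]; simp [recX_zero]

theorem recV_one : recV c s g 1 = fun _ => 1 := by
  funext θ; simp [recV, recD_one]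

theorem recX_one : recX c s g 1 = s := by
  funext θ; simp [recX, recD_one, recV_one]

theorem recV_at_zero (k : ℕ) : recV c s g k 0 = if k = 1 then 1 else 0 := by
  simp [recV]

theorem continuous_recV_of (k : ℕ) (h : Continuous (recD c s g k)) :
    Continuous (recV c s g k) := by
  unfold recV
  exact continuous_const.add
    (intervalIntegral.continuous_primitive (fun a b => h.intervalIntegrable a b) 0)

theorem continuous_recD (hc : Continuous c) (hs : Continuous s) (hg : ∀ w, Continuous (g w))
    (k : ℕ) : Continuous (recD c s g k) := by
  induction k using Nat.strong_induction_on with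
  | _ k ih =>
    have : recD c s g k = fun θ => ∑ j ∈ range k, g (k - j) θ * recX c s g j θ := by
      funext θ; exact recD_eq c s g k θ
    rw [this]
    refine continuous_finsetSum _ fun j hj => (hg _).mul ?_
    have hj' := ih j (mem_range.1 hj)
    exact (hc.mul hj').add ((continuous_const.mul hs).mul (continuous_recV_of j hj'))

theorem continuous_recV (hc : Continuous c) (hs : Continuous s) (hg : ∀ w, Continuous (g w))
    (k : ℕ) : Continuous (recV c s g k) :=
  continuous_recV_of k (continuous_recD hc hs hg k)

theorem continuous_recX (hc : Continuous c) (hs : Continuous s) (hg : ∀ w, Continuous (g w))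
    (k : ℕ) : Continuous (recX c s g k) :=
  (hc.mul (continuous_recD hc hs hg k)).add
    ((continuous_const.mul hs).mul (continuous_recV hc hs hg k))

theorem hasDerivAt_recV (hc : Continuous c) (hs : Continuous s) (hg : ∀ w, Continuous (g w))
    (k : ℕ) (θ : ℝ) : HasDerivAt (recV c s g k) (recD c s g k θ) θ := by
  have h := continuous_recD hc hs hg k
  exact (intervalIntegral.integral_hasDerivAt_right (h.intervalIntegrable 0 θ)
    (h.stronglyMeasurableAtFilter _ _) h.continuousAt).const_add _

end Basic

/-- A double sum along `w + j = k < K`, reordered. -/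
theorem sum_range_conv {M : Type*} [AddCommMonoid M] (F : ℕ → ℕ → M) (hF : ∀ j, F 0 j = 0)
    (K : ℕ) : ∑ k ∈ range K, ∑ j ∈ range k, F (k - j) j
      = ∑ j ∈ range K, ∑ w ∈ range (K - j), F w j := by
  rw [← Finset.sum_range_diag_flip K fun j w => F w j]
  refine sum_congr rfl fun k _ => ?_
  rw [sum_range_succ, Nat.sub_self, hF, add_zero]

/-- All terms are nonnegative, so the triangle `w + j < K` may be enlarged to a square, over which
the sum factors. This is how truncated Cauchy products are bounded below. -/
theorem sum_range_conv_le (F : ℕ → ℕ → ℝ) (hF : ∀ j, F 0 j = 0) (hF0 : ∀ w j, 0 ≤ F w j)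
    (K : ℕ) : ∑ k ∈ range K, ∑ j ∈ range k, F (k - j) j
      ≤ ∑ w ∈ range K, ∑ j ∈ range K, F w j := by
  rw [sum_range_conv F hF, sum_comm (s := range K)]
  refine sum_le_sum fun j _ => sum_le_sum_of_subset_of_nonneg ?_ fun _ _ _ => hF0 _ _
  exact range_subset_range.2 (Nat.sub_le _ _)

/-- The rescaling `g_w ↦ t^w g_w` acts on the coefficients by `v_k ↦ t^{k-1} v_k`. -/
theorem recD_rescale {𝕜 : Type*} [RCLike 𝕜] (c s : ℝ → 𝕜) (g : ℕ → ℝ → 𝕜) (t : 𝕜) (k : ℕ) :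
    recD c s (fun w θ => t ^ w * g w θ) k = fun θ => t ^ (k - 1) * recD c s g k θ := by
  induction k using Nat.strong_induction_on with
  | _ k ih =>
    funext θ
    rw [recD_eq, recD_eq, mul_sum]
    refine sum_congr rfl fun j hj => ?_
    have hj' := mem_range.1 hj
    rcases Nat.eq_zero_or_pos j with rfl | hj0
    · simp [recX_zero]
    have hv : recV c s (fun w θ => t ^ w * g w θ) j θ = t ^ (j - 1) * recV c s g j θ := by
      unfold recV
      rw [ih j hj', intervalIntegral.integral_const_mul, mul_add]
      congr 1
      split_ifs with h
      · simp [h]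
      · simp
    unfold recX
    rw [hv, ih j hj']
    have : t ^ (k - 1) = t ^ (k - j) * t ^ (j - 1) := by
      rw [← pow_add]; congr 1; omega
    rw [this]; ring

theorem recV_rescale {𝕜 : Type*} [RCLike 𝕜] (c s : ℝ → 𝕜) (g : ℕ → ℝ → 𝕜) (t : 𝕜) (k : ℕ)
    (θ : ℝ) : recV c s (fun w θ => t ^ w * g w θ) k θ = t ^ (k - 1) * recV c s g k θ := by
  unfold recV
  rw [recD_rescale, intervalIntegral.integral_const_mul, mul_add]
  congr 1
  split_ifs with h
  · simp [h]
  · simp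

/-- The coefficients up to index `k` only depend on the `g_w` with `w < k`. -/
theorem recD_congr {𝕜 : Type*} [RCLike 𝕜] (c s : ℝ → 𝕜) {g h : ℕ → ℝ → 𝕜} (K : ℕ)
    (hgh : ∀ w < K, 0 < w → g w = h w) (k : ℕ) (hk : k ≤ K) : recD c s g k = recD c s h k := by
  induction k using Nat.strong_induction_on with
  | _ k ih =>
    funext θ
    rw [recD_eq, recD_eq]
    refine sum_congr rfl fun j hj => ?_
    have hj' := mem_range.1 hj
    rcases Nat.eq_zero_or_pos j with rfl | hj0
    · simp [recX_zero]
    rw [hgh (k - j) (by omega) (by omega)]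
    unfold recX recV
    rw [ih j hj' (by omega)]

section Domination

variable {𝕜 : Type*} [RCLike 𝕜] {c s : ℝ → 𝕜} {g h : ℕ → ℝ → 𝕜} {γ γo : ℕ → ℝ → ℝ}

theorem recX_le_of_le {k : ℕ} {θ : ℝ} (hd : ‖recD c s g k θ‖ ≤ recD (‖c ·‖) (‖s ·‖) γ k θ)
    (hv : ‖recV c s g k θ‖ ≤ recV (‖c ·‖) (‖s ·‖) γ k θ) :
    ‖recX c s g k θ‖ ≤ recX (‖c ·‖) (‖s ·‖) γ k θ := by
  unfold recX
  refine (norm_add_le _ _).trans ?_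
  rw [norm_mul, norm_mul, norm_mul, RCLike.norm_natCast]
  gcongr

/-- The recursion uses only sums, products and integrals from `0`, so for `θ ≥ 0` it is monotone
under replacing all data by upper bounds of their absolute values. -/
theorem norm_recD_le_aux (hc : Continuous c) (hs : Continuous s) (hg : ∀ w, Continuous (g w))
    (hγ : ∀ w, Continuous (γ w)) (hle : ∀ w θ, 0 ≤ θ → ‖g w θ‖ ≤ γ w θ) (k : ℕ) :
    ∀ θ, 0 ≤ θ → ‖recD c s g k θ‖ ≤ recD (‖c ·‖) (‖s ·‖) γ k θ ∧
      ‖recV c s g k θ‖ ≤ recV (‖c ·‖) (‖s ·‖) γ k θ := by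
  induction k using Nat.strong_induction_on with
  | _ k ih =>
    have hd : ∀ θ, 0 ≤ θ → ‖recD c s g k θ‖ ≤ recD (‖c ·‖) (‖s ·‖) γ k θ := by
      intro θ hθ
      rw [recD_eq, recD_eq]
      refine norm_sum_le_of_le _ fun j hj => ?_
      obtain ⟨h1, h2⟩ := ih j (mem_range.1 hj) θ hθ
      rw [norm_mul]
      exact mul_le_mul (hle _ _ hθ) (recX_le_of_le h1 h2) (norm_nonneg _)
        ((norm_nonneg _).trans (hle _ _ hθ))
    intro θ hθ
    refine ⟨hd θ hθ, ?_⟩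
    unfold recV
    refine (norm_add_le _ _).trans (add_le_add ?_ ?_)
    · split_ifs <;> simp
    · exact intervalIntegral.norm_integral_le_of_norm_le hθ
        (ae_of_all _ fun t ht => hd t ht.1.le)
        ((continuous_recD hc.norm hs.norm hγ k).intervalIntegrable _ _)

theorem norm_recD_le (hc : Continuous c) (hs : Continuous s) (hg : ∀ w, Continuous (g w))
    (hγ : ∀ w, Continuous (γ w)) (hle : ∀ w θ, 0 ≤ θ → ‖g w θ‖ ≤ γ w θ) (k : ℕ) {θ : ℝ}
    (hθ : 0 ≤ θ) : ‖recD c s g k θ‖ ≤ recD (‖c ·‖) (‖s ·‖) γ k θ :=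
  (norm_recD_le_aux hc hs hg hγ hle k θ hθ).1

theorem norm_recV_le (hc : Continuous c) (hs : Continuous s) (hg : ∀ w, Continuous (g w))
    (hγ : ∀ w, Continuous (γ w)) (hle : ∀ w θ, 0 ≤ θ → ‖g w θ‖ ≤ γ w θ) (k : ℕ) {θ : ℝ}
    (hθ : 0 ≤ θ) : ‖recV c s g k θ‖ ≤ recV (‖c ·‖) (‖s ·‖) γ k θ :=
  (norm_recD_le_aux hc hs hg hγ hle k θ hθ).2

theorem norm_recX_le (hc : Continuous c) (hs : Continuous s) (hg : ∀ w, Continuous (g w))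
    (hγ : ∀ w, Continuous (γ w)) (hle : ∀ w θ, 0 ≤ θ → ‖g w θ‖ ≤ γ w θ) (k : ℕ) {θ : ℝ}
    (hθ : 0 ≤ θ) : ‖recX c s g k θ‖ ≤ recX (‖c ·‖) (‖s ·‖) γ k θ :=
  recX_le_of_le (norm_recD_le hc hs hg hγ hle k hθ) (norm_recV_le hc hs hg hγ hle k hθ)

/-- The majorant principle for differences: a bound that sees only the distance from `g` to `h`. It
is applied with `h` the odd part, whose holonomy vanishes, and so gives bounds linear in the even
parameters. -/
theorem norm_recD_sub_le_aux (hc : Continuous c) (hs : Continuous s)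
    (hg : ∀ w, Continuous (g w)) (hh : ∀ w, Continuous (h w))
    (hγ : ∀ w, Continuous (γ w)) (hγo : ∀ w, Continuous (γo w))
    (hle : ∀ w θ, 0 ≤ θ → ‖h w θ‖ ≤ γo w θ)
    (hsub : ∀ w θ, 0 ≤ θ → ‖g w θ - h w θ‖ ≤ γ w θ - γo w θ) (k : ℕ) :
    ∀ θ, 0 ≤ θ → ‖recD c s g k θ - recD c s h k θ‖ ≤
        recD (‖c ·‖) (‖s ·‖) γ k θ - recD (‖c ·‖) (‖s ·‖) γo k θ ∧
      ‖recV c s g k θ - recV c s h k θ‖ ≤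
        recV (‖c ·‖) (‖s ·‖) γ k θ - recV (‖c ·‖) (‖s ·‖) γo k θ := by
  induction k using Nat.strong_induction_on with
  | _ k ih =>
    have hgle : ∀ w θ, 0 ≤ θ → ‖g w θ‖ ≤ γ w θ := fun w θ hθ => by
      have := norm_add_le (g w θ - h w θ) (h w θ)
      rw [sub_add_cancel] at this
      linarith [hle w θ hθ, hsub w θ hθ]
    have hd : ∀ θ, 0 ≤ θ → ‖recD c s g k θ - recD c s h k θ‖ ≤
        recD (‖c ·‖) (‖s ·‖) γ k θ - recD (‖c ·‖) (‖s ·‖) γo k θ := by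
      intro θ hθ
      rw [recD_eq, recD_eq, recD_eq, recD_eq, ← sum_sub_distrib, ← sum_sub_distrib]
      refine norm_sum_le_of_le _ fun j hj => ?_
      obtain ⟨h1, h2⟩ := ih j (mem_range.1 hj) θ hθ
      have hX : ‖recX c s g j θ - recX c s h j θ‖ ≤
          recX (‖c ·‖) (‖s ·‖) γ j θ - recX (‖c ·‖) (‖s ·‖) γo j θ := by
        unfold recX
        have e1 : ∀ a b : 𝕜, c θ * a + j * s θ * b - (c θ * recD c s h j θ +
            j * s θ * recV c s h j θ) = c θ * (a - recD c s h j θ) +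
            j * s θ * (b - recV c s h j θ) := fun a b => by ring
        rw [e1]
        refine (norm_add_le _ _).trans ?_
        rw [norm_mul, norm_mul, norm_mul, RCLike.norm_natCast]
        have h3 := mul_le_mul_of_nonneg_left h1 (norm_nonneg (c θ))
        have h4 := mul_le_mul_of_nonneg_left h2
          (mul_nonneg (Nat.cast_nonneg (α := ℝ) j) (norm_nonneg (s θ)))
        linarith
      have hX' := norm_recX_le (k := j) hc hs hh hγo hle (hθ := hθ)
      -- The majorants satisfy the same product splitting, with `γ - γo` on `X` of `γo` and `γ` on
      -- the difference of the `X`.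
      have e2 : g (k - j) θ * recX c s g j θ - h (k - j) θ * recX c s h j θ =
          (g (k - j) θ - h (k - j) θ) * recX c s h j θ +
          g (k - j) θ * (recX c s g j θ - recX c s h j θ) := by ring
      rw [e2]
      refine (norm_add_le _ _).trans ?_
      rw [norm_mul, norm_mul]
      have h5 := mul_le_mul (hsub (k - j) θ hθ) hX' (norm_nonneg _)
        ((norm_nonneg _).trans (hsub (k - j) θ hθ))
      have h6 := mul_le_mul (hgle (k - j) θ hθ) hX (norm_nonneg _)
        ((norm_nonneg _).trans (hgle (k - j) θ hθ))
      linarith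
    intro θ hθ
    refine ⟨hd θ hθ, ?_⟩
    unfold recV
    have i1 := (continuous_recD hc hs hg k).intervalIntegrable (μ := volume) 0 θ
    have i2 := (continuous_recD hc hs hh k).intervalIntegrable (μ := volume) 0 θ
    have i3 := (continuous_recD hc.norm hs.norm hγ k).intervalIntegrable (μ := volume) 0 θ
    have i4 := (continuous_recD hc.norm hs.norm hγo k).intervalIntegrable (μ := volume) 0 θ
    rw [add_sub_add_left_eq_sub, add_sub_add_left_eq_sub, ← intervalIntegral.integral_sub i1 i2,
      ← intervalIntegral.integral_sub i3 i4]
    exact intervalIntegral.norm_integral_le_of_norm_le hθ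
      (ae_of_all _ fun t ht => hd t ht.1.le) (i3.sub i4)

theorem norm_recV_sub_le (hc : Continuous c) (hs : Continuous s)
    (hg : ∀ w, Continuous (g w)) (hh : ∀ w, Continuous (h w))
    (hγ : ∀ w, Continuous (γ w)) (hγo : ∀ w, Continuous (γo w))
    (hle : ∀ w θ, 0 ≤ θ → ‖h w θ‖ ≤ γo w θ)
    (hsub : ∀ w θ, 0 ≤ θ → ‖g w θ - h w θ‖ ≤ γ w θ - γo w θ) (k : ℕ) {θ : ℝ} (hθ : 0 ≤ θ) :
    ‖recV c s g k θ - recV c s h k θ‖ ≤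
        recV (‖c ·‖) (‖s ·‖) γ k θ - recV (‖c ·‖) (‖s ·‖) γo k θ :=
  (norm_recD_sub_le_aux hc hs hg hh hγ hγo hle hsub k θ hθ).2

end Domination

end

/-! ### Differential inequalities for truncated majorant series. -/

noncomputable section

open Finset MeasureTheory

section Majorant

variable {a b : ℝ → ℝ} {γ γo : ℕ → ℝ → ℝ}

/-- The recursion with `g = 0` is dominated by the one with `γ`, and a dominating quantity is
nonnegative. -/
theorem recD_recV_nonneg (ha : Continuous a) (hb : Continuous b) (ha0 : ∀ θ, 0 ≤ a θ)
    (hb0 : ∀ θ, 0 ≤ b θ) (hγ : ∀ w, Continuous (γ w)) (hγ0 : ∀ w θ, 0 ≤ γ w θ) (k : ℕ) {θ : ℝ}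
    (hθ : 0 ≤ θ) : 0 ≤ recD a b γ k θ ∧ 0 ≤ recV a b γ k θ ∧ 0 ≤ recX a b γ k θ := by
  have ea : (fun t => ‖a t‖) = a := funext fun t => Real.norm_of_nonneg (ha0 t)
  have eb : (fun t => ‖b t‖) = b := funext fun t => Real.norm_of_nonneg (hb0 t)
  have h1 := norm_recD_le (c := a) (s := b) (g := fun _ _ => 0) ha hb (fun _ => continuous_const)
    hγ (fun w θ _ => by simpa using hγ0 w θ) k hθ
  have h2 := norm_recV_le (c := a) (s := b) (g := fun _ _ => 0) ha hb (fun _ => continuous_const)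
    hγ (fun w θ _ => by simpa using hγ0 w θ) k hθ
  have h3 := norm_recX_le (c := a) (s := b) (g := fun _ _ => 0) ha hb (fun _ => continuous_const)
    hγ (fun w θ _ => by simpa using hγ0 w θ) k hθ
  rw [ea, eb] at h1 h2 h3
  exact ⟨(norm_nonneg _).trans h1, (norm_nonneg _).trans h2, (norm_nonneg _).trans h3⟩

theorem sum_recX_eq (θ x : ℝ) (e : ℕ → ℝ) (K : ℕ) :
    ∑ k ∈ range K, e k * recX a b γ k θ * x ^ k =
      a θ * ∑ k ∈ range K, e k * recD a b γ k θ * x ^ k +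
      b θ * ∑ k ∈ range K, e k * k * recV a b γ k θ * x ^ k := by
  rw [mul_sum, mul_sum, ← sum_add_distrib]
  refine sum_congr rfl fun k _ => ?_
  unfold recX; ring

theorem sum_mul_pow_conv_le (p q : ℕ → ℝ) (hp : ∀ w, 0 ≤ p w) (hq : ∀ w, 0 ≤ q w) (hp0 : p 0 = 0)
    {x : ℝ} (hx : 0 ≤ x) (K : ℕ) :
    ∑ k ∈ range K, (∑ j ∈ range k, p (k - j) * q j) * x ^ k ≤
      (∑ w ∈ range K, p w * x ^ w) * ∑ j ∈ range K, q j * x ^ j := by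
  rw [sum_mul_sum]
  have := sum_range_conv_le (fun w j => p w * x ^ w * (q j * x ^ j)) (fun j => by simp [hp0])
    (fun w j => by have := hp w; have := hq j; positivity) K
  refine le_trans (le_of_eq ?_) this
  refine sum_congr rfl fun k _ => ?_
  rw [sum_mul]
  refine sum_congr rfl fun j hj => ?_
  have : x ^ k = x ^ (k - j) * x ^ j := by
    rw [← pow_add]; congr 1; have := mem_range.1 hj; omega
  rw [this]; ring

variable (ha : Continuous a) (hb : Continuous b) (ha0 : ∀ θ, 0 ≤ a θ)
    (hb0 : ∀ θ, 0 ≤ b θ) (hγ : ∀ w, Continuous (γ w)) (hγ0 : ∀ w θ, 0 ≤ γ w θ)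
    (hγz : ∀ θ, γ 0 θ = 0)
include ha hb ha0 hb0 hγ hγ0 hγz

/-- With `D = ∑ v_k' x^k`, `X = a D + b U` and `D ≤ Γ X`, one solves for `X`. Truncation only loses
nonnegative terms, so the formal identity becomes an inequality. -/
theorem sum_recX_majorant_le {θ x Γ : ℝ} (hθ : 0 ≤ θ) (hx : 0 ≤ x) (K : ℕ)
    (hΓ : ∑ w ∈ range K, γ w θ * x ^ w ≤ Γ) :
    (1 - a θ * Γ) * ∑ k ∈ range K, recX a b γ k θ * x ^ k ≤
      b θ * ∑ k ∈ range K, k * recV a b γ k θ * x ^ k := by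
  have h1 := sum_recX_eq (a := a) (b := b) (γ := γ) θ x (fun _ => 1) K
  simp only [one_mul] at h1
  have hX : 0 ≤ ∑ k ∈ range K, recX a b γ k θ * x ^ k := sum_nonneg fun k _ =>
    mul_nonneg (recD_recV_nonneg ha hb ha0 hb0 hγ hγ0 k hθ).2.2 (by positivity)
  have h2 : ∑ k ∈ range K, recD a b γ k θ * x ^ k ≤
      Γ * ∑ k ∈ range K, recX a b γ k θ * x ^ k := by
    have h3 := sum_mul_pow_conv_le (fun w => γ w θ) (fun j => recX a b γ j θ) (fun w => hγ0 w θ)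
      (fun w => (recD_recV_nonneg ha hb ha0 hb0 hγ hγ0 w hθ).2.2) (hγz θ) hx K
    simp only [← recD_eq] at h3
    exact h3.trans (mul_le_mul_of_nonneg_right hΓ hX)
  have h4 := mul_le_mul_of_nonneg_left h2 (ha0 θ)
  linarith

/-- Applying `x ∂_x` to `D = Γ X` gives `D₂ = Γ₁ X + Γ X₂`. The second term is transport, of speed
`H ≥ b Γ / (1 - a Γ)`, and the first is growth, of rate `ρ ≥ Γ₁ b / (1 - a Γ)²`. -/
theorem sum_deriv_majorant_le {θ x Γ Γ₁ H ρ : ℝ} (hθ : 0 ≤ θ) (hx : 0 ≤ x) (K : ℕ)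
    (hΓ : ∑ w ∈ range K, γ w θ * x ^ w ≤ Γ) (haΓ : a θ * Γ < 1)
    (hΓ₁ : ∑ w ∈ range K, w * γ w θ * x ^ w ≤ Γ₁) (hH : b θ * Γ ≤ (1 - a θ * Γ) * H)
    (hρ : Γ₁ * b θ ≤ (1 - a θ * Γ) ^ 2 * ρ) :
    ∑ k ∈ range K, k * recD a b γ k θ * x ^ k ≤
      ρ * ∑ k ∈ range K, k * recV a b γ k θ * x ^ k +
      H * ∑ k ∈ range K, k * k * recV a b γ k θ * x ^ k := by
  have hnn := fun k => recD_recV_nonneg ha hb ha0 hb0 hγ hγ0 k hθ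
  have hXle := sum_recX_majorant_le ha hb ha0 hb0 hγ hγ0 hγz hθ hx K hΓ
  have h1 := sum_recX_eq (a := a) (b := b) (γ := γ) θ x (fun k => k) K
  set X := ∑ k ∈ range K, recX a b γ k θ * x ^ k with hXdef
  set U := ∑ k ∈ range K, k * recV a b γ k θ * x ^ k with hUdef
  set U₂ := ∑ k ∈ range K, k * k * recV a b γ k θ * x ^ k with hU₂def
  set D₂ := ∑ k ∈ range K, k * recD a b γ k θ * x ^ k with hD₂def
  set X₂ := ∑ k ∈ range K, k * recX a b γ k θ * x ^ k with hX₂def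
  have hX : 0 ≤ X := sum_nonneg fun k _ => mul_nonneg (hnn k).2.2 (by positivity)
  have hX₂ : 0 ≤ X₂ := sum_nonneg fun k _ => mul_nonneg
    (mul_nonneg (Nat.cast_nonneg k) (hnn k).2.2) (by positivity)
  have hU₂ : 0 ≤ U₂ := sum_nonneg fun k _ => mul_nonneg
    (mul_nonneg (by positivity) (hnn k).2.1) (by positivity)
  have hU : 0 ≤ U := sum_nonneg fun k _ => mul_nonneg
    (mul_nonneg (by positivity) (hnn k).2.1) (by positivity)
  have hΓ₁0 : 0 ≤ Γ₁ := (sum_nonneg fun w _ => mul_nonneg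
    (mul_nonneg (Nat.cast_nonneg w) (hγ0 w θ)) (by positivity)).trans hΓ₁
  have h2 : D₂ ≤ Γ₁ * X + Γ * X₂ := by
    have e1 := sum_mul_pow_conv_le (fun w => w * γ w θ) (fun j => recX a b γ j θ)
      (fun w => mul_nonneg (Nat.cast_nonneg w) (hγ0 w θ))
      (fun w => (hnn w).2.2) (by simp) hx K
    have e2 := sum_mul_pow_conv_le (fun w => γ w θ) (fun j => j * recX a b γ j θ)
      (fun w => hγ0 w θ) (fun w => mul_nonneg (Nat.cast_nonneg w) (hnn w).2.2) (hγz θ) hx K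
    have e3 : D₂ = ∑ k ∈ range K, (∑ j ∈ range k, ((k - j : ℕ) : ℝ) * γ (k - j) θ *
          recX a b γ j θ) * x ^ k +
        ∑ k ∈ range K, (∑ j ∈ range k, γ (k - j) θ * (j * recX a b γ j θ)) * x ^ k := by
      rw [← sum_add_distrib]
      refine sum_congr rfl fun k _ => ?_
      rw [← add_mul, ← sum_add_distrib, recD_eq, mul_sum]
      congr 1
      refine sum_congr rfl fun j hj => ?_
      rw [Nat.cast_sub (mem_range.1 hj).le]; ring
    rw [e3]
    exact add_le_add (e1.trans (mul_le_mul_of_nonneg_right hΓ₁ hX))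
      (e2.trans (mul_le_mul_of_nonneg_right hΓ hX₂))
  have h3 : (1 - a θ * Γ) * D₂ ≤ Γ₁ * X + Γ * b θ * U₂ := by
    rw [h1] at h2; linarith
  have hpos : 0 < 1 - a θ * Γ := by linarith
  have h4 : (1 - a θ * Γ) ^ 2 * D₂ ≤ (1 - a θ * Γ) ^ 2 * (ρ * U + H * U₂) := by
    have k1 := mul_le_mul_of_nonneg_left h3 hpos.le
    have k2 := mul_le_mul_of_nonneg_left hXle hΓ₁0
    have k3 := mul_le_mul_of_nonneg_right hρ hU
    have k4 := mul_le_mul_of_nonneg_left (mul_le_mul_of_nonneg_right hH hU₂) hpos.le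
    nlinarith
  exact le_of_mul_le_mul_left h4 (by positivity)

/-- Method of characteristics: along `β' = -β H` the derivative of `β^k` cancels the transport term,
and Gronwall with rate `ρ = A'` handles what is left. At `θ = 0` only `k = 1` survives, whence the
factor `β 0`. -/
theorem sum_mul_recV_le {β H Γ Γ₁ ρ A : ℝ → ℝ} (hβ : ∀ θ, HasDerivAt β (-β θ * H θ) θ)
    (hβ0 : ∀ θ, 0 ≤ β θ) (K : ℕ)
    (hΓ : ∀ θ, 0 ≤ θ → ∑ w ∈ range K, γ w θ * β θ ^ w ≤ Γ θ) (haΓ : ∀ θ, 0 ≤ θ → a θ * Γ θ < 1)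
    (hΓ₁ : ∀ θ, 0 ≤ θ → ∑ w ∈ range K, w * γ w θ * β θ ^ w ≤ Γ₁ θ)
    (hH : ∀ θ, 0 ≤ θ → b θ * Γ θ ≤ (1 - a θ * Γ θ) * H θ)
    (hρ : ∀ θ, 0 ≤ θ → Γ₁ θ * b θ ≤ (1 - a θ * Γ θ) ^ 2 * ρ θ) (hA : ∀ θ, HasDerivAt A (ρ θ) θ)
    {θ : ℝ} (hθ : 0 ≤ θ) :
    ∑ k ∈ range K, k * recV a b γ k θ * β θ ^ k ≤ β 0 * Real.exp (A θ - A 0) := by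
  set f : ℝ → ℝ := fun θ => (∑ k ∈ range K, k * recV a b γ k θ * β θ ^ k) * Real.exp (-A θ)
  have hf : ∀ θ, HasDerivAt f ((∑ k ∈ range K, k * recD a b γ k θ * β θ ^ k -
      H θ * (∑ k ∈ range K, k * k * recV a b γ k θ * β θ ^ k) -
      ρ θ * ∑ k ∈ range K, k * recV a b γ k θ * β θ ^ k) * Real.exp (-A θ)) θ := by
    intro θ
    have h1 : HasDerivAt (fun θ => ∑ k ∈ range K, k * recV a b γ k θ * β θ ^ k)
        (∑ k ∈ range K, (k * recD a b γ k θ * β θ ^ k +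
          k * recV a b γ k θ * (k * β θ ^ (k - 1) * (-β θ * H θ)))) θ := by
      refine HasDerivAt.fun_sum fun k _ => ?_
      exact ((hasDerivAt_recV ha hb hγ k θ).const_mul _).mul ((hβ θ).fun_pow k)
    refine (h1.mul (hA θ).neg.exp).congr_deriv ?_
    rw [sum_add_distrib]
    have : ∑ k ∈ range K, k * recV a b γ k θ * (k * β θ ^ (k - 1) * (-β θ * H θ)) =
        - (H θ * ∑ k ∈ range K, k * k * recV a b γ k θ * β θ ^ k) := by
      rw [mul_sum, ← sum_neg_distrib]
      refine sum_congr rfl fun k _ => ?_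
      rcases Nat.eq_zero_or_pos k with rfl | hk
      · simp
      · obtain ⟨m, rfl⟩ := Nat.exists_eq_add_of_le' hk
        rw [Nat.add_sub_cancel]; ring
    rw [this, Pi.neg_apply]; ring
  -- The weighted sum times `exp (-A)` does not increase; its derivative is the inequality of
  -- `sum_deriv_majorant_le`.
  have hanti : AntitoneOn f (Set.Ici 0) := by
    refine antitoneOn_of_deriv_nonpos (convex_Ici 0)
      (fun θ _ => (hf θ).continuousAt.continuousWithinAt)
      (fun θ _ => (hf θ).differentiableAt.differentiableWithinAt) fun θ hθ => ?_
    rw [interior_Ici] at hθ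
    rw [(hf θ).deriv]
    have hθ' := le_of_lt (Set.mem_Ioi.1 hθ)
    have := sum_deriv_majorant_le ha hb ha0 hb0 hγ hγ0 hγz hθ' (hβ0 θ) K (hΓ θ hθ')
      (haΓ θ hθ') (hΓ₁ θ hθ') (hH θ hθ') (hρ θ hθ')
    exact mul_nonpos_of_nonpos_of_nonneg (by linarith) (Real.exp_pos _).le
  have h0 : f 0 ≤ β 0 * Real.exp (-A 0) := by
    refine mul_le_mul_of_nonneg_right ?_ (Real.exp_pos _).le
    simp only [recV_at_zero]
    rcases lt_or_ge 1 K with hK | hK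
    · rw [sum_eq_single_of_mem 1 (mem_range.2 hK) (fun k _ hk => by simp [hk])]
      simp
    · rw [sum_eq_zero fun k hk => ?_]
      · exact hβ0 0
      · have : k = 0 := by have := mem_range.1 hk; omega
        simp [this]
  have h1 := (hanti Set.self_mem_Ici hθ hθ).trans h0
  have h2 := mul_le_mul_of_nonneg_right h1 (Real.exp_pos (A θ)).le
  have e1 : Real.exp (-A θ) * Real.exp (A θ) = 1 := by rw [← Real.exp_add]; simp
  have e2 : Real.exp (-A 0) * Real.exp (A θ) = Real.exp (A θ - A 0) := by
    rw [← Real.exp_add]; ring_nf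
  calc _ = f θ * Real.exp (A θ) := by simp only [f]; rw [mul_assoc, e1, mul_one]
    _ ≤ _ := h2
    _ = _ := by rw [mul_assoc, e2]

/-- The difference of two majorant recursions, one of which dominates the other. -/
theorem sum_recV_sub_le (hγo : ∀ w, Continuous (γo w)) (hγo0 : ∀ w θ, 0 ≤ γo w θ)
    (hγγo : ∀ w θ, γo w θ ≤ γ w θ)
    {β H Γ Γe S P : ℝ → ℝ} (hβ : ∀ θ, HasDerivAt β (-β θ * H θ) θ)
    (hβ0 : ∀ θ, 0 ≤ β θ) (K : ℕ) {T : ℝ}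
    (hΓ : ∀ θ, 0 ≤ θ → ∑ w ∈ range K, γ w θ * β θ ^ w ≤ Γ θ) (haΓ : ∀ θ, 0 ≤ θ → a θ * Γ θ < 1)
    (hΓe : ∀ θ, 0 ≤ θ → ∑ w ∈ range K, (γ w θ - γo w θ) * β θ ^ w ≤ Γe θ)
    (hH : ∀ θ, 0 ≤ θ → b θ * Γ θ ≤ (1 - a θ * Γ θ) * H θ)
    (hS : ∀ θ, 0 ≤ θ → θ ≤ T → Γe θ * b θ * ∑ k ∈ range K, k * recV a b γo k θ * β θ ^ k ≤
      (1 - a θ * Γ θ) ^ 2 * S θ) (hP : ∀ θ, HasDerivAt P (S θ) θ) (hT : 0 ≤ T) :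
    ∑ k ∈ range K, (recV a b γ k T - recV a b γo k T) * β T ^ k ≤ P T - P 0 := by
  have hγoz : ∀ θ, γo 0 θ = 0 := fun θ => le_antisymm ((hγγo 0 θ).trans_eq (hγz θ)) (hγo0 0 θ)
  have hΓe0 : ∀ θ, 0 ≤ θ → 0 ≤ Γe θ := fun θ hθ => (sum_nonneg fun w _ => mul_nonneg
    (sub_nonneg.2 (hγγo w θ)) (pow_nonneg (hβ0 θ) _)).trans (hΓe θ hθ)
  set f : ℝ → ℝ := fun θ => ∑ k ∈ range K, (recV a b γ k θ - recV a b γo k θ) * β θ ^ k - P θ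
    with hfdef
  have ea : (fun t => ‖a t‖) = a := funext fun t => Real.norm_of_nonneg (ha0 t)
  have eb : (fun t => ‖b t‖) = b := funext fun t => Real.norm_of_nonneg (hb0 t)
  have hmono : ∀ k θ, 0 ≤ θ → 0 ≤ recD a b γ k θ - recD a b γo k θ ∧
      0 ≤ recV a b γ k θ - recV a b γo k θ := by
    intro k θ hθ
    have := norm_recD_sub_le_aux (c := a) (s := b) (g := γ) (h := γo) ha hb hγ hγo hγ hγo
      (fun w θ _ => by rw [Real.norm_of_nonneg (hγo0 w θ)])
      (fun w θ _ => by rw [Real.norm_of_nonneg (sub_nonneg.2 (hγγo w θ))]) k θ hθ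
    rw [ea, eb] at this
    exact ⟨(norm_nonneg _).trans this.1, (norm_nonneg _).trans this.2⟩
  -- The same characteristics as for a single majorant. There is no weight `k` here, so no growth
  -- rate appears, only a source `S` produced by `γ - γo`.
  have hf : ∀ θ, HasDerivAt f (∑ k ∈ range K, (recD a b γ k θ - recD a b γo k θ) * β θ ^ k -
      H θ * (∑ k ∈ range K, k * (recV a b γ k θ - recV a b γo k θ) * β θ ^ k) - S θ) θ := by
    intro θ
    have h1 : HasDerivAt (fun θ => ∑ k ∈ range K, (recV a b γ k θ - recV a b γo k θ) * β θ ^ k)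
        (∑ k ∈ range K, ((recD a b γ k θ - recD a b γo k θ) * β θ ^ k +
          (recV a b γ k θ - recV a b γo k θ) * (k * β θ ^ (k - 1) * (-β θ * H θ)))) θ := by
      refine HasDerivAt.fun_sum fun k _ => ?_
      exact ((hasDerivAt_recV ha hb hγ k θ).sub (hasDerivAt_recV ha hb hγo k θ)).mul
        ((hβ θ).fun_pow k)
    refine (h1.sub (hP θ)).congr_deriv ?_
    rw [sum_add_distrib]
    have : ∑ k ∈ range K, (recV a b γ k θ - recV a b γo k θ) *
        (k * β θ ^ (k - 1) * (-β θ * H θ)) =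
        - (H θ * ∑ k ∈ range K, k * (recV a b γ k θ - recV a b γo k θ) * β θ ^ k) := by
      rw [mul_sum, ← sum_neg_distrib]
      refine sum_congr rfl fun k _ => ?_
      rcases Nat.eq_zero_or_pos k with rfl | hk
      · simp
      · obtain ⟨m, rfl⟩ := Nat.exists_eq_add_of_le' hk
        rw [Nat.add_sub_cancel]; ring
    rw [this]; ring
  have hanti : AntitoneOn f (Set.Icc 0 T) := by
    refine antitoneOn_of_deriv_nonpos (convex_Icc 0 T)
      (fun θ _ => (hf θ).continuousAt.continuousWithinAt)
      (fun θ _ => (hf θ).differentiableAt.differentiableWithinAt) fun θ hθ => ?_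
    rw [interior_Icc] at hθ
    rw [(hf θ).deriv]
    have hθ0 := hθ.1.le
    have hx := hβ0 θ
    have hΓo : ∑ w ∈ range K, γo w θ * β θ ^ w ≤ Γ θ :=
      (sum_le_sum fun w _ => mul_le_mul_of_nonneg_right (hγγo w θ) (pow_nonneg hx _)).trans (hΓ θ hθ0)
    have hXo := sum_recX_majorant_le ha hb ha0 hb0 hγo hγo0 hγoz hθ0 hx K hΓo
    have hnn := fun k => recD_recV_nonneg ha hb ha0 hb0 hγo hγo0 k hθ0
    set Xo := ∑ k ∈ range K, recX a b γo k θ * β θ ^ k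
    set Uo := ∑ k ∈ range K, k * recV a b γo k θ * β θ ^ k
    set D := ∑ k ∈ range K, (recD a b γ k θ - recD a b γo k θ) * β θ ^ k with hD
    set U := ∑ k ∈ range K, k * (recV a b γ k θ - recV a b γo k θ) * β θ ^ k with hUd
    have hXm : ∀ k, 0 ≤ recX a b γ k θ - recX a b γo k θ := fun k => by
      have e : recX a b γ k θ - recX a b γo k θ = a θ * (recD a b γ k θ - recD a b γo k θ) +
        k * b θ * (recV a b γ k θ - recV a b γo k θ) := by unfold recX; ring
      rw [e]
      have h1 := (hmono k θ hθ0).1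
      have h2 := (hmono k θ hθ0).2
      have h3 := ha0 θ
      have h4 := hb0 θ
      positivity
    set X := ∑ k ∈ range K, (recX a b γ k θ - recX a b γo k θ) * β θ ^ k with hX
    have eX : X = a θ * D + b θ * U := by
      rw [hX, hD, hUd, mul_sum, mul_sum, ← sum_add_distrib]
      refine sum_congr rfl fun k _ => ?_
      unfold recX; ring
    have hX0 : 0 ≤ X := sum_nonneg fun k _ => mul_nonneg (hXm k) (pow_nonneg hx _)
    have hXo0 : 0 ≤ Xo := sum_nonneg fun k _ => mul_nonneg (hnn k).2.2 (pow_nonneg hx _)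
    have hU0 : 0 ≤ U := sum_nonneg fun k _ => mul_nonneg (mul_nonneg (Nat.cast_nonneg k)
      (hmono k θ hθ0).2) (pow_nonneg hx _)
    -- Product splitting of `γ X - γo Xo`. The term in `Xo` is the source and is bounded through the
    -- odd sum occurring in `hS`; the term in `X` is transport.
    have hDle : D ≤ Γe θ * Xo + Γ θ * X := by
      have e1 := sum_mul_pow_conv_le (fun w => γ w θ - γo w θ) (fun j => recX a b γo j θ)
        (fun w => sub_nonneg.2 (hγγo w θ)) (fun w => (hnn w).2.2)
        (by simp only [hγz, hγoz, sub_zero]) hx K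
      have e2 := sum_mul_pow_conv_le (fun w => γ w θ)
        (fun j => recX a b γ j θ - recX a b γo j θ) (fun w => hγ0 w θ) hXm (hγz θ) hx K
      have e3 : D = ∑ k ∈ range K, (∑ j ∈ range k, (γ (k - j) θ - γo (k - j) θ) *
            recX a b γo j θ) * β θ ^ k +
          ∑ k ∈ range K, (∑ j ∈ range k, γ (k - j) θ *
            (recX a b γ j θ - recX a b γo j θ)) * β θ ^ k := by
        rw [← sum_add_distrib]
        refine sum_congr rfl fun k _ => ?_
        rw [← add_mul, ← sum_add_distrib, recD_eq, recD_eq, ← sum_sub_distrib]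
        congr 1
        refine sum_congr rfl fun j hj => ?_
        ring
      rw [e3]
      exact add_le_add (e1.trans (mul_le_mul_of_nonneg_right (hΓe θ hθ0) hXo0))
        (e2.trans (mul_le_mul_of_nonneg_right (hΓ θ hθ0) hX0))
    have hpos : 0 < 1 - a θ * Γ θ := by linarith [haΓ θ hθ0]
    have h3 : (1 - a θ * Γ θ) * D ≤ Γe θ * Xo + Γ θ * b θ * U := by
      rw [eX] at hDle; linarith
    have k1 := mul_le_mul_of_nonneg_left h3 hpos.le
    have k2 := mul_le_mul_of_nonneg_left hXo (hΓe0 θ hθ0)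
    have k3 := hS θ hθ0 hθ.2.le
    have k4 := mul_le_mul_of_nonneg_left (mul_le_mul_of_nonneg_right (hH θ hθ0) hU0) hpos.le
    have h4 : (1 - a θ * Γ θ) ^ 2 * (D - H θ * U - S θ) ≤ 0 := by nlinarith
    by_contra hcon
    push Not at hcon
    have : 0 < (1 - a θ * Γ θ) ^ 2 * (D - H θ * U - S θ) := by positivity
    linarith
  have h1 := hanti (Set.left_mem_Icc.2 hT) (Set.right_mem_Icc.2 hT) hT
  simp only [hfdef, recV_at_zero, sub_self, zero_mul, sum_const_zero] at h1
  linarith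

end Majorant

end

/-! ### The Liénard recursion: center condition and triangular structure. -/

noncomputable section

open Finset MeasureTheory

/-- The complex-valued cosine of a real angle. -/
def cosC (θ : ℝ) : ℂ := (Real.cos θ : ℂ)

/-- The complex-valued sine of a real angle. -/
def sinC (θ : ℝ) : ℂ := (Real.sin θ : ℂ)

theorem continuous_cosC : Continuous cosC := Complex.continuous_ofReal.comp Real.continuous_cos

theorem continuous_sinC : Continuous sinC := Complex.continuous_ofReal.comp Real.continuous_sin

theorem norm_cosC (θ : ℝ) : ‖cosC θ‖ = |Real.cos θ| := by simp [cosC, -Complex.ofReal_cos]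

theorem norm_sinC (θ : ℝ) : ‖sinC θ‖ = |Real.sin θ| := by simp [sinC, -Complex.ofReal_sin]

theorem cosC_sq (θ : ℝ) : cosC θ ^ 2 = 1 - sinC θ ^ 2 := by
  unfold cosC sinC
  rw [← Complex.ofReal_pow, Real.cos_sq']; push_cast; ring

/-- The parameters as a sequence indexed from `1`, extended by zero. -/
def lamSeq {d : ℕ} (lam : Fin d → ℂ) (l : ℕ) : ℂ :=
  if h : 0 < l ∧ l - 1 < d then lam ⟨l - 1, h.2⟩ else 0

theorem lamSeq_succ {d : ℕ} (lam : Fin d → ℂ) (i : Fin d) : lamSeq lam (i + 1) = lam i := by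
  simp [lamSeq]

theorem lamSeq_zero {d : ℕ} (lam : Fin d → ℂ) : lamSeq lam 0 = 0 := by simp [lamSeq]

theorem lamSeq_of_lt {d : ℕ} (lam : Fin d → ℂ) {l : ℕ} (h : d < l) : lamSeq lam l = 0 := by
  unfold lamSeq; rw [dif_neg]; omega

theorem sum_lamSeq {d : ℕ} {M : Type*} [AddCommMonoid M] (lam : Fin d → ℂ) (F : ℕ → ℂ → M)
    (hF : F 0 0 = 0) : ∑ l ∈ range (d + 1), F l (lamSeq lam l) = ∑ i : Fin d, F (i + 1) (lam i) := by
  rw [sum_range_succ', lamSeq_zero, hF, add_zero, sum_range]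
  simp [lamSeq_succ]

/-- The coefficients `L_w cos^w sin` of the polar Liénard equation. -/
def lienardG (L : ℕ → ℂ) (w : ℕ) (θ : ℝ) : ℂ := L w * cosC θ ^ w * sinC θ

theorem continuous_lienardG (L : ℕ → ℂ) (w : ℕ) : Continuous (lienardG L w) :=
  (continuous_const.mul (continuous_cosC.pow w)).mul continuous_sinC

/-- The two recursions index the same terms by `l` and by `j = k - l`. After reflection they differ
only in the range, and the extra terms vanish because `λ_l = 0` for `l > d` or because `recX`
vanishes at index `0`. -/
theorem bautinCoeffDeriv_eq {d : ℕ} (lam : Fin d → ℂ) (k : ℕ) :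
    bautinCoeffDeriv lam k = recD cosC sinC (lienardG (lamSeq lam)) k := by
  induction k using Nat.strong_induction_on with
  | _ k ih =>
    funext θ
    rw [bautinCoeffDeriv, recD_eq, ← sum_range_reflect]
    set T : ℕ → ℂ := fun i => lienardG (lamSeq lam) (i + 1) θ *
      recX cosC sinC (lienardG (lamSeq lam)) (k - (i + 1)) θ with hT
    have h1 : ∀ i : Fin d, (if _h : (i : ℕ) + 1 < k then
        lam i * (Real.cos θ : ℂ) ^ ((i : ℕ) + 1) * (Real.sin θ : ℂ) *
          ((Real.cos θ : ℂ) * bautinCoeffDeriv lam (k - ((i : ℕ) + 1)) θ +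
            ((k - ((i : ℕ) + 1) : ℕ) : ℂ) * (Real.sin θ : ℂ) *
              ((if k - ((i : ℕ) + 1) = 1 then 1 else 0) +
                ∫ t in (0 : ℝ)..θ, bautinCoeffDeriv lam (k - ((i : ℕ) + 1)) t))
      else 0) = T i := by
      intro i
      by_cases h : (i : ℕ) + 1 < k
      · rw [dif_pos h]
        rw [ih _ (by omega), hT]
        simp only [lienardG, lamSeq_succ, recX, recV]
        rfl
      · rw [dif_neg h, hT]
        simp only
        rw [Nat.sub_eq_zero_of_le (by omega), recX_zero, mul_zero]
    refine (sum_congr rfl fun i _ => h1 i).trans ?_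
    rw [← Finset.sum_range (f := T)]
    have h2 : ∀ j ∈ range k, lienardG (lamSeq lam) (k - (k - 1 - j)) θ *
        recX cosC sinC (lienardG (lamSeq lam)) (k - 1 - j) θ = T j := by
      intro j hj
      have := mem_range.1 hj
      rw [hT]
      simp only
      rw [show k - (k - 1 - j) = j + 1 by omega, show k - 1 - j = k - (j + 1) by omega]
    rw [sum_congr rfl h2]
    rcases le_total d k with hdk | hdk
    · refine sum_subset (range_subset_range.2 hdk) fun x _ hx => ?_
      have : d < x + 1 := by have := mem_range.not.1 hx; omega
      simp [hT, lienardG, lamSeq_of_lt lam this]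
    · refine (sum_subset (range_subset_range.2 hdk) fun x _ hx => ?_).symm
      have : k - (x + 1) = 0 := by have := mem_range.not.1 hx; omega
      simp only [hT, this, recX_zero, mul_zero]

theorem bautinCoeff_eq {d : ℕ} (lam : Fin d → ℂ) (k : ℕ) (θ : ℝ) :
    bautinCoeff lam k θ = recV cosC sinC (lienardG (lamSeq lam)) k θ := by
  unfold bautinCoeff recV
  rw [bautinCoeffDeriv_eq]

/-- The value at `2π` of the `k`-th coefficient, as a function of the parameter sequence. -/
def holonomy (L : ℕ → ℂ) (k : ℕ) : ℂ := recV cosC sinC (lienardG L) k (2 * Real.pi)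

theorem coeff_inverseReturnSeries {d : ℕ} (lam : Fin d → ℂ) (k : ℕ) :
    PowerSeries.coeff k (inverseReturnSeries lam) = holonomy (lamSeq lam) k := by
  rw [inverseReturnSeries, PowerSeries.coeff_mk, bautinCoeff_eq, holonomy]

theorem holonomy_rescale (L : ℕ → ℂ) (t : ℂ) (k : ℕ) :
    holonomy (fun l => t ^ l * L l) k = t ^ (k - 1) * holonomy L k := by
  unfold holonomy
  rw [← recV_rescale]
  congr 1
  funext w θ
  simp only [lienardG]; ring

theorem holonomy_zero (L : ℕ → ℂ) : holonomy L 0 = 0 := by simp [holonomy, recV_zero]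

theorem holonomy_one (L : ℕ → ℂ) : holonomy L 1 = 1 := by simp [holonomy, recV_one]

/-- If all `g_w` are of the form `cos θ · P(sin θ)`, the origin is a center. -/
theorem recV_two_pi_eq_zero {g : ℕ → ℝ → ℂ}
    (hg : ∀ w, ∃ P : ℝ → ℂ, Continuous P ∧ ∀ θ, g w θ = cosC θ * P (Real.sin θ)) {k : ℕ}
    (hk : k ≠ 1) : recV cosC sinC g k (2 * Real.pi) = 0 := by
  -- The composition condition: `v_k' = cos θ · D(sin θ)` integrates to a function of `sin θ`, which
  -- takes equal values at `0` and `2π`. The induction closes because `cos² = 1 - sin²`.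
  have key : ∀ k, (∃ D : ℝ → ℂ, Continuous D ∧
      ∀ θ, recD cosC sinC g k θ = cosC θ * D (Real.sin θ)) ∧
      ∃ F : ℝ → ℂ, Continuous F ∧ ∀ θ, recV cosC sinC g k θ = F (Real.sin θ) := by
    intro k
    induction k using Nat.strong_induction_on with
    | _ k ih =>
      have hD : ∃ D : ℝ → ℂ, Continuous D ∧
          ∀ θ, recD cosC sinC g k θ = cosC θ * D (Real.sin θ) := by
        choose P hPc hP using hg
        have : ∀ j, ∃ X : ℝ → ℂ, Continuous X ∧
            (j < k → ∀ θ, recX cosC sinC g j θ = X (Real.sin θ)) := by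
          intro j
          by_cases hj : j < k
          · obtain ⟨⟨D, hDc, hD⟩, F, hFc, hF⟩ := ih j hj
            refine ⟨fun x => (1 - (x : ℂ) ^ 2) * D x + j * x * F x, by fun_prop, fun _ θ => ?_⟩
            unfold recX
            rw [hD, hF, ← mul_assoc, ← sq, cosC_sq]
            rfl
          · exact ⟨0, continuous_zero, fun h => absurd h hj⟩
        choose X hXc hX using this
        refine ⟨fun x => ∑ j ∈ range k, P (k - j) x * X j x,
          continuous_finsetSum _ fun j _ => (hPc _).mul (hXc _), fun θ => ?_⟩
        rw [recD_eq, mul_sum]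
        refine sum_congr rfl fun j hj => ?_
        rw [hP, hX j (mem_range.1 hj)]; ring
      refine ⟨hD, ?_⟩
      obtain ⟨D, hDc, hD⟩ := hD
      refine ⟨fun x => (if k = 1 then 1 else 0) + ∫ t in (0 : ℝ)..x, D t,
        continuous_const.add (intervalIntegral.continuous_primitive
          (fun a b => hDc.intervalIntegrable a b) 0), fun θ => ?_⟩
      unfold recV
      congr 1
      have := intervalIntegral.integral_deriv_smul_comp (a := 0) (b := θ) (f := Real.sin)
        (f' := Real.cos) (g := D) (fun x _ => Real.hasDerivAt_sin x)
        Real.continuous_cos.continuousOn hDc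
      rw [Real.sin_zero] at this
      rw [← this]
      refine intervalIntegral.integral_congr fun t _ => ?_
      simp only [hD, Function.comp, Complex.real_smul, cosC]
  obtain ⟨_, F, _, hF⟩ := key k
  rw [hF, Real.sin_two_pi, ← Real.sin_zero, ← hF, recV_at_zero, if_neg hk]

/-- For odd `w` one has `cos^w sin = cos (1 - sin²)^m sin`. This is the reversible center of a
Liénard system with odd damping. -/
theorem holonomy_eq_zero_of_odd {L : ℕ → ℂ} (hL : ∀ l, Even l → L l = 0) {k : ℕ} (hk : k ≠ 1) :
    holonomy L k = 0 := by
  refine recV_two_pi_eq_zero (fun w => ?_) hk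
  rcases Nat.even_or_odd' w with ⟨m, rfl | rfl⟩
  · exact ⟨0, continuous_zero, fun θ => by simp [lienardG, hL]⟩
  · refine ⟨fun x => L (2 * m + 1) * (1 - (x : ℂ) ^ 2) ^ m * x, by fun_prop, fun θ => ?_⟩
    have h := cosC_sq θ
    unfold lienardG
    rw [pow_succ, pow_mul, h]
    simp only [sinC]; ring

/-- The top coefficient enters linearly. -/
theorem holonomy_succ_sub {L L' : ℕ → ℂ} {N : ℕ} (hN : 0 < N)
    (h : ∀ w < N, 0 < w → L w = L' w) : holonomy L (N + 1) = holonomy L' (N + 1) +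
      (L N - L' N) * ∫ θ in (0 : ℝ)..(2 * Real.pi), cosC θ ^ N * sinC θ ^ 2 := by
  have hg : ∀ w < N, 0 < w → lienardG L w = lienardG L' w := fun w h1 h2 => by
    funext θ; simp only [lienardG, h w h1 h2]
  have hX : ∀ j ≤ N, recX cosC sinC (lienardG L) j = recX cosC sinC (lienardG L') j := by
    intro j hj
    unfold recX recV
    rw [recD_congr _ _ N hg j hj]
  -- In `v_{N+1}'` the coefficient `g_N` meets only `X_1 = sin`. All other factors involve indices
  -- below `N`, where the two sequences agree.
  have hD : ∀ θ, recD cosC sinC (lienardG L) (N + 1) θ =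
      recD cosC sinC (lienardG L') (N + 1) θ + (L N - L' N) * (cosC θ ^ N * sinC θ ^ 2) := by
    intro θ
    obtain ⟨n, rfl⟩ := Nat.exists_eq_add_of_le' hN
    rw [recD_eq, recD_eq, sum_range_succ', sum_range_succ', sum_range_succ', sum_range_succ']
    simp only [recX_zero, mul_zero, add_zero, zero_add, recX_one]
    have : ∀ i ∈ range n, lienardG L (n + 1 + 1 - (i + 1 + 1)) θ *
        recX cosC sinC (lienardG L) (i + 1 + 1) θ = lienardG L' (n + 1 + 1 - (i + 1 + 1)) θ *
        recX cosC sinC (lienardG L') (i + 1 + 1) θ := fun i hi => by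
      have := mem_range.1 hi
      rw [hX _ (by omega), hg _ (by omega) (by omega)]
    rw [sum_congr rfl this, Nat.add_sub_cancel]
    unfold lienardG
    ring
  have ic := continuous_recD continuous_cosC continuous_sinC (continuous_lienardG L') (N + 1)
  have i2 : Continuous fun θ => (L N - L' N) * (cosC θ ^ N * sinC θ ^ 2) :=
    continuous_const.mul ((continuous_cosC.pow _).mul (continuous_sinC.pow _))
  unfold holonomy recV
  rw [intervalIntegral.integral_congr fun t _ => hD t,
    intervalIntegral.integral_add (ic.intervalIntegrable _ _) (i2.intervalIntegrable _ _),
    intervalIntegral.integral_const_mul]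
  ring

theorem integral_cosC_pow_mul_sinC_sq (n : ℕ) :
    ∫ θ in (0 : ℝ)..(2 * Real.pi), cosC θ ^ (2 * n) * sinC θ ^ 2 = (wallisConst n : ℂ) := by
  unfold wallisConst cosC sinC
  rw [← intervalIntegral.integral_ofReal]
  push_cast
  rfl

end

/-! ### Polynomial dependence on the parameters and coefficient norms. -/

noncomputable section

open Finset MeasureTheory

section CoeffNorm

variable {d : ℕ}

theorem coeffNorm_eq_sum (p : MvPolynomial (Fin d) ℝ) {F : Finset (Fin d →₀ ℕ)}
    (hF : p.support ⊆ F) : coeffNorm p = ∑ m ∈ F, |p.coeff m| := by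
  refine sum_subset hF fun m _ hm => ?_
  rw [MvPolynomial.notMem_support_iff.1 hm, abs_zero]

theorem coeffNorm_nonneg (p : MvPolynomial (Fin d) ℝ) : 0 ≤ coeffNorm p :=
  sum_nonneg fun _ _ => abs_nonneg _

theorem coeffNorm_zero : coeffNorm (0 : MvPolynomial (Fin d) ℝ) = 0 := by simp [coeffNorm]

theorem coeffNorm_add_le (p q : MvPolynomial (Fin d) ℝ) :
    coeffNorm (p + q) ≤ coeffNorm p + coeffNorm q := by
  classical
  rw [coeffNorm_eq_sum (p + q) MvPolynomial.support_add,
    coeffNorm_eq_sum p (subset_union_left (s₂ := q.support)),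
    coeffNorm_eq_sum q (subset_union_right (s₁ := p.support)), ← sum_add_distrib]
  exact sum_le_sum fun m _ => by rw [MvPolynomial.coeff_add]; exact abs_add_le _ _

theorem coeffNorm_sum_le {ι : Type*} (S : Finset ι) (p : ι → MvPolynomial (Fin d) ℝ) :
    coeffNorm (∑ i ∈ S, p i) ≤ ∑ i ∈ S, coeffNorm (p i) :=
  le_sum_of_subadditive _ coeffNorm_zero.le coeffNorm_add_le _ _

theorem coeffNorm_monomial (m : Fin d →₀ ℕ) (a : ℝ) :
    coeffNorm (MvPolynomial.monomial m a) = |a| := by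
  classical
  rw [coeffNorm_eq_sum (F := {m}) _ MvPolynomial.support_monomial_subset]
  simp

theorem coeffNorm_C (a : ℝ) : coeffNorm (MvPolynomial.C a : MvPolynomial (Fin d) ℝ) = |a| :=
  coeffNorm_monomial 0 a

theorem coeffNorm_mul_le (p q : MvPolynomial (Fin d) ℝ) :
    coeffNorm (p * q) ≤ coeffNorm p * coeffNorm q := by
  rw [MvPolynomial.mul_def, Finsupp.sum]
  refine (coeffNorm_sum_le _ _).trans ?_
  unfold coeffNorm
  rw [sum_mul_sum]
  refine sum_le_sum fun m _ => ?_
  rw [Finsupp.sum]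
  refine (coeffNorm_sum_le _ _).trans (sum_le_sum fun m' _ => ?_)
  rw [coeffNorm_monomial, abs_mul]
  rfl

theorem aeval_eq_sum (p : MvPolynomial (Fin d) ℝ) (lam : Fin d → ℂ) :
    MvPolynomial.aeval lam p = ∑ m ∈ p.support, ((p.coeff m : ℝ) : ℂ) * ∏ i, lam i ^ m i := by
  rw [MvPolynomial.aeval_def, MvPolynomial.eval₂_eq']
  rfl

/-- The weight of a monomial, with `λ_i` of weight `i`. -/
abbrev indexWeight (d : ℕ) (i : Fin d) : ℕ := i + 1

theorem degree_le_weight (m : Fin d →₀ ℕ) :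
    (m.sum fun _ e => e) ≤ Finsupp.weight (indexWeight d) m := by
  rw [Finsupp.weight_apply]
  refine sum_le_sum fun i _ => ?_
  simp [indexWeight, mul_add]

/-- Every variable has weight at least one. This is the source of `deg f_k ≤ k - 1`. -/
theorem totalDegree_le_of_weighted {p : MvPolynomial (Fin d) ℝ} {w : ℕ}
    (hp : p.IsWeightedHomogeneous (indexWeight d) w) : p.totalDegree ≤ w := by
  refine Finset.sup_le fun m hm => ?_
  rw [← hp (MvPolynomial.mem_support_iff.1 hm)]
  exact degree_le_weight m

/-- A finite set of monomials containing all those of weight `w`. -/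
def weightMonomials (d w : ℕ) : Finset (Fin d →₀ ℕ) :=
  (Finsupp.finite_of_nat_weight_le (indexWeight d) (fun _ => Nat.succ_ne_zero _) w).toFinset

theorem support_subset_weightMonomials {p : MvPolynomial (Fin d) ℝ} {w : ℕ}
    (hp : p.IsWeightedHomogeneous (indexWeight d) w) : p.support ⊆ weightMonomials d w := by
  intro m hm
  simp only [weightMonomials, Set.Finite.mem_toFinset, Set.mem_ofPred_eq]
  exact (hp (MvPolynomial.mem_support_iff.1 hm)).le

end CoeffNorm

section Family

variable {d : ℕ}

/-- A family of weighted homogeneous polynomials depending continuously on `θ`. -/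
structure IsPolyFamily (w : ℕ) (P : ℝ → MvPolynomial (Fin d) ℝ) : Prop where
  cont : ∀ m, Continuous fun θ => (P θ).coeff m
  homogeneous : ∀ θ, (P θ).IsWeightedHomogeneous (indexWeight d) w

theorem IsPolyFamily.coeffNorm_eq {w : ℕ} {P : ℝ → MvPolynomial (Fin d) ℝ}
    (hP : IsPolyFamily w P) (θ : ℝ) :
    coeffNorm (P θ) = ∑ m ∈ weightMonomials d w, |(P θ).coeff m| :=
  coeffNorm_eq_sum _ (support_subset_weightMonomials (hP.homogeneous θ))

theorem IsPolyFamily.continuous_coeffNorm {w : ℕ} {P : ℝ → MvPolynomial (Fin d) ℝ}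
    (hP : IsPolyFamily w P) : Continuous fun θ => coeffNorm (P θ) := by
  simp only [hP.coeffNorm_eq]
  exact continuous_finsetSum _ fun m _ => (hP.cont m).abs

theorem isPolyFamily_const {w : ℕ} {p : MvPolynomial (Fin d) ℝ}
    (hp : p.IsWeightedHomogeneous (indexWeight d) w) : IsPolyFamily w fun _ => p :=
  ⟨fun _ => continuous_const, fun _ => hp⟩

theorem IsPolyFamily.add {w : ℕ} {P Q : ℝ → MvPolynomial (Fin d) ℝ}
    (hP : IsPolyFamily w P) (hQ : IsPolyFamily w Q) : IsPolyFamily w fun θ => P θ + Q θ :=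
  ⟨fun m => by simp only [MvPolynomial.coeff_add]; exact (hP.cont m).add (hQ.cont m),
    fun θ => (hP.homogeneous θ).add (hQ.homogeneous θ)⟩

theorem IsPolyFamily.sum {ι : Type*} {w : ℕ} (S : Finset ι)
    {P : ι → ℝ → MvPolynomial (Fin d) ℝ} (hP : ∀ i ∈ S, IsPolyFamily w (P i)) :
    IsPolyFamily w fun θ => ∑ i ∈ S, P i θ :=
  ⟨fun m => by
    simp only [MvPolynomial.coeff_sum]
    exact continuous_finsetSum _ fun i hi => (hP i hi).cont m,
    fun θ => MvPolynomial.IsWeightedHomogeneous.sum S _ w fun i hi => (hP i hi).homogeneous θ⟩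

theorem IsPolyFamily.mul {w w' : ℕ} {P Q : ℝ → MvPolynomial (Fin d) ℝ}
    (hP : IsPolyFamily w P) (hQ : IsPolyFamily w' Q) : IsPolyFamily (w + w') fun θ => P θ * Q θ :=
  ⟨fun m => by
    classical
    simp only [MvPolynomial.coeff_mul]
    exact continuous_finsetSum _ fun i _ => (hP.cont _).mul (hQ.cont _),
    fun θ => (hP.homogeneous θ).mul (hQ.homogeneous θ)⟩

theorem IsPolyFamily.C_mul {w : ℕ} {P : ℝ → MvPolynomial (Fin d) ℝ} {a : ℝ → ℝ}
    (ha : Continuous a) (hP : IsPolyFamily w P) :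
    IsPolyFamily w fun θ => MvPolynomial.C (a θ) * P θ :=
  ⟨fun m => by simp only [MvPolynomial.coeff_C_mul]; exact ha.mul (hP.cont m), fun θ => (hP.homogeneous θ).C_mul _⟩

/-- Integration is done coefficient by coefficient over a finite set of monomials independent of
`θ`, so that evaluation commutes with the integral. -/
theorem IsPolyFamily.exists_integral {w : ℕ} {P : ℝ → MvPolynomial (Fin d) ℝ}
    (hP : IsPolyFamily w P) : ∃ Q : ℝ → MvPolynomial (Fin d) ℝ, IsPolyFamily w Q ∧
      (∀ (lam : Fin d → ℂ) θ, MvPolynomial.aeval lam (Q θ) =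
        ∫ t in (0 : ℝ)..θ, MvPolynomial.aeval lam (P t)) ∧
      ∀ θ, 0 ≤ θ → coeffNorm (Q θ) ≤ ∫ t in (0 : ℝ)..θ, coeffNorm (P t) := by
  classical
  -- `weightMonomials` contains all weights up to `w`; the filter keeps those of weight exactly `w`,
  -- so that the integral is again homogeneous.
  set F := (weightMonomials d w).filter fun m => Finsupp.weight (indexWeight d) m = w with hF
  have hsupp : ∀ θ, (P θ).support ⊆ F := fun θ m hm => by
    rw [hF, mem_filter]
    exact ⟨support_subset_weightMonomials (hP.homogeneous θ) hm,
      hP.homogeneous θ (MvPolynomial.mem_support_iff.1 hm)⟩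
  have hint : ∀ m θ, IntervalIntegrable (fun t => (P t).coeff m) volume 0 θ :=
    fun m θ => (hP.cont m).intervalIntegrable _ _
  refine ⟨fun θ => ∑ m ∈ F, MvPolynomial.monomial m (∫ t in (0 : ℝ)..θ, (P t).coeff m),
    ⟨fun m => ?_, fun θ => ?_⟩, fun lam θ => ?_, fun θ hθ => ?_⟩
  · simp only [MvPolynomial.coeff_sum, MvPolynomial.coeff_monomial]
    refine continuous_finsetSum _ fun m' _ => ?_
    split_ifs
    · exact intervalIntegral.continuous_primitive
        (fun a b => (hP.cont m').intervalIntegrable a b) 0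
    · exact continuous_const
  · refine MvPolynomial.IsWeightedHomogeneous.sum _ _ _ fun m hm => ?_
    exact MvPolynomial.isWeightedHomogeneous_monomial _ _ _ (mem_filter.1 hm).2
  · have h1 : ∀ t, MvPolynomial.aeval lam (P t) =
        ∑ m ∈ F, (((P t).coeff m : ℝ) : ℂ) * ∏ i, lam i ^ m i := fun t => by
      rw [aeval_eq_sum]
      refine sum_subset (hsupp t) fun m _ hm => ?_
      rw [MvPolynomial.notMem_support_iff.1 hm]; simp
    simp only [h1, map_sum]
    rw [intervalIntegral.integral_finsetSum fun m _ => ?_]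
    · refine sum_congr rfl fun m _ => ?_
      rw [intervalIntegral.integral_mul_const, intervalIntegral.integral_ofReal,
        MvPolynomial.aeval_monomial, Finsupp.prod_fintype _ _ (by simp)]
      rfl
    · exact ((Complex.continuous_ofReal.comp (hP.cont m)).mul
        continuous_const).intervalIntegrable _ _
  · refine (coeffNorm_sum_le _ _).trans ?_
    have h1 : ∀ t, coeffNorm (P t) = ∑ m ∈ F, |(P t).coeff m| := fun t =>
      coeffNorm_eq_sum _ (hsupp t)
    simp only [h1]
    rw [intervalIntegral.integral_finsetSum fun m _ => (hP.cont m).abs.intervalIntegrable _ _]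
    refine sum_le_sum fun m _ => ?_
    rw [coeffNorm_monomial]
    exact intervalIntegral.abs_integral_le_integral_abs hθ

/-- If the `g_w` are given by polynomials of weight `w` in the parameters, then `v_k` is given by
polynomials of weight `k - 1`, whose coefficient norms obey the majorant recursion. -/
theorem exists_polyFamily_recV {G : ℕ → ℝ → MvPolynomial (Fin d) ℝ}
    (hG : ∀ w, IsPolyFamily w (G w)) {γ : ℕ → ℝ → ℝ} (hγ : ∀ w, Continuous (γ w))
    (hγ0 : ∀ w θ, 0 ≤ γ w θ) (hle : ∀ w θ, coeffNorm (G w θ) ≤ γ w θ) (k : ℕ) :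
    (∃ D : ℝ → MvPolynomial (Fin d) ℝ, IsPolyFamily (k - 1) D ∧ (∀ (lam : Fin d → ℂ) θ,
      MvPolynomial.aeval lam (D θ) =
        recD cosC sinC (fun w t => MvPolynomial.aeval lam (G w t)) k θ) ∧
      ∀ θ, 0 ≤ θ → coeffNorm (D θ) ≤ recD (|Real.cos ·|) (|Real.sin ·|) γ k θ) ∧
    ∃ V : ℝ → MvPolynomial (Fin d) ℝ, IsPolyFamily (k - 1) V ∧ (∀ (lam : Fin d → ℂ) θ,
      MvPolynomial.aeval lam (V θ) =
        recV cosC sinC (fun w t => MvPolynomial.aeval lam (G w t)) k θ) ∧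
      ∀ θ, 0 ≤ θ → coeffNorm (V θ) ≤ recV (|Real.cos ·|) (|Real.sin ·|) γ k θ := by
  induction k using Nat.strong_induction_on with
  | _ k ih =>
    have hD : ∃ D : ℝ → MvPolynomial (Fin d) ℝ, IsPolyFamily (k - 1) D ∧ (∀ (lam : Fin d → ℂ) θ,
        MvPolynomial.aeval lam (D θ) =
          recD cosC sinC (fun w t => MvPolynomial.aeval lam (G w t)) k θ) ∧
        ∀ θ, 0 ≤ θ → coeffNorm (D θ) ≤ recD (|Real.cos ·|) (|Real.sin ·|) γ k θ := by
      have : ∀ j, ∃ X : ℝ → MvPolynomial (Fin d) ℝ, j ∈ range k → IsPolyFamily (k - 1) X ∧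
          (∀ (lam : Fin d → ℂ) θ, MvPolynomial.aeval lam (X θ) = MvPolynomial.aeval lam (G (k - j) θ) *
            recX cosC sinC (fun w t => MvPolynomial.aeval lam (G w t)) j θ) ∧
          ∀ θ, 0 ≤ θ → coeffNorm (X θ) ≤
            γ (k - j) θ * recX (|Real.cos ·|) (|Real.sin ·|) γ j θ := by
        intro j
        -- The index `j = 0` has to be split off: the weights add up as `(k - j) + (j - 1) = k - 1`
        -- in `ℕ` only for `j ≥ 1`.
        rcases Nat.eq_zero_or_pos j with rfl | hj0
        · refine ⟨fun _ => 0, fun _ => ⟨isPolyFamily_const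
            (MvPolynomial.isWeightedHomogeneous_zero _ _ _), fun lam θ => ?_, fun θ _ => ?_⟩⟩
          · simp [recX_zero]
          · simp [recX_zero, coeffNorm_zero]
        by_cases hj : j ∈ range k
        swap
        · exact ⟨0, fun h => absurd h hj⟩
        have hj' := mem_range.1 hj
        obtain ⟨⟨D, hDf, hDe, hDn⟩, V, hVf, hVe, hVn⟩ := ih j hj'
        refine ⟨fun θ => G (k - j) θ * (MvPolynomial.C (Real.cos θ) * D θ +
          MvPolynomial.C (j * Real.sin θ) * V θ), fun _ => ⟨?_, fun lam θ => ?_, fun θ hθ => ?_⟩⟩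
        · rw [show k - 1 = (k - j) + (j - 1) by omega]
          exact (hG _).mul ((hDf.C_mul Real.continuous_cos).add
            (hVf.C_mul (continuous_const.mul Real.continuous_sin)))
        · rw [map_mul, map_add, map_mul, map_mul, hDe, hVe, MvPolynomial.aeval_C,
            MvPolynomial.aeval_C]
          unfold recX cosC sinC
          simp [-Complex.ofReal_cos, -Complex.ofReal_sin]
        · refine (coeffNorm_mul_le _ _).trans ?_
          refine mul_le_mul (hle _ _) ?_ (coeffNorm_nonneg _) (hγ0 _ _)
          refine (coeffNorm_add_le _ _).trans ?_
          unfold recX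
          refine add_le_add ?_ ?_
          · refine (coeffNorm_mul_le _ _).trans ?_
            rw [coeffNorm_C]
            exact mul_le_mul_of_nonneg_left (hDn θ hθ) (abs_nonneg _)
          · refine (coeffNorm_mul_le _ _).trans ?_
            rw [coeffNorm_C, abs_mul, Nat.abs_cast]
            exact mul_le_mul_of_nonneg_left (hVn θ hθ) (by positivity)
      choose X hX using this
      refine ⟨fun θ => ∑ j ∈ range k, X j θ, IsPolyFamily.sum _ fun j hj => (hX j hj).1,
        fun lam θ => ?_, fun θ hθ => ?_⟩
      · rw [map_sum, recD_eq]
        exact sum_congr rfl fun j hj => (hX j hj).2.1 lam θ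
      · rw [recD_eq]
        exact (coeffNorm_sum_le _ _).trans (sum_le_sum fun j hj => (hX j hj).2.2 θ hθ)
    refine ⟨hD, ?_⟩
    obtain ⟨D, hDf, hDe, hDn⟩ := hD
    obtain ⟨Q, hQf, hQe, hQn⟩ := hDf.exists_integral
    have habs : Continuous (recD (|Real.cos ·|) (|Real.sin ·|) γ k) :=
      continuous_recD Real.continuous_cos.abs Real.continuous_sin.abs hγ k
    refine ⟨fun θ => MvPolynomial.C (if k = 1 then 1 else 0) + Q θ, ?_, fun lam θ => ?_,
      fun θ hθ => ?_⟩
    · refine IsPolyFamily.add (isPolyFamily_const ?_) hQf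
      split_ifs with h
      · rw [h]; exact MvPolynomial.isWeightedHomogeneous_C _ _
      · rw [map_zero]; exact MvPolynomial.isWeightedHomogeneous_zero _ _ _
    · rw [map_add, hQe, MvPolynomial.aeval_C]
      unfold recV
      simp only [hDe]
      congr 1
      split_ifs <;> simp
    · refine (coeffNorm_add_le _ _).trans ?_
      unfold recV
      refine add_le_add ?_ ((hQn θ hθ).trans ?_)
      · rw [coeffNorm_C]; split_ifs <;> simp
      · exact intervalIntegral.integral_mono_on hθ
          (hDf.continuous_coeffNorm.intervalIntegrable _ _) (habs.intervalIntegrable _ _)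
          fun t ht => hDn t ht.1

end Family

end

/-! ### Geometric bounds and the coefficient polynomials. -/

noncomputable section

open Finset MeasureTheory

/-- Geometric bounds for the majorant recursion with constant coefficients. -/
theorem exists_geometric_bound {a : ℕ → ℝ} (ha : ∀ w, 0 ≤ a w) (ha0 : a 0 = 0) {d : ℕ}
    (had : ∀ w, d < w → a w = 0) : ∃ C M : ℝ, 0 < C ∧ 0 < M ∧
      ∀ k θ, 0 ≤ θ → θ ≤ 2 * Real.pi →
        recV (|Real.cos ·|) (|Real.sin ·|) (fun w _ => a w) k θ ≤ C * M ^ k ∧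
        recX (|Real.cos ·|) (|Real.sin ·|) (fun w _ => a w) k θ ≤ C * M ^ k := by
  set S := ∑ w ∈ range (d + 1), a w with hS
  have hS0 : 0 ≤ S := sum_nonneg fun w _ => ha w
  -- Chosen so that `S β₀ ≤ 1/2` and `β₀ ≤ 1`, which makes `Γ = 1/2` admissible below.
  set β₀ : ℝ := 1 / (2 * S + 2) with hβ₀
  have hβ₀pos : 0 < β₀ := by positivity
  set β : ℝ → ℝ := fun θ => β₀ * Real.exp (-θ) with hβdef
  have hβ0 : ∀ θ, 0 < β θ := fun θ => by positivity
  have hβle : ∀ θ, 0 ≤ θ → β θ ≤ β₀ := fun θ hθ => by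
    have : Real.exp (-θ) ≤ 1 := Real.exp_le_one_iff.2 (by linarith)
    exact mul_le_of_le_one_right hβ₀pos.le this
  have hβ : ∀ θ, HasDerivAt β (-β θ * 1) θ := fun θ => by
    have := ((hasDerivAt_id θ).neg.exp).const_mul β₀
    refine this.congr_deriv ?_
    simp [hβdef]
  have hΓ : ∀ θ, 0 ≤ θ → ∀ K, ∑ w ∈ range K, a w * β θ ^ w ≤ 1 / 2 := by
    intro θ hθ K
    have h1 : ∀ w, a w * β θ ^ w ≤ a w * β₀ := fun w => by
      rcases Nat.eq_zero_or_pos w with rfl | hw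
      · simp [ha0]
      · refine mul_le_mul_of_nonneg_left ?_ (ha w)
        have hβ1 : β₀ ≤ 1 := by rw [hβ₀, div_le_one (by positivity)]; linarith
        calc β θ ^ w ≤ β₀ ^ w := pow_le_pow_left₀ (hβ0 θ).le (hβle θ hθ) w
          _ ≤ β₀ ^ 1 := pow_le_pow_of_le_one hβ₀pos.le hβ1 hw
          _ = β₀ := pow_one _
    have h2 : ∑ w ∈ range K, a w ≤ S := by
      have : ∑ w ∈ range K, a w ≤ ∑ w ∈ range (K + (d + 1)), a w :=
        sum_le_sum_of_subset_of_nonneg (range_subset_range.2 (by omega)) fun w _ _ => ha w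
      refine this.trans_eq (sum_subset (range_subset_range.2 (by omega)) fun w _ hw => ?_).symm
      exact had w (by have := mem_range.not.1 hw; omega)
    calc _ ≤ ∑ w ∈ range K, a w * β₀ := sum_le_sum fun w _ => h1 w
      _ = (∑ w ∈ range K, a w) * β₀ := by rw [sum_mul]
      _ ≤ S * β₀ := mul_le_mul_of_nonneg_right h2 hβ₀pos.le
      _ ≤ 1 / 2 := by rw [hβ₀, mul_one_div, div_le_div_iff₀ (by positivity) (by norm_num)]; linarith
  have hcos : Continuous (|Real.cos ·|) := Real.continuous_cos.abs
  have hsin : Continuous (|Real.sin ·|) := Real.continuous_sin.abs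
  have hU : ∀ K θ, 0 ≤ θ → θ ≤ 2 * Real.pi → ∑ k ∈ range K,
      k * recV (|Real.cos ·|) (|Real.sin ·|) (fun w _ => a w) k θ * β θ ^ k ≤
        β₀ * Real.exp (4 * d * Real.pi) := by
    intro K θ hθ hθ2
    -- With `Γ = 1/2` the transport speed is at most `1`, which `β₀ e^{-θ}` absorbs. The rate `2 d`
    -- comes from `Γ₁ = d/2` and `(1 - a Γ)² ≥ 1/4`.
    have := sum_mul_recV_le (a := (|Real.cos ·|)) (b := (|Real.sin ·|)) (γ := fun w _ => a w)
      (β := β) (H := fun _ => 1) (Γ := fun _ => 1 / 2) (Γ₁ := fun _ => d / 2) (ρ := fun _ => 2 * d)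
      (A := fun θ => 2 * d * θ) hcos hsin (fun _ => abs_nonneg _) (fun _ => abs_nonneg _)
      (fun _ => continuous_const) (fun w _ => ha w) (fun _ => ha0) hβ (fun θ => (hβ0 θ).le) K
      (fun θ hθ => hΓ θ hθ K) (fun θ _ => by linarith [Real.abs_cos_le_one θ])
      (fun θ hθ => ?_) (fun θ _ => by linarith [Real.abs_cos_le_one θ, Real.abs_sin_le_one θ])
      (fun θ _ => ?_) (fun θ => ?_) hθ
    · refine this.trans ?_
      have e : β 0 = β₀ := by simp [hβdef]
      rw [e]
      refine mul_le_mul_of_nonneg_left (Real.exp_le_exp.2 ?_) hβ₀pos.le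
      have := mul_le_mul_of_nonneg_left hθ2 (Nat.cast_nonneg (α := ℝ) d)
      linarith
    · calc _ ≤ ∑ w ∈ range K, d * (a w * β θ ^ w) := by
            refine sum_le_sum fun w _ => ?_
            rw [mul_assoc]
            rcases le_or_gt w d with h | h
            · exact mul_le_mul_of_nonneg_right (by exact_mod_cast h)
                (mul_nonneg (ha w) (pow_nonneg (hβ0 θ).le _))
            · simp [had w h]
        _ = d * ∑ w ∈ range K, a w * β θ ^ w := by rw [mul_sum]
        _ ≤ d * (1 / 2) := mul_le_mul_of_nonneg_left (hΓ θ hθ K) (Nat.cast_nonneg d)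
        _ = d / 2 := by ring
    · have h1 := Real.abs_cos_le_one θ
      have h2 := Real.abs_sin_le_one θ
      have h3 : (0 : ℝ) ≤ d := Nat.cast_nonneg d
      have h4 : (1 / 4 : ℝ) ≤ (1 - |Real.cos θ| * (1 / 2)) ^ 2 := by nlinarith
      nlinarith [mul_le_mul_of_nonneg_left h2 h3, mul_le_mul_of_nonneg_right h4 h3]
    · simpa using (hasDerivAt_id θ).const_mul (2 * (d : ℝ))
  refine ⟨2 * (β₀ * Real.exp (4 * d * Real.pi)), Real.exp (2 * Real.pi) / β₀, by positivity,
    by positivity, fun k θ hθ hθ2 => ?_⟩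
  have hnn := fun k => recD_recV_nonneg hcos hsin (fun _ => abs_nonneg _) (fun _ => abs_nonneg _)
    (γ := fun w _ => a w) (fun _ => continuous_const) (fun w _ => ha w) k hθ
  -- On `[0, 2π]` the barrier stays above `β₀ e^{-2π}`, the reciprocal of the geometric ratio.
  have hpow : 1 ≤ (Real.exp (2 * Real.pi) / β₀) ^ k * β θ ^ k := by
    rw [← mul_pow]
    refine one_le_pow₀ ?_
    rw [hβdef]
    have : Real.exp (2 * Real.pi) / β₀ * (β₀ * Real.exp (-θ)) =
        Real.exp (2 * Real.pi + -θ) := by rw [Real.exp_add]; field_simp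
    simp only
    rw [this]
    exact Real.one_le_exp (by linarith)
  have hfin : ∀ v, 0 ≤ v → v * β θ ^ k ≤ 2 * (β₀ * Real.exp (4 * d * Real.pi)) →
      v ≤ 2 * (β₀ * Real.exp (4 * d * Real.pi)) * (Real.exp (2 * Real.pi) / β₀) ^ k := by
    intro v hv hle
    calc v ≤ v * ((Real.exp (2 * Real.pi) / β₀) ^ k * β θ ^ k) := le_mul_of_one_le_right hv hpow
      _ = v * β θ ^ k * (Real.exp (2 * Real.pi) / β₀) ^ k := by ring
      _ ≤ _ := mul_le_mul_of_nonneg_right hle (by positivity)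
  have hUk := hU (k + 1) θ hθ hθ2
  have hEpos : 0 < β₀ * Real.exp (4 * d * Real.pi) := by positivity
  constructor
  · refine hfin _ (hnn k).2.1 ?_
    rcases Nat.eq_zero_or_pos k with rfl | hk
    · rw [recV_zero]; simp only [zero_mul]; linarith
    · have h1 := single_le_sum (f := fun k : ℕ => (k : ℝ) *
          recV (|Real.cos ·|) (|Real.sin ·|) (fun w _ => a w) k θ * β θ ^ k)
        (fun j _ => mul_nonneg (mul_nonneg (Nat.cast_nonneg j) (hnn j).2.1)
          (pow_nonneg (hβ0 θ).le j)) (self_mem_range_succ k)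
      have h2 : (1 : ℝ) ≤ k := by exact_mod_cast hk
      have h3 := mul_nonneg (hnn k).2.1 (pow_nonneg (hβ0 θ).le k)
      have h4 := h1.trans hUk
      simp only [mul_assoc (k : ℝ)] at h4
      nlinarith
  · refine hfin _ (hnn k).2.2 ?_
    have h1 := single_le_sum (f := fun k : ℕ =>
          recX (|Real.cos ·|) (|Real.sin ·|) (fun w _ => a w) k θ * β θ ^ k)
        (fun j _ => mul_nonneg (hnn j).2.2
          (pow_nonneg (hβ0 θ).le j)) (self_mem_range_succ k)
    -- Passing from `U` to `X` costs `1 / (1 - a Γ) ≤ 2`, which is the factor `2` in the constant.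
    have h2 := sum_recX_majorant_le (γ := fun w _ => a w) hcos hsin (fun _ => abs_nonneg _)
      (fun _ => abs_nonneg _) (fun _ => continuous_const) (fun w _ => ha w) (fun _ => ha0)
      hθ (hβ0 θ).le (k + 1) (hΓ θ hθ (k + 1))
    have hX : 0 ≤ ∑ k ∈ range (k + 1),
        recX (|Real.cos ·|) (|Real.sin ·|) (fun w _ => a w) k θ * β θ ^ k :=
      sum_nonneg fun j _ => mul_nonneg (hnn j).2.2 (pow_nonneg (hβ0 θ).le j)
    have hU0 : 0 ≤ ∑ k ∈ range (k + 1),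
        k * recV (|Real.cos ·|) (|Real.sin ·|) (fun w _ => a w) k θ * β θ ^ k :=
      sum_nonneg fun j _ => mul_nonneg (mul_nonneg (Nat.cast_nonneg j) (hnn j).2.1)
        (pow_nonneg (hβ0 θ).le j)
    have h3 := Real.abs_cos_le_one θ
    have h4 := Real.abs_sin_le_one θ
    nlinarith [mul_le_mul_of_nonneg_right h4 hU0, mul_le_mul_of_nonneg_right h3 hX]

/-- The polynomials underlying `lienardG`. -/
def lienardPolyG (d w : ℕ) (θ : ℝ) : MvPolynomial (Fin d) ℝ :=
  if h : 0 < w ∧ w - 1 < d then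
    MvPolynomial.C (Real.cos θ ^ w * Real.sin θ) * MvPolynomial.X ⟨w - 1, h.2⟩ else 0

theorem isPolyFamily_X (i : Fin d) : IsPolyFamily ((i : ℕ) + 1)
    fun _ => (MvPolynomial.X i : MvPolynomial (Fin d) ℝ) :=
  isPolyFamily_const (MvPolynomial.isWeightedHomogeneous_X ℝ (indexWeight d) i)

theorem isPolyFamily_lienardPolyG (d w : ℕ) : IsPolyFamily w (lienardPolyG d w) := by
  unfold lienardPolyG
  split_ifs with h
  · have := (isPolyFamily_X (⟨w - 1, h.2⟩ : Fin d)).C_mul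
      (a := fun θ => Real.cos θ ^ w * Real.sin θ) (by fun_prop)
    simpa [Nat.sub_add_cancel (show 1 ≤ w from h.1)] using this
  · exact isPolyFamily_const (MvPolynomial.isWeightedHomogeneous_zero _ _ _)

theorem aeval_lienardPolyG {d : ℕ} (lam : Fin d → ℂ) (w : ℕ) (θ : ℝ) :
    MvPolynomial.aeval lam (lienardPolyG d w θ) = lienardG (lamSeq lam) w θ := by
  unfold lienardPolyG lienardG lamSeq cosC sinC
  split_ifs with h
  · rw [map_mul, MvPolynomial.aeval_C, MvPolynomial.aeval_X, Complex.coe_algebraMap]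
    push_cast; ring
  · simp

theorem coeffNorm_lienardPolyG_le (d w : ℕ) (θ : ℝ) : coeffNorm (lienardPolyG d w θ) ≤
    if 0 < w ∧ w - 1 < d then 1 else 0 := by
  unfold lienardPolyG
  split_ifs with h
  · rw [MvPolynomial.C_mul_X_eq_monomial, coeffNorm_monomial, abs_mul, abs_pow]
    exact mul_le_one₀ (pow_le_one₀ (abs_nonneg _) (Real.abs_cos_le_one θ)) (abs_nonneg _)
      (Real.abs_sin_le_one θ)
  · rw [coeffNorm_zero]

/-- The coefficients of the inverse return map are weighted homogeneous polynomials in the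
parameters whose norms grow at most geometrically. -/
theorem exists_holonomy_polynomial (d : ℕ) : ∃ f : ℕ → MvPolynomial (Fin d) ℝ,
    (∀ k, (f k).IsWeightedHomogeneous (indexWeight d) (k - 1)) ∧
    (∀ k (lam : Fin d → ℂ), MvPolynomial.aeval lam (f k) = holonomy (lamSeq lam) k) ∧
    ∃ C M : ℝ, 0 < C ∧ 0 < M ∧ ∀ k, coeffNorm (f k) ≤ C * M ^ k := by
  set a : ℕ → ℝ := fun w => if 0 < w ∧ w - 1 < d then 1 else 0 with ha
  have ha0 : ∀ w, 0 ≤ a w := fun w => by simp only [ha]; split_ifs <;> norm_num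
  obtain ⟨C, M, hC, hM, hb⟩ := exists_geometric_bound (a := a) ha0 (by simp [ha]) (d := d)
    (fun w hw => by simp only [ha]; rw [if_neg]; omega)
  have h := fun k => (exists_polyFamily_recV (isPolyFamily_lienardPolyG d) (γ := fun w _ => a w)
    (fun _ => continuous_const) (fun w _ => ha0 w) (coeffNorm_lienardPolyG_le d) k).2
  choose V hVf hVe hVn using h
  refine ⟨fun k => V k (2 * Real.pi), fun k => (hVf k).homogeneous _, fun k lam => ?_,
    C, M, hC, hM, fun k => ?_⟩
  · rw [hVe, holonomy]
    congr 1
    funext w t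
    exact aeval_lienardPolyG lam w t
  · have hpi : 0 ≤ 2 * Real.pi := by positivity
    exact (hVn k _ hpi).trans (hb k _ hpi le_rfl).1

end

/-! ### Solutions of the polar equation and truncated first integrals. -/

noncomputable section

open Finset MeasureTheory

section PolarField

variable {𝕜 : Type*} [RCLike 𝕜]

/-- The truncated series `G(θ, r) = ∑_{w ≤ W} g_w(θ) r^w`. -/
def recG (g : ℕ → ℝ → 𝕜) (W : ℕ) (θ : ℝ) (r : 𝕜) : 𝕜 := ∑ w ∈ range (W + 1), g w θ * r ^ w

/-- The vector field of the equation `(1 - c G) r' = - r s G`. -/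
def polarField (c s : ℝ → 𝕜) (g : ℕ → ℝ → 𝕜) (W : ℕ) (θ : ℝ) (r : 𝕜) : 𝕜 :=
  -(r * s θ * recG g W θ r) / (1 - c θ * recG g W θ r)

/-- The truncated first integral. -/
def recP (c s : ℝ → 𝕜) (g : ℕ → ℝ → 𝕜) (K : ℕ) (θ : ℝ) (r : 𝕜) : 𝕜 :=
  ∑ k ∈ range K, recV c s g k θ * r ^ k

theorem norm_pow_sub_pow_le {x y : 𝕜} (hx : ‖x‖ ≤ 1) (hy : ‖y‖ ≤ 1) (n : ℕ) :
    ‖x ^ n - y ^ n‖ ≤ n * ‖x - y‖ := by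
  induction n with
  | zero => simp
  | succ n ih =>
    have : x ^ (n + 1) - y ^ (n + 1) = (x ^ n - y ^ n) * x + y ^ n * (x - y) := by ring
    rw [this]
    refine (norm_add_le _ _).trans ?_
    rw [norm_mul, norm_mul, norm_pow]
    have h1 := mul_le_mul ih hx (norm_nonneg _) (by positivity)
    have h2 := mul_le_mul_of_nonneg_right (pow_le_one₀ (n := n) (norm_nonneg y) hy)
      (norm_nonneg (x - y))
    push_cast
    linarith

variable {c s : ℝ → 𝕜} {g : ℕ → ℝ → 𝕜} {W : ℕ} {A : ℝ}

theorem norm_recG_le (hg0 : ∀ θ, g 0 θ = 0) {θ : ℝ} (hA : ∀ w, ‖g w θ‖ ≤ A) {r : 𝕜}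
    (hr : ‖r‖ ≤ 1) : ‖recG g W θ r‖ ≤ A * W * ‖r‖ := by
  unfold recG
  rw [sum_range_succ', hg0, zero_mul, add_zero]
  refine (norm_sum_le_of_le _ fun w _ => ?_).trans (b := ∑ w ∈ range W, A * ‖r‖) ?_
  · rw [norm_mul, norm_pow]
    exact mul_le_mul (hA _) (pow_le_of_le_one (norm_nonneg _) hr (by omega)) (by positivity)
      ((norm_nonneg _).trans (hA 0))
  · rw [sum_const, card_range, nsmul_eq_mul]; linarith

theorem norm_recG_sub_le {θ : ℝ} (hA : ∀ w, ‖g w θ‖ ≤ A) {x y : 𝕜}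
    (hx : ‖x‖ ≤ 1) (hy : ‖y‖ ≤ 1) :
    ‖recG g W θ x - recG g W θ y‖ ≤ A * (W + 1) ^ 2 * ‖x - y‖ := by
  unfold recG
  rw [← sum_sub_distrib]
  refine (norm_sum_le_of_le _ fun w hw => ?_).trans
    (b := ∑ w ∈ range (W + 1), A * ((W + 1) * ‖x - y‖)) ?_
  · rw [← mul_sub, norm_mul]
    refine mul_le_mul (hA _) ((norm_pow_sub_pow_le hx hy w).trans ?_) (norm_nonneg _)
      ((norm_nonneg _).trans (hA 0))
    refine mul_le_mul_of_nonneg_right ?_ (norm_nonneg _)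
    have := mem_range.1 hw
    exact_mod_cast this.le
  · rw [sum_const, card_range, nsmul_eq_mul]; push_cast
    exact le_of_eq (by ring)

theorem half_le_norm_one_sub {z : 𝕜} (hz : ‖z‖ ≤ 1 / 2) : 1 / 2 ≤ ‖1 - z‖ := by
  have := norm_sub_norm_le (1 : 𝕜) z
  rw [norm_one] at this
  linarith

variable (hc1 : ∀ θ, ‖c θ‖ ≤ 1) (hs1 : ∀ θ, ‖s θ‖ ≤ 1) (hg0 : ∀ θ, g 0 θ = 0)
  (hA : ∀ w θ, ‖g w θ‖ ≤ A)

include hc1 hg0 hA in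
theorem half_le_norm_one_sub_recG {θ : ℝ} {r : 𝕜} (hr : ‖r‖ ≤ 1) (hr2 : A * W * ‖r‖ ≤ 1 / 2) :
    1 / 2 ≤ ‖1 - c θ * recG g W θ r‖ := by
  refine half_le_norm_one_sub ?_
  rw [norm_mul]
  have h1 := norm_recG_le (W := W) hg0 (fun w => hA w θ) hr
  nlinarith [mul_le_mul (hc1 θ) h1 (norm_nonneg _) zero_le_one]

include hc1 hs1 hg0 hA in
theorem norm_polarField_le {θ : ℝ} {r : 𝕜} (hr : ‖r‖ ≤ 1) (hr2 : A * W * ‖r‖ ≤ 1 / 2) :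
    ‖polarField c s g W θ r‖ ≤ 2 * (A * W) * ‖r‖ ^ 2 := by
  have h1 := norm_recG_le (W := W) hg0 (fun w => hA w θ) hr
  have h2 := half_le_norm_one_sub_recG (W := W) hc1 hg0 hA (θ := θ) hr hr2
  unfold polarField
  rw [norm_div, norm_neg, norm_mul, norm_mul, div_le_iff₀ (by linarith)]
  have h3 : ‖r‖ * ‖s θ‖ * ‖recG g W θ r‖ ≤ ‖r‖ * 1 * (A * W * ‖r‖) := by
    gcongr; exact hs1 θ
  have h4 : 0 ≤ A * W := mul_nonneg ((norm_nonneg _).trans (hA 0 θ)) (Nat.cast_nonneg W)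
  nlinarith [mul_nonneg h4 (sq_nonneg ‖r‖)]

include hc1 hs1 hg0 hA in
theorem norm_polarField_sub_le {θ : ℝ} {x y : 𝕜} (hx : ‖x‖ ≤ 1) (hy : ‖y‖ ≤ 1)
    (hx2 : A * W * ‖x‖ ≤ 1 / 2) (hy2 : A * W * ‖y‖ ≤ 1 / 2) :
    ‖polarField c s g W θ x - polarField c s g W θ y‖ ≤
      4 * (A * (W + 1) ^ 2 + 1) * ‖x - y‖ := by
  have hx1 := norm_recG_le (W := W) hg0 (fun w => hA w θ) hx
  have hy1 := norm_recG_le (W := W) hg0 (fun w => hA w θ) hy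
  have hx3 := half_le_norm_one_sub_recG (W := W) hc1 hg0 hA (θ := θ) hx hx2
  have hy3 := half_le_norm_one_sub_recG (W := W) hc1 hg0 hA (θ := θ) hy hy2
  have hd := norm_recG_sub_le (W := W) (fun w => hA w θ) hx hy
  unfold polarField
  set a := recG g W θ x
  set b := recG g W θ y
  have hxn : 1 - c θ * a ≠ 0 := fun h => by rw [h, norm_zero] at hx3; linarith
  have hyn : 1 - c θ * b ≠ 0 := fun h => by rw [h, norm_zero] at hy3; linarith
  -- Over a common denominator each term of the numerator has a factor `a - b` or `x - y`, which
  -- gives the Lipschitz bound without differentiation.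
  have e : -(x * s θ * a) / (1 - c θ * a) - -(y * s θ * b) / (1 - c θ * b) =
      -(s θ * (x * (a - b) + b * (x - y) - c θ * (a * b * (x - y)))) /
        ((1 - c θ * a) * (1 - c θ * b)) := by
    rw [div_sub_div _ _ hxn hyn]
    congr 1; ring
  rw [e, norm_div, norm_neg, norm_mul, norm_mul, div_le_iff₀ (by positivity)]
  have hA0 : 0 ≤ A := (norm_nonneg _).trans (hA 0 θ)
  have h1 : ‖x * (a - b) + b * (x - y) - c θ * (a * b * (x - y))‖ ≤
      (A * (W + 1) ^ 2 + 1) * ‖x - y‖ := by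
    refine (norm_sub_le _ _).trans ?_
    refine (add_le_add_left (norm_add_le _ _) _).trans ?_
    simp only [norm_mul]
    have k1 : ‖x‖ * ‖a - b‖ ≤ 1 * (A * (W + 1) ^ 2 * ‖x - y‖) := by gcongr
    have k2 : ‖b‖ * ‖x - y‖ ≤ 1 / 2 * ‖x - y‖ := by gcongr; linarith
    have k3 : ‖c θ‖ * (‖a‖ * ‖b‖ * ‖x - y‖) ≤ 1 * (1 / 2 * (1 / 2) * ‖x - y‖) := by
      gcongr
      · exact hc1 θ
      · linarith
      · linarith
    have := norm_nonneg (x - y)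
    linarith
  have h2 : ‖s θ‖ * ‖x * (a - b) + b * (x - y) - c θ * (a * b * (x - y))‖ ≤
      1 * ((A * (W + 1) ^ 2 + 1) * ‖x - y‖) := by
    gcongr; exact hs1 θ
  have h3 : 1 / 4 ≤ ‖1 - c θ * a‖ * ‖1 - c θ * b‖ := by nlinarith
  have h4 : 0 ≤ (A * (W + 1) ^ 2 + 1) * ‖x - y‖ := by positivity
  nlinarith

/-- A solution on `[0, 2π]` of the equation `r' = polarField`. -/
def IsPolarFieldSolution (c s : ℝ → 𝕜) (g : ℕ → ℝ → 𝕜) (W : ℕ) (ρ : ℝ → 𝕜) : Prop :=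
  ∀ θ ∈ Set.Icc (0 : ℝ) (2 * Real.pi),
    HasDerivWithinAt ρ (polarField c s g W θ (ρ θ)) (Set.Icc (0 : ℝ) (2 * Real.pi)) θ

include hc1 hs1 hg0 hA in
-- On the ball of radius `2 ε` the field has size at most `ε / 8`, and `2π ≤ 7`, so a solution
-- starting in the ball of radius `ε` cannot leave. Picard–Lindelöf gives existence; the a priori
-- bound holds for every solution, not only for the one constructed.
theorem exists_polarFieldSolution (hc : Continuous c) (hs : Continuous s)
    (hg : ∀ w, Continuous (g w)) {ε : ℝ} (hε : 0 < ε)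
    (hε2 : 64 * ((A + 1) * (W + 1) ^ 2) * ε ≤ 1) {r₀ : 𝕜} (hr₀ : ‖r₀‖ ≤ ε) :
    (∃ ρ : ℝ → 𝕜, ρ 0 = r₀ ∧ IsPolarFieldSolution c s g W ρ) ∧
    ∀ ρ : ℝ → 𝕜, ρ 0 = r₀ → IsPolarFieldSolution c s g W ρ →
      ∀ θ ∈ Set.Icc (0 : ℝ) (2 * Real.pi), ‖ρ θ‖ ≤ 2 * ε ∧ ‖ρ θ - r₀‖ ≤ 7 / 8 * ε := by
  have hA0 : 0 ≤ A := (norm_nonneg _).trans (hA 0 0)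
  have hW : (0 : ℝ) ≤ W := Nat.cast_nonneg W
  have hAW : 64 * (A * W) * ε ≤ 1 := by
    refine le_trans ?_ hε2
    refine mul_le_mul_of_nonneg_right ?_ hε.le
    nlinarith [mul_nonneg hA0 hW, mul_nonneg hA0 (sq_nonneg (W : ℝ))]
  have hε1 : 64 * ε ≤ 1 := by
    refine le_trans ?_ hε2
    have : (1 : ℝ) ≤ (A + 1) * (W + 1) ^ 2 := by
      nlinarith [mul_nonneg hA0 hW, mul_nonneg hA0 (sq_nonneg (W : ℝ))]
    nlinarith
  have hpi : 2 * Real.pi ≤ 7 := by linarith [Real.pi_lt_d2]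
  have hpi0 : 0 ≤ 2 * Real.pi := by positivity
  have hsmall : ∀ r : 𝕜, ‖r‖ ≤ 2 * ε → ‖r‖ ≤ 1 ∧ A * W * ‖r‖ ≤ 1 / 2 := fun r hr =>
    ⟨by linarith, by nlinarith [mul_le_mul_of_nonneg_left hr (mul_nonneg hA0 hW)]⟩
  have hF : ∀ θ (r : 𝕜), ‖r‖ ≤ 2 * ε → ‖polarField c s g W θ r‖ ≤ ε / 8 := fun θ r hr => by
    obtain ⟨h1, h2⟩ := hsmall r hr
    refine (norm_polarField_le hc1 hs1 hg0 hA h1 h2).trans ?_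
    have h3 : ‖r‖ ^ 2 ≤ (2 * ε) ^ 2 := pow_le_pow_left₀ (norm_nonneg _) hr 2
    have h4 := mul_le_mul_of_nonneg_left h3 (mul_nonneg hA0 hW)
    nlinarith
  refine ⟨?_, fun ρ hρ0 hρ => ?_⟩
  · have hpl : IsPicardLindelof (polarField c s g W) (tmin := 0) (tmax := 2 * Real.pi)
        ⟨0, Set.left_mem_Icc.2 hpi0⟩ (0 : 𝕜) (Real.toNNReal (2 * ε)) (Real.toNNReal ε)
        (Real.toNNReal (ε / 8)) (Real.toNNReal (4 * (A * (W + 1) ^ 2 + 1))) := by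
      have e2 : ((Real.toNNReal (2 * ε) : NNReal) : ℝ) = 2 * ε := Real.coe_toNNReal _ (by positivity)
      have e1 : ((Real.toNNReal ε : NNReal) : ℝ) = ε := Real.coe_toNNReal _ hε.le
      have e8 : ((Real.toNNReal (ε / 8) : NNReal) : ℝ) = ε / 8 :=
        Real.coe_toNNReal _ (by positivity)
      refine ⟨fun t _ => ?_, fun x hx => ?_, fun t _ x hx => ?_, ?_⟩
      · refine LipschitzOnWith.of_dist_le_mul fun x hx y hy => ?_
        rw [mem_closedBall_zero_iff, e2] at hx hy
        rw [dist_eq_norm, dist_eq_norm, Real.coe_toNNReal _ (by positivity)]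
        exact norm_polarField_sub_le hc1 hs1 hg0 hA (hsmall x hx).1 (hsmall y hy).1
          (hsmall x hx).2 (hsmall y hy).2
      · rw [mem_closedBall_zero_iff, e2] at hx
        have hG : Continuous fun t => recG g W t x :=
          continuous_finsetSum _ fun w _ => (hg w).mul continuous_const
        refine Continuous.continuousOn ?_
        refine Continuous.div ((continuous_const.mul hs).mul hG).neg
          (continuous_const.sub (hc.mul hG)) fun t h => ?_
        have := half_le_norm_one_sub_recG (W := W) hc1 hg0 hA (θ := t) (hsmall x hx).1
          (hsmall x hx).2
        rw [h, norm_zero] at this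
        linarith
      · rw [mem_closedBall_zero_iff, e2] at hx
        rw [e8]
        exact hF t x hx
      · simp only [sub_zero, sub_self]
        rw [e1, e2, e8, max_eq_left hpi0]
        nlinarith
    obtain ⟨ρ, h1, h2⟩ := hpl.exists_eq_forall_mem_Icc_hasDerivWithinAt (x := r₀)
      (by rw [mem_closedBall_zero_iff, Real.coe_toNNReal _ hε.le]; exact hr₀)
    exact ⟨ρ, h1, h2⟩
  · have hle : ∀ θ ∈ Set.Icc (0 : ℝ) (2 * Real.pi), ‖ρ θ‖ ≤ 2 * ε := by
      intro θ hθ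
      -- Comparison with `ε (1 + t / 7)`: its slope `ε / 7` strictly exceeds the largest speed `ε /
      -- 8`, and it stays below `2 ε` because `t ≤ 2π ≤ 7`.
      have hB := image_norm_le_of_norm_deriv_right_lt_deriv_boundary' (a := 0) (b := 2 * Real.pi)
        (f := ρ) (f' := fun θ => polarField c s g W θ (ρ θ)) (B := fun t => ε * (1 + t / 7))
        (B' := fun _ => ε / 7) (fun t ht => (hρ t ht).continuousWithinAt)
        (fun t ht => (hρ t ⟨ht.1, ht.2.le⟩).mono_of_mem_nhdsWithin
          (Filter.mem_of_superset (Icc_mem_nhdsGE ht.2) (Set.Icc_subset_Icc_left ht.1)))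
        (by simpa [hρ0] using hr₀) (by fun_prop)
        (fun t _ => by
          have := (((hasDerivAt_id t).div_const 7).const_add 1).const_mul ε
          exact (this.congr_deriv (by ring)).hasDerivWithinAt)
        (fun t ht h => by
          refine (hF t (ρ t) ?_).trans_lt (by linarith)
          rw [h]
          have : t / 7 ≤ 1 := by linarith [ht.2]
          nlinarith) hθ
      refine hB.trans ?_
      have : θ / 7 ≤ 1 := by linarith [hθ.2]
      nlinarith
    intro θ hθ
    refine ⟨hle θ hθ, ?_⟩
    have := (convex_Icc (0 : ℝ) (2 * Real.pi)).norm_image_sub_le_of_norm_hasDerivWithin_le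
      hρ (fun t ht => hF t (ρ t) (hle t ht)) (Set.left_mem_Icc.2 hpi0) hθ
    rw [hρ0, sub_zero, Real.norm_of_nonneg hθ.1] at this
    refine this.trans ?_
    nlinarith [hθ.2]

end PolarField

section FirstIntegral

variable {𝕜 : Type*} [RCLike 𝕜] {c s : ℝ → 𝕜} {g : ℕ → ℝ → 𝕜}

/-- Up to terms of order `K`, the truncated first integral satisfies its differential equation. -/
theorem norm_trunc_remainder_le {W : ℕ} (hg0 : ∀ θ, g 0 θ = 0) (hgW : ∀ w, W < w → ∀ θ, g w θ = 0)
    (θ : ℝ) {r : 𝕜} (hr : ‖r‖ ≤ 1) (K : ℕ) :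
    ‖(1 - c θ * recG g W θ r) * (∑ k ∈ range K, recD c s g k θ * r ^ k) -
      s θ * recG g W θ r * ∑ k ∈ range K, k * recV c s g k θ * r ^ k‖ ≤
    ‖r‖ ^ K * ((∑ w ∈ range (W + 1), ‖g w θ‖) * ∑ j ∈ range K, ‖recX c s g j θ‖) := by
  have hX : ∑ j ∈ range K, recX c s g j θ * r ^ j =
      c θ * (∑ k ∈ range K, recD c s g k θ * r ^ k) +
      s θ * ∑ k ∈ range K, k * recV c s g k θ * r ^ k := by
    rw [mul_sum, mul_sum, ← sum_add_distrib]
    refine sum_congr rfl fun k _ => ?_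
    unfold recX; ring
  have hD : ∑ k ∈ range K, recD c s g k θ * r ^ k =
      ∑ j ∈ range K, ∑ w ∈ range (K - j), g w θ * r ^ w * (recX c s g j θ * r ^ j) := by
    rw [← sum_range_conv (fun w j => g w θ * r ^ w * (recX c s g j θ * r ^ j))
      (fun j => by simp [hg0])]
    refine sum_congr rfl fun k _ => ?_
    rw [recD_eq, sum_mul]
    refine sum_congr rfl fun j hj => ?_
    have : r ^ k = r ^ (k - j) * r ^ j := by
      rw [← pow_add]; congr 1; have := mem_range.1 hj; omega
    rw [this]; ring
  -- The terms with `w + j < K` cancel by the recursion. What remains has `w + j ≥ K`, hence size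
  -- `O(|r|^K)` since `|r| ≤ 1`.
  have e1 : (1 - c θ * recG g W θ r) * (∑ k ∈ range K, recD c s g k θ * r ^ k) -
      s θ * recG g W θ r * ∑ k ∈ range K, k * recV c s g k θ * r ^ k =
      -∑ j ∈ range K, (recG g W θ r - ∑ w ∈ range (K - j), g w θ * r ^ w) *
        (recX c s g j θ * r ^ j) := by
    simp only [sub_mul, sum_sub_distrib, ← mul_sum, sum_mul]
    rw [hX]
    simp only [← sum_mul] at hD ⊢
    rw [← hD]; ring
  rw [e1, norm_neg]
  have e2 : ∀ j ∈ range K, ‖(recG g W θ r - ∑ w ∈ range (K - j), g w θ * r ^ w) *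
      (recX c s g j θ * r ^ j)‖ ≤
      ‖r‖ ^ K * ((∑ w ∈ range (W + 1), ‖g w θ‖) * ‖recX c s g j θ‖) := by
    intro j hj
    have hj' := mem_range.1 hj
    have e3 : recG g W θ r - ∑ w ∈ range (K - j), g w θ * r ^ w =
        ∑ w ∈ range (W + 1), if w < K - j then 0 else g w θ * r ^ w := by
      have : ∑ w ∈ range (K - j), g w θ * r ^ w =
          ∑ w ∈ range (W + 1), if w < K - j then g w θ * r ^ w else 0 := by
        rw [← sum_filter]
        symm
        refine sum_subset (fun w hw => by simp at hw ⊢; exact hw.2) fun w hw hw' => ?_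
        simp only [mem_range, mem_filter, not_and] at hw hw'
        have : W < w := by by_contra h; exact hw' (by omega) hw
        rw [hgW w this, zero_mul]
      rw [this, recG, ← sum_sub_distrib]
      refine sum_congr rfl fun w _ => ?_
      split_ifs <;> simp
    rw [e3, norm_mul, norm_mul, norm_pow]
    have e4 : ‖∑ w ∈ range (W + 1), if w < K - j then 0 else g w θ * r ^ w‖ ≤
        (∑ w ∈ range (W + 1), ‖g w θ‖) * ‖r‖ ^ (K - j) := by
      rw [sum_mul]
      refine norm_sum_le_of_le _ fun w _ => ?_
      split_ifs with h
      · rw [norm_zero]; positivity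
      · rw [norm_mul, norm_pow]
        exact mul_le_mul_of_nonneg_left (pow_le_pow_of_le_one (norm_nonneg _) hr (by omega))
          (norm_nonneg _)
    calc _ ≤ (∑ w ∈ range (W + 1), ‖g w θ‖) * ‖r‖ ^ (K - j) *
          (‖recX c s g j θ‖ * ‖r‖ ^ j) := by gcongr
      _ = (‖r‖ ^ (K - j) * ‖r‖ ^ j) * ((∑ w ∈ range (W + 1), ‖g w θ‖) * ‖recX c s g j θ‖) := by
        ring
      _ = _ := by rw [← pow_add, Nat.sub_add_cancel hj'.le]
  refine (norm_sum_le_of_le _ e2).trans ?_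
  rw [← mul_sum, ← mul_sum]

theorem hasDerivWithinAt_recP (hc : Continuous c) (hs : Continuous s)
    (hg : ∀ w, Continuous (g w)) (K : ℕ) {φ : ℝ → ℝ} {r : ℝ → 𝕜} {φ' : ℝ} {r' : 𝕜} {S : Set ℝ}
    {t : ℝ} (hφ : HasDerivWithinAt φ φ' S t) (hr : HasDerivWithinAt r r' S t) :
    HasDerivWithinAt (fun t => recP c s g K (φ t) (r t))
      ((φ' : 𝕜) * (∑ k ∈ range K, recD c s g k (φ t) * r t ^ k) +
        (∑ k ∈ range K, k * recV c s g k (φ t) * r t ^ (k - 1)) * r') S t := by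
  unfold recP
  have : HasDerivWithinAt (fun t => ∑ k ∈ range K, recV c s g k (φ t) * r t ^ k)
      (∑ k ∈ range K, (φ' • recD c s g k (φ t) * r t ^ k +
        recV c s g k (φ t) * (k * r t ^ (k - 1) * r'))) S t := by
    refine HasDerivWithinAt.fun_sum fun k _ => ?_
    exact ((hasDerivAt_recV hc hs hg k (φ t)).scomp_hasDerivWithinAt t hφ).mul (hr.fun_pow k)
  refine this.congr_deriv ?_
  rw [sum_add_distrib, mul_sum, sum_mul]
  congr 1
  · refine sum_congr rfl fun k _ => ?_
    rw [RCLike.real_smul_eq_coe_mul]; ring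
  · exact sum_congr rfl fun k _ => by ring

/-- Along solutions the truncated first integral is constant up to terms of order `K`. -/
theorem norm_recP_sub_le {W : ℕ} {A : ℝ} (hc1 : ∀ θ, ‖c θ‖ ≤ 1) (hc : Continuous c)
    (hs : Continuous s) (hg : ∀ w, Continuous (g w)) (hg0 : ∀ θ, g 0 θ = 0)
    (hgW : ∀ w, W < w → ∀ θ, g w θ = 0) (hA : ∀ w θ, ‖g w θ‖ ≤ A) {ρ : ℝ → 𝕜}
    (hρ : IsPolarFieldSolution c s g W ρ) {η B : ℝ} (hη1 : η ≤ 1) (hη2 : A * W * η ≤ 1 / 2)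
    (hρη : ∀ θ ∈ Set.Icc (0 : ℝ) (2 * Real.pi), ‖ρ θ‖ ≤ η) (K : ℕ)
    (hB : ∀ θ ∈ Set.Icc (0 : ℝ) (2 * Real.pi), ∑ j ∈ range K, ‖recX c s g j θ‖ ≤ B) :
    ‖recP c s g K (2 * Real.pi) (ρ (2 * Real.pi)) - recP c s g K 0 (ρ 0)‖ ≤
      4 * Real.pi * (A * (W + 1)) * B * η ^ K := by
  have hpi0 : 0 ≤ 2 * Real.pi := by positivity
  have hA0 : 0 ≤ A := (norm_nonneg _).trans (hA 0 0)
  have hder : ∀ θ ∈ Set.Icc (0 : ℝ) (2 * Real.pi), HasDerivWithinAt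
      (fun t => recP c s g K t (ρ t)) (((1 : ℝ) : 𝕜) * (∑ k ∈ range K, recD c s g k θ * ρ θ ^ k) +
        (∑ k ∈ range K, k * recV c s g k θ * ρ θ ^ (k - 1)) * polarField c s g W θ (ρ θ))
      (Set.Icc (0 : ℝ) (2 * Real.pi)) θ := fun θ hθ =>
    hasDerivWithinAt_recP hc hs hg K (hasDerivWithinAt_id θ _) (hρ θ hθ)
  have hbound : ∀ θ ∈ Set.Icc (0 : ℝ) (2 * Real.pi),
      ‖((1 : ℝ) : 𝕜) * (∑ k ∈ range K, recD c s g k θ * ρ θ ^ k) +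
        (∑ k ∈ range K, k * recV c s g k θ * ρ θ ^ (k - 1)) * polarField c s g W θ (ρ θ)‖ ≤
      2 * (η ^ K * (A * (W + 1) * B)) := by
    intro θ hθ
    have hr := hρη θ hθ
    have hr1 := hr.trans hη1
    have hr2 : A * W * ‖ρ θ‖ ≤ 1 / 2 :=
      (mul_le_mul_of_nonneg_left hr (by positivity)).trans hη2
    have h1 := half_le_norm_one_sub_recG (W := W) hc1 hg0 hA (θ := θ) hr1 hr2
    have h2 := norm_trunc_remainder_le (c := c) (s := s) hg0 hgW θ hr1 K
    have hne : 1 - c θ * recG g W θ (ρ θ) ≠ 0 := fun h => by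
      rw [h, norm_zero] at h1; linarith
    have e : (1 - c θ * recG g W θ (ρ θ)) * (((1 : ℝ) : 𝕜) *
        (∑ k ∈ range K, recD c s g k θ * ρ θ ^ k) +
        (∑ k ∈ range K, k * recV c s g k θ * ρ θ ^ (k - 1)) * polarField c s g W θ (ρ θ)) =
        (1 - c θ * recG g W θ (ρ θ)) * (∑ k ∈ range K, recD c s g k θ * ρ θ ^ k) -
        s θ * recG g W θ (ρ θ) * ∑ k ∈ range K, k * recV c s g k θ * ρ θ ^ k := by
      have e2 : (∑ k ∈ range K, k * recV c s g k θ * ρ θ ^ (k - 1)) * ρ θ =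
          ∑ k ∈ range K, k * recV c s g k θ * ρ θ ^ k := by
        rw [sum_mul]
        refine sum_congr rfl fun k _ => ?_
        rcases Nat.eq_zero_or_pos k with rfl | hk
        · simp
        · obtain ⟨m, rfl⟩ := Nat.exists_eq_add_of_le' hk
          rw [Nat.add_sub_cancel]; ring
      rw [← e2, polarField]
      simp only [RCLike.ofReal_one]
      field_simp
      ring
    have h3 : ‖1 - c θ * recG g W θ (ρ θ)‖ * ‖((1 : ℝ) : 𝕜) *
        (∑ k ∈ range K, recD c s g k θ * ρ θ ^ k) +
        (∑ k ∈ range K, k * recV c s g k θ * ρ θ ^ (k - 1)) * polarField c s g W θ (ρ θ)‖ ≤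
        η ^ K * (A * (W + 1) * B) := by
      rw [← norm_mul, e]
      refine h2.trans ?_
      have h4 : ∑ w ∈ range (W + 1), ‖g w θ‖ ≤ A * (W + 1) := by
        refine (sum_le_sum fun w _ => hA w θ).trans ?_
        rw [sum_const, card_range, nsmul_eq_mul]; push_cast; linarith
      have h5 : ‖ρ θ‖ ^ K ≤ η ^ K := pow_le_pow_left₀ (norm_nonneg _) hr K
      have h6 := hB θ hθ
      have h7 : 0 ≤ η ^ K := (pow_nonneg (norm_nonneg _) K).trans h5
      gcongr
    have := mul_le_mul_of_nonneg_right h1 (norm_nonneg (((1 : ℝ) : 𝕜) *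
        (∑ k ∈ range K, recD c s g k θ * ρ θ ^ k) +
        (∑ k ∈ range K, k * recV c s g k θ * ρ θ ^ (k - 1)) * polarField c s g W θ (ρ θ)))
    linarith
  have := (convex_Icc (0 : ℝ) (2 * Real.pi)).norm_image_sub_le_of_norm_hasDerivWithin_le
    hder hbound (Set.left_mem_Icc.2 hpi0) (Set.right_mem_Icc.2 hpi0)
  rw [sub_zero, Real.norm_of_nonneg hpi0] at this
  refine this.trans (le_of_eq ?_)
  ring

theorem recP_zero_angle {K : ℕ} (hK : 1 < K) (r : 𝕜) : recP c s g K 0 r = r := by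
  unfold recP
  simp only [recV_at_zero]
  rw [sum_eq_single_of_mem 1 (mem_range.2 hK) fun k _ hk => by simp [hk]]
  simp

end FirstIntegral

end

/-! ### The series is the germ of the inverse return map. -/

noncomputable section

open Finset MeasureTheory

theorem norm_cosC_le_one (θ : ℝ) : ‖cosC θ‖ ≤ 1 := by
  rw [norm_cosC]; exact Real.abs_cos_le_one θ

theorem norm_sinC_le_one (θ : ℝ) : ‖sinC θ‖ ≤ 1 := by
  rw [norm_sinC]; exact Real.abs_sin_le_one θ

theorem norm_lienardG_le (L : ℕ → ℂ) (w : ℕ) (θ : ℝ) : ‖lienardG L w θ‖ ≤ ‖L w‖ := by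
  unfold lienardG
  rw [norm_mul, norm_mul, norm_pow, mul_assoc]
  exact mul_le_of_le_one_right (norm_nonneg _) (mul_le_one₀
    (pow_le_one₀ (norm_nonneg _) (norm_cosC_le_one θ)) (norm_nonneg _) (norm_sinC_le_one θ))

theorem recG_lienardG {d : ℕ} (lam : Fin d → ℂ) (θ : ℝ) (r : ℂ) :
    recG (lienardG (lamSeq lam)) d θ r = sinC θ * lienardPoly lam (r * cosC θ) := by
  unfold recG lienardG lienardPoly
  rw [sum_lamSeq lam (fun w z => z * cosC θ ^ w * sinC θ * r ^ w) (by simp), mul_sum]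
  exact sum_congr rfl fun i _ => by ring

theorem isPolarSolution_iff {d : ℕ} (lam : Fin d → ℂ) (r₀ : ℂ) (ρ : ℝ → ℂ) :
    IsPolarSolution lam r₀ ρ ↔ ρ 0 = r₀ ∧
      (∀ θ ∈ Set.Icc (0 : ℝ) (2 * Real.pi),
        1 - cosC θ * recG (lienardG (lamSeq lam)) d θ (ρ θ) ≠ 0) ∧
      IsPolarFieldSolution cosC sinC (lienardG (lamSeq lam)) d ρ := by
  have h1 : ∀ θ, -1 + (Real.sin θ : ℂ) * (Real.cos θ : ℂ) *
      lienardPoly lam (ρ θ * (Real.cos θ : ℂ)) =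
      -(1 - cosC θ * recG (lienardG (lamSeq lam)) d θ (ρ θ)) := fun θ => by
    rw [recG_lienardG]; unfold cosC sinC; ring
  have h2 : ∀ θ, ρ θ * lienardPoly lam (ρ θ * (Real.cos θ : ℂ)) * (Real.sin θ : ℂ) ^ 2 /
        (-1 + (Real.sin θ : ℂ) * (Real.cos θ : ℂ) * lienardPoly lam (ρ θ * (Real.cos θ : ℂ))) =
      polarField cosC sinC (lienardG (lamSeq lam)) d θ (ρ θ) := fun θ => by
    rw [h1, polarField, recG_lienardG, div_neg, neg_div]
    unfold cosC sinC
    congr 2; ring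
  unfold IsPolarSolution IsPolarFieldSolution
  simp only [h2]
  simp only [h1, neg_ne_zero]
  exact and_congr_right fun _ => forall₂_and

/-- The truncated first integral equals `r(0)` at angle `0` and the partial sum of the series in
`r(2π)` at angle `2π`. It varies by `O(K 2^{-K})` along a small solution, so the partial sums tend
to `r(0)`. -/
theorem isInverseReturnMap_inverseReturnSeries {d : ℕ} (lam : Fin d → ℂ) :
    IsInverseReturnMap lam (inverseReturnSeries lam) := by
  set L := lamSeq lam with hL
  set A : ℝ := ∑ w ∈ range (d + 1), ‖L w‖ with hAdef
  have hLA : ∀ w, ‖L w‖ ≤ A := fun w => by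
    rcases le_or_gt w d with h | h
    · exact single_le_sum (f := fun w => ‖L w‖) (fun _ _ => norm_nonneg _)
        (mem_range.2 (Nat.lt_succ_of_le h))
    · rw [hL, lamSeq_of_lt lam h, norm_zero]; exact sum_nonneg fun _ _ => norm_nonneg _
  have hA0 : 0 ≤ A := (norm_nonneg _).trans (hLA 0)
  have hA : ∀ w θ, ‖lienardG L w θ‖ ≤ A := fun w θ => (norm_lienardG_le L w θ).trans (hLA w)
  have hg0 : ∀ θ, lienardG L 0 θ = 0 := fun θ => by simp [lienardG, hL, lamSeq_zero]
  have hgW : ∀ w, d < w → ∀ θ, lienardG L w θ = 0 := fun w hw θ => by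
    simp [lienardG, hL, lamSeq_of_lt lam hw]
  obtain ⟨C, M, hC, hM, hb⟩ := exists_geometric_bound (a := fun w => ‖L w‖)
    (fun _ => norm_nonneg _) (by simp [hL, lamSeq_zero]) (d := d)
    (fun w hw => by simp [hL, lamSeq_of_lt lam hw])
  have ec : (fun t => ‖cosC t‖) = (|Real.cos ·|) := funext norm_cosC
  have es : (fun t => ‖sinC t‖) = (|Real.sin ·|) := funext norm_sinC
  have hV : ∀ k, ‖holonomy L k‖ ≤ C * M ^ k := fun k => by
    have := norm_recV_le (g := lienardG L) (γ := fun w _ => ‖L w‖) continuous_cosC continuous_sinC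
      (continuous_lienardG L) (fun _ => continuous_const)
      (fun w θ _ => norm_lienardG_le L w θ) k (θ := 2 * Real.pi) (by positivity)
    rw [ec, es] at this
    exact this.trans (hb k _ (by positivity) le_rfl).1
  have hX : ∀ k, ∀ θ ∈ Set.Icc (0 : ℝ) (2 * Real.pi),
      ‖recX cosC sinC (lienardG L) k θ‖ ≤ C * M ^ k := fun k θ hθ => by
    have := norm_recX_le (g := lienardG L) (γ := fun w _ => ‖L w‖) continuous_cosC continuous_sinC
      (continuous_lienardG L) (fun _ => continuous_const)
      (fun w θ _ => norm_lienardG_le L w θ) k hθ.1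
    rw [ec, es] at this
    exact this.trans (hb k θ hθ.1 hθ.2).2
  -- Small enough for `exists_polarFieldSolution`, and such that `(M + 1) · 2 δ ≤ 1/2`; solutions
  -- stay within `2 δ`.
  set δ : ℝ := 1 / (64 * ((A + 1) * (d + 1) ^ 2) * (M + 1)) with hδ
  have hδ0 : 0 < δ := by positivity
  have hδM : 64 * ((A + 1) * (d + 1) ^ 2) * (M + 1) * δ = 1 := by rw [hδ]; field_simp
  have hAd : (1 : ℝ) ≤ (A + 1) * (d + 1) ^ 2 := by
    have h1 : (1 : ℝ) ≤ (d + 1) ^ 2 := one_le_pow₀ (by linarith [Nat.cast_nonneg (α := ℝ) d])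
    nlinarith
  have hδ1 : 64 * ((A + 1) * (d + 1) ^ 2) * δ ≤ 1 := by
    have : 0 ≤ 64 * ((A + 1) * (d + 1) ^ 2) * δ * M := by positivity
    linarith
  have hδ2 : (M + 1) * (2 * δ) ≤ 1 / 2 := by
    have : 0 < (M + 1) * δ := by positivity
    nlinarith
  have hδ3 : A * d * (2 * δ) ≤ 1 / 2 := by
    have h3 : A * d ≤ (A + 1) * (d + 1) ^ 2 := by
      have : (0 : ℝ) ≤ d := Nat.cast_nonneg d
      nlinarith [mul_nonneg hA0 this, mul_nonneg hA0 (sq_nonneg (d : ℝ))]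
    nlinarith
  have hsmall : ∀ r : ℂ, ‖r‖ ≤ 2 * δ → ‖r‖ ≤ 1 ∧ A * d * ‖r‖ ≤ 1 / 2 := fun r hr =>
    ⟨by nlinarith, by
      have : 0 ≤ A * d := by positivity
      nlinarith⟩
  refine ⟨δ, hδ0, fun r₀ hr₀ => ?_⟩
  obtain ⟨⟨ρ, hρ0, hρ⟩, hall⟩ := exists_polarFieldSolution norm_cosC_le_one norm_sinC_le_one hg0 hA
    continuous_cosC continuous_sinC (continuous_lienardG L) hδ0 (W := d) hδ1 hr₀.le
  refine ⟨⟨ρ, (isPolarSolution_iff lam r₀ ρ).2 ⟨hρ0, fun θ hθ h => ?_, hρ⟩⟩, fun ρ hρ => ?_⟩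
  · obtain ⟨h1, h2⟩ := hsmall _ (hall ρ hρ0 hρ θ hθ).1
    have := half_le_norm_one_sub_recG (W := d) norm_cosC_le_one hg0 hA (θ := θ) h1 h2
    rw [h, norm_zero] at this
    linarith
  · obtain ⟨hρ0, -, hρ⟩ := (isPolarSolution_iff lam r₀ ρ).1 hρ
    have hle := fun θ hθ => (hall ρ hρ0 hρ θ hθ).1
    have hpi : 2 * Real.pi ∈ Set.Icc (0 : ℝ) (2 * Real.pi) :=
      Set.right_mem_Icc.2 (by positivity)
    simp only [coeff_inverseReturnSeries]
    set z := ρ (2 * Real.pi) with hz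
    have hsum : Summable fun k => holonomy L k * z ^ k := by
      refine Summable.of_norm_bounded (g := fun k => C * (1 / 2) ^ k)
        ((summable_geometric_of_lt_one (by norm_num) (by norm_num)).mul_left C) fun k => ?_
      rw [norm_mul, norm_pow]
      calc _ ≤ C * M ^ k * (2 * δ) ^ k := by
            gcongr
            · exact hV k
            · exact hle _ hpi
        _ = C * (M * (2 * δ)) ^ k := by rw [mul_pow]; ring
        _ ≤ C * (1 / 2) ^ k := by gcongr; nlinarith
    refine (hsum.hasSum_iff_tendsto_nat).2 ?_
    have hlim : Filter.Tendsto (fun K : ℕ => 4 * Real.pi * (A * (d + 1)) * C *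
        ((K : ℝ) * (1 / 2) ^ K)) Filter.atTop (nhds 0) := by
      have := (tendsto_self_mul_const_pow_of_lt_one (r := (1 / 2 : ℝ)) (by norm_num)
        (by norm_num)).const_mul (4 * Real.pi * (A * (d + 1)) * C)
      simpa using this
    refine tendsto_iff_norm_sub_tendsto_zero.2 ?_
    refine squeeze_zero' (Filter.Eventually.of_forall fun _ => norm_nonneg _) ?_ hlim
    filter_upwards [Filter.eventually_gt_atTop 1] with K hK
    -- The base `M + 1 ≥ 1` replaces `M`, so that its powers increase and one bound serves all `j <
    -- K`.
    have h1 := norm_recP_sub_le (W := d) (A := A) norm_cosC_le_one continuous_cosC continuous_sinC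
      (continuous_lienardG L) hg0 hgW hA hρ (η := 2 * δ) (B := K * (C * (M + 1) ^ K))
      (by nlinarith) hδ3 hle K (fun θ hθ => by
        refine (sum_le_sum (g := fun _ => C * (M + 1) ^ K) fun j hj => ?_).trans ?_
        · refine (hX j θ hθ).trans ?_
          have h2 : M ^ j ≤ (M + 1) ^ j := pow_le_pow_left₀ hM.le (by linarith) j
          have h3 : (M + 1) ^ j ≤ (M + 1) ^ K :=
            pow_le_pow_right₀ (by linarith) (mem_range.1 hj).le
          exact mul_le_mul_of_nonneg_left (h2.trans h3) hC.le
        · rw [sum_const, card_range, nsmul_eq_mul])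
    rw [recP_zero_angle hK, hρ0] at h1
    refine h1.trans ?_
    have h4 : ((M + 1) * (2 * δ)) ^ K ≤ (1 / 2) ^ K := pow_le_pow_left₀ (by positivity) hδ2 K
    calc _ = 4 * Real.pi * (A * (d + 1)) * C * (K * ((M + 1) * (2 * δ)) ^ K) := by
          rw [mul_pow (M + 1)]; ring
      _ ≤ _ := by gcongr

end

/-! ### The power series `y` and `ψ` and the decay of their coefficients. -/

noncomputable section

open Finset MeasureTheory

/-- The coefficients of the power series `y = X - X²/3 + ...` with `y y' = X (1 - y)`. -/
def centerCoeff : ℕ → ℝ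
  | 0 => 0
  | 1 => 1
  | m + 2 => -centerCoeff (m + 1) / (m + 3) -
      (∑ i : Fin m, centerCoeff (i + 2) * centerCoeff (m + 1 - i)) / 2

theorem centerCoeff_zero : centerCoeff 0 = 0 := by rw [centerCoeff]

theorem centerCoeff_one : centerCoeff 1 = 1 := by rw [centerCoeff]

theorem centerCoeff_add_two (m : ℕ) : centerCoeff (m + 2) = -centerCoeff (m + 1) / (m + 3) -
    (∑ i ∈ range m, centerCoeff (i + 2) * centerCoeff (m + 1 - i)) / 2 := by
  rw [centerCoeff, Finset.sum_range]

theorem centerCoeff_two : centerCoeff 2 = -1 / 3 := by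
  rw [centerCoeff_add_two]; norm_num [centerCoeff_one]

theorem centerCoeff_three : centerCoeff 3 = 1 / 36 := by
  rw [centerCoeff_add_two]; norm_num [sum_range_succ, centerCoeff_two]

theorem centerCoeff_four : centerCoeff 4 = 1 / 270 := by
  rw [centerCoeff_add_two]; norm_num [sum_range_succ, centerCoeff_two, centerCoeff_three]

theorem centerCoeff_five : centerCoeff 5 = 1 / 4320 := by
  rw [centerCoeff_add_two]
  norm_num [sum_range_succ, centerCoeff_two, centerCoeff_three, centerCoeff_four]

/-- The power series `y`. -/
def centerSeries : PowerSeries ℝ := PowerSeries.mk centerCoeff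

/-- The recursion for `centerCoeff` is the integrated equation `(y²)' = 2 X (1 - y)` solved for the
top coefficient, which occurs twice because `y = X + ...`. -/
theorem coeff_centerSeries_sq (m : ℕ) :
    PowerSeries.coeff (m + 3) (centerSeries * centerSeries) =
      -(2 / (m + 3)) * centerCoeff (m + 1) := by
  rw [PowerSeries.coeff_mul, Finset.Nat.sum_antidiagonal_eq_sum_range_succ_mk]
  simp only [centerSeries, PowerSeries.coeff_mk]
  rw [sum_range_succ, sum_range_succ', sum_range_succ, sum_range_succ']
  simp only [centerCoeff_zero, Nat.sub_self, mul_zero, zero_mul, add_zero, zero_add,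
    centerCoeff_one, one_mul]
  have e1 : m + 3 - (m + 1 + 1) = 1 := by omega
  have e2 : m + 3 - 1 = m + 2 := by omega
  have e3 : ∀ i, m + 3 - (i + 1 + 1) = m + 1 - i := fun i => by omega
  rw [e1, e2, centerCoeff_one, mul_one]
  simp only [e3]
  have := centerCoeff_add_two m
  have h3 : ((m : ℝ) + 3) ≠ 0 := by positivity
  have e4 : ∀ i, centerCoeff (i + 1 + 1) = centerCoeff (i + 2) := fun i => rfl
  simp only [e4]
  rw [this]
  field_simp
  ring

theorem centerSeries_ode : centerSeries * PowerSeries.derivative ℝ centerSeries =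
    PowerSeries.X * (1 - centerSeries) := by
  have h : PowerSeries.derivative ℝ (centerSeries * centerSeries) =
      2 * (PowerSeries.X * (1 - centerSeries)) := by
    ext k
    rw [PowerSeries.coeff_derivative, two_mul, map_add]
    rcases k with _ | _ | m
    · simp [PowerSeries.coeff_mul, centerSeries, Finset.Nat.antidiagonal_succ, centerCoeff_zero]
    · simp [PowerSeries.coeff_mul, centerSeries, Finset.Nat.antidiagonal_succ, centerCoeff_zero,
        centerCoeff_one]
    · rw [coeff_centerSeries_sq, PowerSeries.coeff_succ_X_mul, map_sub, PowerSeries.coeff_one,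
        if_neg (Nat.succ_ne_zero m), centerSeries, PowerSeries.coeff_mk]
      push_cast
      have h3 : ((m : ℝ) + 3) ≠ 0 := by positivity
      field_simp
      ring
  rw [Derivation.leibniz, smul_eq_mul, ← two_mul] at h
  have h2 : (2 : PowerSeries ℝ) ≠ 0 := fun h0 => by
    have h1 : PowerSeries.constantCoeff (2 : PowerSeries ℝ) = 0 := by rw [h0, map_zero]
    rw [map_ofNat] at h1
    exact two_ne_zero h1
  exact mul_left_cancel₀ h2 h

/-- The power series `ψ = y / (1 - y)`. -/
def psiSeries : PowerSeries ℝ := centerSeries * (1 - centerSeries)⁻¹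

/-- The coefficients of `ψ = y / (1 - y)`. -/
def psiCoeff (m : ℕ) : ℝ := PowerSeries.coeff m psiSeries

theorem constantCoeff_one_sub_centerSeries :
    PowerSeries.constantCoeff (1 - centerSeries) ≠ 0 := by
  rw [map_sub, map_one, ← PowerSeries.coeff_zero_eq_constantCoeff_apply, centerSeries,
    PowerSeries.coeff_mk, centerCoeff_zero]
  norm_num

theorem one_sub_centerSeries_mul_psiSeries : (1 - centerSeries) * psiSeries = centerSeries := by
  rw [psiSeries, mul_left_comm, PowerSeries.mul_inv_cancel _ constantCoeff_one_sub_centerSeries,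
    mul_one]

/-- Since `1 + ψ = 1 / (1 - y)`, one has `ψ' = y' (1 + ψ)²`, and `y y' = X (1 - y)` gives `y' = (y'
+ X) (1 - y)`. The resulting equation is linear in `ψ` with explicit coefficients. -/
theorem psiSeries_ode : PowerSeries.derivative ℝ psiSeries =
    (PowerSeries.derivative ℝ centerSeries + PowerSeries.X) * (1 + psiSeries) := by
  have hne : (1 - centerSeries) ≠ 0 := fun h => by
    have := constantCoeff_one_sub_centerSeries
    rw [h, map_zero] at this
    exact this rfl
  have h1 := one_sub_centerSeries_mul_psiSeries
  have h2 : (1 - centerSeries) * (1 + psiSeries) = 1 := by rw [mul_add, h1]; ring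
  have h3 := congrArg (PowerSeries.derivative ℝ) h1
  rw [Derivation.leibniz, smul_eq_mul, smul_eq_mul, map_sub, Derivation.map_one_eq_zero] at h3
  refine mul_left_cancel₀ hne ?_
  have h4 := centerSeries_ode
  set D := PowerSeries.derivative ℝ centerSeries
  set D' := PowerSeries.derivative ℝ psiSeries
  linear_combination h3 + (1 + psiSeries) * h4


theorem psiCoeff_zero : psiCoeff 0 = 0 := by
  have := congrArg (PowerSeries.coeff 0) one_sub_centerSeries_mul_psiSeries
  simpa [PowerSeries.coeff_mul, centerSeries, centerCoeff_zero, psiCoeff] using this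

/-- The recursion for `ψ` coming from `ψ' = (y' + X) (1 + ψ)`. -/
theorem psiCoeff_succ (m : ℕ) : (m + 1) * psiCoeff (m + 1) =
    (m + 1) * centerCoeff (m + 1) + (if m = 1 then 1 else 0) +
    ∑ j ∈ range m, ((j + 1) * centerCoeff (j + 1) + if j = 1 then 1 else 0) *
      psiCoeff (m - j) := by
  have h := congrArg (PowerSeries.coeff m) psiSeries_ode
  have hv : ∀ j, PowerSeries.coeff j (PowerSeries.derivative ℝ centerSeries + PowerSeries.X) =
      (j + 1) * centerCoeff (j + 1) + if j = 1 then 1 else 0 := fun j => by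
    rw [map_add, PowerSeries.coeff_derivative, PowerSeries.coeff_X, centerSeries,
      PowerSeries.coeff_mk]
    ring
  rw [PowerSeries.coeff_derivative, mul_add (_ + _) 1 psiSeries, mul_one, map_add, hv, PowerSeries.coeff_mul,
    Finset.Nat.sum_antidiagonal_eq_sum_range_succ_mk, sum_range_succ, Nat.sub_self] at h
  simp only [hv] at h
  change psiCoeff (m + 1) * _ = _ + (_ + _ * psiCoeff 0) at h
  rw [psiCoeff_zero, mul_zero, add_zero] at h
  rw [mul_comm, h]
  rfl

theorem psiCoeff_one : psiCoeff 1 = 1 := by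
  have := psiCoeff_succ 0
  simpa [centerCoeff_one] using this

theorem psiCoeff_two : psiCoeff 2 = 2 / 3 := by
  have := psiCoeff_succ 1
  norm_num [centerCoeff_one, centerCoeff_two, psiCoeff_one] at this
  linarith

theorem psiCoeff_three : psiCoeff 3 = 13 / 36 := by
  have := psiCoeff_succ 2
  norm_num [sum_range_succ, centerCoeff_one, centerCoeff_two, centerCoeff_three, psiCoeff_one,
    psiCoeff_two] at this
  linarith

/-- The scaled absolute values of the coefficients of `y`. -/
def centerAbs (m : ℕ) : ℝ := |centerCoeff m| * 2 ^ (m - 1)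

theorem centerAbs_nonneg (m : ℕ) : 0 ≤ centerAbs m := by unfold centerAbs; positivity

/-- The terms with `a_2 = -1/3` and `a_3 = 1/36` are pulled out of the convolution. The sign of
`a_2` makes its contribution partly cancel the linear term, leaving `1/3 - 1/(m+7)`. -/
theorem centerAbs_le (m : ℕ) : centerAbs (m + 6) ≤ 2 / 3 * centerAbs (m + 5) +
    1 / 9 * centerAbs (m + 4) +
    (∑ i ∈ range m, centerAbs (i + 4) * centerAbs (m + 3 - i)) / 2 := by
  have h := centerCoeff_add_two (m + 4)
  rw [sum_range_succ, sum_range_succ, sum_range_succ', sum_range_succ'] at h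
  rw [show m + 4 + 1 - (m + 2 + 1) = 2 by omega, show m + 4 + 1 - (m + 2) = 3 by omega,
    show m + 4 + 1 - 0 = m + 5 by omega, show m + 4 + 1 - (0 + 1) = m + 4 by omega,
    show m + 2 + 1 + 2 = m + 5 by omega, show m + 2 + 2 = m + 4 by omega,
    show 0 + 2 = 2 by omega, show 0 + 1 + 2 = 3 by omega, centerCoeff_two, centerCoeff_three,
    show m + 4 + 2 = m + 6 by omega, show m + 4 + 1 = m + 5 by omega] at h
  have e : centerCoeff (m + 6) = (1 / 3 - 1 / (m + 7)) * centerCoeff (m + 5) -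
      1 / 36 * centerCoeff (m + 4) -
      (∑ i ∈ range m, centerCoeff (i + 4) * centerCoeff (m + 3 - i)) / 2 := by
    rw [h]
    simp only [add_assoc]
    push_cast
    have : (m : ℝ) + (4 + 3) ≠ 0 := by positivity
    norm_num
    field_simp
    ring
  have h1 : |1 / 3 - 1 / ((m : ℝ) + 7)| ≤ 1 / 3 := by
    have : 1 / ((m : ℝ) + 7) ≤ 1 / 3 :=
      one_div_le_one_div_of_le (by norm_num) (by linarith [Nat.cast_nonneg (α := ℝ) m])
    have h0 : 0 < 1 / ((m : ℝ) + 7) := by positivity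
    rw [abs_of_nonneg (by linarith)]; linarith
  have h2 : |centerCoeff (m + 6)| ≤ 1 / 3 * |centerCoeff (m + 5)| +
      1 / 36 * |centerCoeff (m + 4)| +
      (∑ i ∈ range m, |centerCoeff (i + 4)| * |centerCoeff (m + 3 - i)|) / 2 := by
    rw [e]
    refine (abs_sub _ _).trans (add_le_add ((abs_sub _ _).trans (add_le_add ?_ ?_)) ?_)
    · rw [abs_mul]; exact mul_le_mul_of_nonneg_right h1 (abs_nonneg _)
    · rw [abs_mul, abs_of_nonneg (by norm_num : (0 : ℝ) ≤ 1 / 36)]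
    · rw [abs_div, abs_of_nonneg (by norm_num : (0 : ℝ) ≤ 2)]
      refine div_le_div_of_nonneg_right ((abs_sum_le_sum_abs _ _).trans_eq ?_) (by norm_num)
      exact sum_congr rfl fun i _ => abs_mul _ _
  unfold centerAbs
  have h3 : ∑ i ∈ range m, |centerCoeff (i + 4)| * 2 ^ (i + 4 - 1) *
      (|centerCoeff (m + 3 - i)| * 2 ^ (m + 3 - i - 1)) =
      (∑ i ∈ range m, |centerCoeff (i + 4)| * |centerCoeff (m + 3 - i)|) * 2 ^ (m + 5) := by
    rw [sum_mul]
    refine sum_congr rfl fun i hi => ?_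
    have : (2 : ℝ) ^ (m + 5) = 2 ^ (i + 4 - 1) * 2 ^ (m + 3 - i - 1) := by
      rw [← pow_add]; congr 1; have := mem_range.1 hi; omega
    rw [this]; ring
  rw [h3, show m + 6 - 1 = m + 5 by omega, show m + 5 - 1 = m + 4 by omega,
    show m + 4 - 1 = m + 3 by omega]
  have h4 := mul_le_mul_of_nonneg_right h2 (show (0 : ℝ) ≤ 2 ^ (m + 5) by positivity)
  refine h4.trans (le_of_eq ?_)
  ring

/-- A bootstrap on partial sums: `S ↦ (2/3)(1/270 + S) + (1/9)(9/270 + S) + (9/270 + S)²/2` maps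
`[0, 1/25]` into itself, with almost nothing to spare. -/
theorem sum_centerAbs_le (M : ℕ) : ∑ m ∈ range M, centerAbs (m + 6) ≤ 1 / 25 := by
  have b4 : centerAbs 4 = 8 / 270 := by rw [centerAbs, centerCoeff_four]; norm_num
  have b5 : centerAbs 5 = 1 / 270 := by rw [centerAbs, centerCoeff_five]; norm_num
  induction M with
  | zero => norm_num
  | succ M ih =>
    have h1 : ∑ m ∈ range (M + 1), centerAbs (m + 5) = 1 / 270 +
        ∑ m ∈ range M, centerAbs (m + 6) := by
      rw [sum_range_succ', zero_add, b5]; ring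
    have h2 : ∑ m ∈ range (M + 1), centerAbs (m + 4) ≤ 9 / 270 +
        ∑ m ∈ range M, centerAbs (m + 6) := by
      refine (sum_le_sum_of_subset_of_nonneg (range_subset_range.2 (Nat.le_succ (M + 1)))
        fun i _ _ => centerAbs_nonneg _).trans (le_of_eq ?_)
      rw [sum_range_succ', sum_range_succ']
      simp only [zero_add, add_assoc]
      norm_num [b4, b5]
      ring
    have h3 : ∑ m ∈ range (M + 1), ∑ i ∈ range m, centerAbs (i + 4) * centerAbs (m + 3 - i) ≤
        (9 / 270 + ∑ m ∈ range M, centerAbs (m + 6)) ^ 2 := by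
      have e1 := sum_range_conv_le (fun w j => if w = 0 then 0 else
        centerAbs (j + 4) * centerAbs (w + 3)) (fun j => by simp)
        (fun w j => by
          split_ifs
          · exact le_rfl
          · exact mul_nonneg (centerAbs_nonneg _) (centerAbs_nonneg _)) (M + 1)
      have e2 : ∑ m ∈ range (M + 1), ∑ i ∈ range m,
          centerAbs (i + 4) * centerAbs (m + 3 - i) = ∑ k ∈ range (M + 1), ∑ j ∈ range k,
          if k - j = 0 then 0 else centerAbs (j + 4) * centerAbs (k - j + 3) := by
        refine sum_congr rfl fun k _ => sum_congr rfl fun j hj => ?_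
        have := mem_range.1 hj
        rw [if_neg (by omega), show k - j + 3 = k + 3 - j by omega]
      rw [e2]
      refine e1.trans ?_
      rw [sum_range_succ']
      simp only [Nat.succ_ne_zero, if_false, if_true, sum_const_zero, add_zero]
      simp only [← sum_mul]
      have e3 : ∑ i ∈ range M, (∑ j ∈ range (M + 1), centerAbs (j + 4)) *
          centerAbs (i + 1 + 3) = (∑ j ∈ range (M + 1), centerAbs (j + 4)) *
          ∑ i ∈ range M, centerAbs (i + 4) := by rw [mul_sum]
      rw [e3, sq]
      have e4 : ∑ i ∈ range M, centerAbs (i + 4) ≤ ∑ i ∈ range (M + 1), centerAbs (i + 4) :=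
        sum_le_sum_of_subset_of_nonneg (range_subset_range.2 (Nat.le_succ M))
          fun i _ _ => centerAbs_nonneg _
      exact mul_le_mul h2 (e4.trans h2) (sum_nonneg fun i _ => centerAbs_nonneg _)
        ((sum_nonneg fun i _ => centerAbs_nonneg _).trans h2)
    have h4 : ∑ m ∈ range (M + 1), centerAbs (m + 6) ≤ 2 / 3 *
        ∑ m ∈ range (M + 1), centerAbs (m + 5) + 1 / 9 * ∑ m ∈ range (M + 1), centerAbs (m + 4) +
        (∑ m ∈ range (M + 1), ∑ i ∈ range m, centerAbs (i + 4) * centerAbs (m + 3 - i)) / 2 := by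
      rw [mul_sum, mul_sum, sum_div, ← sum_add_distrib, ← sum_add_distrib]
      exact sum_le_sum fun m _ => centerAbs_le m
    have h5 : 0 ≤ ∑ m ∈ range M, centerAbs (m + 6) := sum_nonneg fun i _ => centerAbs_nonneg _
    set S := ∑ m ∈ range M, centerAbs (m + 6)
    have h6 : (9 / 270 + S) ^ 2 ≤ (9 / 270 + 1 / 25) ^ 2 :=
      pow_le_pow_left₀ (by linarith) (by linarith) 2
    rw [h1] at h4
    norm_num at h6
    linarith

theorem sum_centerAbs_four_le (M : ℕ) : ∑ m ∈ range M, centerAbs (m + 4) ≤ 11 / 150 := by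
  have b4 : centerAbs 4 = 8 / 270 := by rw [centerAbs, centerCoeff_four]; norm_num
  have b5 : centerAbs 5 = 1 / 270 := by rw [centerAbs, centerCoeff_five]; norm_num
  refine (sum_le_sum_of_subset_of_nonneg (range_subset_range.2 (Nat.le_add_right M 2))
    fun i _ _ => centerAbs_nonneg _).trans ?_
  rw [sum_range_succ', sum_range_succ']
  simp only [zero_add, add_assoc]
  norm_num [b4, b5]
  linarith [sum_centerAbs_le M]

/-- The left side does not increase with `j`. It absorbs the factor `i + 4` from differentiation
into the gap between the ratio `1/2` for `y` and `2/3` for `ψ`. -/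
theorem mul_three_quarters_pow_le (j : ℕ) : ((j : ℝ) + 3) * (3 / 4) ^ (j + 3) ≤ 81 / 64 := by
  induction j with
  | zero => norm_num
  | succ j ih =>
    refine le_trans ?_ ih
    rw [show j + 1 + 3 = (j + 3) + 1 by ring, pow_succ]
    have : (0 : ℝ) ≤ (3 / 4) ^ (j + 3) := by positivity
    push_cast
    nlinarith [mul_nonneg (Nat.cast_nonneg (α := ℝ) j) this]

/-- The coefficients of `ψ` decay geometrically. -/
theorem abs_psiCoeff_le (m : ℕ) : |psiCoeff (m + 1)| ≤ (2 / 3) ^ m := by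
  induction m using Nat.strong_induction_on with
  | _ m ih =>
    rcases m with _ | _ | _ | m
    · simp [psiCoeff_one]
    · norm_num [psiCoeff_two]
    · norm_num [psiCoeff_three]
    -- The terms `j = 0, 1, 2` have coefficients `1`, `1/3`, `1/12`. Together with the two tail
    -- estimates they are beaten by the factor `m + 4` on the left once `m ≥ 0`, which is why the
    -- first three values are checked by hand.
    · have h := psiCoeff_succ (m + 3)
      rw [sum_range_succ', sum_range_succ', sum_range_succ'] at h
      rw [if_neg (by omega)] at h
      have e0 : ∀ i ∈ range m, (((i + 1 + 1 + 1 : ℕ) : ℝ) + 1) *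
          centerCoeff (i + 1 + 1 + 1 + 1) + (if i + 1 + 1 + 1 = 1 then 1 else 0) =
          (i + 4) * centerCoeff (i + 4) := fun i _ => by
        rw [if_neg (by omega)]; push_cast; ring_nf
      rw [sum_congr rfl fun i hi => by rw [e0 i hi]] at h
      simp only [zero_add, Nat.sub_zero, Nat.cast_zero, centerCoeff_one, Nat.cast_one,
        show (1 + 1 : ℕ) = 2 from rfl, centerCoeff_two, show (2 + 1 : ℕ) = 3 from rfl,
        centerCoeff_three] at h
      norm_num at h
      rw [show m + 3 - 2 = m + 1 by omega] at h
      -- The constant is `(81/32) · (11/150) ≤ 1/5`.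
      have hS : |∑ i ∈ range m, ((i : ℝ) + 4) * centerCoeff (i + 4) *
          psiCoeff (m + 3 - (i + 1 + 1 + 1))| ≤ 1 / 5 * (2 / 3) ^ (m + 3) := by
        refine (abs_sum_le_sum_abs _ _).trans ?_
        have hi : ∀ i ∈ range m, |((i : ℝ) + 4) * centerCoeff (i + 4) *
            psiCoeff (m + 3 - (i + 1 + 1 + 1))| ≤
            centerAbs (i + 4) * (81 / 32 * (2 / 3) ^ (m + 3)) := by
          intro i hi
          have hi' := mem_range.1 hi
          obtain ⟨k, rfl⟩ := Nat.exists_eq_add_of_lt hi'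
          rw [abs_mul, abs_mul, show i + k + 1 + 3 - (i + 1 + 1 + 1) = k + 1 by omega,
            abs_of_nonneg (by positivity : (0 : ℝ) ≤ i + 4)]
          have h1 := ih k (by omega)
          have h2 := mul_three_quarters_pow_le (i + 1)
          unfold centerAbs
          rw [show i + 4 - 1 = i + 3 by omega]
          have h3 : ((i : ℝ) + 4) * (2 / 3) ^ k ≤
              2 ^ (i + 3) * (81 / 32 * (2 / 3) ^ (i + k + 1 + 3)) := by
            have e1 : (2 : ℝ) ^ (i + 3) * (81 / 32 * (2 / 3) ^ (i + k + 1 + 3)) =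
                81 / 64 * (4 / 3) ^ (i + 4) * (2 / 3) ^ k := by
              rw [show i + k + 1 + 3 = (i + 4) + k by ring, pow_add (2 / 3 : ℝ) (i + 4) k,
                show (4 / 3 : ℝ) = 2 * (2 / 3) by norm_num, mul_pow, pow_succ (2 : ℝ) (i + 3)]
              ring
            rw [e1]
            refine mul_le_mul_of_nonneg_right ?_ (by positivity)
            have e2 : ((3 : ℝ) / 4) ^ (i + 4) * (4 / 3) ^ (i + 4) = 1 := by
              rw [← mul_pow]; norm_num
            have e3 := mul_le_mul_of_nonneg_right h2 (show (0 : ℝ) ≤ (4 / 3) ^ (i + 4) by positivity)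
            rw [show i + 1 + 3 = i + 4 by ring, mul_assoc, e2] at e3
            push_cast at e3
            linarith
          calc (↑i + 4) * |centerCoeff (i + 4)| * |psiCoeff (k + 1)|
              ≤ (↑i + 4) * |centerCoeff (i + 4)| * (2 / 3) ^ k :=
                mul_le_mul_of_nonneg_left h1 (by positivity)
            _ = |centerCoeff (i + 4)| * ((↑i + 4) * (2 / 3) ^ k) := by ring
            _ ≤ |centerCoeff (i + 4)| * (2 ^ (i + 3) * (81 / 32 * (2 / 3) ^ (i + k + 1 + 3))) :=
                mul_le_mul_of_nonneg_left h3 (abs_nonneg _)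
            _ = _ := by ring
        refine (sum_le_sum hi).trans ?_
        rw [← sum_mul]
        have h1 := sum_centerAbs_four_le m
        have h2 : (0 : ℝ) ≤ (2 / 3) ^ (m + 3) := by positivity
        nlinarith
      have h1 : |centerCoeff (m + 4)| ≤ 1 / 10 * (2 / 3) ^ (m + 3) := by
        have h2 := single_le_sum (f := fun i => centerAbs (i + 4)) (fun i _ => centerAbs_nonneg _)
          (self_mem_range_succ m)
        have h3 := h2.trans (sum_centerAbs_four_le (m + 1))
        unfold centerAbs at h3
        rw [show m + 4 - 1 = m + 3 by omega] at h3
        have h4 : (1 : ℝ) ≤ 2 ^ (m + 3) * (2 / 3) ^ (m + 3) := by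
          rw [← mul_pow]; exact one_le_pow₀ (by norm_num)
        have h5 : (0 : ℝ) ≤ (2 / 3) ^ (m + 3) := by positivity
        have h6 := mul_le_mul_of_nonneg_left h4 (abs_nonneg (centerCoeff (m + 4)))
        have h7 := mul_le_mul_of_nonneg_right h3 h5
        linarith
      have p3 := ih (m + 2) (by omega)
      have p2 := ih (m + 1) (by omega)
      have p1 := ih m (by omega)
      have hz : (0 : ℝ) ≤ (2 / 3) ^ m := by positivity
      rw [show m + 3 = m + 2 + 1 by ring, pow_succ, pow_succ, pow_succ] at hS h1
      rw [pow_succ] at p2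
      rw [pow_succ, pow_succ] at p3
      rw [show m + 1 + 1 + 1 = m + 2 + 1 by ring, pow_succ, pow_succ, pow_succ]
      have hm : (0 : ℝ) ≤ m := Nat.cast_nonneg m
      set Z : ℝ := (2 / 3) ^ m
      set S := ∑ i ∈ range m, ((i : ℝ) + 4) * centerCoeff (i + 4) *
        psiCoeff (m + 3 - (i + 1 + 1 + 1))
      change |S| ≤ _ at hS
      change |centerCoeff (m + 3 + 1)| ≤ _ at h1
      change |psiCoeff (m + 3)| ≤ _ at p3
      change |psiCoeff (m + 2)| ≤ _ at p2
      change |psiCoeff (m + 3 + 1)| ≤ _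
      have k1 : |((m : ℝ) + 3 + 1) * psiCoeff (m + 3 + 1)| ≤ ((m : ℝ) + 3 + 1) *
          |centerCoeff (m + 3 + 1)| +
          (|S| + 1 / 12 * |psiCoeff (m + 1)| + 1 / 3 * |psiCoeff (m + 2)| +
            |psiCoeff (m + 3)|) := by
        rw [h]
        refine (abs_add_le _ _).trans (add_le_add (by rw [abs_mul, abs_of_nonneg (by positivity : (0 : ℝ) ≤ m + 3 + 1)]) ?_)
        · refine (abs_add_le _ _).trans (add_le_add_left ?_ _)
          refine (abs_add_le _ _).trans (add_le_add ?_ ?_)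
          · refine (abs_add_le _ _).trans (add_le_add_right ?_ _)
            rw [abs_mul, abs_of_nonneg (by norm_num : (0 : ℝ) ≤ 1 / 12)]
          · rw [abs_mul, abs_of_nonneg (by norm_num : (0 : ℝ) ≤ 1 / 3)]
      rw [abs_mul] at k1
      have k2 : |(m : ℝ) + 3 + 1| = m + 3 + 1 := abs_of_nonneg (by positivity)
      rw [k2] at k1
      have k3 := mul_le_mul_of_nonneg_left h1 (show (0 : ℝ) ≤ m + 3 + 1 by positivity)
      refine le_of_mul_le_mul_left ?_ (show (0 : ℝ) < m + 3 + 1 by positivity)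
      nlinarith [mul_nonneg hm hz]

end

/-! ### The reduced equation and truncated polynomial identities. -/

noncomputable section

open Finset MeasureTheory

/-- The coefficients of the equation obtained by eliminating the parameter `L 1`. -/
def reducedG {𝕜 : Type*} [RCLike 𝕜] (c s : ℝ → 𝕜) (L : ℕ → 𝕜) (d T w : ℕ) (θ : ℝ) : 𝕜 :=
  ∑ l ∈ range (d + 1), if 2 ≤ l ∧ l ≤ w ∧ w - l < T then
    L l * L 1 ^ (w - l) * ((psiCoeff (w - l + 1) : ℝ) : 𝕜) * c θ ^ l * s θ ^ (w - l + 1) else 0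

/-- A sum over `w = l + i`. -/
theorem sum_range_shift {M : Type*} [AddCommMonoid M] (f : ℕ → M) {l T K : ℕ} (h : l + T ≤ K) :
    ∑ w ∈ range K, (if l ≤ w ∧ w - l < T then f (w - l) else 0) = ∑ i ∈ range T, f i := by
  rw [← sum_filter]
  refine sum_bij' (fun w _ => w - l) (fun i _ => l + i) ?_ ?_ ?_ ?_ ?_
  · intro w hw; simp only [mem_filter, mem_range] at hw ⊢; exact hw.2.2
  · intro i hi; simp only [mem_filter, mem_range] at hi ⊢; omega
  · intro w hw; simp only [mem_filter, mem_range] at hw; omega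
  · intro i hi; simp only [mem_range] at hi; omega
  · intro w hw; rfl

/-- The reduced coefficients are made so that `r G(θ, r) = p_2(r cos θ) ψ(r sin θ)`, with `p_2` the
part of the damping of degree at least two and `ψ` scaled by `L 1` and cut after `T` terms. The cut
keeps `G` polynomial, so the existence results for polar equations apply. -/
theorem recG_reducedG {𝕜 : Type*} [RCLike 𝕜] (c s : ℝ → 𝕜) (L : ℕ → 𝕜) (d T : ℕ) (θ : ℝ) (r : 𝕜) :
    r * recG (reducedG c s L d T) (d + T) θ r =
      (∑ l ∈ range (d + 1), if 2 ≤ l then L l * (r * c θ) ^ l else 0) *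
      ∑ i ∈ range T, L 1 ^ i * ((psiCoeff (i + 1) : ℝ) : 𝕜) * (r * s θ) ^ (i + 1) := by
  unfold recG reducedG
  simp only [sum_mul (range (d + 1))]
  rw [sum_comm, mul_sum]
  refine sum_congr rfl fun l hl => ?_
  by_cases h2 : 2 ≤ l
  · simp only [h2, true_and, if_true]
    have hl' := mem_range.1 hl
    rw [← sum_range_shift (fun i => L 1 ^ i * ((psiCoeff (i + 1) : ℝ) : 𝕜) * (r * s θ) ^ (i + 1))
      (show l + T ≤ d + T + 1 by omega), mul_sum, mul_sum]
    refine sum_congr rfl fun w _ => ?_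
    split_ifs with h
    · obtain ⟨i, rfl⟩ := Nat.exists_eq_add_of_le h.1
      rw [Nat.add_sub_cancel_left]
      ring
    · simp
  · simp [h2]

theorem continuous_reducedG {𝕜 : Type*} [RCLike 𝕜] {c s : ℝ → 𝕜} (hc : Continuous c)
    (hs : Continuous s) (L : ℕ → 𝕜) (d T w : ℕ) : Continuous (reducedG c s L d T w) := by
  unfold reducedG
  refine continuous_finsetSum _ fun l _ => ?_
  split_ifs
  · exact (continuous_const.mul (hc.pow _)).mul (hs.pow _)
  · exact continuous_const

theorem reducedG_zero {𝕜 : Type*} [RCLike 𝕜] (c s : ℝ → 𝕜) (L : ℕ → 𝕜) (d T : ℕ) (θ : ℝ) :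
    reducedG c s L d T 0 θ = 0 := by
  unfold reducedG
  refine sum_eq_zero fun l _ => if_neg ?_
  omega

theorem reducedG_of_lt {𝕜 : Type*} [RCLike 𝕜] (c s : ℝ → 𝕜) (L : ℕ → 𝕜) (d T : ℕ) {w : ℕ}
    (hw : d + T < w) (θ : ℝ) : reducedG c s L d T w θ = 0 := by
  unfold reducedG
  refine sum_eq_zero fun l hl => if_neg ?_
  have := mem_range.1 hl
  omega

/-- The cut-off is invisible at indices below it, so the holonomy of index at most `T` does not
depend on `T`. -/
theorem reducedG_congr {𝕜 : Type*} [RCLike 𝕜] (c s : ℝ → 𝕜) (L : ℕ → 𝕜) (d : ℕ) {T T' w : ℕ}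
    (hT : w < T) (hT' : w < T') : reducedG c s L d T w = reducedG c s L d T' w := by
  funext θ
  unfold reducedG
  refine sum_congr rfl fun l hl => ?_
  have : w - l < T ↔ w - l < T' := by omega
  simp only [this]

section CenterPolynomials

open Polynomial

theorem exists_eval_bound (p : ℝ[X]) : ∃ C, 0 ≤ C ∧ ∀ x : ℝ, |x| ≤ 1 → |p.eval x| ≤ C := by
  obtain ⟨C, hC⟩ := (isCompact_Icc (a := (-1 : ℝ)) (b := 1)).exists_bound_of_continuousOn
    (f := fun x => p.eval x) p.continuous.continuousOn
  refine ⟨C, (norm_nonneg _).trans (hC 0 (by simp)), fun x hx => hC x (abs_le.1 hx)⟩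

theorem exists_eval_bound_of_coeff {p : ℝ[X]} {T : ℕ} (hp : ∀ k < T, p.coeff k = 0) :
    ∃ C, 0 ≤ C ∧ ∀ x : ℝ, |x| ≤ 1 → |p.eval x| ≤ C * |x| ^ T := by
  obtain ⟨q, rfl⟩ := Polynomial.X_pow_dvd_iff.2 hp
  obtain ⟨C, hC0, hC⟩ := exists_eval_bound q
  refine ⟨C, hC0, fun x hx => ?_⟩
  rw [eval_mul, eval_pow, eval_X, abs_mul, abs_pow, mul_comm]
  exact mul_le_mul_of_nonneg_right (hC x hx) (by positivity)

/-- The truncation of `∑ Λ^{m-1} a_m X^m`. -/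
def scaledPoly (a : ℕ → ℝ) (Λ : ℝ) (T : ℕ) : ℝ[X] :=
  ∑ i ∈ range T, monomial (i + 1) (Λ ^ i * a (i + 1))

theorem coeff_scaledPoly {a : ℕ → ℝ} (ha : a 0 = 0) (Λ : ℝ) {T k : ℕ} (hk : k ≤ T) :
    (scaledPoly a Λ T).coeff k = Λ ^ (k - 1) * a k := by
  unfold scaledPoly
  simp only [finsetSum_coeff, coeff_monomial]
  rcases k with _ | k
  · simp [ha]
  · simp only [Nat.succ_inj, Nat.add_sub_cancel]
    rw [sum_ite_eq' (range T) k, if_pos (mem_range.2 hk)]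

theorem eval_scaledPoly (a : ℕ → ℝ) (Λ : ℝ) (T : ℕ) (x : ℝ) :
    (scaledPoly a Λ T).eval x = ∑ i ∈ range T, Λ ^ i * a (i + 1) * x ^ (i + 1) := by
  unfold scaledPoly
  simp [eval_finsetSum]

/-- The scaling `a_m ↦ Λ^{m-1} a_m` turns `y y' = X (1 - y)` into `y y' = X (1 - Λ y)`. A truncation
satisfies it in all degrees below `T`, so the defect is divisible by `X^T`. Polynomials avoid any
question of convergence. -/
theorem exists_center_ode_bound (Λ : ℝ) (T : ℕ) : ∃ C, 0 ≤ C ∧ ∀ x : ℝ, |x| ≤ 1 →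
    |(scaledPoly centerCoeff Λ T).eval x * (derivative (scaledPoly centerCoeff Λ T)).eval x -
      x * (1 - Λ * (scaledPoly centerCoeff Λ T).eval x)| ≤ C * |x| ^ T := by
  set Y := scaledPoly centerCoeff Λ T with hY
  obtain ⟨C, hC0, hC⟩ := exists_eval_bound_of_coeff (T := T)
    (p := Y * derivative Y - X * (1 - Polynomial.C Λ * Y)) (fun k hk => by
      have h := congrArg (PowerSeries.coeff k) centerSeries_ode
      rw [PowerSeries.coeff_mul] at h
      simp only [PowerSeries.coeff_derivative] at h
      simp only [centerSeries, PowerSeries.coeff_mk] at h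
      rw [coeff_sub, coeff_mul]
      have e1 : ∑ x ∈ antidiagonal k, Y.coeff x.1 * (derivative Y).coeff x.2 = Λ ^ (k - 1) *
          ∑ x ∈ antidiagonal k, centerCoeff x.1 * (centerCoeff (x.2 + 1) * (x.2 + 1)) := by
        rw [mul_sum]
        refine sum_congr rfl fun x hx => ?_
        have hx' := mem_antidiagonal.1 hx
        rw [coeff_derivative, hY, coeff_scaledPoly centerCoeff_zero _ (by omega),
          coeff_scaledPoly centerCoeff_zero _ (by omega)]
        rcases hx1 : x.1 with _ | i
        · simp [centerCoeff_zero]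
        · have : Λ ^ (k - 1) = Λ ^ (i + 1 - 1) * Λ ^ (x.2 + 1 - 1) := by
            rw [← pow_add]; congr 1; omega
          rw [this]; ring
      rw [e1, h]
      rcases k with _ | k
      · simp
      · rw [PowerSeries.coeff_succ_X_mul, coeff_X_mul, map_sub, coeff_sub, coeff_C_mul, hY,
          coeff_scaledPoly centerCoeff_zero _ (by omega), PowerSeries.coeff_mk,
          PowerSeries.coeff_one, Polynomial.coeff_one]
        rcases k with _ | k
        · simp [centerCoeff_zero]
        · simp only [Nat.add_sub_cancel, Nat.succ_ne_zero, if_false]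
          ring)
  exact ⟨C, hC0, fun x hx => by simpa using hC x hx⟩

/-- The same device for `(1 - Λ y) ψ = y`. -/
theorem exists_psi_bound (Λ : ℝ) (T : ℕ) : ∃ C, 0 ≤ C ∧ ∀ x : ℝ, |x| ≤ 1 →
    |(1 - Λ * (scaledPoly centerCoeff Λ T).eval x) * (scaledPoly psiCoeff Λ T).eval x -
      (scaledPoly centerCoeff Λ T).eval x| ≤ C * |x| ^ T := by
  set Y := scaledPoly centerCoeff Λ T with hY
  set Ψ := scaledPoly psiCoeff Λ T with hΨ
  obtain ⟨C, hC0, hC⟩ := exists_eval_bound_of_coeff (T := T)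
    (p := (1 - Polynomial.C Λ * Y) * Ψ - Y) (fun k hk => by
      have h := congrArg (PowerSeries.coeff k) one_sub_centerSeries_mul_psiSeries
      rw [sub_mul, one_mul, map_sub, PowerSeries.coeff_mul] at h
      simp only [centerSeries, PowerSeries.coeff_mk] at h
      change psiCoeff k - ∑ x ∈ antidiagonal k, centerCoeff x.1 * psiCoeff x.2 = _ at h
      rw [coeff_sub, sub_mul, one_mul, coeff_sub, mul_assoc, coeff_C_mul, coeff_mul]
      have e1 : Λ * ∑ x ∈ antidiagonal k, Y.coeff x.1 * Ψ.coeff x.2 = Λ ^ (k - 1) *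
          ∑ x ∈ antidiagonal k, centerCoeff x.1 * psiCoeff x.2 := by
        rw [mul_sum, mul_sum]
        refine sum_congr rfl fun x hx => ?_
        have hx' := mem_antidiagonal.1 hx
        rw [hY, hΨ, coeff_scaledPoly centerCoeff_zero _ (by omega),
          coeff_scaledPoly psiCoeff_zero _ (by omega)]
        rcases hx1 : x.1 with _ | i
        · simp [centerCoeff_zero]
        rcases hx2 : x.2 with _ | j
        · simp [psiCoeff_zero]
        have : Λ ^ (k - 1) = Λ * (Λ ^ (i + 1 - 1) * Λ ^ (j + 1 - 1)) := by
          rw [← pow_add, ← pow_succ']; congr 1; omega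
        rw [this]; ring
      rw [e1, hY, hΨ, coeff_scaledPoly centerCoeff_zero _ hk.le,
        coeff_scaledPoly psiCoeff_zero _ hk.le, ← h]
      ring)
  exact ⟨C, hC0, fun x hx => by simpa using hC x hx⟩

end CenterPolynomials

/-- A polynomial that is small of order `M` along a sequence of positive arguments tending to `0`
has vanishing coefficients below `M`. -/
theorem coeff_eq_zero_of_small (a : ℕ → ℝ) (K M : ℕ) (C : ℝ)
    (h : ∀ ε : ℝ, 0 < ε → ∃ z, 0 < z ∧ z < ε ∧ |∑ k ∈ range K, a k * z ^ k| ≤ C * z ^ M)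
    (k : ℕ) (hkM : k < M) (hkK : k < K) : a k = 0 := by
  induction k using Nat.strong_induction_on with
  | _ k ih =>
    set B := |C| + ∑ i ∈ range K, |a i| with hB
    have hB0 : 0 ≤ B := add_nonneg (abs_nonneg _) (sum_nonneg fun _ _ => abs_nonneg _)
    have key : ∀ z, 0 < z → z ≤ 1 → |∑ k ∈ range K, a k * z ^ k| ≤ C * z ^ M → |a k| ≤ B * z := by
      intro z hz hz1 hle
      have e : ∑ i ∈ range K, a i * z ^ i = a k * z ^ k +
          ∑ i ∈ range K, if k < i then a i * z ^ i else 0 := by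
        have : ∀ i ∈ range K, a i * z ^ i =
            (if i = k then a k * z ^ k else 0) + if k < i then a i * z ^ i else 0 := by
          intro i hi
          rcases lt_trichotomy i k with h1 | h1 | h1
          · rw [ih i h1 (by omega) (by omega)]; simp [h1.ne, not_lt.2 h1.le]
          · simp [h1]
          · simp [h1.ne', h1]
        rw [sum_congr rfl this, sum_add_distrib, sum_ite_eq' (range K) k,
          if_pos (mem_range.2 hkK)]
      have h2 : |∑ i ∈ range K, if k < i then a i * z ^ i else 0| ≤
          (∑ i ∈ range K, |a i|) * z ^ (k + 1) := by
        rw [sum_mul]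
        refine (abs_sum_le_sum_abs _ _).trans (sum_le_sum fun i _ => ?_)
        split_ifs with h3
        · rw [abs_mul, abs_of_pos (pow_pos hz i)]
          exact mul_le_mul_of_nonneg_left (pow_le_pow_of_le_one hz.le hz1 h3) (abs_nonneg _)
        · rw [abs_zero]; positivity
      have h3 : C * z ^ M ≤ |C| * z ^ (k + 1) := by
        have h4 : z ^ M ≤ z ^ (k + 1) := pow_le_pow_of_le_one hz.le hz1 hkM
        exact (mul_le_mul_of_nonneg_right (le_abs_self C) (by positivity)).trans
          (mul_le_mul_of_nonneg_left h4 (abs_nonneg C))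
      have h5 : |a k * z ^ k| ≤ B * z ^ (k + 1) := by
        have : a k * z ^ k = ∑ i ∈ range K, a i * z ^ i -
            ∑ i ∈ range K, if k < i then a i * z ^ i else 0 := by rw [e]; ring
        rw [this]
        refine (abs_sub _ _).trans ?_
        rw [hB, add_mul]
        linarith
      rw [abs_mul, abs_of_pos (pow_pos hz k), pow_succ', ← mul_assoc] at h5
      exact le_of_mul_le_mul_right h5 (pow_pos hz k)
    -- Smallness gives `|a_k| ≤ B z` for arbitrarily small `z`; a nonzero `a_k` is contradicted by
    -- any `z` below `|a_k| / (B + 1)`.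
    by_contra hne
    have hpos : 0 < |a k| := abs_pos.2 hne
    obtain ⟨z, hz, hz2, hz3⟩ := h (min 1 (|a k| / (B + 1))) (by positivity)
    have h1 := key z hz (hz2.le.trans (min_le_left _ _)) hz3
    have h2 := hz2.trans_le (min_le_right _ _)
    rw [lt_div_iff₀ (by positivity)] at h2
    nlinarith

/-- Derivatives of polar coordinates. -/
theorem polar_deriv {S : Set ℝ} {t : ℝ} (hS : UniqueDiffWithinAt ℝ S t) (ht : t ∈ S)
    {x y φ r : ℝ → ℝ} {x' y' φ' r' : ℝ} (hx : HasDerivWithinAt x x' S t)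
    (hy : HasDerivWithinAt y y' S t) (hφ : HasDerivWithinAt φ φ' S t)
    (hr : HasDerivWithinAt r r' S t) (hxr : ∀ t ∈ S, x t = r t * Real.cos (φ t))
    (hyr : ∀ t ∈ S, y t = r t * Real.sin (φ t)) :
    r' = Real.cos (φ t) * x' + Real.sin (φ t) * y' ∧
    r t * φ' = Real.cos (φ t) * y' - Real.sin (φ t) * x' := by
  have h1 := ((hr.mul hφ.cos).congr hxr (hxr t ht))
  have h2 := ((hr.mul hφ.sin).congr hyr (hyr t ht))
  have e1 := hS.eq_deriv _ hx h1
  have e2 := hS.eq_deriv _ hy h2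
  have h3 := Real.sin_sq_add_cos_sq (φ t)
  rw [e1, e2]
  constructor
  · linear_combination (-r') * h3
  · linear_combination (-r t * φ') * h3

end

/-! ### Polar coordinates of a vertically stretched point. -/

noncomputable section

open Finset MeasureTheory

/-- The slope used to pass from `(R cos t, R sin t)` to `(R cos t, (1 + m) R sin t)`. -/
def bendSlope (m t : ℝ) : ℝ := m * Real.sin t * Real.cos t / (1 + m * Real.sin t ^ 2)

/-- The polar angle of `(cos t, (1 + m) sin t)`. -/
def bendAngle (m t : ℝ) : ℝ := t + Real.arctan (bendSlope m t)

/-- The polar radius of `(cos t, (1 + m) sin t)`. -/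
def bendRadius (m t : ℝ) : ℝ := (1 + m * Real.sin t ^ 2) * √(1 + bendSlope m t ^ 2)

section Bend

variable {m t : ℝ}

theorem half_le_one_add_mul_sin_sq (hm : |m| ≤ 1 / 2) : 1 / 2 ≤ 1 + m * Real.sin t ^ 2 := by
  have h1 := Real.sin_sq_le_one t
  have h2 := sq_nonneg (Real.sin t)
  have h3 := (abs_le.1 hm).1
  nlinarith

/-- In the frame rotated by `t` the point `(cos t, (1 + m) sin t)` has radial component `1 + m sin²
t` and tangential component `m sin t cos t`. Their quotient is the slope, so the arctangent gives a
globally continuous choice of the angle. -/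
theorem bendRadius_mul_cos (hm : |m| ≤ 1 / 2) :
    bendRadius m t * Real.cos (bendAngle m t) = Real.cos t := by
  have h0 := half_le_one_add_mul_sin_sq (t := t) hm
  have h1 : √(1 + bendSlope m t ^ 2) ≠ 0 := (Real.sqrt_pos.2 (by positivity)).ne'
  have h2 : bendSlope m t * (1 + m * Real.sin t ^ 2) = m * Real.sin t * Real.cos t := by
    unfold bendSlope; rw [div_mul_cancel₀]; linarith
  have h3 := Real.sin_sq_add_cos_sq t
  unfold bendRadius bendAngle
  rw [Real.cos_add, Real.cos_arctan, Real.sin_arctan]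
  field_simp
  linear_combination (-Real.sin t) * h2

theorem bendRadius_mul_sin (hm : |m| ≤ 1 / 2) :
    bendRadius m t * Real.sin (bendAngle m t) = (1 + m) * Real.sin t := by
  have h0 := half_le_one_add_mul_sin_sq (t := t) hm
  have h1 : √(1 + bendSlope m t ^ 2) ≠ 0 := (Real.sqrt_pos.2 (by positivity)).ne'
  have h2 : bendSlope m t * (1 + m * Real.sin t ^ 2) = m * Real.sin t * Real.cos t := by
    unfold bendSlope; rw [div_mul_cancel₀]; linarith
  have h3 := Real.sin_sq_add_cos_sq t
  unfold bendRadius bendAngle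
  rw [Real.sin_add, Real.cos_arctan, Real.sin_arctan]
  field_simp
  linear_combination (Real.cos t) * h2 + m * Real.sin t * h3

theorem abs_bendAngle_sub_le : |bendAngle m t - t| ≤ 2 := by
  unfold bendAngle
  rw [add_sub_cancel_left, abs_le]
  have h1 := Real.neg_pi_div_two_lt_arctan (bendSlope m t)
  have h2 := Real.arctan_lt_pi_div_two (bendSlope m t)
  have h3 := Real.pi_lt_d2
  constructor <;> linarith

theorem bendRadius_bounds (hm : |m| ≤ 1 / 2) : 1 / 2 ≤ bendRadius m t ∧ bendRadius m t ≤ 3 := by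
  have h0 := half_le_one_add_mul_sin_sq (t := t) hm
  have h1 : 1 ≤ √(1 + bendSlope m t ^ 2) := Real.one_le_sqrt.2 (by nlinarith [sq_nonneg (bendSlope m t)])
  have hs := Real.sin_sq_le_one t
  have hs0 := sq_nonneg (Real.sin t)
  have hm' := abs_le.1 hm
  have h2 : |bendSlope m t| ≤ 1 := by
    unfold bendSlope
    rw [abs_div, abs_of_pos (by linarith : 0 < 1 + m * Real.sin t ^ 2),
      div_le_one (by linarith), abs_mul, abs_mul]
    have h3 := Real.abs_sin_le_one t
    have h4 := Real.abs_cos_le_one t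
    calc |m| * |Real.sin t| * |Real.cos t| ≤ 1 / 2 * 1 * 1 := by gcongr
      _ ≤ _ := by linarith
  have h5 : √(1 + bendSlope m t ^ 2) ≤ 2 := by
    rw [Real.sqrt_le_left (by norm_num)]
    have := sq_le_sq' (abs_le.1 h2).1 (abs_le.1 h2).2
    linarith
  have h6 : 1 + m * Real.sin t ^ 2 ≤ 3 / 2 := by nlinarith
  unfold bendRadius
  constructor <;> nlinarith

/-- At `t = 0` and `t = 2π` nothing is stretched, so both equations have the same starting and
return points and one full turn corresponds to one full turn. -/
theorem bendAngle_of_sin (h : Real.sin t = 0) : bendAngle m t = t := by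
  simp [bendAngle, bendSlope, h]

theorem bendRadius_of_sin (h : Real.sin t = 0) : bendRadius m t = 1 := by
  simp [bendRadius, bendSlope, h]

theorem differentiable_bend {m : ℝ → ℝ} {S : Set ℝ} (hm : DifferentiableWithinAt ℝ m S t)
    (hm2 : |m t| ≤ 1 / 2) : DifferentiableWithinAt ℝ (fun t => bendAngle (m t) t) S t ∧
      DifferentiableWithinAt ℝ (fun t => bendRadius (m t) t) S t := by
  have h0 := half_le_one_add_mul_sin_sq (t := t) hm2
  have hs : DifferentiableWithinAt ℝ Real.sin S t := Real.differentiable_sin.differentiableAt.differentiableWithinAt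
  have hc : DifferentiableWithinAt ℝ Real.cos S t := Real.differentiable_cos.differentiableAt.differentiableWithinAt
  have h1 : DifferentiableWithinAt ℝ (fun t => 1 + m t * Real.sin t ^ 2) S t :=
    (hm.mul (hs.pow 2)).const_add 1
  have h2 : DifferentiableWithinAt ℝ (fun t => bendSlope (m t) t) S t :=
    ((hm.mul hs).mul hc).div h1 (by linarith)
  refine ⟨differentiableWithinAt_id.add h2.arctan, h1.mul ?_⟩
  exact ((h2.pow 2).const_add 1).sqrt (add_pos_of_pos_of_nonneg one_pos (sq_nonneg _)).ne'

end Bend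

section RealElimination

variable {L : ℕ → ℝ} {d : ℕ}

theorem recG_real (hL0 : L 0 = 0) (θ r : ℝ) :
    recG (fun w θ => L w * Real.cos θ ^ w * Real.sin θ) d θ r = Real.sin θ *
      ((∑ l ∈ range (d + 1), if 2 ≤ l then L l * (r * Real.cos θ) ^ l else 0) +
        (if 1 ≤ d then L 1 else 0) * (r * Real.cos θ)) := by
  unfold recG
  have : ∀ l ∈ range (d + 1), L l * Real.cos θ ^ l * Real.sin θ * r ^ l =
      Real.sin θ * ((if 2 ≤ l then L l * (r * Real.cos θ) ^ l else 0) +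
        if l = 1 then L 1 * (r * Real.cos θ) else 0) := by
    intro l _
    rcases l with _ | _ | l
    · simp [hL0]
    · simp; ring
    · simp; ring
  rw [sum_congr rfl this, ← mul_sum, sum_add_distrib, sum_ite_eq']
  congr 2
  rcases d with _ | d <;> simp

theorem exists_reducedG_bound (L : ℕ → ℝ) (d T : ℕ) :
    ∃ A, 0 ≤ A ∧ ∀ w θ, ‖reducedG Real.cos Real.sin L d T w θ‖ ≤ A := by
  refine ⟨∑ l ∈ range (d + 1), ∑ i ∈ range T, |L l * L 1 ^ i * psiCoeff (i + 1)|,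
    sum_nonneg fun _ _ => sum_nonneg fun _ _ => abs_nonneg _, fun w θ => ?_⟩
  unfold reducedG
  refine norm_sum_le_of_le _ fun l _ => ?_
  split_ifs with h
  · have h1 : |L l * L 1 ^ (w - l) * psiCoeff (w - l + 1)| ≤
        ∑ i ∈ range T, |L l * L 1 ^ i * psiCoeff (i + 1)| :=
      single_le_sum (f := fun i => |L l * L 1 ^ i * psiCoeff (i + 1)|) (fun _ _ => abs_nonneg _)
        (mem_range.2 h.2.2)
    refine le_trans ?_ h1
    simp only [RCLike.ofReal_real_eq_id, id, Real.norm_eq_abs]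
    rw [mul_assoc, abs_mul]
    refine mul_le_of_le_one_right (abs_nonneg _) ?_
    rw [abs_mul, abs_pow, abs_pow]
    exact mul_le_one₀ (pow_le_one₀ (abs_nonneg _) (Real.abs_cos_le_one θ)) (by positivity)
      (pow_le_one₀ (abs_nonneg _) (Real.abs_sin_le_one θ))
  · rw [norm_zero]; exact sum_nonneg fun _ _ => abs_nonneg _

theorem exists_sum_bound {f : ℕ → ℝ → ℝ} (hf : ∀ k, Continuous (f k)) (K : ℕ) (a b : ℝ) :
    ∃ C, 0 ≤ C ∧ ∀ θ ∈ Set.Icc a b, ∑ k ∈ range K, ‖f k θ‖ ≤ C := by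
  obtain ⟨C, hC⟩ := (isCompact_Icc (a := a) (b := b)).exists_bound_of_continuousOn
    (f := fun θ => ∑ k ∈ range K, ‖f k θ‖)
    (continuous_finsetSum _ fun k _ => (hf k).norm).continuousOn
  refine ⟨max C 0, le_max_right _ _, fun θ hθ => ?_⟩
  exact (le_abs_self _).trans ((hC θ hθ).trans (le_max_left _ _))

/-- The derivative of a truncated first integral along a curve that is a solution up to an
error `E`. -/
theorem abs_deriv_recP_le {g : ℕ → ℝ → ℝ} (hg0 : ∀ θ, g 0 θ = 0)
    (hgd : ∀ w, d < w → ∀ θ, g w θ = 0) {A : ℝ} (hA : ∀ w θ, ‖g w θ‖ ≤ A) {K : ℕ} {C₁ C₂ : ℝ}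
    {φ r φ' r' E : ℝ} (hr0 : 0 < r) (hr1 : r ≤ 1) (hr2 : A * d * r ≤ 1 / 2)
    (hC₁ : ∑ k ∈ range K, ‖k * recV Real.cos Real.sin g k φ‖ ≤ C₁)
    (hC₂ : ∑ k ∈ range K, ‖recX Real.cos Real.sin g k φ‖ ≤ C₂)
    (hE : r * (r' * (1 - Real.cos φ * recG g d φ r) + r * Real.sin φ * recG g d φ r * φ') = E) :
    |φ' * (∑ k ∈ range K, recD Real.cos Real.sin g k φ * r ^ k) +
      (∑ k ∈ range K, k * recV Real.cos Real.sin g k φ * r ^ (k - 1)) * r'| ≤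
    2 * (C₁ * (|E| / r) + |φ'| * (r ^ K * (A * (d + 1) * C₂))) := by
  have hA0 : 0 ≤ A := (norm_nonneg _).trans (hA 0 0)
  have hrn : ‖r‖ = r := Real.norm_of_nonneg hr0.le
  have h1 := half_le_norm_one_sub_recG (c := Real.cos) (W := d) Real.abs_cos_le_one hg0 hA
    (θ := φ) (r := r) (by rw [hrn]; exact hr1) (by rw [hrn]; exact hr2)
  have h2 := norm_trunc_remainder_le (c := Real.cos) (s := Real.sin) hg0 hgd φ (r := r)
    (by rw [hrn]; exact hr1) K
  rw [hrn] at h2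
  set G := recG g d φ r
  set D := ∑ k ∈ range K, recD Real.cos Real.sin g k φ * r ^ k
  set U := ∑ k ∈ range K, k * recV Real.cos Real.sin g k φ * r ^ k with hU
  set S := ∑ k ∈ range K, k * recV Real.cos Real.sin g k φ * r ^ (k - 1) with hS
  have hSU : S * r = U := by
    rw [hS, hU, sum_mul]
    refine sum_congr rfl fun k _ => ?_
    rcases Nat.eq_zero_or_pos k with rfl | hk
    · simp
    · obtain ⟨m, rfl⟩ := Nat.exists_eq_add_of_le' hk
      rw [Nat.add_sub_cancel]; ring
  have hSle : |S| ≤ C₁ := by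
    rw [← Real.norm_eq_abs]
    refine (norm_sum_le_of_le _ fun k _ => ?_).trans hC₁
    rw [norm_mul _ (r ^ (k - 1)), norm_pow, hrn]
    exact mul_le_of_le_one_right (norm_nonneg _) (pow_le_one₀ hr0.le hr1)
  -- The defect `E` of the curve and the truncation remainder of the first integral contribute
  -- separately.
  have e : (1 - Real.cos φ * G) * (φ' * D + S * r') = S * (E / r) +
      φ' * ((1 - Real.cos φ * G) * D - Real.sin φ * G * U) := by
    rw [← hE, ← hSU]
    field_simp
    ring
  have h3 : |(1 - Real.cos φ * G) * (φ' * D + S * r')| ≤ C₁ * (|E| / r) +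
      |φ'| * (r ^ K * (A * (d + 1) * C₂)) := by
    rw [e]
    refine (abs_add_le _ _).trans (add_le_add ?_ ?_)
    · rw [abs_mul, abs_div, abs_of_pos hr0]
      exact mul_le_mul_of_nonneg_right hSle (by positivity)
    · rw [abs_mul]
      refine mul_le_mul_of_nonneg_left (h2.trans ?_) (abs_nonneg _)
      have h4 : ∑ w ∈ range (d + 1), ‖g w φ‖ ≤ A * (d + 1) := by
        refine (sum_le_sum fun w _ => hA w φ).trans ?_
        rw [sum_const, card_range, nsmul_eq_mul]; push_cast; linarith
      gcongr
  rw [abs_mul] at h3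
  have h5 := mul_le_mul_of_nonneg_right h1 (abs_nonneg (φ' * D + S * r'))
  rw [Real.norm_eq_abs] at h5
  linarith

end RealElimination

end

/-! ### Elimination of `λ_1` for real parameters. -/

noncomputable section

open Finset MeasureTheory

theorem scaledPoly_eval_eq (a : ℕ → ℝ) (Λ : ℝ) (T : ℕ) (x : ℝ) : (scaledPoly a Λ T).eval x =
    x * (∑ i ∈ range T, Polynomial.monomial i (Λ ^ i * a (i + 1))).eval x := by
  rw [eval_scaledPoly, Polynomial.eval_finsetSum, mul_sum]
  refine sum_congr rfl fun i _ => ?_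
  rw [Polynomial.eval_monomial]; ring

set_option maxHeartbeats 4000000 in
/-- Elimination of the parameter `L 1`, for real parameters. -/
theorem recV_eq_reduced_real {L : ℕ → ℝ} {d : ℕ} (hL0 : L 0 = 0) (hLd : ∀ l, d < l → L l = 0)
    (M k : ℕ) (hk : k < M) :
    recV Real.cos Real.sin (fun w θ => L w * Real.cos θ ^ w * Real.sin θ) k (2 * Real.pi) =
    recV Real.cos Real.sin (reducedG Real.cos Real.sin L d (M + 1)) k (2 * Real.pi) := by
  set g : ℕ → ℝ → ℝ := fun w θ => L w * Real.cos θ ^ w * Real.sin θ with hg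
  set h := reducedG Real.cos Real.sin L d (M + 1) with hh
  set Λ := L 1 with hΛ
  set K := M + 1 with hK
  have hgc : ∀ w, Continuous (g w) := fun w => by simp only [hg]; fun_prop
  have hhc : ∀ w, Continuous (h w) := fun w =>
    continuous_reducedG Real.continuous_cos Real.continuous_sin L d K w
  have hg0 : ∀ θ, g 0 θ = 0 := fun θ => by simp [hg, hL0]
  have hgd : ∀ w, d < w → ∀ θ, g w θ = 0 := fun w hw θ => by simp [hg, hLd w hw]
  have hh0 : ∀ θ, h 0 θ = 0 := fun θ => reducedG_zero _ _ L d K θ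
  have hhd : ∀ w, d + K < w → ∀ θ, h w θ = 0 := fun w hw θ => reducedG_of_lt _ _ L d K hw θ
  set A₁ := ∑ l ∈ range (d + 1), |L l| with hA₁
  have hLA : ∀ w, |L w| ≤ A₁ := fun w => by
    rcases le_or_gt w d with hw | hw
    · exact single_le_sum (f := fun w => |L w|) (fun _ _ => abs_nonneg _)
        (mem_range.2 (Nat.lt_succ_of_le hw))
    · rw [hLd w hw, abs_zero]; exact sum_nonneg fun _ _ => abs_nonneg _
  have hA₁0 : 0 ≤ A₁ := sum_nonneg fun _ _ => abs_nonneg _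
  have hgA : ∀ w θ, ‖g w θ‖ ≤ A₁ := fun w θ => by
    refine le_trans ?_ (hLA w)
    rw [hg, Real.norm_eq_abs, abs_mul, abs_mul, abs_pow, mul_assoc]
    exact mul_le_of_le_one_right (abs_nonneg _) (mul_le_one₀
      (pow_le_one₀ (abs_nonneg _) (Real.abs_cos_le_one θ)) (abs_nonneg _) (Real.abs_sin_le_one θ))
  obtain ⟨A₂, hA₂0, hhA⟩ := exists_reducedG_bound L d K
  set Y := scaledPoly centerCoeff Λ K with hY
  set Ψ := scaledPoly psiCoeff Λ K with hΨ
  -- Since `Y(η) = η Q(η)` with `Q(0) = 1`, the map `η ↦ Y(η)` is the stretching by `1 + m` with `m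
  -- = Q(η) - 1`.
  set Q := ∑ i ∈ range K, Polynomial.monomial i (Λ ^ i * centerCoeff (i + 1)) with hQ
  have hYQ : ∀ x, Y.eval x = x * Q.eval x := scaledPoly_eval_eq centerCoeff Λ K
  obtain ⟨Cm, hCm0, hCm⟩ := exists_eval_bound_of_coeff (p := Q - 1) (T := 1) (fun j hj => by
    obtain rfl : j = 0 := by omega
    rw [Polynomial.coeff_sub, hQ, Polynomial.finsetSum_coeff, Polynomial.coeff_one_zero,
      sum_range_succ']
    simp [Polynomial.coeff_monomial, centerCoeff_one])
  obtain ⟨CY, hCY0, hCY⟩ := exists_eval_bound (Polynomial.derivative Y)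
  obtain ⟨e₁, he₁0, he₁⟩ := exists_center_ode_bound Λ K
  obtain ⟨e₂, he₂0, he₂⟩ := exists_psi_bound Λ K
  obtain ⟨C₁, hC₁0, hC₁⟩ := exists_sum_bound
    (f := fun k θ => (k : ℝ) * recV Real.cos Real.sin g k θ) (fun k => continuous_const.mul
      (continuous_recV Real.continuous_cos Real.continuous_sin hgc k)) K (-2) 9
  obtain ⟨C₂, hC₂0, hC₂⟩ := exists_sum_bound (f := fun k θ => recX Real.cos Real.sin g k θ)
    (fun k => continuous_recX Real.continuous_cos Real.continuous_sin hgc k) K (-2) 9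
  obtain ⟨C₃, hC₃0, hC₃⟩ := exists_sum_bound (f := fun k θ => recX Real.cos Real.sin h k θ)
    (fun k => continuous_recX Real.continuous_cos Real.continuous_sin hhc k) K 0 (2 * Real.pi)
  set B : ℝ := 2 * (C₁ * (2 * (2 * e₁ + 2 * A₁ * e₂)) +
    (2 + 2 * CY) * (A₁ * (d + 1) * C₂)) with hB
  have hB0 : 0 ≤ B := by positivity
  -- Each summand of the denominator secures one smallness condition. The `6 X` occurring there is a
  -- bound for the bent radius, at most three times `R ≤ 2 X`.
  set ε₀ : ℝ := 1 / (64 * ((A₂ + 1) * ((d + K : ℕ) + 1) ^ 2) + 12 * (A₁ * d) + 4 * Cm + 6) with hε₀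
  have hden : 0 < 64 * ((A₂ + 1) * (((d + K : ℕ) : ℝ) + 1) ^ 2) + 12 * (A₁ * d) + 4 * Cm + 6 := by
    positivity
  have hε₀0 : 0 < ε₀ := by positivity
  have hε₀1 : (64 * ((A₂ + 1) * (((d + K : ℕ) : ℝ) + 1) ^ 2) + 12 * (A₁ * d) + 4 * Cm + 6) * ε₀ =
      1 := by rw [hε₀]; field_simp
  have hpi := Real.pi_lt_d2
  have hpi0 : (0 : ℝ) ≤ 2 * Real.pi := by positivity
  have hpK : K = M + 1 := hK
  refine sub_eq_zero.1 (coeff_eq_zero_of_small (fun k => recV Real.cos Real.sin g k (2 * Real.pi) -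
    recV Real.cos Real.sin h k (2 * Real.pi)) K M
    ((2 * Real.pi * (B * 48 ^ M)) + 4 * Real.pi * (A₂ * ((d + K : ℕ) + 1)) * C₃ * 16 ^ M) ?_ k hk
    (by omega))
  intro ε hε
  set X := min ε₀ (ε / 4) with hX
  have hX0 : 0 < X := lt_min hε₀0 (by positivity)
  have hXε : X ≤ ε₀ := min_le_left _ _
  have hXall : (64 * ((A₂ + 1) * (((d + K : ℕ) : ℝ) + 1) ^ 2) + 12 * (A₁ * d) + 4 * Cm + 6) * X ≤
      1 := (mul_le_mul_of_nonneg_left hXε hden.le).trans hε₀1.le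
  have hX1 : 64 * ((A₂ + 1) * (((d + K : ℕ) : ℝ) + 1) ^ 2) * X ≤ 1 := by
    have : 0 ≤ (12 * (A₁ * d) + 4 * Cm + 6) * X := by positivity
    linarith
  have hX2 : A₁ * d * (6 * X) ≤ 1 / 2 := by
    have : 0 ≤ (64 * ((A₂ + 1) * (((d + K : ℕ) : ℝ) + 1) ^ 2) + 4 * Cm + 6) * X := by positivity
    linarith
  have hX3 : Cm * (2 * X) ≤ 1 / 2 := by
    have : 0 ≤ (64 * ((A₂ + 1) * (((d + K : ℕ) : ℝ) + 1) ^ 2) + 12 * (A₁ * d) + 6) * X := by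
      positivity
    linarith
  have hX4 : 6 * X ≤ 1 := by
    have : 0 ≤ (64 * ((A₂ + 1) * (((d + K : ℕ) : ℝ) + 1) ^ 2) + 12 * (A₁ * d) + 4 * Cm) * X := by
      positivity
    linarith
  have hX5 : A₂ * (d + K : ℕ) * (2 * X) ≤ 1 / 2 := by
    have h1 : A₂ * ((d + K : ℕ) : ℝ) ≤ (A₂ + 1) * (((d + K : ℕ) : ℝ) + 1) ^ 2 := by
      have : (0 : ℝ) ≤ ((d + K : ℕ) : ℝ) := Nat.cast_nonneg _
      nlinarith only [mul_nonneg hA₂0 this, mul_nonneg hA₂0 (sq_nonneg ((d + K : ℕ) : ℝ)), this, hA₂0]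
    have h2 := mul_le_mul_of_nonneg_right h1 hX0.le
    linarith only [h2, hX1]
  -- `R` solves the reduced equation. Its image `(R cos t, Y(R sin t))`, written in polar
  -- coordinates `(r, φ)`, is an approximate solution of the original one.
  obtain ⟨⟨R, hR0, hR⟩, hall⟩ := exists_polarFieldSolution (c := Real.cos) (s := Real.sin)
    Real.abs_cos_le_one Real.abs_sin_le_one hh0 hhA Real.continuous_cos Real.continuous_sin hhc
    (W := d + K) hX0 hX1 (r₀ := X) (by rw [Real.norm_of_nonneg hX0.le])
  have hRle : ∀ t ∈ Set.Icc 0 (2 * Real.pi), X / 8 ≤ R t ∧ R t ≤ 2 * X := by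
    intro t ht
    obtain ⟨h1, h2⟩ := hall R hR0 hR t ht
    rw [Real.norm_eq_abs] at h1 h2
    exact ⟨by linarith [(abs_le.1 h2).1], (abs_le.1 h1).2⟩
  set S := Set.Icc 0 (2 * Real.pi) with hS
  have hSu : ∀ t ∈ S, UniqueDiffWithinAt ℝ S t := fun t ht =>
    uniqueDiffOn_Icc (by positivity : (0 : ℝ) < 2 * Real.pi) t ht
  set η : ℝ → ℝ := fun t => R t * Real.sin t with hη
  set m : ℝ → ℝ := fun t => Q.eval (η t) - 1 with hm
  have hηle : ∀ t ∈ S, |η t| ≤ R t := fun t ht => by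
    rw [hη, abs_mul, abs_of_pos (by linarith [(hRle t ht).1] : 0 < R t)]
    exact mul_le_of_le_one_right (by linarith [(hRle t ht).1]) (Real.abs_sin_le_one t)
  have hη1 : ∀ t ∈ S, |η t| ≤ 1 := fun t ht => by linarith [hηle t ht, (hRle t ht).2]
  have hm2 : ∀ t ∈ S, |m t| ≤ 1 / 2 := fun t ht => by
    have h1 := hCm (η t) (hη1 t ht)
    rw [Polynomial.eval_sub, Polynomial.eval_one, pow_one] at h1
    refine h1.trans (le_trans ?_ hX3)
    exact mul_le_mul_of_nonneg_left ((hηle t ht).trans (hRle t ht).2) hCm0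
  set φ : ℝ → ℝ := fun t => bendAngle (m t) t with hφ
  set r : ℝ → ℝ := fun t => R t * bendRadius (m t) t with hr
  have hrc : ∀ t ∈ S, R t * Real.cos t = r t * Real.cos (φ t) := fun t ht => by
    rw [hr, hφ]; simp only; rw [mul_assoc, bendRadius_mul_cos (hm2 t ht)]
  have hrs : ∀ t ∈ S, Y.eval (η t) = r t * Real.sin (φ t) := fun t ht => by
    rw [hr, hφ]; simp only; rw [mul_assoc, bendRadius_mul_sin (hm2 t ht), hYQ, hm, hη]
    ring
  have hder : ∀ t ∈ S, ∃ D, HasDerivWithinAt (fun t => recP Real.cos Real.sin g K (φ t) (r t)) D S t ∧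
      ‖D‖ ≤ B * (6 * X) ^ M := by
    intro t ht
    obtain ⟨hRl, hRu⟩ := hRle t ht
    have hRpos : 0 < R t := by linarith
    have hR' := hR t ht
    set R' := polarField Real.cos Real.sin h (d + K) t (R t) with hR'def
    have hR'le : |R'| ≤ R t := by
      have hn : ‖R t‖ = R t := Real.norm_of_nonneg hRpos.le
      have h1 : A₂ * (d + K : ℕ) * ‖R t‖ ≤ 1 / 2 := by
        rw [hn]; exact (mul_le_mul_of_nonneg_left hRu (by positivity)).trans hX5
      have h2 := norm_polarField_le (c := Real.cos) (s := Real.sin) (W := d + K)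
        Real.abs_cos_le_one Real.abs_sin_le_one hh0 hhA (θ := t) (r := R t)
        (by rw [hn]; linarith) h1
      rw [hn] at h1 h2
      refine h2.trans ?_
      have h3 := mul_le_mul_of_nonneg_right h1 hRpos.le
      linarith only [h1, h3, hRpos, h2]
    have hx : HasDerivWithinAt (fun t => R t * Real.cos t) (R' * Real.cos t - R t * Real.sin t)
        S t := (hR'.mul (Real.hasDerivAt_cos t).hasDerivWithinAt).congr_deriv (by ring)
    have hηd : HasDerivWithinAt η (R' * Real.sin t + R t * Real.cos t) S t :=
      hR'.mul (Real.hasDerivAt_sin t).hasDerivWithinAt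
    set x' := R' * Real.cos t - R t * Real.sin t with hx'
    set η' := R' * Real.sin t + R t * Real.cos t with hη'
    have hy : HasDerivWithinAt (fun t => Y.eval (η t))
        ((Polynomial.derivative Y).eval (η t) * η') S t :=
      (Y.hasDerivAt (η t)).comp_hasDerivWithinAt t hηd
    set y' := (Polynomial.derivative Y).eval (η t) * η' with hy'
    have hmd : DifferentiableWithinAt ℝ m S t :=
      (((Q.hasDerivAt (η t)).comp_hasDerivWithinAt t hηd).differentiableWithinAt).sub_const 1
    obtain ⟨hφd, hbd⟩ := differentiable_bend hmd (hm2 t ht)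
    have hφ' := hφd.hasDerivWithinAt
    have hr' := (hR'.differentiableWithinAt.mul hbd).hasDerivWithinAt
    set φ' := derivWithin (fun t => bendAngle (m t) t) S t
    change HasDerivWithinAt φ φ' S t at hφ'
    change HasDerivWithinAt r _ S t at hr'
    obtain ⟨r', hr'⟩ : ∃ r', HasDerivWithinAt r r' S t := ⟨_, hr'⟩
    obtain ⟨p1, p2⟩ := polar_deriv (hSu t ht) ht hx hy hφ' hr' hrc hrs
    have hbr := bendRadius_bounds (t := t) (hm2 t ht)
    have hrl : R t / 2 ≤ r t := by
      have : r t = R t * bendRadius (m t) t := rfl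
      have w1 := mul_le_mul_of_nonneg_left hbr.1 hRpos.le
      linarith only [this, w1]
    have hru : r t ≤ 6 * X := by
      have : r t = R t * bendRadius (m t) t := rfl
      have w1 := mul_le_mul_of_nonneg_left hbr.2 hRpos.le
      linarith only [this, w1, hRu]
    have hrpos : 0 < r t := by linarith
    have hφmem : φ t ∈ Set.Icc (-2 : ℝ) 9 := by
      have h1 := abs_le.1 (abs_bendAngle_sub_le (m := m t) (t := t))
      change -2 ≤ φ t - t ∧ φ t - t ≤ 2 at h1
      exact ⟨by linarith [ht.1], by linarith [ht.2]⟩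
    have hx'2 : |x'| ≤ 2 * R t := by
      refine (abs_sub _ _).trans ?_
      rw [abs_mul, abs_mul, abs_of_pos hRpos]
      have w1 := mul_le_mul hR'le (Real.abs_cos_le_one t) (abs_nonneg _) hRpos.le
      have w2 := mul_le_mul_of_nonneg_left (Real.abs_sin_le_one t) hRpos.le
      have w3 := mul_le_mul hR'le (Real.abs_sin_le_one t) (abs_nonneg _) hRpos.le
      have w4 := mul_le_mul_of_nonneg_left (Real.abs_cos_le_one t) hRpos.le
      linarith only [w1, w2, w3, w4]
    have hη'2 : |η'| ≤ 2 * R t := by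
      refine (abs_add_le _ _).trans ?_
      rw [abs_mul, abs_mul, abs_of_pos hRpos]
      have w1 := mul_le_mul hR'le (Real.abs_cos_le_one t) (abs_nonneg _) hRpos.le
      have w2 := mul_le_mul_of_nonneg_left (Real.abs_sin_le_one t) hRpos.le
      have w3 := mul_le_mul hR'le (Real.abs_sin_le_one t) (abs_nonneg _) hRpos.le
      have w4 := mul_le_mul_of_nonneg_left (Real.abs_cos_le_one t) hRpos.le
      linarith only [w1, w2, w3, w4]
    have hR1 : 2 * R t ≤ 2 := by linarith
    have hy'2 : |y'| ≤ 2 * CY := by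
      rw [hy', abs_mul]
      have := mul_le_mul (hCY (η t) (hη1 t ht)) (hη'2.trans hR1) (abs_nonneg _) hCY0
      linarith
    have hG := recG_real (L := L) (d := d) hL0 (φ t) (r t)
    rw [← hrc t ht] at hG
    change recG g d (φ t) (r t) = _ at hG
    have hGred := recG_reducedG Real.cos Real.sin L d K t (R t)
    simp only [RCLike.ofReal_real_eq_id, id] at hGred
    rw [← eval_scaledPoly psiCoeff Λ K, ← hΨ] at hGred
    change R t * recG h (d + K) t (R t) = _ * Ψ.eval (η t) at hGred
    set x := R t * Real.cos t with hxdef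
    set p := ∑ l ∈ range (d + 1), if 2 ≤ l then L l * x ^ l else 0 with hp
    set Λ₀ := if 1 ≤ d then Λ else 0 with hΛ₀
    have hΛΛ : Λ₀ = Λ := by
      rw [hΛ₀]; split_ifs with h1
      · rfl
      · exact (hLd 1 (by omega)).symm
    rw [hΛΛ] at hG
    have hx1 : |x| ≤ 1 := by
      rw [hxdef, abs_mul, abs_of_pos hRpos]
      have w1 := mul_le_mul_of_nonneg_left (Real.abs_cos_le_one t) hRpos.le
      linarith only [w1, hR1]
    have hpA : |p| ≤ A₁ := by
      refine (abs_sum_le_sum_abs _ _).trans (sum_le_sum fun l _ => ?_)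
      split_ifs
      · rw [abs_mul, abs_pow]
        exact mul_le_of_le_one_right (abs_nonneg _) (pow_le_one₀ (abs_nonneg _) hx1)
      · rw [abs_zero]; exact abs_nonneg _
    -- The reduced polar equation in Cartesian form.
    have hRR : η t * η' = (-x + p * Ψ.eval (η t)) * x' := by
      have hden : (1 - Real.cos t * recG h (d + K) t (R t)) ≠ 0 := by
        have hn : ‖R t‖ = R t := Real.norm_of_nonneg hRpos.le
        have := half_le_norm_one_sub_recG (c := Real.cos) (W := d + K) Real.abs_cos_le_one hh0 hhA
          (θ := t) (r := R t) (by rw [hn]; linarith)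
          (by rw [hn]; exact (mul_le_mul_of_nonneg_left hRu (by positivity)).trans hX5)
        intro h0
        rw [h0, norm_zero] at this
        linarith
      have h1 : R' * (1 - Real.cos t * recG h (d + K) t (R t)) =
          -(R t * Real.sin t * recG h (d + K) t (R t)) := by
        rw [hR'def, polarField, div_mul_cancel₀ _ hden]
      have h2 := Real.sin_sq_add_cos_sq t
      rw [← hGred]
      simp only [hη, hη', hxdef, hx']
      linear_combination R t * h1 + R t * R' * h2
    -- The defect in the original equation is a combination of the two truncation defects, of the
    -- equation for `Y` and of `(1 - Λ Y) Ψ = Y`; both are `O(R^K)`.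
    have hE : r t * (r' * (1 - Real.cos (φ t) * recG g d (φ t) (r t)) +
        r t * Real.sin (φ t) * recG g d (φ t) (r t) * φ') =
        (Y.eval (η t) * (Polynomial.derivative Y).eval (η t) - η t * (1 - Λ * Y.eval (η t))) * η' +
        p * ((1 - Λ * Y.eval (η t)) * Ψ.eval (η t) - Y.eval (η t)) * x' := by
      have h2 := Real.sin_sq_add_cos_sq (φ t)
      have hxr := hrc t ht
      have hyr := hrs t ht
      rw [← hxdef] at hxr
      rw [hG]
      have k1 : r t * (r' * (1 - Real.cos (φ t) * (Real.sin (φ t) * (p + Λ * x))) +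
          r t * Real.sin (φ t) * (Real.sin (φ t) * (p + Λ * x)) * φ') =
          x * x' + Y.eval (η t) * y' - Y.eval (η t) * (p + Λ * x) * x' := by
        rw [hyr, hxr, p1]
        linear_combination r t * Real.sin (φ t) * Real.sin (φ t) *
          (p + Λ * (r t * Real.cos (φ t))) * p2 -
          r t * Real.sin (φ t) * (p + Λ * (r t * Real.cos (φ t))) * x' * h2
      rw [k1, hy']
      linear_combination (1 - Λ * Y.eval (η t)) * hRR
    have hEle : |(Y.eval (η t) * (Polynomial.derivative Y).eval (η t) -
        η t * (1 - Λ * Y.eval (η t))) * η' +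
        p * ((1 - Λ * Y.eval (η t)) * Ψ.eval (η t) - Y.eval (η t)) * x'| ≤
        (2 * e₁ + 2 * A₁ * e₂) * R t ^ K := by
      have hpow : |η t| ^ K ≤ R t ^ K := pow_le_pow_left₀ (abs_nonneg _) (hηle t ht) K
      have h1 := (he₁ (η t) (hη1 t ht)).trans (mul_le_mul_of_nonneg_left hpow he₁0)
      have h2 := (he₂ (η t) (hη1 t ht)).trans (mul_le_mul_of_nonneg_left hpow he₂0)
      refine (abs_add_le _ _).trans ?_
      rw [abs_mul, abs_mul, abs_mul]
      have hRK : 0 ≤ R t ^ K := by positivity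
      have k1 := mul_le_mul h1 (hη'2.trans hR1) (abs_nonneg _) (mul_nonneg he₁0 hRK)
      have k2 := mul_le_mul (mul_le_mul hpA h2 (abs_nonneg _) hA₁0) (hx'2.trans hR1) (abs_nonneg _)
        (mul_nonneg hA₁0 (mul_nonneg he₂0 hRK))
      linarith
    refine ⟨_, hasDerivWithinAt_recP Real.continuous_cos Real.continuous_sin hgc K hφ' hr', ?_⟩
    have hfin := abs_deriv_recP_le (d := d) hg0 hgd hgA (K := K) (φ' := φ') hrpos (by linarith)
      ((mul_le_mul_of_nonneg_left hru (by positivity)).trans hX2) (hC₁ (φ t) hφmem)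
      (hC₂ (φ t) hφmem) hE
    rw [Real.norm_eq_abs]
    refine hfin.trans ?_
    have hRK : R t ^ K = R t ^ M * R t := by rw [hpK, pow_succ]
    have hrK : r t ^ K = r t ^ M * r t := by rw [hpK, pow_succ]
    have hRM : R t ^ M ≤ (6 * X) ^ M := pow_le_pow_left₀ hRpos.le (by linarith) M
    have hrM : r t ^ M ≤ (6 * X) ^ M := pow_le_pow_left₀ hrpos.le hru M
    have hXM : 0 ≤ (6 * X) ^ M := by positivity
    have q1 : |(Y.eval (η t) * (Polynomial.derivative Y).eval (η t) -
        η t * (1 - Λ * Y.eval (η t))) * η' +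
        p * ((1 - Λ * Y.eval (η t)) * Ψ.eval (η t) - Y.eval (η t)) * x'| / r t ≤
        2 * (2 * e₁ + 2 * A₁ * e₂) * (6 * X) ^ M := by
      rw [div_le_iff₀ hrpos]
      refine hEle.trans ?_
      rw [hRK]
      have hc0 : 0 ≤ 2 * e₁ + 2 * A₁ * e₂ := by positivity
      calc _ = (2 * e₁ + 2 * A₁ * e₂) * (R t ^ M * R t) := rfl
        _ ≤ (2 * e₁ + 2 * A₁ * e₂) * ((6 * X) ^ M * (2 * r t)) := by
          gcongr; linarith
        _ = _ := by ring
    have q2 : |φ'| * r t ≤ 2 + 2 * CY := by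
      rw [mul_comm, ← abs_of_pos hrpos, ← abs_mul, p2]
      refine (abs_sub _ _).trans ?_
      rw [abs_mul (Real.cos (φ t)), abs_mul (Real.sin (φ t))]
      have w1 := mul_le_mul (Real.abs_cos_le_one (φ t)) hy'2 (abs_nonneg _) zero_le_one
      have w2 := mul_le_mul (Real.abs_sin_le_one (φ t)) (hx'2.trans hR1) (abs_nonneg _) zero_le_one
      linarith only [w1, w2]
    have q3 : |φ'| * (r t ^ K * (A₁ * (d + 1) * C₂)) ≤
        (2 + 2 * CY) * (A₁ * (d + 1) * C₂) * (6 * X) ^ M := by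
      rw [hrK]
      calc _ = (|φ'| * r t) * (A₁ * (d + 1) * C₂) * r t ^ M := by ring
        _ ≤ _ := by gcongr
    have q4 := mul_le_mul_of_nonneg_left q1 hC₁0
    refine (mul_le_mul_of_nonneg_left (add_le_add q4 q3) zero_le_two).trans (le_of_eq ?_)
    rw [hB]; ring
  choose! D hD hDle using hder
  have hold := (convex_Icc (0 : ℝ) (2 * Real.pi)).norm_image_sub_le_of_norm_hasDerivWithin_le
    hD hDle (Set.left_mem_Icc.2 hpi0) (Set.right_mem_Icc.2 hpi0)
  -- Both truncated first integrals start at `X` and end at the same point `z = R(2π)`, so the two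
  -- partial sums agree at `z` up to `O(z^M)`. As `z` can be made arbitrarily small, their
  -- coefficients coincide below `M`.
  have hnew := norm_recP_sub_le (c := Real.cos) (s := Real.sin) (W := d + K) Real.abs_cos_le_one
    Real.continuous_cos Real.continuous_sin hhc hh0 hhd hhA hR (η := 2 * X) (by linarith) hX5
    (fun t ht => by
      rw [Real.norm_of_nonneg (by linarith [(hRle t ht).1])]; exact (hRle t ht).2) K hC₃
  have e2 : φ (2 * Real.pi) = 2 * Real.pi := bendAngle_of_sin Real.sin_two_pi
  have e3 : r (2 * Real.pi) = R (2 * Real.pi) := by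
    rw [hr]; simp only; rw [bendRadius_of_sin Real.sin_two_pi, mul_one]
  have e4 : φ 0 = 0 := bendAngle_of_sin Real.sin_zero
  have e5 : r 0 = X := by
    rw [hr]; simp only; rw [bendRadius_of_sin Real.sin_zero, mul_one, hR0]
  have hK1 : 1 < K := by omega
  rw [sub_zero, Real.norm_of_nonneg hpi0, e2, e3, e4, e5, recP_zero_angle hK1] at hold
  rw [hR0, recP_zero_angle hK1] at hnew
  set z := R (2 * Real.pi) with hz
  obtain ⟨hzl, hzu⟩ := hRle (2 * Real.pi) (Set.right_mem_Icc.2 hpi0)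
  rw [← hz] at hzl hzu
  refine ⟨z, by linarith, ?_, ?_⟩
  · have : X ≤ ε / 4 := min_le_right _ _
    linarith
  have e6 : ∑ k ∈ range K, (recV Real.cos Real.sin g k (2 * Real.pi) -
      recV Real.cos Real.sin h k (2 * Real.pi)) * z ^ k =
      (recP Real.cos Real.sin g K (2 * Real.pi) z - X) -
      (recP Real.cos Real.sin h K (2 * Real.pi) z - X) := by
    unfold recP
    rw [sub_sub_sub_cancel_right, ← sum_sub_distrib]
    exact sum_congr rfl fun k _ => by ring
  rw [e6]
  refine (abs_sub _ _).trans ?_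
  rw [Real.norm_eq_abs] at hold hnew
  -- `R ≥ X / 8` converts powers of `X` into powers of `z`.
  have hXz : (6 * X) ^ M ≤ 48 ^ M * z ^ M := by
    rw [← mul_pow]; exact pow_le_pow_left₀ (by positivity) (by linarith) M
  have hXz2 : (2 * X) ^ K ≤ 16 ^ M * z ^ M := by
    rw [hpK, pow_succ, ← mul_pow]
    have h1 : (2 * X) ^ M ≤ (16 * z) ^ M := pow_le_pow_left₀ (by positivity) (by linarith) M
    calc _ ≤ (2 * X) ^ M * 1 := mul_le_mul_of_nonneg_left (by linarith) (by positivity)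
      _ ≤ _ := by rw [mul_one]; exact h1
  have w1 := mul_le_mul_of_nonneg_left (mul_le_mul_of_nonneg_left hXz hB0) hpi0
  have w2 := mul_le_mul_of_nonneg_left hXz2
    (show 0 ≤ 4 * Real.pi * (A₂ * ((d + K : ℕ) + 1)) * C₃ by positivity)
  linarith

end

/-! ### Elimination of `λ_1` for complex parameters. -/

noncomputable section

open Finset MeasureTheory

theorem recD_recV_ofReal {g : ℕ → ℝ → ℝ} (k : ℕ) :
    (∀ θ, recD cosC sinC (fun w θ => (g w θ : ℂ)) k θ = (recD Real.cos Real.sin g k θ : ℝ)) ∧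
    ∀ θ, recV cosC sinC (fun w θ => (g w θ : ℂ)) k θ = (recV Real.cos Real.sin g k θ : ℝ) := by
  induction k using Nat.strong_induction_on with
  | _ k ih =>
    have hD : ∀ θ, recD cosC sinC (fun w θ => (g w θ : ℂ)) k θ =
        (recD Real.cos Real.sin g k θ : ℝ) := by
      intro θ
      rw [recD_eq, recD_eq, Complex.ofReal_sum]
      refine sum_congr rfl fun j hj => ?_
      obtain ⟨h1, h2⟩ := ih j (mem_range.1 hj)
      unfold recX
      rw [h1, h2]
      simp only [cosC, sinC, Complex.ofReal_mul, Complex.ofReal_add, Complex.ofReal_natCast]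
    refine ⟨hD, fun θ => ?_⟩
    unfold recV
    simp only [hD]
    rw [intervalIntegral.integral_ofReal]
    push_cast
    split_ifs <;> rfl

/-- The variable `λ_l`, or `0` if there is none. -/
def lamVar (d l : ℕ) : MvPolynomial (Fin d) ℝ :=
  if h : 0 < l ∧ l - 1 < d then MvPolynomial.X ⟨l - 1, h.2⟩ else 0

theorem aeval_lamVar {d : ℕ} (lam : Fin d → ℂ) (l : ℕ) :
    MvPolynomial.aeval lam (lamVar d l) = lamSeq lam l := by
  unfold lamVar lamSeq
  split_ifs with h
  · rw [MvPolynomial.aeval_X]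
  · simp

theorem isWeightedHomogeneous_lamVar (d l : ℕ) :
    (lamVar d l).IsWeightedHomogeneous (indexWeight d) l := by
  unfold lamVar
  split_ifs with h
  · have := MvPolynomial.isWeightedHomogeneous_X ℝ (indexWeight d) (⟨l - 1, h.2⟩ : Fin d)
    simpa [indexWeight, Nat.sub_add_cancel (show 1 ≤ l from h.1)] using this
  · exact MvPolynomial.isWeightedHomogeneous_zero _ _ _

/-- The polynomials underlying `reducedG`. -/
def reducedPolyG (d T w : ℕ) (θ : ℝ) : MvPolynomial (Fin d) ℝ :=
  ∑ l ∈ range (d + 1), if 2 ≤ l ∧ l ≤ w ∧ w - l < T then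
    MvPolynomial.C (psiCoeff (w - l + 1) * Real.cos θ ^ l * Real.sin θ ^ (w - l + 1)) *
      (lamVar d l * lamVar d 1 ^ (w - l)) else 0

theorem isPolyFamily_reducedPolyG (d T w : ℕ) : IsPolyFamily w (reducedPolyG d T w) := by
  unfold reducedPolyG
  refine IsPolyFamily.sum _ fun l _ => ?_
  split_ifs with h
  · refine IsPolyFamily.C_mul (by fun_prop) (isPolyFamily_const ?_)
    have h1 := (isWeightedHomogeneous_lamVar d l).mul ((isWeightedHomogeneous_lamVar d 1).pow (w - l))
    simpa [Nat.add_sub_cancel' h.2.1] using h1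
  · exact isPolyFamily_const (MvPolynomial.isWeightedHomogeneous_zero _ _ _)

theorem aeval_reducedPolyG {d : ℕ} (lam : Fin d → ℂ) (T w : ℕ) (θ : ℝ) :
    MvPolynomial.aeval lam (reducedPolyG d T w θ) = reducedG cosC sinC (lamSeq lam) d T w θ := by
  unfold reducedPolyG reducedG
  rw [map_sum]
  refine sum_congr rfl fun l _ => ?_
  split_ifs with h
  · rw [map_mul, map_mul (MvPolynomial.aeval lam) (lamVar d l), map_pow, aeval_lamVar,
      aeval_lamVar, MvPolynomial.aeval_C, Complex.coe_algebraMap]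
    simp only [cosC, sinC]
    push_cast
    simp only [Complex.coe_algebraMap]
    ring
  · simp

theorem reducedG_ofReal (L : ℕ → ℝ) (d T w : ℕ) (θ : ℝ) :
    reducedG cosC sinC (fun l => (L l : ℂ)) d T w θ =
      (reducedG Real.cos Real.sin L d T w θ : ℝ) := by
  unfold reducedG
  rw [Complex.ofReal_sum]
  refine sum_congr rfl fun l _ => ?_
  split_ifs with h
  · simp only [cosC, sinC]
    push_cast
    simp only [Complex.coe_algebraMap, RCLike.ofReal_real_eq_id, id]
  · simp

/-- Elimination of the first parameter. -/
theorem holonomy_eq_recV_reducedG {d : ℕ} (lam : Fin d → ℂ) {k T : ℕ} (hk : k ≤ T) :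
    holonomy (lamSeq lam) k =
      recV cosC sinC (reducedG cosC sinC (lamSeq lam) d T) k (2 * Real.pi) := by
  -- The real statement for index `k` is used with `M = k + 1`, whose cut-off is `M + 1 = k + 2`.
  have hT : recV cosC sinC (reducedG cosC sinC (lamSeq lam) d T) k (2 * Real.pi) =
      recV cosC sinC (reducedG cosC sinC (lamSeq lam) d (k + 2)) k (2 * Real.pi) := by
    unfold recV
    rw [recD_congr cosC sinC k (fun w hw _ => reducedG_congr cosC sinC (lamSeq lam) d
      (hw.trans_le hk) (by omega : w < k + 2)) k le_rfl]
  rw [hT]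
  obtain ⟨V₁, -, h₁, -⟩ := (exists_polyFamily_recV (isPolyFamily_lienardPolyG d)
    (γ := fun w θ => coeffNorm (lienardPolyG d w θ))
    (fun w => (isPolyFamily_lienardPolyG d w).continuous_coeffNorm)
    (fun _ _ => coeffNorm_nonneg _) (fun _ _ => le_rfl) k).2
  obtain ⟨V₂, -, h₂, -⟩ := (exists_polyFamily_recV (isPolyFamily_reducedPolyG d (k + 2))
    (γ := fun w θ => coeffNorm (reducedPolyG d (k + 2) w θ))
    (fun w => (isPolyFamily_reducedPolyG d (k + 2) w).continuous_coeffNorm)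
    (fun _ _ => coeffNorm_nonneg _) (fun _ _ => le_rfl) k).2
  simp only [aeval_lienardPolyG, aeval_reducedPolyG] at h₁ h₂
  -- Both sides are polynomials with real coefficients, so equality at real points gives equality at
  -- complex ones.
  have hV : V₁ (2 * Real.pi) = V₂ (2 * Real.pi) := by
    refine MvPolynomial.funext fun x => Complex.ofReal_injective ?_
    have hx : ∀ p : MvPolynomial (Fin d) ℝ, ((MvPolynomial.eval x p : ℝ) : ℂ) =
        MvPolynomial.aeval (fun i => (x i : ℂ)) p := fun p => by
      have := MvPolynomial.aeval_algebraMap_apply ℂ x p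
      exact (this.trans (by rw [MvPolynomial.aeval_eq_eval]; rfl)).symm
    rw [hx, hx, h₁, h₂]
    set L : ℕ → ℝ := fun l => if h : 0 < l ∧ l - 1 < d then x ⟨l - 1, h.2⟩ else 0 with hL
    have hLs : lamSeq (fun i => (x i : ℂ)) = fun l => ((L l : ℝ) : ℂ) := by
      funext l
      simp only [lamSeq, hL]
      split_ifs <;> simp
    have h3 := recV_eq_reduced_real (L := L) (d := d) (by simp [hL])
      (fun l hl => by simp only [hL]; rw [dif_neg]; omega) (k + 1) k (Nat.lt_succ_self k)
    rw [hLs]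
    have e1 : (lienardG fun l => ((L l : ℝ) : ℂ)) = fun w θ =>
        ((L w * Real.cos θ ^ w * Real.sin θ : ℝ) : ℂ) := by
      funext w θ; simp only [lienardG, cosC, sinC]; push_cast; ring
    have e2 : reducedG cosC sinC (fun l => ((L l : ℝ) : ℂ)) d (k + 2) = fun w θ =>
        ((reducedG Real.cos Real.sin L d (k + 2) w θ : ℝ) : ℂ) := by
      funext w θ; exact reducedG_ofReal L d (k + 2) w θ
    rw [e1, e2, (recD_recV_ofReal k).2, (recD_recV_ofReal k).2, h3]
  rw [holonomy, ← h₁, hV, h₂]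

end

/-! ### Wallis constants and majorants of the reduced equation. -/

noncomputable section

open Finset MeasureTheory

theorem wallisConst_eq (j : ℕ) :
    wallisConst j = (∫ θ in (0 : ℝ)..(2 * Real.pi), Real.cos θ ^ (2 * j)) / (2 * j + 2) := by
  have h := integral_cos_pow (a := 0) (b := 2 * Real.pi) (2 * j)
  rw [Real.sin_two_pi, Real.sin_zero, mul_zero, mul_zero, sub_zero, zero_div, zero_add] at h
  have e : wallisConst j = (∫ θ in (0 : ℝ)..(2 * Real.pi), Real.cos θ ^ (2 * j)) -
      ∫ θ in (0 : ℝ)..(2 * Real.pi), Real.cos θ ^ (2 * j + 2) := by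
    unfold wallisConst
    rw [← intervalIntegral.integral_sub
      (Continuous.intervalIntegrable (by fun_prop) _ _)
      (Continuous.intervalIntegrable (by fun_prop) _ _)]
    refine intervalIntegral.integral_congr fun θ _ => ?_
    rw [Real.sin_sq]; ring
  rw [e, h]
  push_cast
  have : (2 * (j : ℝ) + 2) ≠ 0 := by positivity
  field_simp
  ring

theorem wallisConst_zero : wallisConst 0 = Real.pi := by
  rw [wallisConst_eq]; simp

theorem wallisConst_succ (j : ℕ) :
    wallisConst (j + 1) = wallisConst j * (2 * j + 1) / (2 * j + 4) := by
  have h := integral_cos_pow (a := 0) (b := 2 * Real.pi) (2 * j)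
  rw [Real.sin_two_pi, Real.sin_zero, mul_zero, mul_zero, sub_zero, zero_div, zero_add] at h
  rw [wallisConst_eq, wallisConst_eq, mul_add, mul_one, h]
  push_cast
  have h1 : (2 * (j : ℝ) + 2) ≠ 0 := by positivity
  have h2 : (2 * (j : ℝ) + 4) ≠ 0 := by positivity
  have h3 : (2 * ((j : ℝ) + 1) + 2) ≠ 0 := by positivity
  field_simp
  ring

theorem wallisConst_pos (j : ℕ) : 0 < wallisConst j := by
  induction j with
  | zero => rw [wallisConst_zero]; exact Real.pi_pos
  | succ j ih => rw [wallisConst_succ]; positivity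

theorem wallisConst_one : wallisConst 1 = Real.pi / 4 := by
  rw [wallisConst_succ, wallisConst_zero]; norm_num

theorem wallisConst_two : wallisConst 2 = Real.pi / 8 := by
  rw [wallisConst_succ, wallisConst_one]; norm_num; ring

theorem wallisConst_three : wallisConst 3 = 5 * Real.pi / 64 := by
  rw [wallisConst_succ, wallisConst_two]; norm_num; ring

theorem wallisConst_four : wallisConst 4 = 7 * Real.pi / 128 := by
  rw [wallisConst_succ, wallisConst_three]; norm_num; ring

theorem wallisConst_antitone : Antitone wallisConst :=
  antitone_nat_of_succ_le fun j => by
    rw [wallisConst_succ, div_le_iff₀ (by positivity)]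
    have := wallisConst_pos j
    nlinarith

/-- The left side does not increase with `j`, and at `j = 1` it is `9π/16`. The average of
neighbouring constants appears because odd powers of `|cos|` are replaced by averages of even ones.
-/
theorem odd_mul_wallisConst_le (j : ℕ) (hj : 1 ≤ j) :
    (2 * j + 1) * ((wallisConst j + wallisConst (j + 1)) / 2) ≤ 1.77 := by
  induction j, hj using Nat.le_induction with
  | base =>
    rw [wallisConst_one, wallisConst_two]
    have := Real.pi_lt_d4
    push_cast
    linarith
  | succ j hj ih =>
    refine le_trans ?_ ih
    rw [wallisConst_succ (j + 1), wallisConst_succ j]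
    have hp := wallisConst_pos j
    have h4 : (0 : ℝ) < 2 * j + 4 := by positivity
    have h6 : (0 : ℝ) < j + 3 := by positivity
    push_cast
    rw [show (2 * ((j : ℝ) + 1) + 1) * ((wallisConst j * (2 * j + 1) / (2 * j + 4) +
        wallisConst j * (2 * j + 1) / (2 * j + 4) * (2 * (j + 1) + 1) / (2 * (j + 1) + 4)) / 2) =
        (2 * j + 1) * wallisConst j * ((2 * j + 3) * (4 * j + 9) / (8 * (j + 2) * (j + 3))) by
          field_simp; ring,
      show (2 * (j : ℝ) + 1) * ((wallisConst j + wallisConst j * (2 * j + 1) / (2 * j + 4)) / 2) =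
        (2 * j + 1) * wallisConst j * ((4 * j + 5) / (4 * (j + 2))) by field_simp; ring]
    refine mul_le_mul_of_nonneg_left ?_ (by positivity)
    rw [div_le_div_iff₀ (by positivity) (by positivity)]
    have : (0 : ℝ) ≤ j := Nat.cast_nonneg j
    nlinarith [mul_nonneg this this, mul_nonneg this (mul_nonneg this this)]

theorem wallisConst_add_succ_le (j : ℕ) (hj : 1 ≤ j) :
    (wallisConst j + wallisConst (j + 1)) / 2 ≤ 0.59 := by
  have h1 := wallisConst_antitone hj
  have h2 := wallisConst_antitone (show 2 ≤ j + 1 by omega)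
  rw [wallisConst_one] at h1
  rw [wallisConst_two] at h2
  have := Real.pi_lt_d4
  linarith

/-- A majorant of `reducedG`. -/
def majorG (a : ℕ → ℝ) (x : ℝ) (d T w : ℕ) (θ : ℝ) : ℝ :=
  ∑ l ∈ range (d + 1), if 2 ≤ l ∧ l ≤ w ∧ w - l < T then
    a l * x ^ (w - l) * |Real.cos θ| ^ l * |Real.sin θ| ^ (w - l + 1) else 0

theorem continuous_majorG (a : ℕ → ℝ) (x : ℝ) (d T w : ℕ) : Continuous (majorG a x d T w) := by
  unfold majorG
  refine continuous_finsetSum _ fun l _ => ?_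
  split_ifs <;> fun_prop

theorem majorG_nonneg {a : ℕ → ℝ} (ha : ∀ l, 0 ≤ a l) {x : ℝ} (hx : 0 ≤ x) (d T w : ℕ) (θ : ℝ) :
    0 ≤ majorG a x d T w θ := by
  refine sum_nonneg fun l _ => ?_
  have := ha l
  split_ifs <;> positivity

theorem majorG_zero (a : ℕ → ℝ) (x : ℝ) (d T : ℕ) (θ : ℝ) : majorG a x d T 0 θ = 0 := by
  refine sum_eq_zero fun l _ => if_neg ?_
  omega

theorem majorG_mono {a b : ℕ → ℝ} (hab : ∀ l, a l ≤ b l) {x : ℝ} (hx : 0 ≤ x) (d T w : ℕ) (θ : ℝ) :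
    majorG a x d T w θ ≤ majorG b x d T w θ := by
  refine sum_le_sum fun l _ => ?_
  split_ifs
  · have := hab l
    gcongr
  · exact le_rfl

theorem majorG_sub (a b : ℕ → ℝ) (x : ℝ) (d T w : ℕ) (θ : ℝ) :
    majorG a x d T w θ - majorG b x d T w θ = majorG (fun l => a l - b l) x d T w θ := by
  unfold majorG
  rw [← sum_sub_distrib]
  refine sum_congr rfl fun l _ => ?_
  split_ifs <;> ring

/-- By `abs_psiCoeff_le`, `|ψ_{i+1}| |L 1|^i ≤ x^i`. Equality of the first parameters makes the
difference linear in the remaining ones. -/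
theorem norm_reducedG_sub_le {L M : ℕ → ℂ} {a : ℕ → ℝ} {x : ℝ} (hLM : L 1 = M 1)
    (hx : 2 / 3 * ‖L 1‖ ≤ x) (ha : ∀ l, ‖L l - M l‖ ≤ a l) (d T w : ℕ) (θ : ℝ) :
    ‖reducedG cosC sinC L d T w θ - reducedG cosC sinC M d T w θ‖ ≤ majorG a x d T w θ := by
  unfold reducedG majorG
  rw [← sum_sub_distrib]
  refine (norm_sum_le _ _).trans (sum_le_sum fun l _ => ?_)
  split_ifs with h
  · rw [← hLM]
    have e : L l * L 1 ^ (w - l) * ((psiCoeff (w - l + 1) : ℝ) : ℂ) * cosC θ ^ l *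
        sinC θ ^ (w - l + 1) - M l * L 1 ^ (w - l) * ((psiCoeff (w - l + 1) : ℝ) : ℂ) *
        cosC θ ^ l * sinC θ ^ (w - l + 1) = (L l - M l) * (((psiCoeff (w - l + 1) : ℝ) : ℂ) *
        L 1 ^ (w - l)) * cosC θ ^ l * sinC θ ^ (w - l + 1) := by ring
    refine (congrArg norm e).le.trans ?_
    rw [norm_mul, norm_mul, norm_mul, norm_mul, norm_pow, norm_pow, norm_pow, norm_cosC,
      norm_sinC, Complex.norm_real, Real.norm_eq_abs]
    have h1 : |psiCoeff (w - l + 1)| * ‖L 1‖ ^ (w - l) ≤ x ^ (w - l) := by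
      refine (mul_le_mul_of_nonneg_right (abs_psiCoeff_le _) (by positivity)).trans ?_
      rw [← mul_pow]
      exact pow_le_pow_left₀ (by positivity) hx _
    have h3 := ha l
    have h4 : 0 ≤ a l := (norm_nonneg _).trans h3
    have h5 : 0 ≤ x := le_trans (by positivity) hx
    gcongr
  · simp

theorem norm_reducedG_le {L : ℕ → ℂ} {a : ℕ → ℝ} {x : ℝ}
    (hx : 2 / 3 * ‖L 1‖ ≤ x) (ha : ∀ l, ‖L l‖ ≤ a l) (d T w : ℕ) (θ : ℝ) :
    ‖reducedG cosC sinC L d T w θ‖ ≤ majorG a x d T w θ := by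
  unfold reducedG majorG
  refine (norm_sum_le _ _).trans (sum_le_sum fun l _ => ?_)
  split_ifs with h
  · rw [norm_mul, norm_mul, norm_mul, norm_mul, norm_pow, norm_pow, norm_pow,
      norm_cosC, norm_sinC]
    have h1 : |psiCoeff (w - l + 1)| * ‖L 1‖ ^ (w - l) ≤ x ^ (w - l) := by
      refine (mul_le_mul_of_nonneg_right (abs_psiCoeff_le _) (by positivity)).trans ?_
      rw [← mul_pow]
      exact pow_le_pow_left₀ (by positivity) hx _
    have h3 := ha l
    have h4 : 0 ≤ a l := (norm_nonneg _).trans h3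
    have h5 : 0 ≤ x := le_trans (by positivity) hx
    have h6 : ‖(((psiCoeff (w - l + 1) : ℝ)) : ℂ)‖ = |psiCoeff (w - l + 1)| := by
      rw [Complex.norm_real, Real.norm_eq_abs]
    calc _ = ‖L l‖ * (|psiCoeff (w - l + 1)| * ‖L 1‖ ^ (w - l)) * |Real.cos θ| ^ l *
          |Real.sin θ| ^ (w - l + 1) := by
          rw [← h6]; simp only [Complex.coe_algebraMap]; ring
      _ ≤ _ := by gcongr
  · simp

/-- Writing `w = l + i` factors the sum into a damping part in `l` and a geometric part in `i`; all
but one power of `|sin|` are dropped. The weight `e` covers the plain sum and the one with the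
factor `w`. -/
theorem sum_majorG_le {a : ℕ → ℝ} (ha : ∀ l, 0 ≤ a l) {x β β₀ : ℝ} (hx : 0 ≤ x) (hβ : 0 ≤ β)
    (hββ : β ≤ β₀) {e : ℕ → ℝ} (he : ∀ w, 0 ≤ e w) (d T K : ℕ) (θ : ℝ) :
    ∑ w ∈ range K, e w * majorG a x d T w θ * β ^ w ≤ |Real.sin θ| *
      ∑ l ∈ range (d + 1), if 2 ≤ l then
        a l * |Real.cos θ| ^ l * β ^ l * ∑ i ∈ range T, e (l + i) * (x * β₀) ^ i else 0 := by
  have hnn : ∀ w, 0 ≤ e w * majorG a x d T w θ * β ^ w := fun w =>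
    mul_nonneg (mul_nonneg (he w) (majorG_nonneg ha hx d T w θ)) (pow_nonneg hβ w)
  refine (sum_le_sum_of_subset_of_nonneg (range_subset_range.2
    (show K ≤ K + (d + T) by omega)) fun w _ _ => hnn w).trans ?_
  unfold majorG
  simp only [mul_sum (range (d + 1)), sum_mul (range (d + 1))]
  rw [sum_comm]
  refine sum_le_sum fun l hl => ?_
  by_cases h2 : 2 ≤ l
  · simp only [h2, true_and, if_true]
    have hl' := mem_range.1 hl
    calc _ = ∑ w ∈ range (K + (d + T)), (if l ≤ w ∧ w - l < T then
          (fun i => e (l + i) * (a l * x ^ i * |Real.cos θ| ^ l * |Real.sin θ| ^ (i + 1)) *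
            β ^ (l + i))
            (w - l) else 0) := by
          refine sum_congr rfl fun w _ => ?_
          split_ifs with h
          · simp only
            rw [Nat.add_sub_cancel' h.1]
          · simp
      _ = ∑ i ∈ range T, e (l + i) * (a l * x ^ i * |Real.cos θ| ^ l *
          |Real.sin θ| ^ (i + 1)) * β ^ (l + i) := sum_range_shift (fun i => e (l + i) *
          (a l * x ^ i * |Real.cos θ| ^ l * |Real.sin θ| ^ (i + 1)) *
            β ^ (l + i))
          (show l + T ≤ K + (d + T) by omega)
      _ ≤ ∑ i ∈ range T, |Real.sin θ| * (a l * |Real.cos θ| ^ l * β ^ l) *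
          (e (l + i) * (x * β₀) ^ i) := by
          refine sum_le_sum fun i _ => ?_
          have h3 : β ^ i ≤ β₀ ^ i := pow_le_pow_left₀ hβ hββ i
          have := ha l
          have := he (l + i)
          have h4 : |Real.sin θ| ^ (i + 1) ≤ |Real.sin θ| :=
            pow_le_of_le_one (abs_nonneg _) (Real.abs_sin_le_one θ) (Nat.succ_ne_zero i)
          calc _ = |Real.sin θ| ^ (i + 1) * (a l * |Real.cos θ| ^ l * β ^ l) * (e (l + i) *
                (x ^ i * β ^ i)) := by ring
            _ ≤ |Real.sin θ| * (a l * |Real.cos θ| ^ l * β ^ l) * (e (l + i) *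
                (x ^ i * β₀ ^ i)) := by gcongr
            _ = _ := by ring
      _ = _ := by rw [← mul_sum]; ring
  · simp [h2]

theorem sum_geometric_le {y : ℝ} (hy0 : 0 ≤ y) (hy1 : y < 1) (T : ℕ) :
    ∑ i ∈ range T, y ^ i ≤ 1 / (1 - y) := by
  rw [one_div, ← tsum_geometric_of_lt_one hy0 hy1]
  exact (summable_geometric_of_lt_one hy0 hy1).sum_le_tsum _ fun i _ => by positivity

theorem sum_mul_geometric_le {y : ℝ} (hy0 : 0 ≤ y) (hy1 : y < 1) (T : ℕ) :
    ∑ i ∈ range T, (i : ℝ) * y ^ i ≤ y / (1 - y) ^ 2 := by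
  have h := hasSum_coe_mul_geometric_of_norm_lt_one (𝕜 := ℝ) (r := y)
    (by rwa [Real.norm_of_nonneg hy0])
  exact sum_le_hasSum _ (fun i _ => by positivity) h

end

/-! ### The barrier and the basic estimate for differences of majorants. -/

noncomputable section

open Finset MeasureTheory

/-- With `u = cos² θ` the square is `u³ (1 - u)`, whose maximum `27/256`, at `u = 3/4`, is below
`1/9`. -/
theorem abs_cos_cube_mul_abs_sin_le (θ : ℝ) : |Real.cos θ| ^ 3 * |Real.sin θ| ≤ 1 / 3 := by
  have h1 := Real.sin_sq_add_cos_sq θ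
  rw [← sq_abs (Real.sin θ), ← sq_abs (Real.cos θ)] at h1
  set c := |Real.cos θ|
  set s := |Real.sin θ|
  have hc : 0 ≤ c := abs_nonneg _
  have hs : 0 ≤ s := abs_nonneg _
  have h2 : (c ^ 3 * s) ^ 2 ≤ (1 / 3) ^ 2 := by
    have e : (c ^ 3 * s) ^ 2 = (c ^ 2) ^ 3 * (1 - c ^ 2) := by
      rw [show 1 - c ^ 2 = s ^ 2 by linarith]; ring
    rw [e]
    have hx : 0 ≤ c ^ 2 := sq_nonneg c
    nlinarith [sq_nonneg (c ^ 2 - 3 / 4), sq_nonneg (c ^ 2 * (c ^ 2 - 3 / 4)),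
      sq_nonneg (c ^ 2 * c ^ 2 - 9 / 16)]
  exact (pow_le_pow_iff_left₀ (by positivity) (by norm_num) two_ne_zero).1 h2

/-- The equation `β' = -E f β³` is linear for `β^{-2}`, which grows by `2 E ∫ f`. Over a full turn
this is `E π / 2`, since `∫ cos² sin² = π/4`. -/
theorem exists_barrier {E β₀ : ℝ} (hE : 0 ≤ E) (hβ₀ : 0 < β₀) : ∃ β : ℝ → ℝ,
    (∀ θ, HasDerivAt β (-β θ * (E * (Real.cos θ ^ 2 * Real.sin (max θ 0) ^ 2) * β θ ^ 2)) θ) ∧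
    (∀ θ, 0 < β θ) ∧ (∀ θ, β θ ≤ β₀) ∧ β 0 = β₀ ∧
    ∀ b, 0 < b → (β₀ ^ 2)⁻¹ + E * (Real.pi / 2) ≤ (b ^ 2)⁻¹ → b ≤ β (2 * Real.pi) := by
  -- The maximum switches `f` off for negative angles, so that the primitive is nonnegative and the
  -- barrier is defined on the whole line.
  set f : ℝ → ℝ := fun t => Real.cos t ^ 2 * Real.sin (max t 0) ^ 2 with hf
  have hfc : Continuous f := by fun_prop
  have hf0 : ∀ t, 0 ≤ f t := fun t => by positivity
  set I : ℝ → ℝ := fun θ => ∫ t in (0 : ℝ)..θ, f t with hI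
  have hId : ∀ θ, HasDerivAt I (f θ) θ := fun θ => intervalIntegral.integral_hasDerivAt_right
    (hfc.intervalIntegrable _ _) (hfc.stronglyMeasurableAtFilter _ _) hfc.continuousAt
  have hI0 : ∀ θ, 0 ≤ I θ := by
    intro θ
    rcases le_total 0 θ with h | h
    · exact intervalIntegral.integral_nonneg h fun t _ => hf0 t
    · have : I θ = ∫ t in (0 : ℝ)..θ, (0 : ℝ) := intervalIntegral.integral_congr fun t ht => by
        rw [Set.uIcc_of_ge h] at ht
        simp [hf, max_eq_right ht.2]
      rw [this]; simp
  have hI2 : I (2 * Real.pi) = Real.pi / 4 := by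
    rw [← wallisConst_one]
    refine intervalIntegral.integral_congr fun t ht => ?_
    rw [Set.uIcc_of_le (by positivity)] at ht
    simp [hf, max_eq_left ht.1]
  set u : ℝ → ℝ := fun θ => (β₀ ^ 2)⁻¹ + 2 * E * I θ with hu
  have hu0 : ∀ θ, (β₀ ^ 2)⁻¹ ≤ u θ := fun θ => le_add_of_nonneg_right (by have := hI0 θ; positivity)
  have hupos : ∀ θ, 0 < u θ := fun θ => lt_of_lt_of_le (by positivity) (hu0 θ)
  have hud : ∀ θ, HasDerivAt u (2 * E * f θ) θ := fun θ => ((hId θ).const_mul _).const_add _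
  have hs0 : √((β₀ ^ 2)⁻¹) = β₀⁻¹ := by rw [Real.sqrt_inv, Real.sqrt_sq hβ₀.le]
  refine ⟨fun θ => (√(u θ))⁻¹, fun θ => ?_, fun θ => inv_pos.2 (Real.sqrt_pos.2 (hupos θ)),
    fun θ => ?_, ?_, fun b hb hle => ?_⟩
  · have hsp := Real.sqrt_pos.2 (hupos θ)
    refine (((hud θ).sqrt (hupos θ).ne').fun_inv hsp.ne').congr_deriv ?_
    simp only [hf]
    field_simp
  · calc _ ≤ (√((β₀ ^ 2)⁻¹))⁻¹ := inv_anti₀ (Real.sqrt_pos.2 (by positivity))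
          (Real.sqrt_le_sqrt (hu0 θ))
      _ = β₀ := by rw [hs0, inv_inv]
  · simp only [hu, hI, intervalIntegral.integral_same, mul_zero, add_zero]
    rw [hs0, inv_inv]
  · have h1 : u (2 * Real.pi) ≤ (b ^ 2)⁻¹ := by
      simp only [hu]; rw [hI2]; linarith
    have h2 := inv_anti₀ (Real.sqrt_pos.2 (hupos _)) (Real.sqrt_le_sqrt h1)
    rwa [Real.sqrt_inv, Real.sqrt_sq hb.le, inv_inv] at h2

theorem hasDerivAt_primitive {f : ℝ → ℝ} (hf : Continuous f) (θ : ℝ) :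
    HasDerivAt (fun θ => ∫ t in (0 : ℝ)..θ, f t) (f θ) θ :=
  intervalIntegral.integral_hasDerivAt_right (hf.intervalIntegrable _ _)
    (hf.stronglyMeasurableAtFilter _ _) hf.continuousAt

/-- The odd part of a sequence. -/
def oddPart {R : Type*} [Zero R] (a : ℕ → R) (l : ℕ) : R := if Odd l then a l else 0

/-- The arithmetic-geometric mean inequality. It trades odd powers of `|cos|` for polynomials whose
integrals are Wallis constants. -/
theorem abs_cos_pow_le_even (θ : ℝ) {l : ℕ} (hl : Odd l) : |Real.cos θ| ^ l ≤
    (Real.cos θ ^ (2 * (l / 2)) + Real.cos θ ^ (2 * (l / 2 + 1))) / 2 := by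
  obtain ⟨j, rfl⟩ := hl
  rw [show (2 * j + 1) / 2 = j by omega, ← Even.pow_abs ⟨j, by ring⟩ (Real.cos θ),
    ← Even.pow_abs (n := 2 * (j + 1)) ⟨j + 1, by ring⟩ (Real.cos θ)]
  have h := mul_nonneg (pow_nonneg (abs_nonneg (Real.cos θ)) (2 * j))
    (sq_nonneg (1 - |Real.cos θ|))
  have e1 : |Real.cos θ| ^ (2 * (j + 1)) = |Real.cos θ| ^ (2 * j) * |Real.cos θ| ^ 2 := by
    rw [← pow_add]; congr 1
  have e2 : |Real.cos θ| ^ (2 * j + 1) = |Real.cos θ| ^ (2 * j) * |Real.cos θ| := pow_succ _ _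
  rw [e1, e2]
  linarith

section Estimate

variable {a : ℕ → ℝ} {x β₀ : ℝ} (d T : ℕ)

/-- The derivative of the exponent in the bound for the odd part of the majorant. -/
def oddRate (a : ℕ → ℝ) (β₀ Ψ₀ Ψ₁ χ : ℝ) (d : ℕ) (θ : ℝ) : ℝ :=
  ∑ l ∈ range (d + 1), if 3 ≤ l ∧ Odd l then χ ^ 2 * (a l * β₀ ^ l * (l * Ψ₀ + Ψ₁)) *
    ((Real.cos θ ^ (2 * (l / 2)) + Real.cos θ ^ (2 * (l / 2 + 1))) / 2 * Real.sin θ ^ 2) else 0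

theorem continuous_oddRate (a : ℕ → ℝ) (β₀ Ψ₀ Ψ₁ χ : ℝ) (d : ℕ) :
    Continuous (oddRate a β₀ Ψ₀ Ψ₁ χ d) := by
  unfold oddRate
  refine continuous_finsetSum _ fun l _ => ?_
  split_ifs <;> fun_prop

theorem even_pow_cos_nonneg (θ : ℝ) (j : ℕ) : 0 ≤ Real.cos θ ^ (2 * j) :=
  Even.pow_nonneg ⟨j, by ring⟩ _

theorem oddRate_nonneg (ha : ∀ l, 0 ≤ a l) (hβ₀ : 0 ≤ β₀) {Ψ₀ Ψ₁ χ : ℝ} (h0 : 0 ≤ Ψ₀)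
    (h1 : 0 ≤ Ψ₁) (θ : ℝ) : 0 ≤ oddRate a β₀ Ψ₀ Ψ₁ χ d θ := by
  refine sum_nonneg fun l _ => ?_
  have := ha l
  have := even_pow_cos_nonneg θ (l / 2)
  have := even_pow_cos_nonneg θ (l / 2 + 1)
  split_ifs <;> positivity

/-- With `l = 2j + 1 ≥ 3`, the coefficient `1.77` of `Ψ₀` comes from `odd_mul_wallisConst_le` and
the coefficient `0.59` of `Ψ₁` from `wallisConst_add_succ_le`. -/
theorem integral_oddRate_le (ha : ∀ l, 0 ≤ a l) (hβ₀ : 0 ≤ β₀) {Ψ₀ Ψ₁ χ O : ℝ} (h0 : 0 ≤ Ψ₀)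
    (h1 : 0 ≤ Ψ₁)
    (hO : ∑ l ∈ range (d + 1), (if 3 ≤ l ∧ Odd l then a l * β₀ ^ l else 0) ≤ O) :
    ∫ θ in (0 : ℝ)..(2 * Real.pi), oddRate a β₀ Ψ₀ Ψ₁ χ d θ ≤
      χ ^ 2 * (1.77 * Ψ₀ + 0.59 * Ψ₁) * O := by
  unfold oddRate
  rw [intervalIntegral.integral_finsetSum (fun l _ => Continuous.intervalIntegrable
    (by split_ifs <;> fun_prop) _ _)]
  refine le_trans ?_ (mul_le_mul_of_nonneg_left hO (by positivity))
  rw [mul_sum]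
  refine sum_le_sum fun l _ => ?_
  split_ifs with h
  · rw [intervalIntegral.integral_const_mul]
    have e : ∫ θ in (0 : ℝ)..(2 * Real.pi), (Real.cos θ ^ (2 * (l / 2)) +
        Real.cos θ ^ (2 * (l / 2 + 1))) / 2 * Real.sin θ ^ 2 =
        (wallisConst (l / 2) + wallisConst (l / 2 + 1)) / 2 := by
      unfold wallisConst
      rw [← intervalIntegral.integral_add (Continuous.intervalIntegrable (by fun_prop) _ _)
        (Continuous.intervalIntegrable (by fun_prop) _ _), ← intervalIntegral.integral_div]
      refine intervalIntegral.integral_congr fun θ _ => ?_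
      ring
    rw [e]
    obtain ⟨h3, j, hj⟩ := h
    have hj2 : l / 2 = j := by omega
    have k1 := odd_mul_wallisConst_le j (by omega)
    have k2 := wallisConst_add_succ_le j (by omega)
    have hl : (l : ℝ) = 2 * j + 1 := by rw [hj]; push_cast; ring
    rw [hj2, hl]
    have k3 : ((2 * (j : ℝ) + 1) * Ψ₀ + Ψ₁) * ((wallisConst j + wallisConst (j + 1)) / 2) ≤
        1.77 * Ψ₀ + 0.59 * Ψ₁ := by
      have := mul_le_mul_of_nonneg_right k1 h0
      have := mul_le_mul_of_nonneg_right k2 h1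
      linarith
    have := ha l
    calc _ = χ ^ 2 * (a l * β₀ ^ l) * (((2 * (j : ℝ) + 1) * Ψ₀ + Ψ₁) *
          ((wallisConst j + wallisConst (j + 1)) / 2)) := by ring
      _ ≤ χ ^ 2 * (a l * β₀ ^ l) * (1.77 * Ψ₀ + 0.59 * Ψ₁) := by gcongr
      _ = _ := by ring
  · simp

theorem sum_mul_majorG_odd_le (ha : ∀ l, 0 ≤ a l) (hx : 0 ≤ x) (hxβ : x * β₀ < 1) (K : ℕ) {β θ : ℝ}
    (hβ : 0 ≤ β) (hββ : β ≤ β₀) :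
    ∑ w ∈ range K, (w : ℝ) * majorG (oddPart a) x d T w θ * β ^ w ≤ |Real.sin θ| *
      ∑ l ∈ range (d + 1), if 3 ≤ l ∧ Odd l then
        a l * β₀ ^ l * (l * (1 / (1 - x * β₀)) + x * β₀ / (1 - x * β₀) ^ 2) *
        ((Real.cos θ ^ (2 * (l / 2)) + Real.cos θ ^ (2 * (l / 2 + 1))) / 2) else 0 := by
  have hao : ∀ l, 0 ≤ oddPart a l := fun l => by unfold oddPart; have := ha l; split_ifs <;> simp [this]
  refine (sum_majorG_le hao hx hβ hββ (e := fun w => (w : ℝ)) (fun w => Nat.cast_nonneg w)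
    d T K θ).trans (mul_le_mul_of_nonneg_left (sum_le_sum fun l _ => ?_) (abs_nonneg _))
  have hβ₀ : 0 ≤ β₀ := hβ.trans hββ
  have hy : 0 ≤ x * β₀ := mul_nonneg hx hβ₀
  by_cases ho : Odd l
  · by_cases h2 : 2 ≤ l
    · have h3 : 3 ≤ l := by obtain ⟨j, rfl⟩ := ho; omega
      rw [if_pos h2, if_pos ⟨h3, ho⟩, oddPart, if_pos ho]
      have k1 : ∑ i ∈ range T, ((l + i : ℕ) : ℝ) * (x * β₀) ^ i ≤
          l * (1 / (1 - x * β₀)) + x * β₀ / (1 - x * β₀) ^ 2 := by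
        push_cast
        simp only [add_mul]
        rw [sum_add_distrib, ← mul_sum]
        exact add_le_add (mul_le_mul_of_nonneg_left (sum_geometric_le hy hxβ T) (Nat.cast_nonneg l))
          (sum_mul_geometric_le hy hxβ T)
      have k2 := abs_cos_pow_le_even θ ho
      have k3 : β ^ l ≤ β₀ ^ l := pow_le_pow_left₀ hβ hββ l
      have := ha l
      have k4 : 0 ≤ ∑ i ∈ range T, ((l + i : ℕ) : ℝ) * (x * β₀) ^ i := by positivity
      calc _ = a l * β ^ l * (∑ i ∈ range T, ((l + i : ℕ) : ℝ) * (x * β₀) ^ i) *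
            |Real.cos θ| ^ l := by ring
        _ ≤ _ := by gcongr
    · rw [if_neg h2, if_neg (by omega)]
  · have h3 : ¬(3 ≤ l ∧ Odd l) := fun h => ho h.2
    rw [if_neg h3, oddPart, if_neg ho]; simp

/-- Subtracting the majorant of the odd part leaves the majorant of the even part, and even powers
of `|cos|` need no averaging. -/
theorem sum_majorG_even_le (ha : ∀ l, 0 ≤ a l) (hx : 0 ≤ x) (hxβ : x * β₀ < 1) (K : ℕ) {β θ : ℝ}
    (hβ : 0 ≤ β) (hββ : β ≤ β₀) :
    ∑ w ∈ range K, (majorG a x d T w θ - majorG (oddPart a) x d T w θ) * β ^ w ≤ |Real.sin θ| *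
      ∑ l ∈ range (d + 1), if 2 ≤ l ∧ Even l then
        a l * β₀ ^ l * (1 / (1 - x * β₀)) * Real.cos θ ^ (2 * (l / 2)) else 0 := by
  have hae : ∀ l, 0 ≤ a l - oddPart a l := fun l => by
    unfold oddPart; have := ha l; split_ifs <;> simp [this]
  simp only [majorG_sub]
  have h := sum_majorG_le hae hx hβ hββ (e := fun _ => (1 : ℝ)) (fun _ => zero_le_one) d T K θ
  simp only [one_mul] at h
  refine h.trans (mul_le_mul_of_nonneg_left (sum_le_sum fun l _ => ?_) (abs_nonneg _))
  have hβ₀ : 0 ≤ β₀ := hβ.trans hββ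
  have hy : 0 ≤ x * β₀ := mul_nonneg hx hβ₀
  by_cases h2 : 2 ≤ l
  · by_cases he : Even l
    · rw [if_pos h2, if_pos ⟨h2, he⟩, oddPart, if_neg (Nat.not_odd_iff_even.2 he), sub_zero,
        Even.pow_abs he, show 2 * (l / 2) = l from Nat.mul_div_cancel' he.two_dvd]
      have k1 := sum_geometric_le hy hxβ T
      have k3 : β ^ l ≤ β₀ ^ l := pow_le_pow_left₀ hβ hββ l
      have := ha l
      have := he.pow_nonneg (Real.cos θ)
      calc _ = a l * β ^ l * (∑ i ∈ range T, (x * β₀) ^ i) * Real.cos θ ^ l := by ring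
        _ ≤ _ := by gcongr
    · rw [if_pos h2, if_neg (by tauto), oddPart, if_pos (Nat.not_even_iff_odd.1 he)]; simp
  · rw [if_neg h2, if_neg (by tauto)]

/-- Only indices `l ≥ 2` occur, so `β² cos²` can be factored out. This is the shape of transport
speed that `exists_barrier` can absorb. -/
theorem sum_majorG_le_quadratic (ha : ∀ l, 0 ≤ a l) (hx : 0 ≤ x) (hxβ : x * β₀ < 1) (K : ℕ)
    {β θ E : ℝ} (hβ : 0 ≤ β) (hββ : β ≤ β₀)
    (hE : ∑ l ∈ range (d + 1), (if 2 ≤ l then a l * β₀ ^ (l - 2) else 0) ≤ E) :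
    ∑ w ∈ range K, majorG a x d T w θ * β ^ w ≤
      E * (1 / (1 - x * β₀)) * Real.cos θ ^ 2 * |Real.sin θ| * β ^ 2 := by
  have h := sum_majorG_le ha hx hβ hββ (e := fun _ => (1 : ℝ)) (fun _ => zero_le_one) d T K θ
  simp only [one_mul] at h
  refine h.trans ?_
  have hβ₀ : 0 ≤ β₀ := hβ.trans hββ
  have hy : 0 ≤ x * β₀ := mul_nonneg hx hβ₀
  have h1x : 0 < 1 - x * β₀ := by linarith
  have hΨ : 0 ≤ 1 / (1 - x * β₀) := by positivity
  calc _ ≤ |Real.sin θ| * ∑ l ∈ range (d + 1), (if 2 ≤ l then a l * β₀ ^ (l - 2) else 0) *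
        (Real.cos θ ^ 2 * β ^ 2 * (1 / (1 - x * β₀))) := by
        refine mul_le_mul_of_nonneg_left (sum_le_sum fun l _ => ?_) (abs_nonneg _)
        split_ifs with h2
        · obtain ⟨m, rfl⟩ := Nat.exists_eq_add_of_le h2
          rw [Nat.add_sub_cancel_left]
          have k1 := sum_geometric_le hy hxβ T
          have k2 : |Real.cos θ| ^ (2 + m) ≤ Real.cos θ ^ 2 := by
            rw [pow_add, sq_abs]
            exact mul_le_of_le_one_right (sq_nonneg _)
              (pow_le_one₀ (abs_nonneg _) (Real.abs_cos_le_one θ))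
          have k3 : β ^ (2 + m) ≤ β ^ 2 * β₀ ^ m := by
            rw [pow_add]; gcongr
          have := ha (2 + m)
          calc _ ≤ a (2 + m) * Real.cos θ ^ 2 * (β ^ 2 * β₀ ^ m) * (1 / (1 - x * β₀)) := by gcongr
            _ = _ := by ring
        · simp
    _ = (|Real.sin θ| * (Real.cos θ ^ 2 * β ^ 2 * (1 / (1 - x * β₀)))) *
        ∑ l ∈ range (d + 1), (if 2 ≤ l then a l * β₀ ^ (l - 2) else 0) := by
        rw [← sum_mul]; ring
    _ ≤ (|Real.sin θ| * (Real.cos θ ^ 2 * β ^ 2 * (1 / (1 - x * β₀)))) * E := by gcongr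
    _ = _ := by ring

/-- `χ` bounds `1 / (1 - a Γ)`. The full series gives the transport speed, hence the barrier from
`β₀` down to at least `b`. Along it the odd majorant grows by at most the exponential factor, and
the even part enters linearly as the source. The radius thus does not depend on `k`. -/
theorem sum_majorant_sub_le (ha : ∀ l, 0 ≤ a l) (hx : 0 ≤ x) (hβ₀ : 0 < β₀) (hxβ : x * β₀ < 1)
    (K : ℕ) {Ψ₀ Ψ₁ E O χ b : ℝ} (hΨ₀ : Ψ₀ = 1 / (1 - x * β₀)) (hΨ₁ : Ψ₁ = x * β₀ / (1 - x * β₀) ^ 2)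
    (hE : ∑ l ∈ range (d + 1), (if 2 ≤ l then a l * β₀ ^ (l - 2) else 0) ≤ E)
    (hO : ∑ l ∈ range (d + 1), (if 3 ≤ l ∧ Odd l then a l * β₀ ^ l else 0) ≤ O)
    (hχ0 : 0 < χ) (hχ : 1 ≤ χ * (1 - E * Ψ₀ * β₀ ^ 2 / 3)) (hb0 : 0 < b)
    (hb : (β₀ ^ 2)⁻¹ + E * Ψ₀ * χ * (Real.pi / 2) ≤ (b ^ 2)⁻¹) :
    ∑ k ∈ range K, (recV (|Real.cos ·|) (|Real.sin ·|) (majorG a x d T) k (2 * Real.pi) -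
      recV (|Real.cos ·|) (|Real.sin ·|) (majorG (oddPart a) x d T) k (2 * Real.pi)) * b ^ k ≤
    Ψ₀ * χ ^ 2 * β₀ * Real.exp (χ ^ 2 * (1.77 * Ψ₀ + 0.59 * Ψ₁) * O) *
      ∑ l ∈ range (d + 1), if 2 ≤ l ∧ Even l then a l * β₀ ^ l * wallisConst (l / 2) else 0 := by
  have hcos : Continuous fun θ => |Real.cos θ| := Real.continuous_cos.abs
  have hsin : Continuous fun θ => |Real.sin θ| := Real.continuous_sin.abs
  have hcos0 : ∀ θ, 0 ≤ |Real.cos θ| := fun _ => abs_nonneg _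
  have hsin0 : ∀ θ, 0 ≤ |Real.sin θ| := fun _ => abs_nonneg _
  have h1x : 0 < 1 - x * β₀ := by linarith
  have hΨ₀0 : 0 ≤ Ψ₀ := by rw [hΨ₀]; positivity
  have hΨ₁0 : 0 ≤ Ψ₁ := by rw [hΨ₁]; positivity
  have hE0 : 0 ≤ E := le_trans (sum_nonneg fun l _ => by
    have := ha l; split_ifs <;> positivity) hE
  have hao : ∀ l, 0 ≤ oddPart a l := fun l => by unfold oddPart; have := ha l; split_ifs <;> simp [this]
  have haole : ∀ l, oddPart a l ≤ a l := fun l => by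
    unfold oddPart; have := ha l; split_ifs <;> simp [this]
  have hγ := continuous_majorG a x d T
  have hγo := continuous_majorG (oddPart a) x d T
  have hγ0 := majorG_nonneg ha hx d T
  have hγo0 := majorG_nonneg hao hx d T
  have hγz := majorG_zero a x d T
  have hγoz := majorG_zero (oddPart a) x d T
  have hγγo := majorG_mono haole hx d T
  obtain ⟨β, hβd, hβpos, hββ, hβz, hβb⟩ := exists_barrier (E := E * Ψ₀ * χ) (by positivity) hβ₀
  have hbβ := hβb b hb0 hb
  set Γ : ℝ → ℝ := fun θ => E * Ψ₀ * Real.cos θ ^ 2 * |Real.sin θ| * β θ ^ 2 with hΓdef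
  have hΓ : ∀ θ, ∑ w ∈ range K, majorG a x d T w θ * β θ ^ w ≤ Γ θ := fun θ => by
    rw [hΓdef, hΨ₀]
    exact sum_majorG_le_quadratic d T ha hx hxβ K (hβpos θ).le (hββ θ) hE
  have haΓ : ∀ θ, |Real.cos θ| * Γ θ ≤ E * Ψ₀ * β₀ ^ 2 / 3 := fun θ => by
    have k1 := abs_cos_cube_mul_abs_sin_le θ
    have k2 : β θ ^ 2 ≤ β₀ ^ 2 := pow_le_pow_left₀ (hβpos θ).le (hββ θ) 2
    calc _ = E * Ψ₀ * (|Real.cos θ| ^ 3 * |Real.sin θ|) * β θ ^ 2 := by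
          rw [hΓdef]; simp only; rw [← sq_abs (Real.cos θ)]; ring
      _ ≤ E * Ψ₀ * (1 / 3) * β₀ ^ 2 := by gcongr
      _ = _ := by ring
  have hlt : E * Ψ₀ * β₀ ^ 2 / 3 < 1 := by
    by_contra hcon
    have : χ * (1 - E * Ψ₀ * β₀ ^ 2 / 3) ≤ 0 := mul_nonpos_of_nonneg_of_nonpos hχ0.le (by linarith)
    linarith
  have hχΓ : ∀ θ, 1 ≤ χ * (1 - |Real.cos θ| * Γ θ) := fun θ => hχ.trans
    (mul_le_mul_of_nonneg_left (by linarith [haΓ θ]) hχ0.le)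
  have hχΓ2 : ∀ θ, 1 ≤ (1 - |Real.cos θ| * Γ θ) ^ 2 * χ ^ 2 := fun θ => by
    have := one_le_pow₀ (hχΓ θ) (n := 2)
    calc 1 ≤ _ := this
      _ = _ := by ring
  have hH : ∀ θ, 0 ≤ θ → |Real.sin θ| * Γ θ ≤ (1 - |Real.cos θ| * Γ θ) *
      (E * Ψ₀ * χ * (Real.cos θ ^ 2 * Real.sin (max θ 0) ^ 2) * β θ ^ 2) := fun θ hθ => by
    rw [max_eq_left hθ, ← sq_abs (Real.sin θ)]
    have h0 : 0 ≤ E * Ψ₀ * (Real.cos θ ^ 2 * |Real.sin θ| ^ 2) * β θ ^ 2 := by positivity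
    calc _ = 1 * (E * Ψ₀ * (Real.cos θ ^ 2 * |Real.sin θ| ^ 2) * β θ ^ 2) := by
          rw [hΓdef]; ring
      _ ≤ χ * (1 - |Real.cos θ| * Γ θ) * (E * Ψ₀ * (Real.cos θ ^ 2 * |Real.sin θ| ^ 2) * β θ ^ 2) :=
          mul_le_mul_of_nonneg_right (hχΓ θ) h0
      _ = _ := by ring
  set A : ℝ → ℝ := fun θ => ∫ t in (0 : ℝ)..θ, oddRate a β₀ Ψ₀ Ψ₁ χ d t with hA
  have hrc := continuous_oddRate a β₀ Ψ₀ Ψ₁ χ d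
  have hr0 := oddRate_nonneg d ha hβ₀.le (χ := χ) hΨ₀0 hΨ₁0
  set e := Real.exp (χ ^ 2 * (1.77 * Ψ₀ + 0.59 * Ψ₁) * O) with he
  -- The odd majorant is followed along the barrier of the full one, which is legitimate because the
  -- odd `Γ` is the smaller.
  have hU : ∀ θ, 0 ≤ θ → θ ≤ 2 * Real.pi → ∑ k ∈ range K,
      k * recV (|Real.cos ·|) (|Real.sin ·|) (majorG (oddPart a) x d T) k θ * β θ ^ k ≤ β₀ * e := by
    intro θ hθ hθ2
    have hΓ₁ := fun θ => sum_mul_majorG_odd_le d T ha hx hxβ K (θ := θ) (hβpos θ).le (hββ θ)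
    refine (sum_mul_recV_le (A := A) (ρ := oddRate a β₀ Ψ₀ Ψ₁ χ d) hcos hsin hcos0 hsin0 hγo hγo0
      hγoz hβd (fun θ => (hβpos θ).le) K (Γ := Γ) (fun θ _ => (sum_le_sum fun w _ =>
        mul_le_mul_of_nonneg_right (hγγo w θ) (pow_nonneg (hβpos θ).le w)).trans (hΓ θ))
      (fun θ _ => (haΓ θ).trans_lt hlt) (fun θ _ => hΓ₁ θ) hH (fun θ _ => ?_)
      (fun θ => hasDerivAt_primitive hrc θ) hθ).trans ?_
    · rw [← hΨ₀, ← hΨ₁]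
      set s := ∑ l ∈ range (d + 1), if 3 ≤ l ∧ Odd l then a l * β₀ ^ l * (l * Ψ₀ + Ψ₁) *
        ((Real.cos θ ^ (2 * (l / 2)) + Real.cos θ ^ (2 * (l / 2 + 1))) / 2) else 0 with hs
      have hs0 : 0 ≤ s := sum_nonneg fun l _ => by
        have := ha l
        have := even_pow_cos_nonneg θ (l / 2)
        have := even_pow_cos_nonneg θ (l / 2 + 1)
        split_ifs <;> positivity
      have e1 : oddRate a β₀ Ψ₀ Ψ₁ χ d θ = χ ^ 2 * (s * |Real.sin θ| ^ 2) := by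
        rw [hs, sq_abs, sum_mul, mul_sum]
        refine sum_congr rfl fun l _ => ?_
        split_ifs <;> ring
      rw [e1]
      calc _ = 1 * (s * |Real.sin θ| ^ 2) := by ring
        _ ≤ (1 - |Real.cos θ| * Γ θ) ^ 2 * χ ^ 2 * (s * |Real.sin θ| ^ 2) :=
            mul_le_mul_of_nonneg_right (hχΓ2 θ) (by positivity)
        _ = _ := by ring
    · rw [hβz]
      refine mul_le_mul_of_nonneg_left (Real.exp_le_exp.2 ?_) hβ₀.le
      have k1 := integral_oddRate_le d ha hβ₀.le (χ := χ) hΨ₀0 hΨ₁0 hO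
      refine le_trans ?_ k1
      simp only [hA, intervalIntegral.integral_same, sub_zero]
      exact intervalIntegral.integral_mono_interval le_rfl hθ hθ2
        (Filter.Eventually.of_forall hr0) (hrc.intervalIntegrable _ _)
  set S : ℝ → ℝ := fun θ => ∑ l ∈ range (d + 1), if 2 ≤ l ∧ Even l then
    (Ψ₀ * χ ^ 2 * β₀ * e) * (a l * β₀ ^ l) * (Real.cos θ ^ (2 * (l / 2)) * Real.sin θ ^ 2) else 0
    with hS
  have hSc : Continuous S := continuous_finsetSum _ fun l _ => by split_ifs <;> fun_prop
  have hΓe := fun θ => sum_majorG_even_le d T ha hx hxβ K (θ := θ) (hβpos θ).le (hββ θ)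
  have hmain := sum_recV_sub_le (a := (|Real.cos ·|)) (b := (|Real.sin ·|))
    (P := fun θ => ∫ t in (0 : ℝ)..θ, S t) (S := S) hcos hsin hcos0 hsin0 hγ hγ0
    hγz hγo hγo0 hγγo hβd (fun θ => (hβpos θ).le) K (T := 2 * Real.pi) (Γ := Γ) (fun θ _ => hΓ θ)
    (fun θ _ => (haΓ θ).trans_lt hlt) (fun θ _ => hΓe θ) hH (fun θ hθ hθ2 => ?_)
    (fun θ => hasDerivAt_primitive hSc θ) (by positivity)
  · have hnn : ∀ k, 0 ≤ recV (|Real.cos ·|) (|Real.sin ·|) (majorG a x d T) k (2 * Real.pi) -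
        recV (|Real.cos ·|) (|Real.sin ·|) (majorG (oddPart a) x d T) k (2 * Real.pi) := fun k => by
      have := norm_recV_sub_le (c := (|Real.cos ·|)) (s := (|Real.sin ·|)) (g := majorG a x d T)
        (h := majorG (oddPart a) x d T) hcos hsin hγ hγo hγ hγo
        (fun w θ _ => by rw [Real.norm_of_nonneg (hγo0 w θ)])
        (fun w θ _ => by rw [Real.norm_of_nonneg (sub_nonneg.2 (hγγo w θ))]) k
        (θ := 2 * Real.pi) (by positivity)
      simp only [Real.norm_eq_abs, abs_abs] at this
      exact (abs_nonneg _).trans this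
    refine le_trans (sum_le_sum fun k _ => mul_le_mul_of_nonneg_left
      (pow_le_pow_left₀ hb0.le hbβ k) (hnn k)) (hmain.trans ?_)
    simp only [intervalIntegral.integral_same, sub_zero, hS]
    rw [intervalIntegral.integral_finsetSum (fun l _ => Continuous.intervalIntegrable
      (by split_ifs <;> fun_prop) _ _), mul_sum]
    refine (sum_congr rfl fun l _ => ?_).le
    split_ifs with h
    · rw [intervalIntegral.integral_const_mul, wallisConst]; ring
    · simp
  · rw [← hΨ₀]
    set s := ∑ l ∈ range (d + 1), if 2 ≤ l ∧ Even l then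
      a l * β₀ ^ l * Ψ₀ * Real.cos θ ^ (2 * (l / 2)) else 0 with hs
    have hs0 : 0 ≤ s := sum_nonneg fun l _ => by
      have := ha l
      have := even_pow_cos_nonneg θ (l / 2)
      split_ifs <;> positivity
    have e1 : S θ = χ ^ 2 * (s * |Real.sin θ| ^ 2 * (β₀ * e)) := by
      rw [hs, sq_abs, sum_mul, sum_mul, mul_sum]
      refine sum_congr rfl fun l _ => ?_
      split_ifs <;> ring
    rw [e1]
    have he0 : 0 < e := Real.exp_pos _
    calc _ = s * |Real.sin θ| ^ 2 * ∑ k ∈ range K, k * recV (|Real.cos ·|) (|Real.sin ·|)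
          (majorG (oddPart a) x d T) k θ * β θ ^ k := by ring
      _ ≤ 1 * (s * |Real.sin θ| ^ 2 * (β₀ * e)) := by
          rw [one_mul]; exact mul_le_mul_of_nonneg_left (hU θ hθ hθ2) (by positivity)
      _ ≤ (1 - |Real.cos θ| * Γ θ) ^ 2 * χ ^ 2 * (s * |Real.sin θ| ^ 2 * (β₀ * e)) :=
          mul_le_mul_of_nonneg_right (hχΓ2 θ) (by positivity)
      _ = _ := by ring

end Estimate

end

/-! ### Bounds for the holonomy linear in the even parameters. -/

noncomputable section

open Finset MeasureTheory

/-- The holonomy coefficients are dominated by the difference of two majorants. -/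
theorem norm_holonomy_le_majorant {d : ℕ} (lam : Fin d → ℂ) {k : ℕ} (hk : k ≠ 1) {x : ℝ}
    (hx : x = 2 / 3 * ‖lamSeq lam 1‖) : ‖holonomy (lamSeq lam) k‖ ≤
      recV (|Real.cos ·|) (|Real.sin ·|) (majorG (fun l => ‖lamSeq lam l‖) x d k) k (2 * Real.pi) -
      recV (|Real.cos ·|) (|Real.sin ·|) (majorG (oddPart fun l => ‖lamSeq lam l‖) x d k) k
        (2 * Real.pi) := by
  set L := lamSeq lam with hL
  set a : ℕ → ℝ := fun l => ‖L l‖ with ha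
  set lamo : Fin d → ℂ := fun i => if Odd ((i : ℕ) + 1) then lam i else 0 with hlamo
  have hLo : lamSeq lamo = oddPart L := by
    funext l
    simp only [hL, lamSeq, hlamo, oddPart]
    by_cases h : 0 < l ∧ l - 1 < d
    · simp only [h, and_self, dif_pos]
      rw [Nat.sub_add_cancel h.1]
    · simp [h]
  -- The odd part has trivial holonomy, so the coefficient itself is a difference of two recursions,
  -- to which `norm_recV_sub_le` applies. Both sequences have the same first entry, as elimination
  -- of `λ_1` requires.
  have hodd : holonomy (lamSeq lamo) k = 0 := holonomy_eq_zero_of_odd (fun l hl => by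
    rw [hLo, oddPart, if_neg (Nat.not_odd_iff_even.2 hl)]) hk
  have hno : ∀ l, ‖oddPart L l‖ = oddPart a l := fun l => by
    unfold oddPart; split_ifs <;> simp [ha]
  have h1 := holonomy_eq_recV_reducedG lam (le_refl k)
  have h2 := holonomy_eq_recV_reducedG lamo (le_refl k)
  rw [hodd, hLo] at h2
  have hL1 : oddPart L 1 = L 1 := by simp [oddPart]
  have key := norm_recV_sub_le (g := reducedG cosC sinC L d k)
    (h := reducedG cosC sinC (oddPart L) d k) (γ := majorG a x d k)
    (γo := majorG (oddPart a) x d k) continuous_cosC continuous_sinC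
    (fun w => continuous_reducedG continuous_cosC continuous_sinC L d k w)
    (fun w => continuous_reducedG continuous_cosC continuous_sinC _ d k w)
    (continuous_majorG a x d k) (continuous_majorG (oddPart a) x d k)
    (fun w θ _ => norm_reducedG_le (by rw [hL1, hx]) (fun l => (hno l).le) d k w θ)
    (fun w θ _ => by
      rw [majorG_sub]
      refine norm_reducedG_sub_le hL1.symm (by rw [hx]) (fun l => ?_) d k w θ
      simp only [oddPart, ha]
      split_ifs <;> simp) k (θ := 2 * Real.pi) (by positivity)
  rw [← h1, ← h2, sub_zero] at key
  simp only [norm_cosC, norm_sinC] at key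
  exact key

theorem norm_holonomy_mul_pow_le {d : ℕ} (lam : Fin d → ℂ) {k : ℕ} (hk : k ≠ 1)
    {x β₀ Ψ₀ Ψ₁ E O χ b : ℝ} (hx : x = 2 / 3 * ‖lamSeq lam 1‖) (hβ₀ : 0 < β₀) (hxβ : x * β₀ < 1)
    (hΨ₀ : Ψ₀ = 1 / (1 - x * β₀)) (hΨ₁ : Ψ₁ = x * β₀ / (1 - x * β₀) ^ 2)
    (hE : ∑ l ∈ range (d + 1), (if 2 ≤ l then ‖lamSeq lam l‖ * β₀ ^ (l - 2) else 0) ≤ E)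
    (hO : ∑ l ∈ range (d + 1), (if 3 ≤ l ∧ Odd l then ‖lamSeq lam l‖ * β₀ ^ l else 0) ≤ O)
    (hχ0 : 0 < χ) (hχ : 1 ≤ χ * (1 - E * Ψ₀ * β₀ ^ 2 / 3)) (hb0 : 0 < b)
    (hb : (β₀ ^ 2)⁻¹ + E * Ψ₀ * χ * (Real.pi / 2) ≤ (b ^ 2)⁻¹) :
    ‖holonomy (lamSeq lam) k‖ * b ^ k ≤
    Ψ₀ * χ ^ 2 * β₀ * Real.exp (χ ^ 2 * (1.77 * Ψ₀ + 0.59 * Ψ₁) * O) *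
      ∑ l ∈ range (d + 1), if 2 ≤ l ∧ Even l then
        ‖lamSeq lam l‖ * β₀ ^ l * wallisConst (l / 2) else 0 := by
  set a : ℕ → ℝ := fun l => ‖lamSeq lam l‖ with ha
  have ha0 : ∀ l, 0 ≤ a l := fun l => norm_nonneg _
  have hx0 : 0 ≤ x := by rw [hx]; positivity
  have hao : ∀ l, 0 ≤ oddPart a l := fun l => by
    unfold oddPart; have := ha0 l; split_ifs <;> simp [this]
  have haole : ∀ l, oddPart a l ≤ a l := fun l => by
    unfold oddPart; have := ha0 l; split_ifs <;> simp [this]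
  have key := norm_holonomy_le_majorant lam hk hx
  have hmain := sum_majorant_sub_le d k ha0 hx0 hβ₀ hxβ (k + 1) hΨ₀ hΨ₁ hE hO hχ0 hχ hb0 hb
  refine le_trans ?_ hmain
  have hnn : ∀ j, 0 ≤ recV (|Real.cos ·|) (|Real.sin ·|) (majorG a x d k) j (2 * Real.pi) -
      recV (|Real.cos ·|) (|Real.sin ·|) (majorG (oddPart a) x d k) j (2 * Real.pi) := fun j => by
    have := norm_recV_sub_le (c := (|Real.cos ·|)) (s := (|Real.sin ·|)) (g := majorG a x d k)
      (h := majorG (oddPart a) x d k) Real.continuous_cos.abs Real.continuous_sin.abs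
      (continuous_majorG a x d k) (continuous_majorG (oddPart a) x d k)
      (continuous_majorG a x d k) (continuous_majorG (oddPart a) x d k)
      (fun w θ _ => by rw [Real.norm_of_nonneg (majorG_nonneg hao hx0 d k w θ)])
      (fun w θ _ => by
        rw [Real.norm_of_nonneg (sub_nonneg.2 (majorG_mono haole hx0 d k w θ))]) j
      (θ := 2 * Real.pi) (by positivity)
    simp only [Real.norm_eq_abs, abs_abs] at this
    exact (abs_nonneg _).trans this
  exact (mul_le_mul_of_nonneg_right key (by positivity)).trans (single_le_sum
    (f := fun j => (recV (|Real.cos ·|) (|Real.sin ·|) (majorG a x d k) j (2 * Real.pi) -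
      recV (|Real.cos ·|) (|Real.sin ·|) (majorG (oddPart a) x d k) j (2 * Real.pi)) * b ^ j)
    (fun j _ => mul_nonneg (hnn j) (by positivity)) (self_mem_range_succ k))

theorem exp_le_of_le {y Y : ℝ} (hy0 : 0 ≤ y) (hy1 : y ≤ 1)
    (h : 1 + y + y ^ 2 / 2 + y ^ 3 / 6 + y ^ 4 * 5 / 96 ≤ Y) : Real.exp y ≤ Y := by
  refine (Real.exp_bound' hy0 hy1 (n := 4) (by norm_num)).trans (le_trans (le_of_eq ?_) h)
  simp [sum_range_succ, Nat.factorial]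
  ring

/-- `norm_holonomy_mul_pow_le` with final radius `0.8`. When `p` is small the even and odd tails are
negligible, and when `p` is near `1` the first parameter is, so one set of constants serves all `p`.
-/
theorem norm_holonomy_le_even_sum {d : ℕ} (lam : Fin d → ℂ) {k : ℕ} (hk : k ≠ 1) {p : ℝ}
    (hp0 : 0 ≤ p) (hp1 : p ≤ 1) (hq : ‖lamSeq lam 1‖ = 1 - p)
    (h2 : ∑ l ∈ range (d + 1), (if 2 ≤ l then ‖lamSeq lam l‖ else 0) ≤ p ^ 2 / 4)
    (h3 : ∑ l ∈ range (d + 1), (if 3 ≤ l ∧ Odd l then ‖lamSeq lam l‖ else 0) ≤ 4 * p ^ 3 / 27) :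
    ‖holonomy (lamSeq lam) k‖ * 0.8 ^ k ≤
      1.3 * ∑ l ∈ range (d + 1), if 2 ≤ l ∧ Even l then ‖lamSeq lam l‖ else 0 := by
  -- The surplus `0.14 p` over the final radius pays for the decay of the barrier, which is of size
  -- `p² / D`.
  set β₀ : ℝ := 0.8 + 0.14 * p with hβ
  set x : ℝ := 2 / 3 * (1 - p) with hx
  set D := 1 - x * β₀ with hD
  have hDe : D = 7 / 15 + 0.44 * p + 7 / 75 * p ^ 2 := by rw [hD, hx, hβ]; ring
  have hβ0 : 0 < β₀ := by positivity
  have hβ1 : β₀ ≤ 0.94 := by linarith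
  have hβ1' : β₀ ≤ 1 := by linarith
  have hDpos : 0 < D := by rw [hDe]; positivity
  have hD1 : D ≤ 1 := by
    have : 0 ≤ x * β₀ := mul_nonneg (by rw [hx]; linarith) hβ0.le
    linarith
  have hpD : p ≤ D := by rw [hDe]; nlinarith
  have hO0 : 0 ≤ β₀ ^ 3 * (4 * p ^ 3 / 27) := by positivity
  have hmain := norm_holonomy_mul_pow_le lam hk (x := x) (β₀ := β₀) (Ψ₀ := 1 / D)
    (Ψ₁ := x * β₀ / D ^ 2) (E := p ^ 2 / 4) (O := β₀ ^ 3 * (4 * p ^ 3 / 27)) (χ := 1.08) (b := 0.8)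
    (by rw [hq]) hβ0 (by linarith) rfl rfl
    (le_trans (sum_le_sum fun l _ => by
      split_ifs
      · exact mul_le_of_le_one_right (norm_nonneg _) (pow_le_one₀ hβ0.le hβ1')
      · exact le_rfl) h2)
    (by
      refine le_trans ?_ (mul_le_mul_of_nonneg_left h3 (by positivity))
      rw [mul_sum]
      refine sum_le_sum fun l _ => ?_
      split_ifs with h
      · rw [mul_comm]
        exact mul_le_mul_of_nonneg_right (pow_le_pow_of_le_one hβ0.le hβ1' h.1) (norm_nonneg _)
      · simp)
    (by norm_num)
    (by
      have : p ^ 2 / 4 * (1 / D) * β₀ ^ 2 / 3 ≤ 0.074 := by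
        rw [show p ^ 2 / 4 * (1 / D) * β₀ ^ 2 / 3 = (p / D) * p * (β₀ ^ 2) / 12 by field_simp; ring]
        have k1 : p / D ≤ 1 := (div_le_one hDpos).2 hpD
        have k0 : 0 ≤ p / D := by positivity
        have k2 : β₀ ^ 2 ≤ 0.94 ^ 2 := pow_le_pow_left₀ hβ0.le hβ1 2
        have k3 : p / D * p ≤ 1 := mul_le_one₀ k1 hp0 hp1
        have k4 := mul_le_mul k3 k2 (by positivity) zero_le_one
        norm_num at k4 ⊢
        linarith
      linarith)
    (by norm_num)
    (by
      have hpi := Real.pi_lt_d4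
      have e1 : p ^ 2 / 4 * (1 / D) * 1.08 * (Real.pi / 2) ≤ 0.42414 * (p ^ 2 / D) := by
        have : 0 ≤ p ^ 2 / D := by positivity
        calc _ = (0.135 * Real.pi) * (p ^ 2 / D) := by ring
          _ ≤ _ := by gcongr; linarith
      have e2 : 0.42414 * (p ^ 2 / D) ≤ 1.5625 - (β₀ ^ 2)⁻¹ := by
        rw [show 0.42414 * (p ^ 2 / D) = 0.42414 * p ^ 2 / D by ring,
          show 1.5625 - (β₀ ^ 2)⁻¹ = (1.5625 * β₀ ^ 2 - 1) / β₀ ^ 2 by field_simp,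
          div_le_div_iff₀ hDpos (by positivity), hDe, hβ]
        have k : 0.42414 * p * (0.8 + 0.14 * p) ^ 2 ≤
            (0.35 + 0.030625 * p) * (7 / 15 + 0.44 * p + 7 / 75 * p ^ 2) := by
          nlinarith [mul_nonneg hp0 (sub_nonneg.2 hp1),
            mul_nonneg (mul_nonneg hp0 hp0) (sub_nonneg.2 hp1),
            mul_nonneg hp0 (mul_nonneg (sub_nonneg.2 hp1) (sub_nonneg.2 hp1))]
        have := mul_le_mul_of_nonneg_left k hp0
        linarith
      have e3 : ((0.8 : ℝ) ^ 2)⁻¹ = 1.5625 := by norm_num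
      rw [e3]; linarith)
  refine hmain.trans ?_
  have hexp : Real.exp (1.08 ^ 2 * (1.77 * (1 / D) + 0.59 * (x * β₀ / D ^ 2)) *
      (β₀ ^ 3 * (4 * p ^ 3 / 27))) ≤ 1.29 := by
    have hxb : x * β₀ = 1 - D := by rw [hD]; ring
    rw [hxb]
    have hle : 1.08 ^ 2 * (1.77 * (1 / D) + 0.59 * ((1 - D) / D ^ 2)) *
        (β₀ ^ 3 * (4 * p ^ 3 / 27)) ≤ 0.2541 := by
      have k1 : p / D ≤ 1 := (div_le_one hDpos).2 hpD
      have k0 : 0 ≤ p / D := by positivity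
      have k2 : (p / D) ^ 2 ≤ 1 := pow_le_one₀ k0 k1
      have k3 : β₀ ^ 3 ≤ 0.94 ^ 3 := pow_le_pow_left₀ hβ0.le hβ1 3
      have k4 : 1.77 * (p / D) * p ^ 2 + 0.59 * (1 - D) * (p / D) ^ 2 * p ≤ 1.77 := by
        have w1 : (p / D) * p ^ 2 ≤ p ^ 2 := mul_le_of_le_one_left (by positivity) k1
        have w2 : (p / D) ^ 2 * ((1 - D) * p) ≤ (1 - D) * p :=
          mul_le_of_le_one_left (mul_nonneg (by linarith) hp0) k2
        have w3 : (1 - D) * p ≤ (1 - p) * p := mul_le_mul_of_nonneg_right (by linarith) hp0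
        nlinarith
      have k5 : 0 ≤ 1.77 * (p / D) * p ^ 2 + 0.59 * (1 - D) * (p / D) ^ 2 * p := by
        have : 0 ≤ 1 - D := by linarith
        positivity
      calc _ = 1.08 ^ 2 * 4 / 27 * ((1.77 * (p / D) * p ^ 2 + 0.59 * (1 - D) * (p / D) ^ 2 * p) *
            β₀ ^ 3) := by field_simp
        _ ≤ 1.08 ^ 2 * 4 / 27 * (1.77 * 0.94 ^ 3) := by gcongr
        _ ≤ _ := by norm_num
    exact (Real.exp_le_exp.2 hle).trans (exp_le_of_le (by norm_num) (by norm_num) (by norm_num))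
  have hb3 : β₀ ^ 3 ≤ 1.0972 * D := by
    rw [hDe, hβ]
    nlinarith [mul_nonneg hp0 hp0, mul_nonneg (mul_nonneg hp0 hp0) (sub_nonneg.2 hp1)]
  set e := Real.exp (1.08 ^ 2 * (1.77 * (1 / D) + 0.59 * (x * β₀ / D ^ 2)) *
      (β₀ ^ 3 * (4 * p ^ 3 / 27))) with he
  have he0 : 0 < e := Real.exp_pos _
  have hsum : ∑ l ∈ range (d + 1), (if 2 ≤ l ∧ Even l then
      ‖lamSeq lam l‖ * β₀ ^ l * wallisConst (l / 2) else 0) ≤ (β₀ ^ 2 * (Real.pi / 4)) *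
      ∑ l ∈ range (d + 1), (if 2 ≤ l ∧ Even l then ‖lamSeq lam l‖ else 0) := by
    rw [mul_sum]
    refine sum_le_sum fun l _ => ?_
    split_ifs with h
    · have k1 : wallisConst (l / 2) ≤ Real.pi / 4 := by
        rw [← wallisConst_one]; exact wallisConst_antitone (by omega)
      have k2 : β₀ ^ l ≤ β₀ ^ 2 := pow_le_pow_of_le_one hβ0.le hβ1' h.1
      have k3 := wallisConst_pos (l / 2)
      calc _ = (β₀ ^ l * wallisConst (l / 2)) * ‖lamSeq lam l‖ := by ring
        _ ≤ _ := by gcongr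
    · simp
  have hs0 : 0 ≤ ∑ l ∈ range (d + 1), (if 2 ≤ l ∧ Even l then ‖lamSeq lam l‖ else 0) :=
    sum_nonneg fun l _ => by split_ifs <;> positivity
  calc _ ≤ 1 / D * 1.08 ^ 2 * β₀ * e * ((β₀ ^ 2 * (Real.pi / 4)) *
        ∑ l ∈ range (d + 1), (if 2 ≤ l ∧ Even l then ‖lamSeq lam l‖ else 0)) := by gcongr
    _ = (β₀ ^ 3 / D) * (1.08 ^ 2 * e * (Real.pi / 4)) *
        ∑ l ∈ range (d + 1), (if 2 ≤ l ∧ Even l then ‖lamSeq lam l‖ else 0) := by ring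
    _ ≤ 1.0972 * (1.08 ^ 2 * 1.29 * (3.1416 / 4)) *
        ∑ l ∈ range (d + 1), (if 2 ≤ l ∧ Even l then ‖lamSeq lam l‖ else 0) := by
        have k1 : β₀ ^ 3 / D ≤ 1.0972 := (div_le_iff₀ hDpos).2 hb3
        have k2 := Real.pi_lt_d4.le
        gcongr
    _ ≤ _ := by
        refine mul_le_mul_of_nonneg_right (by norm_num) hs0

end

/-! ### The non-linear part of `f_{2n+1}`. -/

noncomputable section

open Finset MeasureTheory

theorem truncated_rate_bound {p D β₀ : ℝ} (hp0 : 0 ≤ p) (hp1 : p ≤ 1) (hβ0 : 0 < β₀)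
    (hβle : β₀ ≤ 0.8923 + 0.09 * p ^ 2) (hD : 0.405 + 0.579 * p ≤ D) (hD1 : D ≤ 1) :
    (1.0096 + 0.0441 * p ^ 2) ^ 2 * (1.77 * (1 / D) + 0.59 * ((1 - D) / D ^ 2)) *
      (β₀ ^ 3 * (4 * p ^ 3 / 27)) ≤ 0.3389 * p ^ 2 := by
  have ht1 : p ^ 2 ≤ 1 := pow_le_one₀ hp0 hp1
  have hDpos : 0 < D := by linarith
  have k1 : p / D ≤ 1.0163 := by rw [div_le_iff₀ hDpos]; linarith
  have k2 : p / D ^ 2 ≤ 1.0662 := by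
    rw [div_le_iff₀ (by positivity)]
    nlinarith [sq_nonneg (0.405 - 0.579 * p)]
  have k3 : β₀ ^ 3 ≤ 0.9823 ^ 3 := pow_le_pow_left₀ hβ0.le (by linarith) 3
  have k4 : (1.0096 + 0.0441 * p ^ 2) ^ 2 ≤ 1.0537 ^ 2 :=
    pow_le_pow_left₀ (by positivity) (by linarith) 2
  have k5 : 0 ≤ p / D ^ 2 := by positivity
  have k6 : 1.77 * (p / D) + 0.59 * ((1 - D) * (p / D ^ 2)) ≤ 2.1732 := by
    have := mul_le_mul (show 1 - D ≤ 0.595 by linarith) k2 k5 (by norm_num)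
    linarith
  have k7 : 0 ≤ 1 - D := by linarith
  calc _ = (1.0096 + 0.0441 * p ^ 2) ^ 2 * (β₀ ^ 3 *
        (1.77 * (p / D) + 0.59 * ((1 - D) * (p / D ^ 2)))) * (4 / 27) * p ^ 2 := by field_simp
    _ ≤ 1.0537 ^ 2 * (0.9823 ^ 3 * 2.1732) * (4 / 27) * p ^ 2 := by gcongr
    _ ≤ 0.3389 * p ^ 2 := mul_le_mul_of_nonneg_right (by norm_num) (sq_nonneg p)

/-- Polynomial inequalities in `t = p²`, collecting the admissibility of the radius `β₀`, of `χ` and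
of the gap `δ` in the next estimate. -/
theorem truncated_radius_bound {t : ℝ} (ht0 : 0 ≤ t) (ht1 : t ≤ 1) :
    1 ≤ (0.8923 + 0.09 * t) ^ 2 * (1.2563 - 0.2152 * t) ∧
    1 ≤ (0.796 + 0.1646 * t) * (1.2563 - 0.2152 * t) ∧
    1 ≤ (1.0096 + 0.0441 * t) *
      (1 - (0.029 + 0.13 * t) * (0.796 + 0.1646 * t) / 3) ∧
    (0.029 + 0.13 * t) * (1.0096 + 0.0441 * t) * (3.1416 / 2) ≤ 0.048 + 0.2152 * t ∧
    (1.0096 + 0.0441 * t) ^ 2 ≤ 1.0193 + 0.0911 * t := by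
  have h2 : 0 ≤ t * (1 - t) := mul_nonneg ht0 (sub_nonneg.2 ht1)
  have h3 : 0 ≤ t * t * (1 - t) := mul_nonneg (mul_nonneg ht0 ht0) (sub_nonneg.2 ht1)
  refine ⟨?_, ?_, ?_, ?_, ?_⟩ <;> linarith

/-- A bound for the first Lyapunov coefficient not controlled by the preceding ones, when the
parameters of index at least `2n` vanish. -/
theorem norm_holonomy_le_of_truncated {n d : ℕ} (hn : 3 ≤ n) (lam : Fin d → ℂ)
    (ht : ∀ l, 2 * n ≤ l → lamSeq lam l = 0) {p : ℝ} (hp0 : 0 ≤ p) (hp1 : p ≤ 1)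
    (hq : ‖lamSeq lam 1‖ = 1 - p)
    (h3 : ∑ l ∈ range (d + 1), (if 3 ≤ l ∧ Odd l then ‖lamSeq lam l‖ else 0) ≤ 4 * p ^ 3 / 27)
    (h2 : ∑ l ∈ range (d + 1), (if 2 ≤ l ∧ Even l then ‖lamSeq lam l‖ else 0) ≤ 0.0104) :
    ‖holonomy (lamSeq lam) (2 * n + 1)‖ ≤
      3 * ∑ l ∈ range (d + 1), if 2 ≤ l ∧ Even l then
        ‖lamSeq lam l‖ * wallisConst (l / 2) * ((n : ℝ) / 2.3) ^ (n - l / 2) else 0 := by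
  have ht0 : 0 ≤ p ^ 2 := sq_nonneg p
  have ht1 : p ^ 2 ≤ 1 := pow_le_one₀ hp0 hp1
  have hn3 : (3 : ℝ) ≤ n := by exact_mod_cast hn
  -- The final radius is `N^{-1/2}`, depending on `n`: then `b^{2n+1} N^{n-i} = b^{2i+1}`, so the
  -- weights in the conclusion match powers of the radius exactly.
  set N : ℝ := (n : ℝ) / 2.3 with hN
  have hN1 : 1.3043 ≤ N := by rw [hN, le_div_iff₀ (by norm_num)]; linarith
  have hnN : (n : ℝ) = 2.3 * N := by rw [hN]; field_simp
  have hNpos : 0 < N := by linarith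
  -- `δ` is the gap between `b^{-2} = N` and `β₀^{-2} = V`; it must bound the total growth `E Ψ₀ χ π
  -- / 2` of `β^{-2}`.
  set δ : ℝ := 0.048 + 0.2152 * p ^ 2 with hδ
  have hδ0 : 0 < δ := by positivity
  set V := N - δ with hV
  have hV1 : 1.2563 - 0.2152 * p ^ 2 ≤ V := by rw [hV, hδ]; linarith
  have hVpos : 0 < V := by linarith
  set b : ℝ := (√N)⁻¹ with hb
  have hb0 : 0 < b := inv_pos.2 (Real.sqrt_pos.2 hNpos)
  have hb2 : (b ^ 2)⁻¹ = N := by rw [hb, inv_pow, Real.sq_sqrt hNpos.le, inv_inv]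
  set β₀ : ℝ := (√V)⁻¹ with hβ
  have hβ0 : 0 < β₀ := inv_pos.2 (Real.sqrt_pos.2 hVpos)
  have hβ2 : (β₀ ^ 2)⁻¹ = V := by rw [hβ, inv_pow, Real.sq_sqrt hVpos.le, inv_inv]
  have hβ2V : β₀ ^ 2 * V = 1 := by rw [← hβ2]; field_simp
  have hβsq : β₀ ^ 2 ≤ 0.796 + 0.1646 * p ^ 2 := by
    have : β₀ ^ 2 * (1.2563 - 0.2152 * p ^ 2) ≤ 1 :=
      (mul_le_mul_of_nonneg_left hV1 (sq_nonneg _)).trans hβ2V.le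
    exact le_of_mul_le_mul_right (this.trans (truncated_radius_bound ht0 ht1).2.1) (by linarith)
  have hβle : β₀ ≤ 0.8923 + 0.09 * p ^ 2 := by
    refine (pow_le_pow_iff_left₀ hβ0.le (by positivity) two_ne_zero).1 ?_
    have : β₀ ^ 2 * (1.2563 - 0.2152 * p ^ 2) ≤ 1 :=
      (mul_le_mul_of_nonneg_left hV1 (sq_nonneg _)).trans hβ2V.le
    exact le_of_mul_le_mul_right (this.trans (truncated_radius_bound ht0 ht1).1) (by linarith)
  have hβ1 : β₀ ≤ 1 := by linarith
  set x : ℝ := 2 / 3 * (1 - p) with hx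
  have hx0 : 0 ≤ x := by rw [hx]; linarith
  set D := 1 - x * β₀ with hD
  have hDlow : 0.405 + 0.579 * p ≤ D := by
    have h1 : x * β₀ ≤ x * (0.8923 + 0.09 * p ^ 2) := mul_le_mul_of_nonneg_left hβle hx0
    have h2 : 0 ≤ p * (0.06 * (p - 0.5) ^ 2) := by positivity
    rw [hx] at h1
    rw [hD, hx]
    linarith
  have hDpos : 0 < D := by linarith
  have hD1 : D ≤ 1 := by have := mul_nonneg hx0 hβ0.le; linarith
  set E : ℝ := 0.0104 + β₀ * (4 * p ^ 3 / 27) with hE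
  set ε : ℝ := 0.029 + 0.13 * p ^ 2 with hε
  have hEε : E * (1 / D) ≤ ε := by
    rw [mul_one_div, div_le_iff₀ hDpos]
    refine le_trans ?_ (mul_le_mul_of_nonneg_left hDlow (by positivity))
    have h1 : β₀ * (4 * p ^ 3 / 27) ≤ (0.8923 + 0.09) * (4 * p ^ 3 / 27) :=
      mul_le_mul_of_nonneg_right (by linarith) (by positivity)
    have h4 : p ^ 3 ≤ p ^ 2 := pow_le_pow_of_le_one hp0 hp1 (by norm_num)
    have h5 : p ^ 3 ≤ p := pow_le_of_le_one hp0 hp1 (by norm_num)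
    rw [hE, hε]
    have h6 : p ^ 2 * p = p ^ 3 := by ring
    have h7 : p ^ 3 ≤ 1 := pow_le_one₀ hp0 hp1
    linarith
  set χ : ℝ := 1.0096 + 0.0441 * p ^ 2 with hχ
  have hE0 : 0 ≤ E := by positivity
  have hmain := norm_holonomy_mul_pow_le lam (k := 2 * n + 1) (by omega) (x := x) (β₀ := β₀)
    (Ψ₀ := 1 / D) (Ψ₁ := x * β₀ / D ^ 2) (E := E) (O := β₀ ^ 3 * (4 * p ^ 3 / 27)) (χ := χ) (b := b)
    (by rw [hq]) hβ0 (by linarith) rfl rfl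
    (by
      refine le_trans ?_ (add_le_add h2 (mul_le_mul_of_nonneg_left h3 hβ0.le))
      rw [mul_sum, ← sum_add_distrib]
      refine sum_le_sum fun l _ => ?_
      by_cases hl : 2 ≤ l
      · by_cases he : Even l
        · have ho : ¬(3 ≤ l ∧ Odd l) := fun h => (Nat.not_odd_iff_even.2 he) h.2
          rw [if_pos hl, if_pos ⟨hl, he⟩, if_neg ho, mul_zero, add_zero]
          exact mul_le_of_le_one_right (norm_nonneg _) (pow_le_one₀ hβ0.le hβ1)
        · have ho := Nat.not_even_iff_odd.1 he
          have hl3 : 3 ≤ l := by obtain ⟨j, rfl⟩ := ho; omega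
          rw [if_pos hl, if_neg (fun h => he h.2), if_pos ⟨hl3, ho⟩, zero_add, mul_comm]
          exact mul_le_mul_of_nonneg_right (pow_le_of_le_one hβ0.le hβ1 (by omega)) (norm_nonneg _)
      · rw [if_neg hl, if_neg (fun h => hl h.1), if_neg (fun h => by omega)]; simp)
    (by
      refine le_trans ?_ (mul_le_mul_of_nonneg_left h3 (by positivity))
      rw [mul_sum]
      refine sum_le_sum fun l _ => ?_
      split_ifs with h
      · rw [mul_comm]
        exact mul_le_mul_of_nonneg_right (pow_le_pow_of_le_one hβ0.le hβ1 h.1) (norm_nonneg _)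
      · simp)
    (by positivity)
    (by
      have h1 : E * (1 / D) * β₀ ^ 2 ≤ ε * (0.796 + 0.1646 * p ^ 2) := by gcongr
      have h4 : 1 ≤ χ * (1 - ε * (0.796 + 0.1646 * p ^ 2) / 3) := by
        rw [hχ, hε]
        exact (truncated_radius_bound ht0 ht1).2.2.1
      exact h4.trans (mul_le_mul_of_nonneg_left (by linarith) (by positivity)))
    hb0
    (by
      rw [hβ2, hb2]
      have h1 : E * (1 / D) * χ * (Real.pi / 2) ≤ ε * χ * (3.1416 / 2) := by
        have := Real.pi_lt_d4.le
        gcongr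
      have h4 : ε * χ * (3.1416 / 2) ≤ δ := by
        rw [hε, hχ, hδ]
        exact (truncated_radius_bound ht0 ht1).2.2.2.1
      linarith)
  set e := Real.exp (χ ^ 2 * (1.77 * (1 / D) + 0.59 * (x * β₀ / D ^ 2)) *
    (β₀ ^ 3 * (4 * p ^ 3 / 27))) with he
  have he0 : 0 < e := Real.exp_pos _
  have hele : e ≤ Real.exp (0.3389 * p ^ 2) := by
    have hxb : x * β₀ = 1 - D := by rw [hD]; ring
    rw [he, hxb]
    exact Real.exp_le_exp.2 (truncated_rate_bound hp0 hp1 hβ0 hβle hDlow hD1)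
  set σ := β₀ / b with hσ
  have hσb : β₀ = σ * b := by rw [hσ]; field_simp
  have hVN : V ≤ N := by rw [hV]; linarith
  have hσ0 : 0 < σ := by positivity
  have hσsq : σ ^ 2 = N / V := by
    rw [hσ, div_pow, ← hb2, ← hβ2]; field_simp
  have hσ1 : 1 ≤ σ := by
    refine (one_le_sq_iff₀ hσ0.le).1 ?_
    rw [hσsq]; exact (one_le_div hVpos).2 hVN
  -- The ratio of the radii satisfies `σ² = 1 + δ / V`, and `2n - 1 ≤ 4.804 V`, so the power stays
  -- bounded uniformly in `n`. This is what a radius of order `n^{-1/2}` achieves.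
  have hσpow : σ ^ (2 * n - 1) ≤ Real.exp (2.402 * δ) := by
    refine (pow_le_pow_iff_left₀ (by positivity) (Real.exp_pos _).le two_ne_zero).1 ?_
    have h1 : σ ^ 2 ≤ Real.exp (δ / V) := by
      rw [hσsq]
      refine le_trans (le_of_eq ?_) (Real.add_one_le_exp _)
      rw [show N = V + δ by rw [hV]; ring, add_div, div_self hVpos.ne', add_comm]
    calc (σ ^ (2 * n - 1)) ^ 2 = (σ ^ 2) ^ (2 * n - 1) := by ring
      _ ≤ (Real.exp (δ / V)) ^ (2 * n - 1) := pow_le_pow_left₀ (sq_nonneg _) h1 _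
      _ = Real.exp ((2 * n - 1 : ℕ) * (δ / V)) := by rw [← Real.exp_nat_mul]
      _ ≤ Real.exp ((2 : ℕ) * (2.402 * δ)) := by
          refine Real.exp_le_exp.2 ?_
          rw [← mul_div_assoc, div_le_iff₀ hVpos, Nat.cast_sub (by omega)]
          push_cast
          have h4 : 2 * (n : ℝ) - 1 ≤ 4.804 * V := by rw [hnN, hV, hδ]; linarith
          calc _ ≤ 4.804 * V * δ := mul_le_mul_of_nonneg_right h4 hδ0.le
            _ = _ := by ring
      _ = _ := by rw [Real.exp_nat_mul]
  have hfinal : 1 / D * χ ^ 2 * (e * σ ^ (2 * n - 1)) ≤ 3 := by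
    have h1 : e * σ ^ (2 * n - 1) ≤ 1.1225 * (1 + 1.36 * p ^ 2) := by
      calc _ ≤ Real.exp (0.3389 * p ^ 2) * Real.exp (2.402 * δ) := by gcongr
        _ ≤ Real.exp (0.1153) * Real.exp (0.856 * p ^ 2) := by
            rw [← Real.exp_add, ← Real.exp_add]
            refine Real.exp_le_exp.2 ?_
            rw [hδ]; linarith
        _ ≤ _ := by
            refine mul_le_mul (exp_le_of_le (by norm_num) (by norm_num) (by norm_num))
              (exp_le_of_le (by positivity) (by linarith) ?_) (Real.exp_pos _).le (by norm_num)
            have w2 : (p ^ 2) ^ 2 ≤ p ^ 2 := pow_le_of_le_one ht0 ht1 (by norm_num)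
            have w3 : (p ^ 2) ^ 3 ≤ p ^ 2 := pow_le_of_le_one ht0 ht1 (by norm_num)
            have w4 : (p ^ 2) ^ 4 ≤ p ^ 2 := pow_le_of_le_one ht0 ht1 (by norm_num)
            rw [mul_pow, mul_pow, mul_pow]
            norm_num
            linarith
    have h4 : χ ^ 2 ≤ 1.0193 + 0.0911 * p ^ 2 := by
      rw [hχ]; exact (truncated_radius_bound ht0 ht1).2.2.2.2
    calc _ ≤ 1 / D * (1.0193 + 0.0911 * p ^ 2) * (1.1225 * (1 + 1.36 * p ^ 2)) := by gcongr
      _ = (1.0193 + 0.0911 * p ^ 2) * (1.1225 * (1 + 1.36 * p ^ 2)) / D := by ring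
      _ ≤ 3 := by
          rw [div_le_iff₀ hDpos]
          have w1 : p ^ 2 ≤ p := pow_le_of_le_one hp0 hp1 (by norm_num)
          have w2 : (p ^ 2) ^ 2 ≤ p ^ 2 := pow_le_of_le_one ht0 ht1 (by norm_num)
          linarith only [w1, w2, hDlow, hp0, hp1]
  set S := ∑ l ∈ range (d + 1), (if 2 ≤ l ∧ Even l then
      ‖lamSeq lam l‖ * wallisConst (l / 2) * N ^ (n - l / 2) else 0) with hS
  have hs0 : 0 ≤ S :=
    sum_nonneg fun l _ => by have := wallisConst_pos (l / 2); split_ifs <;> positivity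
  have hsum : β₀ * ∑ l ∈ range (d + 1), (if 2 ≤ l ∧ Even l then
      ‖lamSeq lam l‖ * β₀ ^ l * wallisConst (l / 2) else 0) ≤ σ ^ (2 * n - 1) * b ^ (2 * n + 1) * S := by
    rw [hS, mul_sum, mul_sum]
    refine sum_le_sum fun l _ => ?_
    split_ifs with h
    · rcases le_or_gt (2 * n) l with hl | hl
      · rw [ht l hl]; simp
      · obtain ⟨-, i, hi⟩ := h
        have hi2 : l / 2 = i := by omega
        rw [hi2]
        have e1 : b ^ (2 * n + 1) * N ^ (n - i) = b ^ (l + 1) := by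
          have : 2 * n + 1 = (l + 1) + 2 * (n - i) := by omega
          rw [this, pow_add, pow_mul, mul_assoc, ← hb2, ← mul_pow,
            mul_inv_cancel₀ (pow_ne_zero 2 hb0.ne'), one_pow, mul_one]
        have e2 : σ ^ (l + 1) ≤ σ ^ (2 * n - 1) := pow_le_pow_right₀ hσ1 (by omega)
        have hw := wallisConst_pos i
        calc _ = ‖lamSeq lam l‖ * wallisConst i * β₀ ^ (l + 1) := by ring
          _ = ‖lamSeq lam l‖ * wallisConst i * (σ ^ (l + 1) * b ^ (l + 1)) := by
              rw [hσb, mul_pow]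
          _ ≤ ‖lamSeq lam l‖ * wallisConst i * (σ ^ (2 * n - 1) * b ^ (l + 1)) := by gcongr
          _ = _ := by rw [← e1]; ring
    · simp
  have hbp : 0 < b ^ (2 * n + 1) := by positivity
  refine le_of_mul_le_mul_right (hmain.trans ?_) hbp
  calc _ = 1 / D * χ ^ 2 * e * (β₀ * ∑ l ∈ range (d + 1), (if 2 ≤ l ∧ Even l then
        ‖lamSeq lam l‖ * β₀ ^ l * wallisConst (l / 2) else 0)) := by ring
    _ ≤ 1 / D * χ ^ 2 * e * (σ ^ (2 * n - 1) * b ^ (2 * n + 1) * S) := by gcongr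
    _ = 1 / D * χ ^ 2 * (e * σ ^ (2 * n - 1)) * (S * b ^ (2 * n + 1)) := by ring
    _ ≤ 3 * (S * b ^ (2 * n + 1)) := by gcongr
    _ = _ := by ring

end

/-! ### Explicit estimates for `f_4`, `f_5`, `f_6`. -/

noncomputable section

open Finset MeasureTheory

section Majorant

theorem majorG_eq_of_small {a : ℕ → ℝ} {d : ℕ} (ha4 : ∀ l, 4 ≤ l → a l = 0)
    (had : ∀ l, d < l → a l = 0) (x : ℝ) (T w : ℕ) (θ : ℝ) : majorG a x d T w θ =
      (if 2 ≤ w ∧ w - 2 < T then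
        a 2 * x ^ (w - 2) * |Real.cos θ| ^ 2 * |Real.sin θ| ^ (w - 2 + 1) else 0) +
      (if 3 ≤ w ∧ w - 3 < T then
        a 3 * x ^ (w - 3) * |Real.cos θ| ^ 3 * |Real.sin θ| ^ (w - 3 + 1) else 0) := by
  unfold majorG
  set f : ℕ → ℝ := fun l => if 2 ≤ l ∧ l ≤ w ∧ w - l < T then
    a l * x ^ (w - l) * |Real.cos θ| ^ l * |Real.sin θ| ^ (w - l + 1) else 0 with hf
  have hz : ∀ l, a l = 0 → f l = 0 := fun l hl => by simp [hf, hl]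
  have h1 : ∑ l ∈ range (d + 1), f l = ∑ l ∈ range (d + 4), f l :=
    sum_subset (range_subset_range.2 (by omega)) fun l _ hl => hz l (had l (by
      have := mem_range.not.1 hl; omega))
  have h2 : ∑ l ∈ range 4, f l = ∑ l ∈ range (d + 4), f l :=
    sum_subset (range_subset_range.2 (by omega)) fun l _ hl => hz l (ha4 l (by
      have := mem_range.not.1 hl; omega))
  change ∑ l ∈ range (d + 1), f l = _
  rw [h1, ← h2]
  simp [sum_range_succ, hf]

variable {a b : ℝ → ℝ} {γ : ℕ → ℝ → ℝ}

/-- Once `λ_1` has been eliminated there is no `γ 1`; hence `v_2 = 0` and only a few products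
survive. -/
theorem recD_four_five_six (h1 : γ 1 = 0) (θ : ℝ) :
    recD a b γ 3 θ = γ 2 θ * b θ ∧ recD a b γ 4 θ = γ 3 θ * b θ ∧
    recD a b γ 5 θ = γ 4 θ * b θ + γ 2 θ * recX a b γ 3 θ ∧
    recD a b γ 6 θ = γ 5 θ * b θ + γ 3 θ * recX a b γ 3 θ + γ 2 θ * recX a b γ 4 θ := by
  have hD2 : recD a b γ 2 = 0 := by
    funext t; rw [recD_eq]; simp [sum_range_succ, recX_zero, h1]
  have hX2 : recX a b γ 2 = 0 := by
    funext t; simp [recX, recV, hD2]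
  refine ⟨?_, ?_, ?_, ?_⟩ <;> rw [recD_eq] <;>
    simp [sum_range_succ, recX_zero, recX_one, h1, hX2]

/-- The part of first order in `γ` comes from `j = 1`, where `X_1 = b`. Every other term contains at
least two factors `γ`, hence `ε²`. -/
theorem recD_smul_le (ha : Continuous a) (hb : Continuous b) (ha0 : ∀ θ, 0 ≤ a θ)
    (hb0 : ∀ θ, 0 ≤ b θ) (hγ : ∀ w, Continuous (γ w)) (hγ0 : ∀ w θ, 0 ≤ γ w θ) {ε : ℝ}
    (hε0 : 0 ≤ ε) (hε1 : ε ≤ 1) {k : ℕ} (hk : 2 ≤ k) {θ : ℝ} (hθ : 0 ≤ θ) :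
    recD a b (fun w t => ε * γ w t) k θ ≤
      ε * γ (k - 1) θ * b θ + ε ^ 2 * recD a b γ k θ := by
  have ea : (fun t => ‖a t‖) = a := funext fun t => Real.norm_of_nonneg (ha0 t)
  have eb : (fun t => ‖b t‖) = b := funext fun t => Real.norm_of_nonneg (hb0 t)
  set γ' : ℕ → ℝ → ℝ := fun w t => ε * γ w t with hγ'
  have hγc' : ∀ w, Continuous (γ' w) := fun w => continuous_const.mul (hγ w)
  have hγ0' : ∀ w θ, 0 ≤ γ' w θ := fun w θ => mul_nonneg hε0 (hγ0 w θ)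
  have hmono : ∀ j θ, 0 ≤ θ → recX a b γ' j θ ≤ recX a b γ j θ := fun j θ hθ => by
    have h := norm_recX_le (c := a) (s := b) (g := γ') (γ := γ) ha hb hγc' hγ (fun w θ _ => by
      rw [Real.norm_of_nonneg (hγ0' w θ)]
      exact mul_le_of_le_one_left (hγ0 w θ) hε1) j hθ
    rw [ea, eb] at h
    exact (le_abs_self _).trans h
  have hnn := fun j θ (hθ : 0 ≤ θ) => recD_recV_nonneg ha hb ha0 hb0 hγ hγ0 j hθ
  have hD : ∀ j θ, 0 ≤ θ → recD a b γ' j θ ≤ ε * recD a b γ j θ := fun j θ hθ => by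
    rw [recD_eq, recD_eq, mul_sum]
    refine sum_le_sum fun i _ => ?_
    simp only [hγ', mul_assoc]
    exact mul_le_mul_of_nonneg_left (mul_le_mul_of_nonneg_left (hmono i θ hθ) (hγ0 _ _)) hε0
  have hX : ∀ j θ, j ≠ 1 → 0 ≤ θ → recX a b γ' j θ ≤ ε * recX a b γ j θ := fun j θ hj hθ => by
    have hV : recV a b γ' j θ ≤ ε * recV a b γ j θ := by
      unfold recV
      rw [if_neg hj, zero_add, zero_add, ← intervalIntegral.integral_const_mul]
      exact intervalIntegral.integral_mono_on hθ
        ((continuous_recD ha hb hγc' j).intervalIntegrable _ _)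
        ((continuous_const.mul (continuous_recD ha hb hγ j)).intervalIntegrable _ _)
        fun t ht => hD j t ht.1
    unfold recX
    have h1 := mul_le_mul_of_nonneg_left (hD j θ hθ) (ha0 θ)
    have h2 := mul_le_mul_of_nonneg_left hV (mul_nonneg (Nat.cast_nonneg (α := ℝ) j) (hb0 θ))
    linarith
  obtain ⟨m, rfl⟩ := Nat.exists_eq_add_of_le hk
  have hsplit : ∀ g : ℕ → ℝ → ℝ, recD a b g (2 + m) θ = g (2 + m - 1) θ * b θ +
      ∑ i ∈ range m, g (2 + m - (i + 2)) θ * recX a b g (i + 2) θ := fun g => by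
    rw [recD_eq, add_comm 2 m, sum_range_succ', sum_range_succ', recX_zero, recX_one]
    simp only [mul_zero, add_zero, zero_add]
    exact add_comm _ _
  rw [hsplit γ', hsplit γ]
  have hsum : ∑ i ∈ range m, γ' (2 + m - (i + 2)) θ * recX a b γ' (i + 2) θ ≤
      ε ^ 2 * ∑ i ∈ range m, γ (2 + m - (i + 2)) θ * recX a b γ (i + 2) θ := by
    rw [mul_sum]
    refine sum_le_sum fun i _ => ?_
    calc _ ≤ ε * γ (2 + m - (i + 2)) θ * (ε * recX a b γ (i + 2) θ) :=
          mul_le_mul_of_nonneg_left (hX (i + 2) θ (by omega) hθ) (hγ0' _ _)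
      _ = _ := by ring
  have h3 : 0 ≤ ε ^ 2 * (γ (2 + m - 1) θ * b θ) := by have := hγ0 (2 + m - 1) θ; have := hb0 θ; positivity
  have h4 : γ' (2 + m - 1) θ = ε * γ (2 + m - 1) θ := rfl
  rw [h4]
  linarith

end Majorant

theorem integral_le_of_hasDerivAt {f G G' : ℝ → ℝ} (hf : Continuous f) (hG' : Continuous G')
    (hG : ∀ θ, HasDerivAt G (G' θ) θ) {T : ℝ} (hT : 0 ≤ T) (h : ∀ θ, 0 ≤ θ → θ ≤ T → f θ ≤ G' θ) :
    ∫ θ in (0 : ℝ)..T, f θ ≤ G T - G 0 := by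
  rw [← intervalIntegral.integral_eq_sub_of_hasDerivAt (fun θ _ => hG θ)
    (hG'.intervalIntegrable _ _)]
  exact intervalIntegral.integral_mono_on hT (hf.intervalIntegrable _ _)
    (hG'.intervalIntegrable _ _) fun t ht => h t ht.1 ht.2

/-- Explicit bounds for the coefficients of degree four, five and six. -/
theorem norm_holonomy_four_five_six {d : ℕ} (lam : Fin d → ℂ)
    (h4 : ∀ l, 4 ≤ l → lamSeq lam l = 0) {q a₂ a₃ : ℝ} (hq : ‖lamSeq lam 1‖ = q)
    (ha₂ : ‖lamSeq lam 2‖ = a₂) (ha₃ : ‖lamSeq lam 3‖ = a₃) :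
    ‖holonomy (lamSeq lam) 4‖ ≤ a₂ * (2 / 3 * q) * (Real.pi / 4) ∧
    ‖holonomy (lamSeq lam) 5‖ ≤ a₂ * ((2 / 3 * q) ^ 2 * (Real.pi / 8) +
      a₂ * (Real.pi / 12 + 3 / 2 * (Real.pi / 4) ^ 2)) ∧
    ‖holonomy (lamSeq lam) 6‖ ≤ a₂ * ((2 / 3 * q) ^ 3 * (Real.pi / 4) +
      (a₂ * (2 / 3 * q) + a₃) * (Real.pi / 6 + 7 / 2 * (Real.pi / 4) ^ 2)) := by
  set x := 2 / 3 * q with hx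
  set a : ℕ → ℝ := fun l => ‖lamSeq lam l‖ with ha
  have hq0 : 0 ≤ q := by rw [← hq]; exact norm_nonneg _
  have hx0 : 0 ≤ x := by positivity
  have ha0 : ∀ l, 0 ≤ a l := fun l => norm_nonneg _
  have ha2 : a 2 = a₂ := ha₂
  have ha3 : a 3 = a₃ := ha₃
  have ha₂0 : 0 ≤ a₂ := ha2 ▸ ha0 2
  have ha₃0 : 0 ≤ a₃ := ha3 ▸ ha0 3
  have hao : ∀ l, 0 ≤ oddPart a l := fun l => by
    unfold oddPart; have := ha0 l; split_ifs <;> simp [this]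
  have hcos : Continuous fun θ => |Real.cos θ| := Real.continuous_cos.abs
  have hsin : Continuous fun θ => |Real.sin θ| := Real.continuous_sin.abs
  have hcos0 : ∀ θ, 0 ≤ |Real.cos θ| := fun _ => abs_nonneg _
  have hsin0 : ∀ θ, 0 ≤ |Real.sin θ| := fun _ => abs_nonneg _
  have e1 := fun T w θ => majorG_eq_of_small (a := a) (d := d) (fun l hl => by simp [ha, h4 l hl])
    (fun l hl => by simp [ha, lamSeq_of_lt lam hl]) x T w θ
  have e2 := fun T w θ => majorG_eq_of_small (a := oddPart a) (d := d)
    (fun l hl => by simp [oddPart, ha, h4 l hl])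
    (fun l hl => by simp [oddPart, ha, lamSeq_of_lt lam hl]) x T w θ
  have o2 : oddPart a 2 = 0 := by simp [oddPart]
  have o3 : oddPart a 3 = a 3 := by simp [oddPart, show Odd 3 by decide]
  rw [o2, o3] at e2
  have key : ∀ k, k ≠ 1 → ‖holonomy (lamSeq lam) k‖ ≤ ∫ θ in (0 : ℝ)..(2 * Real.pi),
      (recD (|Real.cos ·|) (|Real.sin ·|) (majorG a x d k) k θ -
        recD (|Real.cos ·|) (|Real.sin ·|) (majorG (oddPart a) x d k) k θ) := fun k hk => by
    refine (norm_holonomy_le_majorant lam hk (x := x) (by rw [hx, hq])).trans (le_of_eq ?_)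
    unfold recV
    rw [if_neg hk, zero_add, zero_add, intervalIntegral.integral_sub
      ((continuous_recD hcos hsin (continuous_majorG a x d k) k).intervalIntegrable _ _)
      ((continuous_recD hcos hsin (continuous_majorG _ x d k) k).intervalIntegrable _ _)]
  have hfc : ∀ k, Continuous fun θ => recD (|Real.cos ·|) (|Real.sin ·|) (majorG a x d k) k θ -
        recD (|Real.cos ·|) (|Real.sin ·|) (majorG (oddPart a) x d k) k θ := fun k =>
    (continuous_recD hcos hsin (continuous_majorG a x d k) k).sub
      (continuous_recD hcos hsin (continuous_majorG _ x d k) k)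
  set f : ℝ → ℝ := fun t => Real.cos t ^ 2 * Real.sin t ^ 2 with hf
  have hfcont : Continuous f := by fun_prop
  set I : ℝ → ℝ := fun θ => ∫ t in (0 : ℝ)..θ, f t with hI
  have hId := hasDerivAt_primitive hfcont
  have hI0 : I 0 = 0 := intervalIntegral.integral_same
  have hI2 : I (2 * Real.pi) = Real.pi / 4 := by
    rw [← wallisConst_one, hI, hf, wallisConst]
  have hIcont : Continuous I := continuous_iff_continuousAt.2 fun θ => (hId θ).continuousAt
  have hInn : ∀ θ, 0 ≤ θ → 0 ≤ I θ := fun θ hθ =>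
    intervalIntegral.integral_nonneg hθ fun t _ => by positivity
  have hγ1 : ∀ (b : ℕ → ℝ) k, majorG b x d k 1 = 0 := fun b k =>
    funext fun θ => sum_eq_zero fun l _ => if_neg (by omega)
  have hpi : 0 ≤ 2 * Real.pi := by positivity
  -- the low-order terms of the majorants
  have hD3 : ∀ k θ, 3 ≤ k → recD (|Real.cos ·|) (|Real.sin ·|) (majorG a x d k) 3 θ = a₂ * f θ :=
    fun k θ hk => by
      rw [(recD_four_five_six (hγ1 a k) θ).1, e1]
      simp [show 0 < k by omega, ha2, hf]
      rw [← sq_abs (Real.sin θ)]; ring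
  have hV3 : ∀ k θ, 3 ≤ k → recV (|Real.cos ·|) (|Real.sin ·|) (majorG a x d k) 3 θ = a₂ * I θ :=
    fun k θ hk => by
      unfold recV
      simp only [hD3 k _ hk]
      rw [intervalIntegral.integral_const_mul]; simp [hI]
  have hX3 : ∀ k θ, 3 ≤ k → recX (|Real.cos ·|) (|Real.sin ·|) (majorG a x d k) 3 θ =
      a₂ * (|Real.cos θ| * f θ + 3 * |Real.sin θ| * I θ) := fun k θ hk => by
    unfold recX; rw [hD3 k θ hk, hV3 k θ hk]; push_cast; ring
  -- The odd majorant has no entry at `w = 2`, so its `v_3` vanishes and its quadratic terms of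
  -- these degrees drop out.
  have hX3o : ∀ k θ, 3 ≤ k →
      recX (|Real.cos ·|) (|Real.sin ·|) (majorG (oddPart a) x d k) 3 θ = 0 := fun k θ hk => by
    have : recD (|Real.cos ·|) (|Real.sin ·|) (majorG (oddPart a) x d k) 3 = fun _ => 0 := by
      funext t
      rw [(recD_four_five_six (hγ1 _ k) t).1, e2]
      simp
    simp [recX, recV, this]
  have hcs : ∀ θ, |Real.cos θ| ^ 2 * |Real.sin θ| * (|Real.cos θ| * f θ) ≤ f θ / 3 := fun θ => by
    have h := abs_cos_cube_mul_abs_sin_le θ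
    have : 0 ≤ f θ := by positivity
    calc _ = |Real.cos θ| ^ 3 * |Real.sin θ| * f θ := by ring
      _ ≤ 1 / 3 * f θ := mul_le_mul_of_nonneg_right h this
      _ = _ := by ring
  have hfabs : ∀ θ, |Real.cos θ| ^ 2 * |Real.sin θ| ^ 2 = f θ := fun θ => by
    rw [sq_abs, sq_abs]
  have hs1 : ∀ θ n, |Real.sin θ| ^ n ≤ 1 := fun θ n =>
    pow_le_one₀ (abs_nonneg _) (Real.abs_sin_le_one θ)
  refine ⟨?_, ?_, ?_⟩
  · refine (key 4 (by norm_num)).trans ((integral_le_of_hasDerivAt (G := fun θ => a₂ * x * I θ)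
      (hfc 4) (by fun_prop) (fun θ => (hId θ).const_mul _) hpi fun θ hθ _ => ?_).trans (le_of_eq ?_))
    · rw [(recD_four_five_six (hγ1 _ 4) θ).2.1,
        (recD_four_five_six (hγ1 _ 4) θ).2.1]
      have k1 : majorG a x d 4 3 θ = a₂ * x * |Real.cos θ| ^ 2 * |Real.sin θ| ^ 2 +
          a 3 * |Real.cos θ| ^ 3 * |Real.sin θ| := by rw [e1]; norm_num [ha2]
      have k2 : majorG (oddPart a) x d 4 3 θ = a 3 * |Real.cos θ| ^ 3 * |Real.sin θ| := by
        rw [e2]; norm_num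
      rw [k1, k2]
      calc _ = a₂ * x * (|Real.cos θ| ^ 2 * |Real.sin θ| ^ 2) * |Real.sin θ| ^ 1 := by ring
        _ ≤ _ := by
            rw [hfabs]
            exact mul_le_of_le_one_right (by positivity) (hs1 θ 1)
    · rw [hI0, hI2]; ring
  · refine (key 5 (by norm_num)).trans ((integral_le_of_hasDerivAt
      -- Since `I' = f`, products `I f` integrate to `I² / 2`, which produces the squares of `I(2π)
      -- = π/4`.
      (G := fun θ => a₂ * x ^ 2 * (∫ t in (0 : ℝ)..θ, f t * Real.sin t ^ 2) +
        a₂ ^ 2 * (1 / 3 * I θ + 3 / 2 * I θ ^ 2))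
      (G' := fun θ => a₂ * x ^ 2 * (f θ * Real.sin θ ^ 2) +
        a₂ ^ 2 * (1 / 3 * f θ + 3 / 2 * (2 * I θ * f θ)))
      (hfc 5) (by fun_prop) (fun θ => ?_) hpi fun θ hθ _ => ?_).trans (le_of_eq ?_))
    · have h1 := hasDerivAt_primitive (f := fun t => f t * Real.sin t ^ 2) (by fun_prop) θ
      have h2 := (((hId θ).const_mul (1 / 3 : ℝ)).add (((hId θ).fun_pow 2).const_mul (3 / 2 : ℝ)))
      refine ((h1.const_mul (a₂ * x ^ 2)).add (h2.const_mul (a₂ ^ 2))).congr_deriv ?_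
      simp only [hI]; push_cast; ring
    · rw [(recD_four_five_six (hγ1 _ 5) θ).2.2.1,
        (recD_four_five_six (hγ1 _ 5) θ).2.2.1, hX3 5 θ (by norm_num),
        hX3o 5 θ (by norm_num)]
      have k1 : majorG a x d 5 4 θ = a₂ * x ^ 2 * |Real.cos θ| ^ 2 * |Real.sin θ| ^ 3 +
          a 3 * x * |Real.cos θ| ^ 3 * |Real.sin θ| ^ 2 := by rw [e1]; norm_num [ha2]
      have k2 : majorG (oddPart a) x d 5 4 θ = a 3 * x * |Real.cos θ| ^ 3 * |Real.sin θ| ^ 2 := by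
        rw [e2]; norm_num
      have k3 : majorG a x d 5 2 θ = a₂ * |Real.cos θ| ^ 2 * |Real.sin θ| := by
        rw [e1]; norm_num [ha2]
      rw [k1, k2, k3, sq_abs (Real.cos θ)]
      have h1 := mul_le_mul_of_nonneg_left (hcs θ) (sq_nonneg a₂)
      rw [sq_abs] at h1
      have h2 : f θ = Real.cos θ ^ 2 * Real.sin θ ^ 2 := rfl
      have h3 : |Real.sin θ| ^ 2 = Real.sin θ ^ 2 := sq_abs _
      rw [show |Real.sin θ| ^ 3 = |Real.sin θ| ^ 2 * |Real.sin θ| by ring, h3]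
      have e3 : |Real.sin θ| * |Real.sin θ| = Real.sin θ ^ 2 := abs_mul_abs_self _ |>.trans (sq _).symm
      have h4 : a₂ * x ^ 2 * Real.cos θ ^ 2 * (Real.sin θ ^ 2 * |Real.sin θ|) * |Real.sin θ| =
          a₂ * x ^ 2 * (f θ * Real.sin θ ^ 2) := by
        rw [h2]; linear_combination (a₂ * x ^ 2 * Real.cos θ ^ 2 * Real.sin θ ^ 2) * e3
      have h5 : a₂ * Real.cos θ ^ 2 * |Real.sin θ| * (a₂ * (|Real.cos θ| * f θ +
          3 * |Real.sin θ| * I θ)) = a₂ ^ 2 * (Real.cos θ ^ 2 * |Real.sin θ| *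
          (|Real.cos θ| * f θ)) + 3 * a₂ ^ 2 * f θ * I θ := by
        rw [h2]; linear_combination (3 * a₂ ^ 2 * Real.cos θ ^ 2 * I θ) * e3
      linarith
    · have h1 : ∫ t in (0 : ℝ)..(2 * Real.pi), f t * Real.sin t ^ 2 = Real.pi / 8 := by
        have : ∫ t in (0 : ℝ)..(2 * Real.pi), f t * Real.sin t ^ 2 =
            wallisConst 1 - wallisConst 2 := by
          unfold wallisConst
          rw [← intervalIntegral.integral_sub (Continuous.intervalIntegrable (by fun_prop) _ _)
            (Continuous.intervalIntegrable (by fun_prop) _ _)]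
          refine intervalIntegral.integral_congr fun t _ => ?_
          simp only [hf]
          have := Real.sin_sq t
          linear_combination (Real.cos t ^ 2 * Real.sin t ^ 2) * this
        rw [this, wallisConst_one, wallisConst_two]; ring
      rw [hI0, hI2, h1, intervalIntegral.integral_same]; ring
  · set A := a₂ * x + a₃ with hA
    have hA0 : 0 ≤ A := by positivity
    have hγ3 : ∀ θ, majorG a x d 6 3 θ ≤ A * |Real.cos θ| ^ 2 * |Real.sin θ| := fun θ => by
      have k1 : majorG a x d 6 3 θ = a₂ * x * |Real.cos θ| ^ 2 * |Real.sin θ| ^ 2 +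
          a₃ * |Real.cos θ| ^ 3 * |Real.sin θ| := by rw [e1]; norm_num [ha2, ha3]
      rw [k1]
      have h1 : |Real.sin θ| ^ 2 ≤ |Real.sin θ| :=
        pow_le_of_le_one (abs_nonneg _) (Real.abs_sin_le_one θ) two_ne_zero
      have h2 : |Real.cos θ| ^ 3 ≤ |Real.cos θ| ^ 2 :=
        pow_le_pow_of_le_one (abs_nonneg _) (Real.abs_cos_le_one θ) (by norm_num)
      have h3 := mul_le_mul_of_nonneg_left h1 (show 0 ≤ a₂ * x * |Real.cos θ| ^ 2 by positivity)
      have h5 := mul_le_mul_of_nonneg_left h2 (show 0 ≤ a₃ * |Real.sin θ| by positivity)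
      rw [hA]; linarith
    have hD4 : ∀ θ, recD (|Real.cos ·|) (|Real.sin ·|) (majorG a x d 6) 4 θ ≤ A * f θ := fun θ => by
      rw [(recD_four_five_six (hγ1 _ 6) θ).2.1]
      refine (mul_le_mul_of_nonneg_right (hγ3 θ) (abs_nonneg _)).trans (le_of_eq ?_)
      rw [← hfabs]; ring
    have hV4 : ∀ θ, 0 ≤ θ → recV (|Real.cos ·|) (|Real.sin ·|) (majorG a x d 6) 4 θ ≤ A * I θ :=
      fun θ hθ => by
        unfold recV
        rw [if_neg (by norm_num), zero_add, hI, ← intervalIntegral.integral_const_mul]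
        exact intervalIntegral.integral_mono_on hθ
          ((continuous_recD hcos hsin (continuous_majorG a x d 6) 4).intervalIntegrable _ _)
          ((continuous_const.mul hfcont).intervalIntegrable _ _) fun t _ => hD4 t
    have hX4 : ∀ θ, 0 ≤ θ → recX (|Real.cos ·|) (|Real.sin ·|) (majorG a x d 6) 4 θ ≤
        A * (|Real.cos θ| * f θ + 4 * |Real.sin θ| * I θ) := fun θ hθ => by
      unfold recX
      have h1 := mul_le_mul_of_nonneg_left (hD4 θ) (abs_nonneg (Real.cos θ))
      have h2 := mul_le_mul_of_nonneg_left (hV4 θ hθ) (show 0 ≤ 4 * |Real.sin θ| by positivity)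
      push_cast
      linarith
    refine (key 6 (by norm_num)).trans ((integral_le_of_hasDerivAt
      (G := fun θ => a₂ * x ^ 3 * I θ + a₂ * A * (2 / 3 * I θ + 7 / 2 * I θ ^ 2))
      (G' := fun θ => a₂ * x ^ 3 * f θ + a₂ * A * (2 / 3 * f θ + 7 / 2 * (2 * I θ * f θ)))
      (hfc 6) (by fun_prop) (fun θ => ?_) hpi fun θ hθ _ => ?_).trans (le_of_eq ?_))
    · have h2 := (((hId θ).const_mul (2 / 3 : ℝ)).add (((hId θ).fun_pow 2).const_mul (7 / 2 : ℝ)))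
      refine (((hId θ).const_mul (a₂ * x ^ 3)).add (h2.const_mul (a₂ * A))).congr_deriv ?_
      simp only [hI]; push_cast; ring
    · rw [(recD_four_five_six (hγ1 _ 6) θ).2.2.2,
        (recD_four_five_six (hγ1 _ 6) θ).2.2.2, hX3o 6 θ (by norm_num),
        hX3 6 θ (by norm_num)]
      have g5 : majorG a x d 6 5 θ * |Real.sin θ| - majorG (oddPart a) x d 6 5 θ * |Real.sin θ| ≤
          a₂ * x ^ 3 * f θ := by
        have k1 : majorG a x d 6 5 θ = a₂ * x ^ 3 * |Real.cos θ| ^ 2 * |Real.sin θ| ^ 4 +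
            a 3 * x ^ 2 * |Real.cos θ| ^ 3 * |Real.sin θ| ^ 3 := by rw [e1]; norm_num [ha2]
        have k2 : majorG (oddPart a) x d 6 5 θ =
            a 3 * x ^ 2 * |Real.cos θ| ^ 3 * |Real.sin θ| ^ 3 := by rw [e2]; norm_num
        rw [k1, k2]
        have h1 := mul_le_mul_of_nonneg_left (hs1 θ 3) (show 0 ≤ a₂ * x ^ 3 * f θ by positivity)
        refine le_trans (le_of_eq ?_) (h1.trans (le_of_eq (mul_one _)))
        rw [← hfabs]; ring
      have g2 : majorG a x d 6 2 θ = a₂ * |Real.cos θ| ^ 2 * |Real.sin θ| := by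
        rw [e1, ha2]; norm_num
      have g2o : majorG (oddPart a) x d 6 2 θ = 0 := by rw [e2]; norm_num
      have hIθ := hInn θ hθ
      have hfθ : 0 ≤ f θ := by positivity
      have w1 : majorG a x d 6 3 θ * (a₂ * (|Real.cos θ| * f θ + 3 * |Real.sin θ| * I θ)) ≤
          a₂ * A * (f θ / 3 + 3 * f θ * I θ) := by
        calc _ ≤ A * |Real.cos θ| ^ 2 * |Real.sin θ| *
              (a₂ * (|Real.cos θ| * f θ + 3 * |Real.sin θ| * I θ)) :=
              mul_le_mul_of_nonneg_right (hγ3 θ) (by positivity)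
          _ = a₂ * A * (|Real.cos θ| ^ 2 * |Real.sin θ| * (|Real.cos θ| * f θ) +
              3 * (|Real.cos θ| ^ 2 * |Real.sin θ| ^ 2) * I θ) := by ring
          _ ≤ _ := by
              rw [hfabs]
              exact mul_le_mul_of_nonneg_left (by linarith [hcs θ]) (by positivity)
      have w2 : majorG a x d 6 2 θ * recX (|Real.cos ·|) (|Real.sin ·|) (majorG a x d 6) 4 θ ≤
          a₂ * A * (f θ / 3 + 4 * f θ * I θ) := by
        rw [g2]
        calc _ ≤ a₂ * |Real.cos θ| ^ 2 * |Real.sin θ| *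
              (A * (|Real.cos θ| * f θ + 4 * |Real.sin θ| * I θ)) :=
              mul_le_mul_of_nonneg_left (hX4 θ hθ) (by positivity)
          _ = a₂ * A * (|Real.cos θ| ^ 2 * |Real.sin θ| * (|Real.cos θ| * f θ) +
              4 * (|Real.cos θ| ^ 2 * |Real.sin θ| ^ 2) * I θ) := by ring
          _ ≤ _ := by
              rw [hfabs]
              exact mul_le_mul_of_nonneg_left (by linarith [hcs θ]) (by positivity)
      rw [g2o]
      linarith
    · rw [hI0, hI2]; ring

end

/-! ### Estimates through monomials. -/

noncomputable section

open Finset MeasureTheory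

section Monomials

variable {d : ℕ}

theorem norm_prod_le_one {lam : Fin d → ℂ} (hle : ∀ i, ‖lam i‖ ≤ 1) (m : Fin d →₀ ℕ) :
    ‖∏ i, lam i ^ m i‖ ≤ 1 := by
  rw [norm_prod]
  exact prod_le_one (fun _ _ => norm_nonneg _) fun i _ => by
    rw [norm_pow]; exact pow_le_one₀ (norm_nonneg _) (hle i)

theorem norm_prod_le_pair {lam : Fin d → ℂ} (hle : ∀ i, ‖lam i‖ ≤ 1) (m : Fin d →₀ ℕ)
    {i j : Fin d} (hij : i ≠ j) {e e' : ℕ} (hi : e ≤ m i) (hj : e' ≤ m j) :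
    ‖∏ i, lam i ^ m i‖ ≤ ‖lam i‖ ^ e * ‖lam j‖ ^ e' := by
  classical
  rw [norm_prod]
  simp only [norm_pow]
  have h1 : ∀ l, ‖lam l‖ ^ m l ≤ 1 := fun l => pow_le_one₀ (norm_nonneg _) (hle l)
  rw [← mul_prod_erase univ _ (mem_univ i),
    ← mul_prod_erase (univ.erase i) _ (mem_erase.2 ⟨hij.symm, mem_univ j⟩), ← mul_assoc]
  have h2 : ∏ l ∈ (univ.erase i).erase j, ‖lam l‖ ^ m l ≤ 1 :=
    prod_le_one (fun _ _ => by positivity) fun l _ => h1 l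
  refine (mul_le_of_le_one_right (by positivity) h2).trans ?_
  exact mul_le_mul (pow_le_pow_of_le_one (norm_nonneg _) (hle i) hi)
    (pow_le_pow_of_le_one (norm_nonneg _) (hle j) hj) (by positivity) (by positivity)

theorem norm_prod_le_pow {lam : Fin d → ℂ} (hle : ∀ i, ‖lam i‖ ≤ 1) (m : Fin d →₀ ℕ)
    {i : Fin d} {e : ℕ} (hi : e ≤ m i) : ‖∏ i, lam i ^ m i‖ ≤ ‖lam i‖ ^ e := by
  classical
  rw [norm_prod]
  simp only [norm_pow]
  rw [← mul_prod_erase univ _ (mem_univ i)]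
  refine (mul_le_of_le_one_right (by positivity) (prod_le_one (fun _ _ => by positivity)
    fun l _ => pow_le_one₀ (norm_nonneg _) (hle l))).trans ?_
  exact pow_le_pow_of_le_one (norm_nonneg _) (hle i) hi

/-- The monomials containing a parameter of even index. -/
def evenSupport (p : MvPolynomial (Fin d) ℝ) : Finset (Fin d →₀ ℕ) :=
  open Classical in p.support.filter fun m => ∃ i : Fin d, Odd (i : ℕ) ∧ m i ≠ 0

theorem evenSupport_subset (p : MvPolynomial (Fin d) ℝ) : evenSupport p ⊆ p.support := by
  unfold evenSupport; exact filter_subset _ _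

/-- Only monomials containing a parameter of even index contribute. -/
theorem holonomy_eq_even_sum {p : MvPolynomial (Fin d) ℝ} {k : ℕ} (hk : k ≠ 1)
    (hp : ∀ lam : Fin d → ℂ, MvPolynomial.aeval lam p = holonomy (lamSeq lam) k)
    (lam : Fin d → ℂ) : holonomy (lamSeq lam) k =
      ∑ m ∈ evenSupport p, ((p.coeff m : ℝ) : ℂ) * ∏ i, lam i ^ m i := by
  classical
  -- An odd position `i` carries the even-index parameter `λ_{i+1}`. Setting these to zero kills the
  -- holonomy, so the monomials without them sum to zero.
  set lamo : Fin d → ℂ := fun i => if Odd (i : ℕ) then 0 else lam i with hlamo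
  have h0 : MvPolynomial.aeval lamo p = 0 := by
    rw [hp]
    refine holonomy_eq_zero_of_odd (fun l hl => ?_) hk
    unfold lamSeq
    split_ifs with h
    · have : Odd (l - 1) := Nat.Even.sub_odd h.1 hl odd_one
      simp [hlamo, this]
    · rfl
  rw [← hp, aeval_eq_sum]
  rw [aeval_eq_sum] at h0
  rw [← sum_filter_add_sum_filter_not p.support (fun m => ∃ i : Fin d, Odd (i : ℕ) ∧ m i ≠ 0)] at h0 ⊢
  have h1 : ∑ m ∈ p.support with ∃ i : Fin d, Odd (i : ℕ) ∧ m i ≠ 0,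
      ((p.coeff m : ℝ) : ℂ) * ∏ i, lamo i ^ m i = 0 := by
    refine sum_eq_zero fun m hm => ?_
    obtain ⟨i, hi, hmi⟩ := (mem_filter.1 hm).2
    rw [prod_eq_zero (mem_univ i), mul_zero]
    simp [hlamo, hi, hmi]
  have h2 : ∑ m ∈ p.support with ¬∃ i : Fin d, Odd (i : ℕ) ∧ m i ≠ 0,
      ((p.coeff m : ℝ) : ℂ) * ∏ i, lamo i ^ m i =
      ∑ m ∈ p.support with ¬∃ i : Fin d, Odd (i : ℕ) ∧ m i ≠ 0,
      ((p.coeff m : ℝ) : ℂ) * ∏ i, lam i ^ m i := by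
    refine sum_congr rfl fun m hm => ?_
    have hm' := (mem_filter.1 hm).2
    push Not at hm'
    congr 1
    refine prod_congr rfl fun i _ => ?_
    by_cases hi : Odd (i : ℕ)
    · rw [hm' i hi]; simp
    · simp [hlamo, hi]
  rw [h1, h2, zero_add] at h0
  rw [h0, add_zero]
  unfold evenSupport
  congr!

theorem norm_aeval_le {p : MvPolynomial (Fin d) ℝ} {lam : Fin d → ℂ} (hle : ∀ i, ‖lam i‖ ≤ 1) :
    ‖MvPolynomial.aeval lam p‖ ≤ coeffNorm p := by
  rw [aeval_eq_sum]
  refine (norm_sum_le _ _).trans (sum_le_sum fun m _ => ?_)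
  rw [norm_mul, Complex.norm_real, Real.norm_eq_abs]
  exact mul_le_of_le_one_right (abs_nonneg _) (norm_prod_le_one hle m)

/-- Every contributing monomial contains an even-index parameter, and all other factors have modulus
at most one. -/
theorem norm_holonomy_le_coeffNorm {p : MvPolynomial (Fin d) ℝ} {k : ℕ} (hk : k ≠ 1)
    (hp : ∀ lam : Fin d → ℂ, MvPolynomial.aeval lam p = holonomy (lamSeq lam) k)
    {lam : Fin d → ℂ} (hle : ∀ i, ‖lam i‖ ≤ 1) {Z : ℝ} (hZ0 : 0 ≤ Z)
    (hZ : ∀ i : Fin d, Odd (i : ℕ) → ‖lam i‖ ≤ Z) :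
    ‖holonomy (lamSeq lam) k‖ ≤ coeffNorm p * Z := by
  classical
  rw [holonomy_eq_even_sum hk hp, coeffNorm, sum_mul]
  refine (norm_sum_le _ _).trans ((sum_le_sum fun m hm => ?_).trans
    (sum_le_sum_of_subset_of_nonneg (evenSupport_subset p)
      fun m _ _ => mul_nonneg (abs_nonneg _) hZ0))
  rw [norm_mul, Complex.norm_real, Real.norm_eq_abs]
  refine mul_le_mul_of_nonneg_left ?_ (abs_nonneg _)
  obtain ⟨i, hi, hmi⟩ := (mem_filter.1 hm).2
  refine (norm_prod_le_pow hle m (Nat.one_le_iff_ne_zero.2 hmi)).trans ?_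
  rw [pow_one]
  exact hZ i hi

end Monomials

section LowDegree

variable {d : ℕ} (hd : d = 2 ∨ d = 3)
include hd

/-- The index of the parameter `λ_1`. -/
theorem zero_lt_of_low : 0 < d := by omega

theorem one_lt_of_low : 1 < d := by omega

/-- Here `λ_2` is the only even-index parameter. If it occurs without `λ_3` and exactly twice, then
the weight `k - 1 ≥ 6` forces at least two factors `λ_1`; if it occurs once, only `λ_1^{k-3} λ_2` is
left. -/
theorem monomial_cases {k : ℕ} (hk : 7 ≤ k) {m : Fin d →₀ ℕ}
    (hm : Finsupp.weight (indexWeight d) m = k - 1)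
    (he : ∃ i : Fin d, Odd (i : ℕ) ∧ m i ≠ 0)
    (hne : m ≠ Finsupp.single ⟨0, zero_lt_of_low hd⟩ (k - 3) +
      Finsupp.single ⟨1, one_lt_of_low hd⟩ 1) :
    (1 ≤ m ⟨1, one_lt_of_low hd⟩ ∧ ∃ i : Fin d, (i : ℕ) = 2 ∧ 1 ≤ m i) ∨
    3 ≤ m ⟨1, one_lt_of_low hd⟩ ∨
    (2 ≤ m ⟨1, one_lt_of_low hd⟩ ∧ 2 ≤ m ⟨0, zero_lt_of_low hd⟩) := by
  obtain ⟨i, hi, hmi⟩ := he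
  have hi1 : i = ⟨1, one_lt_of_low hd⟩ := by
    apply Fin.ext
    have := i.2
    obtain ⟨j, hj⟩ := hi
    simp only
    omega
  rw [hi1] at hmi
  rw [Finsupp.weight_apply, Finsupp.sum_fintype _ _ (by simp)] at hm
  rcases hd with rfl | rfl
  · rw [Fin.sum_univ_two] at hm
    simp [indexWeight] at hm hmi hne ⊢
    by_contra hcon
    push Not at hcon
    refine hne (Finsupp.ext fun j => ?_)
    fin_cases j
    · simp; omega
    · simp; omega
  · rw [Fin.sum_univ_three] at hm
    simp [indexWeight] at hm hmi hne ⊢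
    by_contra hcon
    push Not at hcon
    obtain ⟨c1, c2, c3⟩ := hcon
    have c4 := c1 (by omega) 2 rfl
    refine hne (Finsupp.ext fun j => ?_)
    fin_cases j
    · simp; omega
    · simp; omega
    · simpa using by omega

/-- Test on `λ_1 = 1`, `λ_2 = ε`, all other parameters zero. The majorant is at most `ε ∫ cos² sin²
= ε π/4` up to `O(ε²)`, and the other monomials contribute `O(ε²)`, so the coefficient is at most
`π/4 < 1`. -/
theorem abs_pure_coeff_le {p : MvPolynomial (Fin d) ℝ} {k : ℕ} (hk : 7 ≤ k)
    (hw : p.IsWeightedHomogeneous (indexWeight d) (k - 1))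
    (hp : ∀ lam : Fin d → ℂ, MvPolynomial.aeval lam p = holonomy (lamSeq lam) k) :
    |p.coeff (Finsupp.single ⟨0, zero_lt_of_low hd⟩ (k - 3) +
      Finsupp.single ⟨1, one_lt_of_low hd⟩ 1)| ≤ 1 := by
  classical
  set i₀ : Fin d := ⟨0, zero_lt_of_low hd⟩ with hi₀
  set i₁ : Fin d := ⟨1, one_lt_of_low hd⟩ with hi₁
  set mp : Fin d →₀ ℕ := Finsupp.single i₀ (k - 3) + Finsupp.single i₁ 1 with hmp
  have h01 : i₀ ≠ i₁ := by simp [hi₀, hi₁]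
  set lam : ℝ → Fin d → ℂ := fun ε i => if i = i₀ then 1 else if i = i₁ then (ε : ℂ) else 0 with hlam
  have hl0 : ∀ ε, lam ε i₀ = 1 := fun ε => by simp [hlam]
  have hl1 : ∀ ε, lam ε i₁ = ε := fun ε => by simp [hlam, h01.symm]
  have hl2 : ∀ ε (i : Fin d), 2 ≤ (i : ℕ) → lam ε i = 0 := fun ε i hi => by
    have e0 : i ≠ i₀ := fun h => by rw [h] at hi; simp [hi₀] at hi
    have e1 : i ≠ i₁ := fun h => by rw [h] at hi; simp [hi₁] at hi
    simp [hlam, e0, e1]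
  have hs1 : ∀ ε, lamSeq (lam ε) 1 = 1 := fun ε => by rw [← hl0 ε]; exact lamSeq_succ (lam ε) i₀
  have hs2 : ∀ ε, lamSeq (lam ε) 2 = ε := fun ε => by rw [← hl1 ε]; exact lamSeq_succ (lam ε) i₁
  have hs3 : ∀ ε l, 3 ≤ l → lamSeq (lam ε) l = 0 := fun ε l hl => by
    unfold lamSeq
    split_ifs with h
    · exact hl2 ε _ (by simp only; omega)
    · rfl
  set γ : ℕ → ℝ → ℝ := majorG (fun l => ‖lamSeq (lam 1) l‖) (2 / 3) d k with hγ
  have hγc := continuous_majorG (fun l => ‖lamSeq (lam 1) l‖) (2 / 3) d k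
  have hγ0 := majorG_nonneg (a := fun l => ‖lamSeq (lam 1) l‖) (fun l => norm_nonneg _)
    (x := 2 / 3) (by norm_num) d k
  have hcos : Continuous fun θ => |Real.cos θ| := Real.continuous_cos.abs
  have hsin : Continuous fun θ => |Real.sin θ| := Real.continuous_sin.abs
  have hcos0 : ∀ θ, 0 ≤ |Real.cos θ| := fun _ => abs_nonneg _
  have hsin0 : ∀ θ, 0 ≤ |Real.sin θ| := fun _ => abs_nonneg _
  have hpi : 0 ≤ 2 * Real.pi := by positivity
  have hval : ∀ ε w θ, 0 ≤ ε → majorG (fun l => ‖lamSeq (lam ε) l‖) (2 / 3) d k w θ =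
      if 2 ≤ w ∧ w - 2 < k then
        ε * (2 / 3) ^ (w - 2) * |Real.cos θ| ^ 2 * |Real.sin θ| ^ (w - 2 + 1) else 0 :=
    fun ε w θ hε => by
      rw [majorG_eq_of_small (fun l hl => by rw [hs3 ε l (by omega), norm_zero])
        (fun l hl => by rw [lamSeq_of_lt _ hl, norm_zero]), hs2, hs3 ε 3 le_rfl]
      simp [abs_of_nonneg hε]
  set C := recV (|Real.cos ·|) (|Real.sin ·|) γ k (2 * Real.pi) + coeffNorm p with hC
  have hbound : ∀ ε : ℝ, 0 < ε → ε ≤ 1 → |p.coeff mp| * ε ≤ ε * (Real.pi / 4) + ε ^ 2 * C := by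
    intro ε hε hε1
    have hle : ∀ i, ‖lam ε i‖ ≤ 1 := fun i => by
      simp only [hlam]; split_ifs <;> simp [abs_of_pos hε, hε1]
    have hx : ‖lamSeq (lam ε) 1‖ = 1 := by rw [hs1, norm_one]
    have h1 : ‖holonomy (lamSeq (lam ε)) k‖ ≤ ε * (Real.pi / 4) +
        ε ^ 2 * recV (|Real.cos ·|) (|Real.sin ·|) γ k (2 * Real.pi) := by
      have hk1 : k ≠ 1 := by omega
      have hmaj := norm_holonomy_le_majorant (lam ε) hk1 (x := 2 / 3) (by rw [hx, mul_one])
      have hnn := (recD_recV_nonneg (γ := majorG (oddPart fun l => ‖lamSeq (lam ε) l‖) (2 / 3) d k)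
        hcos hsin hcos0 hsin0 (continuous_majorG _ _ d k) (majorG_nonneg (fun l => by
          unfold oddPart; split_ifs <;> simp) (by norm_num) d k) k hpi).2.1
      have hγε : majorG (fun l => ‖lamSeq (lam ε) l‖) (2 / 3) d k = fun w t => ε * γ w t := by
        funext w t
        rw [hγ, hval ε w t hε.le, hval 1 w t zero_le_one]
        split_ifs <;> ring
      rw [hγε] at hmaj
      refine hmaj.trans ((sub_le_self _ hnn).trans ?_)
      unfold recV
      rw [if_neg hk1, zero_add, zero_add]
      have e1 : ε * (Real.pi / 4) + ε ^ 2 * ∫ t in (0 : ℝ)..(2 * Real.pi),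
          recD (|Real.cos ·|) (|Real.sin ·|) γ k t = ∫ t in (0 : ℝ)..(2 * Real.pi),
          (ε * (Real.cos t ^ (2 * 1) * Real.sin t ^ 2) +
            ε ^ 2 * recD (|Real.cos ·|) (|Real.sin ·|) γ k t) := by
        have i1 : IntervalIntegrable (fun t => ε * (Real.cos t ^ (2 * 1) * Real.sin t ^ 2))
            volume 0 (2 * Real.pi) := Continuous.intervalIntegrable (by fun_prop) _ _
        have i2 : IntervalIntegrable
            (fun t => ε ^ 2 * recD (|Real.cos ·|) (|Real.sin ·|) γ k t)
            volume 0 (2 * Real.pi) :=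
          (continuous_const.mul (continuous_recD hcos hsin hγc k)).intervalIntegrable _ _
        rw [intervalIntegral.integral_add i1 i2,
          intervalIntegral.integral_const_mul, intervalIntegral.integral_const_mul,
          ← wallisConst_one, wallisConst]
      rw [e1]
      refine intervalIntegral.integral_mono_on hpi
        ((continuous_recD hcos hsin (fun w => continuous_const.mul (hγc w)) k).intervalIntegrable _ _)
        (((by fun_prop : Continuous fun t => ε * (Real.cos t ^ (2 * 1) * Real.sin t ^ 2)).add
          (continuous_const.mul (continuous_recD hcos hsin hγc k))).intervalIntegrable _ _)
        fun t ht => ?_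
      refine (recD_smul_le hcos hsin hcos0 hsin0 hγc hγ0 hε.le hε1 (by omega) ht.1).trans ?_
      refine add_le_add ?_ le_rfl
      rw [mul_assoc]
      refine mul_le_mul_of_nonneg_left ?_ hε.le
      rw [hval 1 (k - 1) t zero_le_one, if_pos (by omega)]
      have k1 : ((2 : ℝ) / 3) ^ (k - 1 - 2) ≤ 1 := pow_le_one₀ (by norm_num) (by norm_num)
      have k2 : |Real.sin t| ^ (k - 1 - 2 + 1) * |Real.sin t| ≤ |Real.sin t| ^ 2 := by
        rw [← pow_succ]
        exact pow_le_pow_of_le_one (abs_nonneg _) (Real.abs_sin_le_one t) (by omega)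
      calc _ = (2 / 3) ^ (k - 1 - 2) * (|Real.cos t| ^ 2 *
            (|Real.sin t| ^ (k - 1 - 2 + 1) * |Real.sin t|)) := by ring
        _ ≤ 1 * (|Real.cos t| ^ 2 * |Real.sin t| ^ 2) := by gcongr
        _ = _ := by rw [sq_abs, sq_abs, one_mul, mul_one]
    have hprod : ∏ i, lam ε i ^ mp i = ε := by
      rw [← mul_prod_erase univ _ (mem_univ i₁), prod_eq_one, mul_one, hl1]
      · simp [hmp, h01]
      · intro i hi
        by_cases h : i = i₀
        · rw [h, hl0, one_pow]
        · simp [hmp, Ne.symm h, Ne.symm (ne_of_mem_erase hi)]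
    by_cases hmem : mp ∈ p.support
    · have hmpe : mp ∈ evenSupport p := by
        unfold evenSupport
        refine mem_filter.2 ⟨hmem, i₁, by simp [hi₁], by simp [hmp, h01]⟩
      have hsum := holonomy_eq_even_sum (by omega) hp (lam ε)
      rw [← add_sum_erase _ _ hmpe, hprod] at hsum
      have hrest : ‖∑ m ∈ (evenSupport p).erase mp,
          ((p.coeff m : ℝ) : ℂ) * ∏ i, lam ε i ^ m i‖ ≤ ε ^ 2 * coeffNorm p := by
        rw [coeffNorm, mul_sum]
        refine (norm_sum_le _ _).trans ((sum_le_sum fun m hm => ?_).trans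
          (sum_le_sum_of_subset_of_nonneg ((erase_subset _ _).trans (evenSupport_subset p))
            fun m _ _ => mul_nonneg (sq_nonneg _) (abs_nonneg _)))
        rw [norm_mul, Complex.norm_real, Real.norm_eq_abs, mul_comm]
        refine mul_le_mul_of_nonneg_right ?_ (abs_nonneg _)
        obtain ⟨hm1, hm2⟩ := mem_erase.1 hm
        have hn1 : ‖lam ε i₁‖ = ε := by rw [hl1, Complex.norm_real, Real.norm_of_nonneg hε.le]
        rcases monomial_cases hd hk (hw (MvPolynomial.mem_support_iff.1 (evenSupport_subset p hm2)))
          (mem_filter.1 hm2).2 hm1 with ⟨-, i, hi, hmi⟩ | h | h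
        · refine (norm_prod_le_pow hle m hmi).trans ?_
          rw [hl2 ε i hi.ge]; simp; positivity
        · have := norm_prod_le_pow hle m (le_trans (by norm_num : 2 ≤ 3) h)
          rwa [hn1] at this
        · have := norm_prod_le_pow hle m h.1
          rwa [hn1] at this
      have h2 : ‖((p.coeff mp : ℝ) : ℂ) * (ε : ℂ)‖ = |p.coeff mp| * ε := by
        rw [norm_mul, Complex.norm_real, Complex.norm_real, Real.norm_eq_abs,
          Real.norm_of_nonneg hε.le]
      have h3 := norm_sub_norm_le (((p.coeff mp : ℝ) : ℂ) * (ε : ℂ))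
        (-∑ m ∈ (evenSupport p).erase mp, ((p.coeff m : ℝ) : ℂ) * ∏ i, lam ε i ^ m i)
      rw [sub_neg_eq_add, ← hsum, norm_neg, h2] at h3
      rw [hC]; linarith
    · rw [MvPolynomial.notMem_support_iff.1 hmem, abs_zero, zero_mul]
      have := (norm_nonneg _).trans h1
      have := mul_nonneg (sq_nonneg ε) (coeffNorm_nonneg p)
      rw [hC]; linarith
  by_contra hcon
  push Not at hcon
  have hpi4 := Real.pi_lt_d2
  have hC0 : 0 ≤ C := add_nonneg
    (recD_recV_nonneg hcos hsin hcos0 hsin0 hγc hγ0 k hpi).2.1 (coeffNorm_nonneg p)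
  have hε : 0 < 0.2 / (C + 1) := by positivity
  have h := hbound (0.2 / (C + 1)) hε (by rw [div_le_one (by positivity)]; linarith)
  have h1 : 0.2 / (C + 1) * C ≤ 0.2 := by
    rw [div_mul_eq_mul_div, div_le_iff₀ (by positivity)]; linarith
  have h2 : |p.coeff mp| ≤ Real.pi / 4 + 0.2 / (C + 1) * C := by
    refine le_of_mul_le_mul_right (h.trans (le_of_eq ?_)) hε
    ring
  linarith

/-- For `q` near `1` the pure monomial dominates but has a controlled coefficient. Each of the
others has, besides one `λ_2`, a factor `λ_3`, `λ_2²` or `λ_2 λ_1²`, and normalization bounds each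
of these by `(4/27)(1 - q)`. -/
theorem norm_holonomy_le_pure {p : MvPolynomial (Fin d) ℝ} {k : ℕ} (hk : 7 ≤ k)
    (hw : p.IsWeightedHomogeneous (indexWeight d) (k - 1))
    (hp : ∀ lam : Fin d → ℂ, MvPolynomial.aeval lam p = holonomy (lamSeq lam) k)
    {lam : Fin d → ℂ} (hle : ∀ i, ‖lam i‖ ≤ 1) {q : ℝ} (hq0 : 0 ≤ q) (hq1 : q ≤ 1)
    (hq : ‖lamSeq lam 1‖ = q) (h2 : ‖lamSeq lam 2‖ ≤ (1 - q) ^ 2 / 4)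
    (h3 : ‖lamSeq lam 3‖ ≤ 4 * (1 - q) ^ 3 / 27) :
    ‖holonomy (lamSeq lam) k‖ ≤ ‖lamSeq lam 2‖ * (q + coeffNorm p * (4 / 27) * (1 - q)) := by
  classical
  set i₀ : Fin d := ⟨0, zero_lt_of_low hd⟩ with hi₀
  set i₁ : Fin d := ⟨1, one_lt_of_low hd⟩ with hi₁
  set mp : Fin d →₀ ℕ := Finsupp.single i₀ (k - 3) + Finsupp.single i₁ 1 with hmp
  have h01 : i₀ ≠ i₁ := by simp [hi₀, hi₁]
  have hs1 : lamSeq lam 1 = lam i₀ := lamSeq_succ lam i₀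
  have hs2 : lamSeq lam 2 = lam i₁ := lamSeq_succ lam i₁
  have hm1 : mp i₁ = 1 := by simp [hmp, h01]
  have hm0 : mp i₀ = k - 3 := by simp [hmp, h01.symm]
  rw [hs1] at hq
  set P := 1 - q with hP
  have hP0 : 0 ≤ P := by linarith
  have hP1 : P ≤ 1 := by linarith
  set Z := ‖lamSeq lam 2‖ with hZ
  have hZ0 : 0 ≤ Z := norm_nonneg _
  have hZ1 : ‖lam i₁‖ = Z := by rw [hZ, hs2]
  have hrest : ∀ m ∈ evenSupport p, m ≠ mp → ‖∏ i, lam i ^ m i‖ ≤ Z * (4 / 27 * P) := by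
    intro m hm hne
    rcases monomial_cases hd hk (hw (MvPolynomial.mem_support_iff.1 (evenSupport_subset p hm)))
      (mem_filter.1 hm).2 hne with ⟨h1, i, hi, hmi⟩ | h | ⟨h, h'⟩
    · have hii : i₁ ≠ i := fun e => by rw [← e] at hi; simp [hi₁] at hi
      refine (norm_prod_le_pair hle m hii h1 hmi).trans ?_
      have hs3 : lamSeq lam 3 = lam i := by rw [← lamSeq_succ lam i, hi]
      rw [pow_one, pow_one, hZ1, ← hs3]
      refine mul_le_mul_of_nonneg_left (h3.trans ?_) hZ0
      have : P ^ 3 ≤ P := pow_le_of_le_one hP0 hP1 (by norm_num)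
      linarith
    · refine (norm_prod_le_pow hle m h).trans ?_
      rw [hZ1, pow_succ' Z 2]
      refine mul_le_mul_of_nonneg_left ((pow_le_pow_left₀ hZ0 h2 2).trans ?_) hZ0
      have : P ^ 4 ≤ P := pow_le_of_le_one hP0 hP1 (by norm_num)
      have e : (P ^ 2 / 4) ^ 2 = P ^ 4 / 16 := by ring
      rw [e]; linarith
    · refine (norm_prod_le_pair hle m h01.symm h h').trans ?_
      rw [hZ1, hq, sq Z, mul_assoc]
      refine mul_le_mul_of_nonneg_left ?_ hZ0
      have k1 : Z * q ^ 2 ≤ P ^ 2 / 4 * q ^ 2 := mul_le_mul_of_nonneg_right h2 (sq_nonneg q)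
      have k2 : P * q ≤ 1 / 4 := by rw [hP]; nlinarith [sq_nonneg (q - 1 / 2)]
      have k3 : P * q * (P * q) ≤ 1 / 4 * P := by
        refine mul_le_mul k2 (mul_le_of_le_one_right hP0 hq1) (by positivity) (by norm_num)
      have k4 : P ^ 2 / 4 * q ^ 2 = P * q * (P * q) / 4 := by ring
      linarith
  have hpure : ‖∏ i, lam i ^ mp i‖ ≤ Z * q := by
    refine (norm_prod_le_pair hle mp h01.symm hm1.ge (e' := 1) (by rw [hm0]; omega)).trans ?_
    rw [pow_one, pow_one, hZ1, hq]
  rw [holonomy_eq_even_sum (by omega) hp]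
  have hα := abs_pure_coeff_le hd hk hw hp
  change |p.coeff mp| ≤ 1 at hα
  have hterm : ∀ m ∈ evenSupport p, ‖((p.coeff m : ℝ) : ℂ) * ∏ i, lam i ^ m i‖ ≤
      (if m = mp then Z * q else 0) + |p.coeff m| * (Z * (4 / 27 * P)) := by
    intro m hm
    rw [norm_mul, Complex.norm_real, Real.norm_eq_abs]
    split_ifs with h
    · rw [h]
      have k1 := mul_le_mul hα hpure (norm_nonneg _) zero_le_one
      have k2 : 0 ≤ |p.coeff mp| * (Z * (4 / 27 * P)) := by positivity
      linarith
    · rw [zero_add]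
      exact mul_le_mul_of_nonneg_left (hrest m hm h) (abs_nonneg _)
  refine (norm_sum_le _ _).trans ((sum_le_sum hterm).trans ?_)
  rw [sum_add_distrib, ← sum_mul]
  have k1 : ∑ m ∈ evenSupport p, (if m = mp then Z * q else 0) ≤ Z * q := by
    rw [sum_ite_eq']
    split_ifs
    · exact le_rfl
    · positivity
  have k2 : ∑ m ∈ evenSupport p, |p.coeff m| ≤ coeffNorm p :=
    sum_le_sum_of_subset_of_nonneg (evenSupport_subset p) fun _ _ _ => abs_nonneg _
  have k3 := mul_le_mul_of_nonneg_right k2 (show 0 ≤ Z * (4 / 27 * P) by positivity)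
  linarith

end LowDegree

end

/-! ### Numerical constants for the even parameters. -/

noncomputable section
open Finset MeasureTheory

/-- Constants with `|λ_{2j}| ≤ evenBound j · max_i |f_{2i+1}(λ)|` for normalized parameters. -/
def evenBound (j : ℕ) : ℝ :=
  if j = 1 then 1.2733 else if j = 2 then 3.51 else j / wallisConst j ^ (j - 1)

theorem evenBound_of_three_le {j : ℕ} (hj : 3 ≤ j) :
    evenBound j = j / wallisConst j ^ (j - 1) := by
  rw [evenBound, if_neg (by omega), if_neg (by omega)]

theorem evenBound_one : evenBound 1 = 1.2733 := if_pos rfl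

theorem evenBound_two : evenBound 2 = 3.51 := by simp [evenBound]

theorem evenBound_nonneg (j : ℕ) : 0 ≤ evenBound j := by
  have := (wallisConst_pos j).le
  unfold evenBound
  split_ifs <;> [norm_num; norm_num; positivity]

theorem nat_mul_wallisConst_succ_le {n : ℕ} (hn : 1 ≤ n) :
    ((n + 1 : ℕ) : ℝ) * wallisConst (n + 1) ≤ n * wallisConst n := by
  have h1 : (1 : ℝ) ≤ n := by exact_mod_cast hn
  have h := wallisConst_pos n
  rw [wallisConst_succ, mul_div_assoc', div_le_iff₀ (by positivity)]
  push_cast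
  nlinarith

theorem nat_mul_wallisConst_le {m n : ℕ} (hm : 1 ≤ m) (hmn : m ≤ n) :
    (n : ℝ) * wallisConst n ≤ m * wallisConst m := by
  induction n, hmn using Nat.le_induction with
  | base => rfl
  | succ n h ih => exact (nat_mul_wallisConst_succ_le (by omega)).trans ih

theorem inv_wallisConst_succ_pow (n m : ℕ) :
    1 / wallisConst (n + 1) ^ m = ((2 * n + 4) / (2 * n + 1) : ℝ) ^ m / wallisConst n ^ m := by
  have := wallisConst_pos n
  rw [wallisConst_succ, div_pow, div_pow, mul_pow]
  field_simp

theorem one_add_mul_le_ratio_pow (n m : ℕ) :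
    1 + (m : ℝ) * (3 / (2 * n + 1)) ≤ ((2 * n + 4) / (2 * n + 1) : ℝ) ^ m := by
  have h : ((2 * n + 4) / (2 * n + 1) : ℝ) = 1 + 3 / (2 * n + 1) := by field_simp; ring
  rw [h]
  have h0 : (0 : ℝ) ≤ 3 / (2 * n + 1) := by positivity
  exact one_add_mul_le_pow (by linarith) m

/-- Bernoulli's inequality for the ratio of Wallis constants, combined with the decrease of `n
c_{2n+1}`. The factor `11.41` is what the induction in `sum_evenBound_le` needs: `1.0961 ≤ 0.0961 ·
11.41`. -/
theorem evenBound_succ_ge {n : ℕ} (hn : 3 ≤ n) : 11.41 * evenBound n ≤ evenBound (n + 1) := by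
  have hc := wallisConst_pos n
  have hnR : (3 : ℝ) ≤ n := by exact_mod_cast hn
  have h1 := nat_mul_wallisConst_le (by norm_num : 1 ≤ 3) hn
  rw [wallisConst_three] at h1
  have h2 := one_add_mul_le_ratio_pow n n
  have hpi := Real.pi_lt_d4
  have h3 : (16 : ℝ) / 7 ≤ ((2 * n + 4) / (2 * n + 1) : ℝ) ^ n := by
    refine le_trans ?_ h2
    have : (9 : ℝ) / 7 ≤ n * (3 / (2 * n + 1)) := by
      rw [mul_div_assoc', le_div_iff₀ (by positivity)]; linarith
    linarith
  rw [evenBound_of_three_le hn, evenBound_of_three_le (by omega), Nat.add_sub_cancel]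
  rw [show ((n + 1 : ℕ) : ℝ) / wallisConst (n + 1) ^ n =
    ((n + 1 : ℕ) : ℝ) * (1 / wallisConst (n + 1) ^ n) by ring, inv_wallisConst_succ_pow]
  have e : wallisConst n ^ n = wallisConst n ^ (n - 1) * wallisConst n := by
    rw [← pow_succ]; congr 1; omega
  rw [e, mul_div_assoc', mul_div_assoc', div_le_div_iff₀ (by positivity) (by positivity)]
  have key : 11.41 * (n * wallisConst n) ≤ ((n + 1 : ℕ) : ℝ) * ((2 * n + 4) / (2 * n + 1) : ℝ) ^ n := by
    push_cast at h1 ⊢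
    have : (4 : ℝ) * (16 / 7) ≤ (n + 1) * ((2 * n + 4) / (2 * n + 1) : ℝ) ^ n :=
      mul_le_mul (by linarith) h3 (by norm_num) (by linarith)
    nlinarith
  calc _ = 11.41 * (n * wallisConst n) * wallisConst n ^ (n - 1) := by ring
    _ ≤ _ := mul_le_mul_of_nonneg_right key (by positivity)

theorem evenBound_three_eq : evenBound 3 = 3 / (5 * Real.pi / 64) ^ 2 := by
  rw [evenBound_of_three_le le_rfl, wallisConst_three]; norm_num

theorem sum_evenBound_le {i : ℕ} (hi : 3 ≤ i) :
    ∑ j ∈ Ico 1 i, evenBound j ≤ 0.0961 * evenBound i := by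
  induction i, hi using Nat.le_induction with
  | base =>
    rw [evenBound_three_eq, sum_Ico_succ_top (by norm_num), sum_Ico_succ_top (by norm_num)]
    simp only [evenBound_one, evenBound_two, Ico_self, sum_empty, zero_add]
    have hpi := Real.pi_lt_d4
    have hp := Real.pi_pos
    rw [mul_div_assoc', le_div_iff₀ (by positivity)]
    have : Real.pi ^ 2 ≤ 3.1416 ^ 2 := pow_le_pow_left₀ hp.le hpi.le 2
    nlinarith
  | succ i hi ih =>
    rw [sum_Ico_succ_top (by omega)]
    have := evenBound_succ_ge hi
    have := evenBound_nonneg i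
    linarith

/-- `evenBound j` times the Wallis constant. -/
def evenWeight (j : ℕ) : ℝ := wallisConst j * evenBound j

theorem evenWeight_nonneg (j : ℕ) : 0 ≤ evenWeight j :=
  mul_nonneg (wallisConst_pos j).le (evenBound_nonneg j)

theorem evenWeight_of_three_le {j : ℕ} (hj : 3 ≤ j) :
    evenWeight j = j / wallisConst j ^ (j - 2) := by
  have := wallisConst_pos j
  have e : wallisConst j ^ (j - 1) = wallisConst j ^ (j - 2) * wallisConst j := by
    rw [← pow_succ]; congr 1; omega
  rw [evenWeight, evenBound_of_three_le hj, e]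
  field_simp

theorem evenWeight_succ_ge {n : ℕ} (hn : 4 ≤ n) :
    2.9 * (n + 1) * evenWeight n ≤ evenWeight (n + 1) := by
  have hc := wallisConst_pos n
  have hnR : (4 : ℝ) ≤ n := by exact_mod_cast hn
  have h1 := nat_mul_wallisConst_le (by norm_num : 1 ≤ 4) hn
  rw [wallisConst_four] at h1
  have h2 := one_add_mul_le_ratio_pow n (n - 1)
  have hpi := Real.pi_lt_d4
  have h3 : (2 : ℝ) ≤ ((2 * n + 4) / (2 * n + 1) : ℝ) ^ (n - 1) := by
    refine le_trans ?_ h2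
    have : (1 : ℝ) ≤ (n - 1 : ℕ) * (3 / (2 * n + 1)) := by
      rw [mul_div_assoc', le_div_iff₀ (by positivity), Nat.cast_sub (by omega)]
      push_cast; linarith
    linarith
  rw [evenWeight_of_three_le (by omega), evenWeight_of_three_le (by omega),
    show n + 1 - 2 = n - 1 by omega]
  rw [show ((n + 1 : ℕ) : ℝ) / wallisConst (n + 1) ^ (n - 1) =
    ((n + 1 : ℕ) : ℝ) * (1 / wallisConst (n + 1) ^ (n - 1)) by ring, inv_wallisConst_succ_pow]
  have e : wallisConst n ^ (n - 1) = wallisConst n ^ (n - 2) * wallisConst n := by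
    rw [← pow_succ]; congr 1; omega
  rw [e, mul_div_assoc', mul_div_assoc', div_le_div_iff₀ (by positivity) (by positivity)]
  have key : 2.9 * (n * wallisConst n) ≤ ((2 * n + 4) / (2 * n + 1) : ℝ) ^ (n - 1) := by
    push_cast at h1
    nlinarith
  calc _ = 2.9 * (n * wallisConst n) * ((n + 1) * wallisConst n ^ (n - 2)) := by ring
    _ ≤ ((2 * n + 4) / (2 * n + 1) : ℝ) ^ (n - 1) * ((n + 1) * wallisConst n ^ (n - 2)) :=
      mul_le_mul_of_nonneg_right key (by positivity)
    _ = _ := by push_cast; ring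

theorem evenWeight_one_le : evenWeight 1 ≤ 1.0001 := by
  rw [evenWeight, evenBound_one, wallisConst_one]
  have hpi := Real.pi_lt_d4
  linarith

theorem evenWeight_two_le : evenWeight 2 ≤ 1.3785 := by
  rw [evenWeight, evenBound_two, wallisConst_two]
  have hpi := Real.pi_lt_d4
  linarith

theorem evenWeight_three_eq : evenWeight 3 = 38.4 / Real.pi := by
  rw [evenWeight_of_three_le le_rfl, wallisConst_three]
  have := Real.pi_pos
  norm_num
  field_simp
  norm_num

theorem evenWeight_four_eq : evenWeight 4 = 65536 / 49 / Real.pi ^ 2 := by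
  rw [evenWeight_of_three_le (by norm_num), wallisConst_four]
  have := Real.pi_pos
  norm_num
  field_simp
  norm_num

/-- Weighted sum of `evenWeight j`, `j < i`. -/
def evenWeightSum (i : ℕ) : ℝ := ∑ j ∈ Ico 1 i, evenWeight j * ((i : ℝ) / 2.3) ^ (i - j)

/-- Passing to `n + 1` multiplies the powers by at most `(1 + 1/n)^{n-1} ≤ 3`. The induction closes
because `3 · 0.29 + 1 = 1.87` and `1.87 / 2.3 ≤ 0.29 · 2.9`. -/
theorem evenWeightSum_succ_le {n : ℕ} (hn : 4 ≤ n) (h : evenWeightSum n ≤ 0.29 * evenWeight n) :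
    evenWeightSum (n + 1) ≤ 0.29 * evenWeight (n + 1) := by
  have hnR : (4 : ℝ) ≤ n := by exact_mod_cast hn
  have hg : ((n + 1 : ℝ) / n) ^ (n - 1) ≤ 3 := by
    have h1 : ((n + 1 : ℝ) / n) = 1 / n + 1 := by field_simp; ring
    have h1' : 1 ≤ (n + 1 : ℝ) / n := by rw [h1]; have : 0 ≤ 1 / (n : ℝ) := by positivity
                                         linarith
    calc ((n + 1 : ℝ) / n) ^ (n - 1) ≤ ((n + 1 : ℝ) / n) ^ n := pow_le_pow_right₀ h1' (by omega)
      _ ≤ Real.exp (1 / n) ^ n := by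
        gcongr; rw [h1]; exact Real.add_one_le_exp _
      _ = Real.exp 1 := by rw [← Real.exp_nat_mul]; congr 1; field_simp
      _ ≤ 3 := by have := Real.exp_one_lt_d9; linarith
  have hT := evenWeight_nonneg n
  have h2 : evenWeightSum (n + 1) ≤ (n + 1) / 2.3 * (3 * evenWeightSum n + evenWeight n) := by
    unfold evenWeightSum
    rw [sum_Ico_succ_top (by omega), mul_add, mul_sum, mul_sum]
    refine add_le_add (sum_le_sum fun j hj => ?_) (le_of_eq ?_)
    · obtain ⟨hj1, hj2⟩ := mem_Ico.1 hj
      rw [show n + 1 - j = (n - j) + 1 by omega, pow_succ]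
      have e : ((n + 1 : ℕ) : ℝ) / 2.3 = ((n + 1 : ℝ) / n) * (n / 2.3) := by
        push_cast; field_simp
      have h1' : 1 ≤ (n + 1 : ℝ) / n := by rw [le_div_iff₀ (by positivity)]; linarith
      have h3 : ((n + 1 : ℝ) / n) ^ (n - j) ≤ 3 :=
        (pow_le_pow_right₀ h1' (by omega)).trans hg
      have h4 := evenWeight_nonneg j
      calc _ = (((n + 1 : ℕ) : ℝ) / 2.3) * (evenWeight j * (((n + 1 : ℕ) : ℝ) / 2.3) ^ (n - j)) := by
            ring
        _ = ((n + 1 : ℝ) / 2.3) * (((n + 1 : ℝ) / n) ^ (n - j) * (evenWeight j *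
            ((n : ℝ) / 2.3) ^ (n - j))) := by rw [e, mul_pow, ← e]; push_cast; ring
        _ ≤ _ := by gcongr
    · rw [show n + 1 - n = 1 by omega, pow_one]; push_cast; ring
  have h3 := evenWeight_succ_ge hn
  refine h2.trans (le_trans ?_ (mul_le_mul_of_nonneg_left h3 (by norm_num)))
  have h4 : 3 * evenWeightSum n + evenWeight n ≤ 1.87 * evenWeight n := by linarith
  calc _ ≤ (n + 1 : ℝ) / 2.3 * (1.87 * evenWeight n) := by gcongr
    _ = (1.87 / 2.3) * ((n + 1) * evenWeight n) := by ring
    _ ≤ (0.29 * 2.9) * ((n + 1) * evenWeight n) := by gcongr; norm_num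
    _ = _ := by ring

/-- The two bounds give `1 + 3 · evenWeightSum i ≤ evenWeight i`, the factor `3` being that of
`norm_holonomy_le_of_truncated`. -/
theorem evenWeightSum_le {i : ℕ} (hi : 3 ≤ i) :
    evenWeightSum i ≤ 0.29 * evenWeight i ∧ 12 ≤ evenWeight i := by
  have hpi := Real.pi_lt_d4
  have hpi' := Real.pi_gt_d4
  have hp := Real.pi_pos
  have h1 := evenWeight_one_le
  have h2 := evenWeight_two_le
  have h3 : evenWeight 3 ≤ 12.225 := by
    rw [evenWeight_three_eq, div_le_iff₀ hp]; linarith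
  have h3' : 12.222 ≤ evenWeight 3 := by
    rw [evenWeight_three_eq, le_div_iff₀ hp]; linarith
  rcases hi.eq_or_lt with rfl | hi
  · refine ⟨?_, by linarith⟩
    unfold evenWeightSum
    rw [sum_Ico_succ_top (by norm_num), sum_Ico_succ_top (by norm_num)]
    simp only [Ico_self, sum_empty, zero_add]
    norm_num
    linarith
  · induction i, hi using Nat.le_induction with
    | base =>
      have h4 : 135 ≤ evenWeight 4 := by
        rw [evenWeight_four_eq, le_div_iff₀ (by positivity)]
        have : Real.pi ^ 2 ≤ 3.1416 ^ 2 := pow_le_pow_left₀ hp.le hpi.le 2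
        norm_num at this ⊢
        linarith
      refine ⟨?_, by linarith⟩
      unfold evenWeightSum
      rw [sum_Ico_succ_top (by norm_num), sum_Ico_succ_top (by norm_num),
        sum_Ico_succ_top (by norm_num)]
      simp only [Ico_self, sum_empty, zero_add]
      norm_num
      linarith
    | succ n hn ih =>
      refine ⟨evenWeightSum_succ_le hn (ih (by omega)).1, ?_⟩
      have h := evenWeight_succ_ge hn
      have hnR : (4 : ℝ) ≤ n := by exact_mod_cast hn
      have h12 := (ih (by omega)).2
      nlinarith

end

/-! ### Normalized parameters and control of `λ_{2j}` by the odd coefficients. -/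

noncomputable section
open Finset MeasureTheory

/-- Size restrictions on the parameters `λ_l (1 + |λ|)^{-l}`; here `1 - p = |λ_1| / (1 + |λ|)`. -/
structure IsNormalizedParam {d : ℕ} (Q : Fin d → ℂ) (p : ℝ) : Prop where
  nonneg : 0 ≤ p
  le_one : p ≤ 1
  norm_one : ‖lamSeq Q 1‖ = 1 - p
  sum_two_le : ∑ l ∈ range (d + 1), (if 2 ≤ l then ‖lamSeq Q l‖ else 0) ≤ p ^ 2 / 4
  sum_odd_le :
    ∑ l ∈ range (d + 1), (if 3 ≤ l ∧ Odd l then ‖lamSeq Q l‖ else 0) ≤ 4 * p ^ 3 / 27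
  norm_le : ∀ l, 4 ≤ l → ‖lamSeq Q l‖ ≤ 27 / 256

section normalized
variable {d : ℕ}

theorem norm_lamSeq_le_sum (Q : Fin d → ℂ) (P : ℕ → Prop) [DecidablePred P] {l : ℕ} (hl : P l) :
    ‖lamSeq Q l‖ ≤ ∑ l ∈ range (d + 1), if P l then ‖lamSeq Q l‖ else 0 := by
  by_cases h : d < l
  · rw [lamSeq_of_lt _ h, norm_zero]
    exact sum_nonneg fun l _ => by split_ifs <;> simp
  · have := single_le_sum (f := fun l => if P l then ‖lamSeq Q l‖ else 0) (s := range (d + 1))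
      (fun l _ => by split_ifs <;> simp) (mem_range.2 (by omega : l < d + 1))
    simpa [hl] using this

namespace IsNormalizedParam
variable {Q : Fin d → ℂ} {p : ℝ} (hQ : IsNormalizedParam Q p)
include hQ

theorem norm_two_le : ‖lamSeq Q 2‖ ≤ p ^ 2 / 4 :=
  (norm_lamSeq_le_sum Q (2 ≤ ·) le_rfl).trans hQ.sum_two_le

theorem norm_three_le : ‖lamSeq Q 3‖ ≤ 4 * p ^ 3 / 27 :=
  (norm_lamSeq_le_sum Q (fun l => 3 ≤ l ∧ Odd l) ⟨le_rfl, by decide⟩).trans hQ.sum_odd_le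

theorem norm_apply_le_one (i : Fin d) : ‖Q i‖ ≤ 1 := by
  rw [← lamSeq_succ Q i]
  have h0 := hQ.nonneg
  have h1 := hQ.le_one
  rcases Nat.eq_zero_or_pos (i : ℕ) with h | h
  · rw [h, hQ.norm_one]; linarith
  · have := (norm_lamSeq_le_sum Q (2 ≤ ·) (by omega : 2 ≤ (i : ℕ) + 1)).trans hQ.sum_two_le
    nlinarith

/-- Dropping the parameters of index at least `m` preserves normalization. -/
theorem truncate {m : ℕ} (hm : 1 < m) {Q' : Fin d → ℂ}
    (hQ' : ∀ l, lamSeq Q' l = if l < m then lamSeq Q l else 0) : IsNormalizedParam Q' p := by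
  have hle : ∀ l, ‖lamSeq Q' l‖ ≤ ‖lamSeq Q l‖ := fun l => by
    rw [hQ']; split_ifs <;> simp
  refine ⟨hQ.nonneg, hQ.le_one, ?_, (sum_le_sum fun l _ => ?_).trans hQ.sum_two_le,
    (sum_le_sum fun l _ => ?_).trans hQ.sum_odd_le, fun l hl => (hle l).trans (hQ.norm_le l hl)⟩
  · rw [hQ', if_pos hm, hQ.norm_one]
  · split_ifs <;> [exact hle l; rfl]
  · split_ifs <;> [exact hle l; rfl]

end IsNormalizedParam

/-- The parameters of index less than `m`. -/
def truncateParam (Q : Fin d → ℂ) (m : ℕ) (i : Fin d) : ℂ := if (i : ℕ) + 1 < m then Q i else 0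

theorem lamSeq_truncateParam (Q : Fin d → ℂ) {m : ℕ} (l : ℕ) :
    lamSeq (truncateParam Q m) l = if l < m then lamSeq Q l else 0 := by
  unfold lamSeq truncateParam
  by_cases h : 0 < l ∧ l - 1 < d
  · rw [dif_pos h, dif_pos h]
    simp only [show l - 1 + 1 = l by omega]
  · rw [dif_neg h, dif_neg h, ite_self]

/-- With `u = 1/s` the numbers `b_l = |λ_l| u` sum to `1 - u`, and the normalized `λ_l` has modulus
`b_l u^{l-1}`. A tail starting at `l = m` is therefore at most `u^{m-1} (p - u)`. Maximizing over
`u` gives `p²/4`, `4p³/27` and, with `p ≤ 1`, `27/256`. -/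
theorem exists_normalizedParam (lam : Fin d → ℂ) :
    ∃ (Q : Fin d → ℂ) (p : ℝ), IsNormalizedParam Q p ∧ ∀ k, holonomy (lamSeq lam) k =
      ((1 + paramNorm lam : ℝ) : ℂ) ^ (k - 1) * holonomy (lamSeq Q) k := by
  set s := 1 + paramNorm lam with hs
  have hs1 : 1 ≤ s := by
    have : 0 ≤ paramNorm lam := sum_nonneg fun _ _ => norm_nonneg _
    linarith
  have hs0 : 0 < s := by linarith
  have hsC : (s : ℂ) ≠ 0 := by exact_mod_cast hs0.ne'
  set Q : Fin d → ℂ := fun i => lam i / (s : ℂ) ^ ((i : ℕ) + 1) with hQdef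
  have hlam : lamSeq lam = fun l => (s : ℂ) ^ l * lamSeq Q l := by
    funext l
    unfold lamSeq
    split_ifs with h
    · simp only [hQdef]
      rw [show l - 1 + 1 = l by omega, mul_div_cancel₀ _ (pow_ne_zero _ hsC)]
    · rw [mul_zero]
  set u := 1 / s with hu
  have hu0 : 0 < u := by positivity
  have hu1 : u ≤ 1 := by rw [hu, div_le_one hs0]; exact hs1
  have hsu : s * u = 1 := by rw [hu]; field_simp
  set b : ℕ → ℝ := fun l => ‖lamSeq lam l‖ * u with hb
  have hb0 : ∀ l, 0 ≤ b l := fun l => by positivity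
  have hQb : ∀ l, 1 ≤ l → ‖lamSeq Q l‖ = b l * u ^ (l - 1) := fun l hl => by
    simp only [hb]
    rw [mul_assoc, ← pow_succ', show l - 1 + 1 = l by omega, hlam]
    simp only [norm_mul, norm_pow, Complex.norm_real, Real.norm_of_nonneg hs0.le]
    rw [mul_right_comm, ← mul_pow, hsu, one_pow, one_mul]
  have hsum : ∑ l ∈ range (d + 1), b l = 1 - u := by
    rw [sum_lamSeq lam (fun _ z => ‖z‖ * u) (by simp), ← sum_mul, ← paramNorm]
    have : paramNorm lam = s - 1 := by rw [hs]; ring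
    rw [this]; linarith
  have hbl : ∀ l, d < l → b l = 0 := fun l hl => by simp [hb, lamSeq_of_lt lam hl]
  have hsum2 : b 1 + ∑ l ∈ range (d + 1), (if 2 ≤ l then b l else 0) = 1 - u := by
    rw [← hsum]
    have e : ∀ l ∈ range (d + 1), b l = (if l = 1 then b 1 else 0) + if 2 ≤ l then b l else 0 := by
      intro l _
      rcases Nat.lt_or_ge l 2 with h | h
      · interval_cases l
        · simp [hb, lamSeq_zero]
        · simp
      · rw [if_neg (by omega), if_pos h, zero_add]
    rw [sum_congr rfl e, sum_add_distrib, sum_ite_eq' (range (d + 1)) 1 (fun _ => b 1)]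
    split_ifs with h
    · rfl
    · rw [hbl 1 (by rw [mem_range] at h; omega)]
  have h2nn : 0 ≤ ∑ l ∈ range (d + 1), (if 2 ≤ l then b l else 0) :=
    sum_nonneg fun l _ => by split_ifs <;> simp [hb0]
  have hb1 := hb0 1
  have htail : ∀ (P : ℕ → Prop) [DecidablePred P] (m : ℕ), 2 ≤ m → (∀ l, P l → m ≤ l) →
      ∑ l ∈ range (d + 1), (if P l then ‖lamSeq Q l‖ else 0) ≤ u ^ (m - 1) * (1 - b 1 - u) := by
    intro P _ m hm hP
    have : 1 - b 1 - u = ∑ l ∈ range (d + 1), (if 2 ≤ l then b l else 0) := by linarith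
    rw [this, mul_sum]
    refine sum_le_sum fun l _ => ?_
    split_ifs with h h' h'
    · rw [hQb l (by omega), mul_comm]
      exact mul_le_mul_of_nonneg_right (pow_le_pow_of_le_one hu0.le hu1 (by have := hP l h; omega))
        (hb0 l)
    · exact absurd (hP l h) (by omega)
    · exact mul_nonneg (by positivity) (hb0 l)
    · simp
  refine ⟨Q, 1 - b 1, ⟨by linarith, by linarith, ?_, ?_, ?_, fun l hl => ?_⟩, fun k => ?_⟩
  · rw [hQb 1 le_rfl, Nat.sub_self, pow_zero, mul_one]; ring
  · refine (htail _ 2 le_rfl fun l hl => hl).trans ?_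
    nlinarith [sq_nonneg (1 - b 1 - 2 * u)]
  · refine (htail _ 3 (by norm_num) fun l hl => hl.1).trans ?_
    have h : 0 ≤ (u - 2 * (1 - b 1) / 3) ^ 2 * (u + (1 - b 1) / 3) :=
      mul_nonneg (sq_nonneg _) (by linarith)
    norm_num
    linarith
  · refine (norm_lamSeq_le_sum Q (4 ≤ ·) hl).trans ((htail _ 4 (by norm_num) fun l hl => hl).trans ?_)
    have h : 0 ≤ (u - 3 / 4) ^ 2 * (u ^ 2 + u / 2 + 3 / 16) :=
      mul_nonneg (sq_nonneg _) (by positivity)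
    have : u ^ (4 - 1) * (1 - b 1 - u) ≤ u ^ 3 * (1 - u) :=
      mul_le_mul_of_nonneg_left (by linarith) (by positivity)
    refine this.trans ?_
    linarith
  · rw [hlam, holonomy_rescale]

theorem sum_even_le {F : ℕ → ℝ} (hF : ∀ l, 0 ≤ F l) {i : ℕ} (hi : ∀ l, 2 * i ≤ l → F l = 0)
    (D : ℕ) : ∑ l ∈ range D, (if 2 ≤ l ∧ Even l then F l else 0) ≤ ∑ j ∈ Ico 1 i, F (2 * j) := by
  have h : ∑ j ∈ Ico 1 i, F (2 * j) = ∑ l ∈ (Ico 1 i).image (2 * ·), F l :=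
    (sum_image fun a _ b _ h => by simpa using h).symm
  have e : ∑ l ∈ range D, (if 2 ≤ l ∧ Even l then F l else 0) =
      ∑ l ∈ (range D).filter (fun l => 2 ≤ l ∧ Even l ∧ l < 2 * i), F l := by
    rw [sum_filter]
    refine sum_congr rfl fun l _ => ?_
    by_cases h : l < 2 * i
    · simp [h]
    · simp [h, hi l (by omega)]
  rw [h, e]
  refine sum_le_sum_of_subset_of_nonneg (fun l hl => ?_) fun l _ _ => hF l
  obtain ⟨-, h1, ⟨m, rfl⟩, h3⟩ := mem_filter.1 hl
  exact mem_image.2 ⟨m, mem_Ico.2 ⟨by omega, by omega⟩, by ring⟩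

/-- The triangular structure: parameters of index above `2j` do not enter `f_{2j+1}`, and `λ_{2j}`
enters linearly with coefficient `c_{2j+1}`. -/
theorem holonomy_eq_add_even (Q : Fin d → ℂ) {j : ℕ} (hj : 1 ≤ j) :
    holonomy (lamSeq Q) (2 * j + 1) =
      holonomy (lamSeq (truncateParam Q (2 * j))) (2 * j + 1) +
        lamSeq Q (2 * j) * (wallisConst j : ℂ) := by
  rw [holonomy_succ_sub (L' := lamSeq (truncateParam Q (2 * j))) (by omega)
    (fun w hw _ => by rw [lamSeq_truncateParam, if_pos hw]), integral_cosC_pow_mul_sinC_sq,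
    lamSeq_truncateParam, if_neg (lt_irrefl _), sub_zero]

theorem holonomy_truncateParam_two (Q : Fin d → ℂ) {k : ℕ} (hk : k ≠ 1) :
    holonomy (lamSeq (truncateParam Q 2)) k = 0 := by
  refine holonomy_eq_zero_of_odd (fun l hl => ?_) hk
  rw [lamSeq_truncateParam]
  split_ifs with h
  · obtain rfl : l = 0 := by rcases hl with ⟨m, rfl⟩; omega
    exact lamSeq_zero _
  · rfl

/-- Strong induction on the triangular system: `λ_{2i} c_{2i+1}` is `f_{2i+1}` minus the value at
the truncated parameters, which is bounded linearly by the earlier even parameters. -/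
theorem IsNormalizedParam.norm_le_evenBound {Q : Fin d → ℂ} {p : ℝ} (hQ : IsNormalizedParam Q p)
    {n : ℕ} {M : ℝ} (hM : ∀ j, 1 ≤ j → j ≤ n → ‖holonomy (lamSeq Q) (2 * j + 1)‖ ≤ M) :
    ∀ i, 1 ≤ i → i ≤ n → ‖lamSeq Q (2 * i)‖ ≤ evenBound i * M := by
  intro i
  induction i using Nat.strong_induction_on with
  | _ i ih =>
    intro hi hin
    have hM0 : 0 ≤ M := (norm_nonneg _).trans (hM i hi hin)
    have hc := wallisConst_pos i
    have hf := holonomy_eq_add_even Q hi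
    have hnorm : ‖lamSeq Q (2 * i)‖ * wallisConst i ≤
        M + ‖holonomy (lamSeq (truncateParam Q (2 * i))) (2 * i + 1)‖ := by
      have e : lamSeq Q (2 * i) * (wallisConst i : ℂ) = holonomy (lamSeq Q) (2 * i + 1) -
          holonomy (lamSeq (truncateParam Q (2 * i))) (2 * i + 1) := by rw [hf]; ring
      calc _ = ‖lamSeq Q (2 * i) * (wallisConst i : ℂ)‖ := by
            rw [norm_mul, Complex.norm_real, Real.norm_of_nonneg hc.le]
        _ ≤ _ := by rw [e]; exact (norm_sub_le _ _).trans (add_le_add (hM i hi hin) le_rfl)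
    have hpi := Real.pi_gt_d4
    have hpi' := Real.pi_lt_d4
    rcases (show i = 1 ∨ i = 2 ∨ 3 ≤ i by omega) with rfl | rfl | h3
    · rw [mul_one, holonomy_truncateParam_two _ (by norm_num), norm_zero, add_zero,
        wallisConst_one] at hnorm
      rw [mul_one, evenBound_one]
      nlinarith [norm_nonneg (lamSeq Q 2)]
    · have h1 := ih 1 (by norm_num) le_rfl (by omega)
      rw [evenBound_one, mul_one] at h1
      have ht := lamSeq_truncateParam Q (m := 4)
      have hp0 := hQ.nonneg
      have hp1 := hQ.le_one
      have h5 := (norm_holonomy_four_five_six (truncateParam Q 4)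
        (fun l hl => by rw [ht, if_neg (by omega)]) (by rw [ht, if_pos (by norm_num), hQ.norm_one])
        (by rw [ht, if_pos (by norm_num)]) rfl).2.1
      have h2 := hQ.norm_two_le
      have ha := norm_nonneg (lamSeq Q 2)
      -- The value `0.297` yields `(1 + 0.297 · 1.2733) · 8/π ≤ 3.51`, the constant for `j = 2`.
      have hB : (2 / 3 * (1 - p)) ^ 2 * (Real.pi / 8) +
          ‖lamSeq Q 2‖ * (Real.pi / 12 + 3 / 2 * (Real.pi / 4) ^ 2) ≤ 0.297 := by
        have hsq : Real.pi ^ 2 ≤ 9.8697 := by nlinarith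
        have k1 : (2 / 3 * (1 - p)) ^ 2 * (Real.pi / 8) ≤ (2 / 3 * (1 - p)) ^ 2 * 0.3928 :=
          mul_le_mul_of_nonneg_left (by linarith) (sq_nonneg _)
        have k2 : ‖lamSeq Q 2‖ * (Real.pi / 12 + 3 / 2 * (Real.pi / 4) ^ 2) ≤ p ^ 2 / 4 * 1.1872 :=
          mul_le_mul h2 (by nlinarith) (by positivity) (by positivity)
        nlinarith
      have h5' : ‖holonomy (lamSeq (truncateParam Q 4)) 5‖ ≤ ‖lamSeq Q 2‖ * 0.297 :=
        h5.trans (mul_le_mul_of_nonneg_left hB ha)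
      norm_num at hnorm
      rw [evenBound_two, wallisConst_two] at *
      norm_num at hnorm ⊢
      nlinarith [norm_nonneg (lamSeq Q 4)]
    -- Arguing by contradiction supplies smallness: failure forces `evenBound i * M < 27/256`. The
    -- earlier even parameters then sum to at most `0.0961 · 27/256 ≤ 0.0104`, the hypothesis of
    -- `norm_holonomy_le_of_truncated`.
    · by_contra hcon
      push Not at hcon
      have hτ := evenBound_nonneg i
      have ht := lamSeq_truncateParam Q (m := 2 * i)
      have hQ' := hQ.truncate (by omega) ht
      have hsmall := hcon.trans_le (hQ.norm_le (2 * i) (by omega))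
      have hj : ∀ j ∈ Ico 1 i, lamSeq (truncateParam Q (2 * i)) (2 * j) = lamSeq Q (2 * j) :=
        fun j hj => by rw [ht, if_pos (by have := (mem_Ico.1 hj).2; omega)]
      have h2 : ∑ l ∈ range (d + 1), (if 2 ≤ l ∧ Even l then
          ‖lamSeq (truncateParam Q (2 * i)) l‖ else 0) ≤ 0.0104 := by
        refine (sum_even_le (fun l => norm_nonneg _) (i := i) (fun l hl => by
          rw [ht, if_neg (by omega), norm_zero]) (d + 1)).trans ?_
        have : ∑ j ∈ Ico 1 i, ‖lamSeq (truncateParam Q (2 * i)) (2 * j)‖ ≤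
            (∑ j ∈ Ico 1 i, evenBound j) * M := by
          rw [sum_mul]
          refine sum_le_sum fun j hj' => ?_
          obtain ⟨hj1, hj2⟩ := mem_Ico.1 hj'
          rw [hj j hj']; exact ih j hj2 hj1 (by omega)
        have := mul_le_mul_of_nonneg_right (sum_evenBound_le h3) hM0
        linarith
      have hE := norm_holonomy_le_of_truncated h3 (truncateParam Q (2 * i))
        (fun l hl => by rw [ht, if_neg (by omega)]) hQ'.nonneg hQ'.le_one hQ'.norm_one
        hQ'.sum_odd_le h2
      have hX : ∑ l ∈ range (d + 1), (if 2 ≤ l ∧ Even l then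
          ‖lamSeq (truncateParam Q (2 * i)) l‖ * wallisConst (l / 2) *
            ((i : ℝ) / 2.3) ^ (i - l / 2) else 0) ≤ evenWeightSum i * M := by
        refine (sum_even_le (F := fun l => ‖lamSeq (truncateParam Q (2 * i)) l‖ *
          wallisConst (l / 2) * ((i : ℝ) / 2.3) ^ (i - l / 2)) (fun l => ?_) (i := i) (fun l hl => by
            rw [ht, if_neg (by omega), norm_zero, zero_mul, zero_mul]) (d + 1)).trans ?_
        · have := (wallisConst_pos (l / 2)).le
          positivity
        · rw [evenWeightSum, sum_mul]
          refine sum_le_sum fun j hj' => ?_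
          obtain ⟨hj1, hj2⟩ := mem_Ico.1 hj'
          rw [hj j hj', Nat.mul_div_cancel_left j (by norm_num : 0 < 2)]
          have hcj := (wallisConst_pos j).le
          calc _ ≤ evenBound j * M * wallisConst j * ((i : ℝ) / 2.3) ^ (i - j) := by
                gcongr; exact ih j hj2 hj1 (by omega)
            _ = _ := by unfold evenWeight; ring
      obtain ⟨hX1, hX2⟩ := evenWeightSum_le h3
      have hfin : ‖lamSeq Q (2 * i)‖ * wallisConst i ≤ evenWeight i * M := by
        nlinarith
      have : evenBound i * M * wallisConst i < ‖lamSeq Q (2 * i)‖ * wallisConst i :=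
        mul_lt_mul_of_pos_right hcon hc
      unfold evenWeight at hfin
      linarith
end normalized
end

/-! ### Coefficient estimates against the constants `K₃` and `K₄`. -/

noncomputable section
open Finset MeasureTheory

section final
variable {d : ℕ}

theorem evenBound_mono_succ {j : ℕ} (hj : 1 ≤ j) : evenBound j ≤ evenBound (j + 1) := by
  rcases (show j = 1 ∨ j = 2 ∨ 3 ≤ j by omega) with rfl | rfl | h
  · rw [evenBound_one, evenBound_two]; norm_num
  · rw [evenBound_two, evenBound_three_eq]
    have hpi := Real.pi_lt_d4
    have hp := Real.pi_pos
    rw [le_div_iff₀ (by positivity)]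
    nlinarith
  · have := evenBound_succ_ge h
    have := evenBound_nonneg j
    linarith

theorem evenBound_mono {i j : ℕ} (hi : 1 ≤ i) (hij : i ≤ j) : evenBound i ≤ evenBound j := by
  induction j, hij using Nat.le_induction with
  | base => rfl
  | succ j h ih => exact ih.trans (evenBound_mono_succ (by omega))

theorem evenBound_le_div {n : ℕ} (hn : 2 ≤ n) :
    evenBound n ≤ n / wallisConst n ^ (n - 1) := by
  rcases hn.eq_or_lt with rfl | h
  · have hpi := Real.pi_lt_d4
    have hp := Real.pi_pos
    rw [evenBound_two, wallisConst_two]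
    norm_num
    rw [le_div_iff₀ (by positivity)]
    linarith
  · exact (evenBound_of_three_le h).le

theorem IsNormalizedParam.norm_holonomy_le_pow {Q : Fin d → ℂ} {p : ℝ}
    (hQ : IsNormalizedParam Q p) {k : ℕ} (hk : k ≠ 1) {E : ℝ}
    (hE : ∑ j ∈ Ico 1 (d / 2 + 1), ‖lamSeq Q (2 * j)‖ ≤ E) :
    ‖holonomy (lamSeq Q) k‖ ≤ 1.25 ^ k * (1.3 * E) := by
  have h := norm_holonomy_le_even_sum Q hk hQ.nonneg hQ.le_one hQ.norm_one hQ.sum_two_le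
    hQ.sum_odd_le
  have h2 := (sum_even_le (F := fun l => ‖lamSeq Q l‖) (fun l => norm_nonneg _) (i := d / 2 + 1)
    (fun l hl => by rw [lamSeq_of_lt _ (by omega), norm_zero]) (d + 1)).trans hE
  have e : (1.25 : ℝ) ^ k * 0.8 ^ k = 1 := by rw [← mul_pow]; norm_num
  calc _ = 1.25 ^ k * (‖holonomy (lamSeq Q) k‖ * 0.8 ^ k) := by
        rw [mul_left_comm, e, mul_one]
    _ ≤ _ := mul_le_mul_of_nonneg_left (h.trans (by linarith)) (by positivity)

theorem IsNormalizedParam.norm_holonomy_le_coeffNorm_mul {Q : Fin d → ℂ} {q : ℝ}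
    (hQ : IsNormalizedParam Q q) {p : MvPolynomial (Fin d) ℝ} {k : ℕ} (hk : k ≠ 1)
    (hp : ∀ lam : Fin d → ℂ, MvPolynomial.aeval lam p = holonomy (lamSeq lam) k) {Z : ℝ}
    (hZ0 : 0 ≤ Z) (hZ : ∀ j, 1 ≤ j → j ≤ d / 2 → ‖lamSeq Q (2 * j)‖ ≤ Z) :
    ‖holonomy (lamSeq Q) k‖ ≤ coeffNorm p * Z := by
  refine norm_holonomy_le_coeffNorm hk hp hQ.norm_apply_le_one hZ0 fun i hi => ?_
  obtain ⟨m, hm⟩ := hi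
  have := i.2
  rw [← lamSeq_succ Q i, hm, show 2 * m + 1 + 1 = 2 * (m + 1) by ring]
  exact hZ _ (by omega) (by omega)

theorem norm_holonomy_three (Q : Fin d → ℂ) :
    ‖holonomy (lamSeq Q) 3‖ = ‖lamSeq Q 2‖ * wallisConst 1 := by
  have h := holonomy_eq_add_even Q le_rfl
  rw [mul_one, holonomy_truncateParam_two _ (by norm_num), zero_add] at h
  rw [h, norm_mul, Complex.norm_real, Real.norm_of_nonneg (wallisConst_pos 1).le]

theorem IsNormalizedParam.norm_holonomy_le_of_four_five_six {Q : Fin d → ℂ} {p : ℝ}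
    (hQ : IsNormalizedParam Q p) (hd : d < 4) {k : ℕ} (hk4 : 4 ≤ k) (hk6 : k ≤ 6) :
    ‖holonomy (lamSeq Q) k‖ ≤ ‖lamSeq Q 2‖ := by
  obtain ⟨h4, h5, h6⟩ := norm_holonomy_four_five_six Q
    (fun l hl => lamSeq_of_lt _ (by omega)) hQ.norm_one rfl rfl
  have ha := norm_nonneg (lamSeq Q 2)
  have h2 := hQ.norm_two_le
  have h3 := hQ.norm_three_le
  have hp0 := hQ.nonneg
  have hp1 := hQ.le_one
  have hpi := Real.pi_gt_d4
  have hpi' := Real.pi_lt_d4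
  have hsq : Real.pi ^ 2 ≤ 9.8697 := by nlinarith
  have hpp : p ^ 2 ≤ p := by nlinarith
  interval_cases k
  · refine h4.trans ?_
    rw [mul_assoc]
    exact mul_le_of_le_one_right ha (by nlinarith)
  · refine h5.trans (mul_le_of_le_one_right ha ?_)
    have k1 : (2 / 3 * (1 - p)) ^ 2 * (Real.pi / 8) ≤ (2 / 3 * (1 - p)) ^ 2 * 0.3928 :=
      mul_le_mul_of_nonneg_left (by linarith) (sq_nonneg _)
    have k2 : ‖lamSeq Q 2‖ * (Real.pi / 12 + 3 / 2 * (Real.pi / 4) ^ 2) ≤ p ^ 2 / 4 * 1.1872 :=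
      mul_le_mul h2 (by nlinarith) (by positivity) (by positivity)
    nlinarith
  · refine h6.trans (mul_le_of_le_one_right ha ?_)
    have hq0 : 0 ≤ 2 / 3 * (1 - p) := by linarith
    have k0 : (2 / 3 * (1 - p)) ^ 3 ≤ 8 / 27 := by
      calc _ ≤ (2 / 3 : ℝ) ^ 3 := pow_le_pow_left₀ hq0 (by linarith) 3
        _ = _ := by norm_num
    have k1 : (2 / 3 * (1 - p)) ^ 3 * (Real.pi / 4) ≤ 8 / 27 * 0.7854 :=
      mul_le_mul k0 (by linarith) (by positivity) (by positivity)
    have k3 : ‖lamSeq Q 2‖ * (2 / 3 * (1 - p)) + ‖lamSeq Q 3‖ ≤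
        p ^ 2 / 4 * (2 / 3 * (1 - p)) + 4 * p ^ 3 / 27 :=
      add_le_add (mul_le_mul_of_nonneg_right h2 hq0) h3
    have k4 : p ^ 2 / 4 * (2 / 3 * (1 - p)) + 4 * p ^ 3 / 27 ≤ 1 / 6 := by
      have : 0 ≤ p ^ 3 := by positivity
      nlinarith
    have k5 : (‖lamSeq Q 2‖ * (2 / 3 * (1 - p)) + ‖lamSeq Q 3‖) *
        (Real.pi / 6 + 7 / 2 * (Real.pi / 4) ^ 2) ≤ 1 / 6 * 2.7 :=
      mul_le_mul (k3.trans k4) (by nlinarith) (by positivity) (by norm_num)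
    linarith

theorem le_of_lt_pow_three {a K : ℝ} (h0 : 0 ≤ K) (h : a ^ 3 ≤ K ^ 3) : a ≤ K :=
  le_of_pow_le_pow_left₀ (by norm_num) h0 h

/-- An inequality of this type propagates from `k₀` to all larger `k`, because each step multiplies
the left by `1.25` and the right by `K ≥ 1.25`. -/
theorem mul_pow_le_pow_add {K A : ℝ} (hK : 1.25 ≤ K) {m k₀ k : ℕ} (hm : m ≤ k₀) (hk : k₀ ≤ k)
    (h : A * 1.25 ^ k₀ ≤ K ^ (k₀ - m)) : A * 1.25 ^ k ≤ K ^ (k - m) := by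
  have hK0 : 0 ≤ K := by linarith
  obtain ⟨j, rfl⟩ := Nat.exists_eq_add_of_le hk
  rw [show k₀ + j - m = (k₀ - m) + j by omega, pow_add, pow_add, ← mul_assoc]
  exact mul_le_mul h (pow_le_pow_left₀ (by norm_num) hK j) (by positivity) (by positivity)

/-- The coefficient estimate for `d ∈ {2, 3}`. -/
theorem IsNormalizedParam.norm_holonomy_le_of_half_eq_one {Q : Fin d → ℂ} {q : ℝ}
    (hQ : IsNormalizedParam Q q) (hd : d / 2 = 1) {p : MvPolynomial (Fin d) ℝ} {k : ℕ} (hk : 4 ≤ k)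
    (hw : p.IsWeightedHomogeneous (indexWeight d) (k - 1))
    (hp : ∀ lam : Fin d → ℂ, MvPolynomial.aeval lam p = holonomy (lamSeq lam) k) {K₃ K₄ : ℝ}
    (hK : 0 < K₄) (hu : 1 ≤ K₃ * K₄) (hcn : coeffNorm p ≤ K₃ * K₄ ^ k) :
    ‖holonomy (lamSeq Q) k‖ ≤ K₃ ^ 2 * K₄ ^ (k - 2) * ‖lamSeq Q 2‖ := by
  have ha := norm_nonneg (lamSeq Q 2)
  have hK3 : 0 < K₃ := by by_contra h; push Not at h; nlinarith
  have hu2 : 1 ≤ (K₃ * K₄) ^ 2 := one_le_pow₀ hu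
  have hKk : K₄ ^ k = K₄ ^ (k - 2) * K₄ ^ 2 := by rw [← pow_add]; congr 1; omega
  have hKk4 : K₄ ^ (k - 2) = K₄ ^ (k - 4) * K₄ ^ 2 := by rw [← pow_add]; congr 1; omega
  have hge : K₄ ^ (k - 4) ≤ K₃ ^ 2 * K₄ ^ (k - 2) := by
    rw [hKk4]
    calc K₄ ^ (k - 4) ≤ K₄ ^ (k - 4) * (K₃ * K₄) ^ 2 := le_mul_of_one_le_right (by positivity) hu2
      _ = _ := by ring
  -- If `K₄ < 1`, then `K₃ ≥ 1 / K₄ > 1 > K₄²`, and the coefficient norm alone suffices.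
  rcases lt_or_ge K₄ 1 with h1 | h1
  · have h := hQ.norm_holonomy_le_coeffNorm_mul (by omega) hp ha fun j hj1 hj2 => by
      obtain rfl : j = 1 := by omega
      exact le_rfl
    refine h.trans (mul_le_mul_of_nonneg_right (hcn.trans ?_) ha)
    have : K₄ ^ 2 ≤ K₃ := by
      have : K₄ ^ 2 ≤ 1 := pow_le_one₀ hK.le h1.le
      nlinarith
    rw [hKk]
    have h0 : 0 ≤ K₃ * K₄ ^ (k - 2) := by positivity
    nlinarith
  · rcases Nat.lt_or_ge 6 k with h6 | h6
    -- The threshold is `27/4`. Below it `(4/27) K₄² ≤ K₃`, so the non-pure monomials fit; above it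
    -- `1.3 · 1.25^7 ≤ K₄³` starts the geometric comparison at `k = 7`.
    · rcases le_or_gt (K₄ ^ 3) 6.75 with h3 | h3
      · have hq : ‖lamSeq Q 1‖ = 1 - q := hQ.norm_one
        have h := norm_holonomy_le_pure (by omega) h6 hw hp hQ.norm_apply_le_one
          (q := 1 - q) (by linarith [hQ.le_one]) (by linarith [hQ.nonneg]) hq
          (by rw [sub_sub_cancel]; exact hQ.norm_two_le)
          (by rw [sub_sub_cancel]; exact hQ.norm_three_le)
        refine h.trans ?_
        rw [mul_comm]
        refine mul_le_mul_of_nonneg_right ?_ ha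
        have hge1 : 1 ≤ K₃ ^ 2 * K₄ ^ (k - 2) := (one_le_pow₀ h1).trans hge
        have hc : coeffNorm p * (4 / 27) ≤ K₃ ^ 2 * K₄ ^ (k - 2) := by
          have e : K₃ * K₄ ^ k * (4 / 27) = K₃ * K₄ ^ (k - 2) * (K₄ ^ 2 * (4 / 27)) := by
            rw [hKk]; ring
          have : K₄ ^ 2 * (4 / 27) ≤ K₃ := by
            refine le_of_mul_le_mul_right ?_ hK
            have : K₄ ^ 3 = K₄ ^ 2 * K₄ := by ring
            linarith
          have h0 : 0 ≤ K₃ * K₄ ^ (k - 2) := by positivity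
          calc _ ≤ K₃ * K₄ ^ k * (4 / 27) := by linarith
            _ = K₃ * K₄ ^ (k - 2) * (K₄ ^ 2 * (4 / 27)) := e
            _ ≤ K₃ * K₄ ^ (k - 2) * K₃ := mul_le_mul_of_nonneg_left this h0
            _ = _ := by ring
        have := hQ.nonneg
        have := hQ.le_one
        nlinarith
      · have hK' : 1.889 ≤ K₄ := le_of_lt_pow_three hK.le (by norm_num at h3 ⊢; linarith)
        have hE := hQ.norm_holonomy_le_pow (k := k) (by omega) (E := ‖lamSeq Q 2‖) (by simp [hd])
        have hpow := mul_pow_le_pow_add (K := K₄) (A := 1.3) (by linarith) (by norm_num : 4 ≤ 7) h6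
          (by norm_num at h3 ⊢; linarith)
        refine hE.trans ?_
        rw [← mul_assoc, mul_comm _ (1.3 : ℝ)]
        exact mul_le_mul_of_nonneg_right (hpow.trans hge) ha
    · refine (hQ.norm_holonomy_le_of_four_five_six (by omega) hk h6).trans ?_
      exact le_mul_of_one_le_left ha ((one_le_pow₀ h1).trans hge)

/-- The coefficient estimate for `d ≥ 4`, in the case `K₄ ≥ 1`. -/
theorem IsNormalizedParam.norm_holonomy_le_of_one_le {Q : Fin d → ℂ} {q : ℝ}
    (hQ : IsNormalizedParam Q q) (hd : 2 ≤ d / 2) {p : MvPolynomial (Fin d) ℝ} {k : ℕ}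
    (hk : 2 * (d / 2) + 2 ≤ k)
    (hp : ∀ lam : Fin d → ℂ, MvPolynomial.aeval lam p = holonomy (lamSeq lam) k) {K₃ K₄ M : ℝ}
    (hK : 1 ≤ K₄) (hu : 1 ≤ K₃ * K₄) (hcn : coeffNorm p ≤ K₃ * K₄ ^ k)
    (hM : ∀ j, 1 ≤ j → j ≤ d / 2 → ‖holonomy (lamSeq Q) (2 * j + 1)‖ ≤ M) :
    ‖holonomy (lamSeq Q) k‖ ≤
      (d / 2 : ℕ) / wallisConst (d / 2) ^ (d / 2) * (K₃ ^ 2 * K₄ ^ (k - 2)) * M := by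
  have hM0 : 0 ≤ M := (norm_nonneg _).trans (hM 1 le_rfl (by omega))
  have hK0 : 0 < K₄ := by linarith
  have hK3 : 0 < K₃ := by by_contra h; push Not at h; nlinarith
  have hu2 : 1 ≤ (K₃ * K₄) ^ 2 := one_le_pow₀ hu
  have hKk : K₄ ^ k = K₄ ^ (k - 2) * K₄ ^ 2 := by rw [← pow_add]; congr 1; omega
  have hKk4 : K₄ ^ (k - 2) = K₄ ^ (k - 4) * K₄ ^ 2 := by rw [← pow_add]; congr 1; omega
  have hge : K₄ ^ (k - 4) ≤ K₃ ^ 2 * K₄ ^ (k - 2) := by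
    rw [hKk4]
    calc K₄ ^ (k - 4) ≤ K₄ ^ (k - 4) * (K₃ * K₄) ^ 2 := le_mul_of_one_le_right (by positivity) hu2
      _ = _ := by ring
  have hτ := hQ.norm_le_evenBound hM
  set n := d / 2 with hn
  have hc := wallisConst_pos n
  have hpi := Real.pi_gt_d4
  have hpi' := Real.pi_lt_d4
  have hτ0 := evenBound_nonneg n
  -- Moderate `K₄`: the coefficient norm times the largest even parameter, with `K₃ K₄ ≥ 1` used to
  -- spend a factor `K₃`.
  have hsmall : K₄ ^ 3 * evenBound n ≤ n / wallisConst n ^ n →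
      ‖holonomy (lamSeq Q) k‖ ≤ n / wallisConst n ^ n * (K₃ ^ 2 * K₄ ^ (k - 2)) * M := by
    intro h
    have h1 := hQ.norm_holonomy_le_coeffNorm_mul (by omega) hp (mul_nonneg hτ0 hM0)
      fun j hj1 hj2 => (hτ j hj1 hj2).trans
        (mul_le_mul_of_nonneg_right (evenBound_mono hj1 hj2) hM0)
    refine h1.trans ?_
    rw [← mul_assoc]
    refine mul_le_mul_of_nonneg_right ?_ hM0
    have h2 : K₄ ^ 2 * evenBound n ≤ n / wallisConst n ^ n * K₃ := by
      have h3 : n / wallisConst n ^ n ≤ n / wallisConst n ^ n * (K₃ * K₄) :=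
        le_mul_of_one_le_right (by positivity) hu
      refine le_of_mul_le_mul_right ?_ hK0
      calc _ = K₄ ^ 3 * evenBound n := by ring
        _ ≤ _ := h.trans h3
        _ = _ := by ring
    calc coeffNorm p * evenBound n ≤ K₃ * K₄ ^ k * evenBound n :=
          mul_le_mul_of_nonneg_right hcn hτ0
      _ = K₃ * K₄ ^ (k - 2) * (K₄ ^ 2 * evenBound n) := by rw [hKk]; ring
      _ ≤ K₃ * K₄ ^ (k - 2) * (n / wallisConst n ^ n * K₃) :=
          mul_le_mul_of_nonneg_left h2 (by positivity)
      _ = _ := by ring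
  -- Large `K₄`: the uniform growth `1.25^k` against `K₄^{k-4}`.
  have hlarge : ∀ S : ℝ, ∑ j ∈ Ico 1 (n + 1), evenBound j ≤ S →
      1.3 * S * 1.25 ^ k ≤ n / wallisConst n ^ n * K₄ ^ (k - 4) →
      ‖holonomy (lamSeq Q) k‖ ≤ n / wallisConst n ^ n * (K₃ ^ 2 * K₄ ^ (k - 2)) * M := by
    intro S hS h
    have hE := hQ.norm_holonomy_le_pow (k := k) (by omega) (E := S * M) (by
      refine le_trans ?_ (mul_le_mul_of_nonneg_right hS hM0)
      rw [sum_mul]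
      refine sum_le_sum fun j hj => ?_
      obtain ⟨hj1, hj2⟩ := mem_Ico.1 hj
      exact hτ j hj1 (by omega))
    calc _ ≤ _ := hE
      _ = 1.3 * S * 1.25 ^ k * M := by ring
      _ ≤ _ := mul_le_mul_of_nonneg_right (h.trans (mul_le_mul_of_nonneg_left hge (by positivity)))
          hM0
  rcases hd.eq_or_lt with h2 | h3
  · rw [← h2] at hsmall hlarge hk ⊢
    rw [evenBound_two, wallisConst_two] at *
    have hsq : Real.pi ^ 2 ≤ 9.8697 := by nlinarith
    have hval : 12.96 ≤ ((2 : ℕ) : ℝ) / (Real.pi / 8) ^ 2 := by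
      rw [le_div_iff₀ (by positivity)]; push_cast; nlinarith
    -- The threshold satisfies `3.69 · 3.51 ≤ 12.96`, a lower bound for `2 / (π/8)²`.
    rcases le_or_gt (K₄ ^ 3) 3.69 with h | h
    · exact hsmall (by linarith)
    · have hK' : 1.545 ≤ K₄ := le_of_lt_pow_three hK0.le (by norm_num at h ⊢; linarith)
      have hpow := mul_pow_le_pow_add (K := K₄) (A := 0.5) (k := k) (by linarith) (by norm_num : 4 ≤ 6) hk
        (by norm_num; nlinarith)
      refine hlarge 4.784 ?_ ?_
      · rw [sum_Ico_succ_top (by norm_num), sum_Ico_succ_top (by norm_num)]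
        simp only [Ico_self, sum_empty, evenBound_one, evenBound_two]
        norm_num
      · have h0 : 0 ≤ K₄ ^ (k - 4) := by positivity
        have h1 := mul_le_mul_of_nonneg_right hval h0
        linarith
  · have hcn3 := wallisConst_antitone (show 3 ≤ n from h3)
    rw [wallisConst_three] at hcn3
    have hcn4 : wallisConst n ≤ 0.24545 := by linarith
    have hτn := evenBound_of_three_le h3
    have e : (n : ℝ) / wallisConst n ^ n = evenBound n * (1 / wallisConst n) := by
      have e' : wallisConst n ^ n = wallisConst n ^ (n - 1) * wallisConst n := by
        rw [← pow_succ]; congr 1; omega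
      rw [hτn, e']; field_simp
    have hinv : 4.07 ≤ 1 / wallisConst n := by rw [le_div_iff₀ hc]; linarith
    rcases le_or_gt (K₄ ^ 3) (1 / wallisConst n) with h | h
    · refine hsmall ?_
      rw [e, mul_comm]
      exact mul_le_mul_of_nonneg_left h hτ0
    · have hK' : 1.59 ≤ K₄ := le_of_lt_pow_three hK0.le (by norm_num at h hinv ⊢; linarith)
      have h8 : 8 ≤ k := by omega
      have hpow := mul_pow_le_pow_add (K := K₄) (A := 1) (by linarith) (by norm_num : 4 ≤ 8) h8
        (by
          have : (1.59 : ℝ) ^ 4 ≤ K₄ ^ 4 := pow_le_pow_left₀ (by norm_num) hK' 4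
          refine le_trans ?_ this
          norm_num)
      refine hlarge (1.0961 * evenBound n) ?_ ?_
      · rw [sum_Ico_succ_top (by omega)]
        have := sum_evenBound_le h3
        linarith
      · have h0 : 0 ≤ K₄ ^ (k - 4) := by positivity
        have h1 : 4 * K₄ ^ (k - 4) ≤ 1 / wallisConst n * K₄ ^ (k - 4) :=
          mul_le_mul_of_nonneg_right (by linarith) h0
        have h2 : 1.3 * 1.0961 * 1.25 ^ k ≤ 1 / wallisConst n * K₄ ^ (k - 4) := by linarith
        calc _ = evenBound n * (1.3 * 1.0961 * 1.25 ^ k) := by ring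
          _ ≤ _ := mul_le_mul_of_nonneg_left h2 hτ0
          _ = _ := by rw [e]; ring
end final
end

/-! ### The Bernstein inequality and the main theorem. -/

noncomputable section
open Finset MeasureTheory

section bernstein
variable {d : ℕ}

/-- Evaluate at `λ_{2n} = 1`, all other parameters zero, where `f_{2n+1} = c_{2n+1}`. This bounds
`K₃ K₄^{2n+1}` from below, which is needed when `K₄ < 1`. -/
theorem wallisConst_le_coeffNorm {n : ℕ} (hn : 1 ≤ n) (hnd : 2 * n ≤ d)
    {p : MvPolynomial (Fin d) ℝ}
    (hp : ∀ lam : Fin d → ℂ, MvPolynomial.aeval lam p = holonomy (lamSeq lam) (2 * n + 1)) :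
    wallisConst n ≤ coeffNorm p := by
  set lam : Fin d → ℂ := fun i => if (i : ℕ) + 1 = 2 * n then 1 else 0 with hlam
  have hseq : ∀ l, lamSeq lam l = if l = 2 * n then 1 else 0 := fun l => by
    unfold lamSeq
    by_cases h : 0 < l ∧ l - 1 < d
    · rw [dif_pos h]; simp only [hlam, show l - 1 + 1 = l by omega]
    · rw [dif_neg h, if_neg (by omega)]
  have h := norm_aeval_le (p := p) (lam := lam) fun i => by
    simp only [hlam]; split_ifs <;> simp
  rw [hp, holonomy_eq_add_even lam hn, holonomy_eq_zero_of_odd (fun l _ => by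
    rw [lamSeq_truncateParam, hseq]; split_ifs <;> first | rfl | omega) (by omega), hseq,
    if_pos rfl, zero_add, one_mul, Complex.norm_real,
    Real.norm_of_nonneg (wallisConst_pos n).le] at h
  exact h

theorem IsNormalizedParam.norm_holonomy_le_bernsteinConst {Q : Fin d → ℂ} {q : ℝ}
    (hQ : IsNormalizedParam Q q) {f : ℕ → MvPolynomial (Fin d) ℝ}
    (hw : ∀ k, (f k).IsWeightedHomogeneous (indexWeight d) (k - 1))
    (hf : ∀ k (lam : Fin d → ℂ), MvPolynomial.aeval lam (f k) = holonomy (lamSeq lam) k)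
    {K₃ K₄ : ℝ} (hA : IsA0Series 1 (-1) K₃ K₄ f) {k : ℕ} (hk : 2 * (d / 2) + 1 < k) {μ : ℝ}
    (hμ : ∀ j, 1 ≤ j → j ≤ d / 2 →
      ‖holonomy (lamSeq Q) (2 * j + 1)‖ ≤ μ * K₄ ^ (2 * j + 1)) :
    ‖holonomy (lamSeq Q) k‖ ≤ bernsteinConst (d / 2) K₃ K₄ * (μ * K₄ ^ k) := by
  have hK := hA.K₄_pos
  have hK3 := hA.K₃_pos
  have hc := wallisConst_pos (d / 2)
  -- The coefficient `f_1 = 1` makes the given constants satisfy `K₃ K₄ ≥ 1`.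
  have hu : 1 ≤ K₃ * K₄ := by
    have h := norm_aeval_le (p := f 1) (lam := fun _ => 0) fun i => by simp
    rw [hf, holonomy_one, NormOneClass.norm_one] at h
    simpa using h.trans (hA.norm_le 1)
  -- For `n = 0` there is no even-index parameter: every `f_k` with `k > 1` vanishes, in accordance
  -- with the constant being `0`.
  rcases Nat.eq_zero_or_pos (d / 2) with h0 | hn
  · rw [holonomy_eq_zero_of_odd (fun l hl => ?_) (by omega), norm_zero, bernsteinConst, h0]
    · simp
    · rcases hl with ⟨m, rfl⟩
      rcases Nat.eq_zero_or_pos m with rfl | hm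
      · exact lamSeq_zero _
      · exact lamSeq_of_lt _ (by omega)
  have hμ0 : 0 ≤ μ := by
    have h := (norm_nonneg _).trans (hμ 1 le_rfl hn)
    exact nonneg_of_mul_nonneg_left h (by positivity)
  rcases Nat.lt_or_ge 1 (d / 2) with hn2 | hn1
  swap
  · have hd : d / 2 = 1 := by omega
    have h := hQ.norm_holonomy_le_of_half_eq_one hd (by omega) (hw k) (hf k) hK hu (hA.norm_le k)
    have h3 := hμ 1 le_rfl hn
    rw [norm_holonomy_three] at h3
    have hc1 := wallisConst_pos 1
    have h2 : ‖lamSeq Q 2‖ ≤ μ * K₄ ^ 3 / wallisConst 1 := by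
      rw [le_div_iff₀ hc1]; exact h3
    refine h.trans ((mul_le_mul_of_nonneg_left h2 (by positivity)).trans (le_of_eq ?_))
    have hKk : K₄ ^ k = K₄ ^ (k - 2) * K₄ ^ 2 := by rw [← pow_add]; congr 1; omega
    rw [bernsteinConst, hd, hKk]
    push_cast
    ring
  set n := d / 2 with hnd
  have hconst : bernsteinConst n K₃ K₄ = n / wallisConst n ^ n * (K₃ ^ 2 * K₄ ^ (2 * n - 1)) := by
    rw [bernsteinConst]; ring
  have hKn : K₄ ^ (2 * n + 1) = K₄ ^ (2 * n - 1) * K₄ ^ 2 := by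
    rw [← pow_add]; congr 1; omega
  have hKk : K₄ ^ k = K₄ ^ (k - 2) * K₄ ^ 2 := by rw [← pow_add]; congr 1; omega
  -- The largest of the bounds `μ K₄^{2j+1}` is the one with `j = 1` if `K₄ < 1`, and with `j = n`
  -- otherwise.
  rcases lt_or_ge K₄ 1 with h1 | h1
  · have hτ := hQ.norm_le_evenBound (M := μ * K₄ ^ 3) (n := n) fun j hj1 hj2 =>
      (hμ j hj1 hj2).trans (mul_le_mul_of_nonneg_left
        (pow_le_pow_of_le_one hK.le h1.le (by omega)) hμ0)
    have hM0 : 0 ≤ μ * K₄ ^ 3 := by positivity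
    have h := hQ.norm_holonomy_le_coeffNorm_mul (by omega) (hf k)
      (Z := n / wallisConst n ^ (n - 1) * (μ * K₄ ^ 3)) (by positivity) fun j hj1 hj2 =>
        (hτ j hj1 hj2).trans (mul_le_mul_of_nonneg_right
          ((evenBound_mono hj1 hj2).trans (evenBound_le_div hn2)) hM0)
    have hcn := (wallisConst_le_coeffNorm hn (by omega) (hf (2 * n + 1))).trans
      (hA.norm_le (2 * n + 1))
    have e : wallisConst n ^ n = wallisConst n ^ (n - 1) * wallisConst n := by
      rw [← pow_succ]; congr 1; omega
    have hkey : K₄ ^ 3 * wallisConst n ≤ K₃ * K₄ ^ (2 * n - 1) := by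
      have h2 : K₄ ^ 2 ≤ 1 := pow_le_one₀ hK.le h1.le
      have h3 : K₄ ^ 3 ≤ 1 := pow_le_one₀ hK.le h1.le
      have h4 : 0 ≤ K₃ * K₄ ^ (2 * n - 1) := by positivity
      rw [hKn, ← mul_assoc] at hcn
      nlinarith
    calc _ ≤ _ := h
      _ ≤ K₃ * K₄ ^ k * (n / wallisConst n ^ (n - 1) * (μ * K₄ ^ 3)) :=
          mul_le_mul_of_nonneg_right (hA.norm_le k) (by positivity)
      _ = K₃ * K₄ ^ k * (n / wallisConst n ^ n) * μ * (K₄ ^ 3 * wallisConst n) := by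
          rw [e]; field_simp
      _ ≤ K₃ * K₄ ^ k * (n / wallisConst n ^ n) * μ * (K₃ * K₄ ^ (2 * n - 1)) :=
          mul_le_mul_of_nonneg_left hkey (by positivity)
      _ = _ := by rw [hconst]; ring
  · have h := hQ.norm_holonomy_le_of_one_le hn2 (by omega) (hf k) h1 hu (hA.norm_le k)
      (M := μ * K₄ ^ (2 * n + 1)) fun j hj1 hj2 => (hμ j hj1 hj2).trans
        (mul_le_mul_of_nonneg_left (pow_le_pow_right₀ h1 (by omega)) hμ0)
    refine h.trans (le_of_eq ?_)
    rw [hconst, hKn, hKk, ← hnd]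
    ring

/-- Only the odd-index coefficients from `f_3` to `f_{2n+1}` are used to bound the later ones, so
the coefficient of `x` plays no role. One statement therefore covers the series with and without its
linear term. -/
theorem mem_bernsteinClass2_of_coeff_eq {f : ℕ → MvPolynomial (Fin d) ℝ}
    (hw : ∀ k, (f k).IsWeightedHomogeneous (indexWeight d) (k - 1))
    (hf : ∀ k (lam : Fin d → ℂ), MvPolynomial.aeval lam (f k) = holonomy (lamSeq lam) k)
    {K₃ K₄ : ℝ} (hA : IsA0Series 1 (-1) K₃ K₄ f) (lam : Fin d → ℂ) {g : PowerSeries ℂ}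
    (hg : ∀ k, 2 ≤ k → PowerSeries.coeff k g = holonomy (lamSeq lam) k)
    (hg' : ∀ k, ‖PowerSeries.coeff k g‖ ≤ ‖holonomy (lamSeq lam) k‖) :
    g ∈ bernsteinClass2 (2 * (d / 2) + 1) (1 / (K₄ * (1 + paramNorm lam)))
      (bernsteinConst (d / 2) K₃ K₄) := by
  obtain ⟨Q, q, hQ, hhol⟩ := exists_normalizedParam lam
  have hK := hA.K₄_pos
  have hK3 := hA.K₃_pos
  set s := 1 + paramNorm lam with hs
  have hs1 : 1 ≤ s := by
    have : 0 ≤ paramNorm lam := sum_nonneg fun _ _ => norm_nonneg _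
    linarith
  have hs0 : 0 < s := by linarith
  have hnorm : ∀ k, ‖holonomy (lamSeq lam) k‖ = s ^ (k - 1) * ‖holonomy (lamSeq Q) k‖ := fun k => by
    rw [hhol, norm_mul, norm_pow, Complex.norm_real, Real.norm_of_nonneg hs0.le]
  refine ⟨fun x hx => ?_, fun k hk => ?_⟩
  · have hx1 : K₄ * s * ‖x‖ < 1 := by
      rw [lt_div_iff₀ (by positivity)] at hx; linarith
    refine Summable.of_norm_bounded
      ((summable_geometric_of_lt_one (by positivity) hx1).mul_left K₃) fun k => ?_
    have h1 : ‖holonomy (lamSeq Q) k‖ ≤ K₃ * K₄ ^ k := by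
      rw [← hf]; exact (norm_aeval_le hQ.norm_apply_le_one).trans (hA.norm_le k)
    have h2 : s ^ (k - 1) ≤ s ^ k := pow_le_pow_right₀ hs1 (by omega)
    rw [norm_mul, norm_pow]
    calc _ ≤ s ^ k * (K₃ * K₄ ^ k) * ‖x‖ ^ k := by
          refine mul_le_mul_of_nonneg_right ((hg' k).trans ?_) (by positivity)
          rw [hnorm]
          exact mul_le_mul h2 h1 (norm_nonneg _) (by positivity)
      _ = _ := by rw [mul_pow, mul_pow]; ring
  · set m := (range (2 * (d / 2) + 1 + 1)).sup' nonempty_range_add_one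
      fun i => ‖PowerSeries.coeff i g‖ * (1 / (K₄ * s)) ^ i with hm
    -- The weight `i - 1` of `f_i` leaves exactly one factor `s` against `R^i`. It is common to all
    -- indices and cancels in the comparison.
    have hscale : ∀ i, 2 ≤ i → ‖PowerSeries.coeff i g‖ * (1 / (K₄ * s)) ^ i =
        ‖holonomy (lamSeq Q) i‖ / (s * K₄ ^ i) := fun i hi => by
      have e : s ^ i = s ^ (i - 1) * s := by rw [← pow_succ]; congr 1; omega
      rw [hg i hi, hnorm, div_pow, mul_pow, e, one_pow]
      field_simp
    have hμ : ∀ j, 1 ≤ j → j ≤ d / 2 →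
        ‖holonomy (lamSeq Q) (2 * j + 1)‖ ≤ m * s * K₄ ^ (2 * j + 1) := fun j hj1 hj2 => by
      have h : ‖PowerSeries.coeff (2 * j + 1) g‖ * (1 / (K₄ * s)) ^ (2 * j + 1) ≤ m :=
        le_sup' (fun i => ‖PowerSeries.coeff i g‖ * (1 / (K₄ * s)) ^ i)
          (mem_range.2 (by omega : 2 * j + 1 < 2 * (d / 2) + 1 + 1))
      rw [hscale _ (by omega), div_le_iff₀ (by positivity)] at h
      linarith
    have h := hQ.norm_holonomy_le_bernsteinConst hw hf hA hk hμ
    rw [hscale k (by omega), div_le_iff₀ (by positivity)]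
    linarith
end bernstein
end

theorem mainTheorem7 (d : ℕ) :
    ∃ f : ℕ → MvPolynomial (Fin d) ℝ,
      (∀ (k : ℕ) (lam : Fin d → ℂ),
        MvPolynomial.aeval lam (f k) = PowerSeries.coeff k (inverseReturnSeries lam)) ∧
      (∀ lam : Fin d → ℂ, IsInverseReturnMap lam (inverseReturnSeries lam)) ∧
      (∃ K₃ K₄ : ℝ, IsA0Series 1 (-1) K₃ K₄ f) ∧
      ∀ K₃ K₄ : ℝ, IsA0Series 1 (-1) K₃ K₄ f →
        ∀ lam : Fin d → ℂ,
          inverseReturnSeries lam ∈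
            bernsteinClass2 (2 * (d / 2) + 1) (1 / (K₄ * (1 + paramNorm lam)))
              (bernsteinConst (d / 2) K₃ K₄) ∧
          inverseReturnSeries lam - PowerSeries.X ∈
            bernsteinClass2 (2 * (d / 2) + 1) (1 / (K₄ * (1 + paramNorm lam)))
              (bernsteinConst (d / 2) K₃ K₄) := by
  obtain ⟨f, hw, hf, C, M, hC, hM, hCM⟩ := exists_holonomy_polynomial d
  refine ⟨f, fun k lam => by rw [hf, coeff_inverseReturnSeries],
    isInverseReturnMap_inverseReturnSeries, ⟨C, M, hC, hM, fun k hk => ?_, hCM⟩,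
    fun K₃ K₄ hA lam => ⟨?_, ?_⟩⟩
  -- At `k = 0` the degree bound reads `-1`, so it can hold only because `f_0` is the zero
  -- polynomial.
  · rcases Nat.eq_zero_or_pos k with rfl | hk0
    · refine absurd (MvPolynomial.funext fun x => ?_) hk
      have h := hf 0 fun i => (x i : ℂ)
      rw [holonomy_zero] at h
      have e : MvPolynomial.aeval (fun i => (x i : ℂ)) (f 0) = ((MvPolynomial.eval x (f 0) : ℝ) : ℂ) :=
        (MvPolynomial.aeval_algebraMap_apply ℂ x (f 0))
      rw [e] at h
      rw [map_zero]
      exact_mod_cast h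
    · have h : ((f k).totalDegree : ℝ) ≤ (k - 1 : ℕ) := by
        exact_mod_cast totalDegree_le_of_weighted (hw k)
      rw [Nat.cast_sub hk0] at h
      push_cast at h
      linarith
  · exact mem_bernsteinClass2_of_coeff_eq hw hf hA lam (fun k _ => coeff_inverseReturnSeries lam k)
      fun k => by rw [coeff_inverseReturnSeries]
  · refine mem_bernsteinClass2_of_coeff_eq hw hf hA lam (fun k hk => ?_) fun k => ?_
    · rw [map_sub, coeff_inverseReturnSeries, PowerSeries.coeff_X, if_neg (by omega), sub_zero]
    · rw [map_sub, coeff_inverseReturnSeries, PowerSeries.coeff_X]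
      split_ifs with h
      · rw [h, holonomy_one, sub_self, norm_zero]; positivity
      · rw [sub_zero]
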